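/- **Setting.** Let $d\ge 1$ and let $|\cdot|$ be the Euclidean norm on $\mathbb R^d\supset\mathbb Z^d$. *Hopping.* $h:\mathbb Z^d\to\mathbb C$ satisfies $h(\zeta)=\overline{h(-\zeta)}$, $\sum_y e^{m|y|}|h(y)|<\infty$ for some $m>0$, and for every $0\ne k\in\mathbb R^d$ there is $y\in\mathbb Z^d$ with $k\cdot y\ne 0$ and $h(y)\neq 0$. Put $K\psi(x)=\sum_y h(x-y)\psi(y)$. *Noise.* $\Omega$ is a topological space with a Borel probability measure $\mu$, and $\sigma_x:\Omega\to\Omega$ ($x\in\mathbb Z^d$) are $\mu$-preserving maps with $\sigma_0=\mathrm{id}$ and $\sigma_x\circ\sigma_y=\sigma_{x+y}$. $(\mathbb P_a)_{a\in\Omega}$ is a measurable family of laws of right-continuous paths $(\omega_t)_{t\ge0}$ in $\Omega$ with $\omega_0=a$ almost surely, such that $\mathbb P_{\sigma_x a}$ is the law of $(\sigma_x\omega_t)_{t\ge 0}$ under $\mathbb P_a$; $\mathbb P_a((\omega_{t+s})_{t\ge0}\in\mathcal A)=\mathbb E_a(\mathbb P_{\omega_s}(\mathcal A))$ for all $s>0$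 and measurable $\mathcal A$ (Markov property); and $\int\mathbb P_a(\omega_t\in A)\,d\mu(a)=\mu(A)$ for all $t>0$ and Borel $A$. Write $\mathbb E(\cdot)=\int\mathbb E_a(\cdot)\,d\mu(a)$. Let $S_t^\dagger$ be the semigroup on $L^2(\mu)$ given by $\langle g,S_t^\dagger f\rangle=\mathbb E(\overline{g(\omega_t)}f(\omega_0))$ and let $Bf=\lim_{t\downarrow0}t^{-1}(f-S_t^\dagger f)$, on the domain $\mathcal D(B)$ where the limit exists in $L^2(\mu)$. There are $T>0$ and $b,q\in\mathbb R$ such that for all $f\in\mathcal D(B)$ with $\int f\,d\mu=0$ $$\operatorname{Re}\langle f,Bf\rangle\ge \tfrac1T\|f\|^2,\qquad |\operatorname{Im}\langle f,Bf\rangle|\le q\,|\operatorname{Re}\langle f,Bf\rangle+b|.$$ *Potential.* $v_x=v_0\circ\sigma_x$ with $v_0\in L^\infty(\mu)$ real, and there is $\chi>0$ with $\|B^{-1}(v_x-v_0)\|_{L^2(\mu)}\ge\chi$ for all $x\ne0$, where $B^{-1}$ is the inverse of $B$ on mean-zero functions. For $\psi_0\in\ell^2(\mathbb Z^d)$ let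 $\psi_t$ be the (almost surely unique) solution, continuous in $\ell^2(\mathbb Z^d)$, of the time-integrated form of $$i\partial_t\psi_t(x)=K\psi_t(x)+v_x(\omega_t)\psi_t(x),\qquad \psi_t|_{t=0}=\psi_0 .$$ **Statement.** There is a positive definite real matrix $D$ (depending only on $h$, the process and $v_0$) such that for every $\psi_0$ with $\sup_x e^{\nu|x|}|\psi_0(x)|<\infty$ for some $\nu>0$, the following holds. 1. For every continuous $f:\mathbb R^d\to\mathbb R$ with $|f(y)|\le C(1+|y|)^n$ for some $C,n$, the sums below converge for all $t>0$ and $$\lim_{t\to\infty}\sum_{x\in\mathbb Z^d}f\!\left(\frac{x}{\sqrt t}\right)\mathbb E\big(|\psi_t(x)|^2\big)=\|\psi_0\|_{\ell^2}^2\int_{\mathbb R^d}f(y)\,\frac{1}{\sqrt{(2\pi)^d\det D}}\,e^{-\frac12 y\cdot D^{-1}y}\,dy .$$ 2. For every $p>0$, $\sum_x|x|^p\,\mathbb E(|\psi_t(x)|^2)$ is finite for all $t\ge 0$ and $$\lim_{t\to\infty}t^{-p/2}\sum_{x\in\mathbb Z^d}|x|^p\,\mathbb E\big(|\psi_t(x)|^2\big)=\|\psi_0\|_{\ell^2}^2\int_{\mathbb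 R^d}|y|^p\,\frac{1}{\sqrt{(2\pi)^d\det D}}\,e^{-\frac12 y\cdot D^{-1}y}\,dy ,$$ where the integral on the right is strictly positive. -/

import Mathlib

open MeasureTheory ProbabilityTheory Filter Topology
open scoped NNReal ENNReal

namespace MarkovSchrodinger

noncomputable section

/-! ### The lattice and the hopping kernel -/

/-- The lattice `ℤ^d`. -/
abbrev Site (d : ℕ) : Type := Fin d → ℤ

/-- The Hilbert space `ℓ²(ℤ^d)`. -/
abbrev Ell2 (d : ℕ) : Type := lp (fun _ : Site d => ℂ) 2

/-- The inclusion `ℤ^d ⊆ ℝ^d`; `ℝ^d` carries the Euclidean norm. -/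
def toSpace {d : ℕ} (x : Site d) : EuclideanSpace ℝ (Fin d) :=
  WithLp.toLp 2 fun i => (x i : ℝ)

/-- Assumptions on the hopping kernel: self-adjointness, exponential boundedness, and
non-degeneracy. -/
structure IsHoppingKernel {d : ℕ} (h : Site d → ℂ) : Prop where
  selfAdjoint : ∀ ζ, h ζ = star (h (-ζ))
  expBounded : ∃ m : ℝ, 0 < m ∧ Summable fun y : Site d => Real.exp (m * ‖toSpace y‖) * ‖h y‖
  nondegenerate : ∀ k : EuclideanSpace ℝ (Fin d), k ≠ 0 →
    ∃ y : Site d, inner ℝ k (toSpace y) ≠ 0 ∧ h y ≠ 0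

/-! ### The Markov process -/

section MarkovPaths

variable {d : ℕ} {Ω : Type*} [TopologicalSpace Ω] [MeasurableSpace Ω]

/-- Right-continuous paths `[0,∞) → Ω`, with the trace of the `σ`-algebra on `Ω^[0,∞)` generated
by the cylinder sets (the instance on a subtype of a product). The set of right-continuous paths is
in general not a measurable subset of `Ω^[0,∞)`; a probability measure on `Ω^[0,∞)` that is carried
by the right-continuous paths is the same as a probability measure on this space. -/
abbrev RCPath (Ω : Type*) [TopologicalSpace Ω] : Type _ :=
  {ω : ℝ≥0 → Ω // ∀ t, ContinuousWithinAt ω (Set.Ici t) t}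

/-- The time shift `(𝒯_s ω)_t = ω_{t+s}`. -/
def timeShift (s : ℝ≥0) (ω : RCPath Ω) : RCPath Ω :=
  ⟨fun t => ω.1 (t + s), fun t =>
    (ω.2 (t + s)).comp (f := fun u : ℝ≥0 => u + s) (by fun_prop)
      (fun u hu => by simpa using hu)⟩

/-- The shifts `σ_x` (`x ∈ ℤ^d`) act on `Ω` and preserve `μ`. -/
structure IsShiftAction (μ : Measure Ω) (σ : Site d → Ω → Ω) : Prop where
  zero : σ 0 = id
  add : ∀ x y, σ x ∘ σ y = σ (x + y)
  preserving : ∀ x, MeasurePreserving (σ x) μ μ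

/-- `P a` is the law, on right-continuous paths, of a time homogeneous Markov process started at
`a`; it is compatible with the shifts, and `μ` is invariant. -/
structure IsMarkovProcess (μ : Measure Ω) (σ : Site d → Ω → Ω) (P : Kernel Ω (RCPath Ω)) :
    Prop where
  /-- the initial value is `a` -/
  initial : ∀ a, (P a).map (fun ω => ω.1 0) = Measure.dirac a
  /-- shift invariance in distribution, as an identity between measures on `Ω^[0,∞)` -/
  shift : ∀ a x, (P (σ x a)).map (fun ω (t : ℝ≥0) => ω.1 t)
    = (P a).map (fun ω (t : ℝ≥0) => σ x (ω.1 t))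
  markov : ∀ s : ℝ≥0, 0 < s → ∀ a, ∀ A : Set (RCPath Ω), MeasurableSet A →
    P a (timeShift s ⁻¹' A) = ∫⁻ ω, P (ω.1 s) A ∂(P a)
  invariant : ∀ t : ℝ≥0, 0 < t → ∀ A : Set Ω, MeasurableSet A →
    ∫⁻ a, P a {ω | ω.1 t ∈ A} ∂μ = μ A

/-- The law of the stationary process: `𝔼(F) = ∫ 𝔼_a(F) dμ(a)` is the integral of `F` against
this measure on path space. -/
def pathLaw (μ : Measure Ω) (P : Kernel Ω (RCPath Ω)) : Measure (RCPath Ω) := μ.bind P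


theorem measurable_eval (t : ℝ≥0) : Measurable fun ω : RCPath Ω => ω.1 t :=
  (measurable_pi_apply t).comp measurable_subtype_coe

/-- Invariance of `μ`: each `ω_t` has distribution `μ` under the stationary law. -/
theorem IsMarkovProcess.measurePreserving_eval {μ : Measure Ω} {σ : Site d → Ω → Ω}
    {P : Kernel Ω (RCPath Ω)} (hP : IsMarkovProcess μ σ P) (t : ℝ≥0) :
    MeasurePreserving (fun ω : RCPath Ω => ω.1 t) (pathLaw μ P) μ := by
  refine ⟨measurable_eval t, Measure.ext fun A hA => ?_⟩
  have hpre : MeasurableSet {ω : RCPath Ω | ω.1 t ∈ A} := measurable_eval t hA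
  rw [Measure.map_apply (measurable_eval t) hA, pathLaw,
    Measure.bind_apply (measurable_eval t hA) P.measurable.aemeasurable]
  rcases eq_or_lt_of_le (zero_le : 0 ≤ t) with rfl | ht
  · have h0 : ∀ a, P a ((fun ω : RCPath Ω => ω.1 0) ⁻¹' A) = A.indicator 1 a := fun a => by
      rw [← Measure.map_apply (measurable_eval 0) hA, hP.initial a, Measure.dirac_apply' a hA]
    simp_rw [h0]
    exact lintegral_indicator_one hA
  · exact hP.invariant t ht A hA

/-! ### The generator -/

/-- `f ↦ f(ω_t)`, an isometry from `L²(μ)` to `L²` of the path space. -/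
def evalL2 {μ : Measure Ω} {σ : Site d → Ω → Ω} {P : Kernel Ω (RCPath Ω)}
    (hP : IsMarkovProcess μ σ P) (t : ℝ≥0) : Lp ℂ 2 μ →L[ℂ] Lp ℂ 2 (pathLaw μ P) :=
  (Lp.compMeasurePreservingₗᵢ ℂ (fun ω : RCPath Ω => ω.1 t)
    (hP.measurePreserving_eval t)).toContinuousLinearMap

/-- The semigroup `S_t†` on `L²(μ)`, characterized by `⟨g, S_t† f⟩ = 𝔼(conj g(ω_t) · f(ω_0))`. -/
def backwardSemigroup {μ : Measure Ω} {σ : Site d → Ω → Ω} {P : Kernel Ω (RCPath Ω)}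
    (hP : IsMarkovProcess μ σ P) (t : ℝ≥0) : Lp ℂ 2 μ →L[ℂ] Lp ℂ 2 μ :=
  (ContinuousLinearMap.adjoint (evalL2 hP t)).comp (evalL2 hP 0)

/-- `f ∈ 𝒟(B)` and `B f = g`, where `B f = lim_{t ↓ 0} (f - S_t† f) / t` in `L²(μ)`. -/
def IsGenerator {μ : Measure Ω} {σ : Site d → Ω → Ω} {P : Kernel Ω (RCPath Ω)}
    (hP : IsMarkovProcess μ σ P) (f g : Lp ℂ 2 μ) : Prop :=
  Tendsto (fun t : ℝ≥0 => ((t : ℝ)⁻¹ : ℂ) • (f - backwardSemigroup hP t f)) (𝓝[>] 0) (𝓝 g)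

/-- Gap condition and sectoriality of `B` on the mean-zero part `𝒟₀(B)` of its domain. -/
structure HasGapSectorial {μ : Measure Ω} {σ : Site d → Ω → Ω} {P : Kernel Ω (RCPath Ω)}
    (hP : IsMarkovProcess μ σ P) : Prop where
  gap : ∃ T : ℝ, 0 < T ∧ ∀ f g : Lp ℂ 2 μ, IsGenerator hP f g → ∫ a, f a ∂μ = 0 →
    1 / T * ‖f‖ ^ 2 ≤ (inner ℂ f g).re
  sectorial : ∃ b q : ℝ, ∀ f g : Lp ℂ 2 μ, IsGenerator hP f g → ∫ a, f a ∂μ = 0 →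
    |(inner ℂ f g).im| ≤ q * |(inner ℂ f g).re + b|

/-! ### The potential and the Schrödinger equation -/

/-- Assumptions on the potential `v_x = v₀ ∘ σ_x`. -/
structure IsPotential {μ : Measure Ω} {σ : Site d → Ω → Ω} {P : Kernel Ω (RCPath Ω)}
    (hP : IsMarkovProcess μ σ P) (v₀ : Ω → ℝ) : Prop where
  memLp : MemLp v₀ ⊤ μ
  /-- `(t, ω) ↦ v_x(ω_t)` is jointly measurable (up to null sets), so that the random equation makes
  sense; this is automatic if `Ω` is metrizable or the `v_x` are continuous. -/
  measurable : ∀ x : Site d, AEStronglyMeasurable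
    (fun p : ℝ × RCPath Ω => v₀ (σ x (p.2.1 p.1.toNNReal)))
    ((volume.restrict (Set.Ici 0)).prod (pathLaw μ P))
  /-- `‖B⁻¹ (v_x - v₀)‖ ≥ χ`: here `u = B⁻¹ w` is the mean-zero solution of `B u = w`, and
  `w = v_x - v₀` in `L²(μ)`. -/
  nondegenerate : ∃ χ : ℝ, 0 < χ ∧ ∀ x : Site d, x ≠ 0 → ∀ u w : Lp ℂ 2 μ,
    (w =ᵐ[μ] fun a => ((v₀ (σ x a) - v₀ a : ℝ) : ℂ)) →
    IsGenerator hP u w → ∫ a, u a ∂μ = 0 → χ ≤ ‖u‖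

/-- `(H(t) ψ)(x) = (K ψ)(x) + v_x(ω_t) ψ(x)` with `K ψ(x) = ∑_y h(x - y) ψ(y)`. -/
def hamiltonian (h : Site d → ℂ) (σ : Site d → Ω → Ω) (v₀ : Ω → ℝ) (ω : RCPath Ω) (t : ℝ≥0)
    (ψ : Ell2 d) (x : Site d) : ℂ :=
  (∑' y : Site d, h (x - y) * ψ y) + (v₀ (σ x (ω.1 t)) : ℂ) * ψ x

/-- `ψ : [0,∞) → ℓ²(ℤ^d)` solves `i ∂_t ψ_t(x) = K ψ_t(x) + v_x(ω_t) ψ_t(x)` along the path `ω` with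
initial value `ψ₀`. As `t ↦ v_x(ω_t)` is only measurable, the equation is read in its integrated
form (it holds at almost every time). -/
structure IsSolution (h : Site d → ℂ) (σ : Site d → Ω → Ω) (v₀ : Ω → ℝ) (ω : RCPath Ω)
    (ψ₀ : Ell2 d) (ψ : ℝ≥0 → Ell2 d) : Prop where
  continuous : Continuous ψ
  integrable : ∀ (x : Site d) (t : ℝ≥0), IntervalIntegrable
    (fun s : ℝ => hamiltonian h σ v₀ ω s.toNNReal (ψ s.toNNReal) x) volume 0 t
  equation : ∀ (x : Site d) (t : ℝ≥0), ψ t x = ψ₀ x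
    - Complex.I * ∫ s in (0 : ℝ)..t, hamiltonian h σ v₀ ω s.toNNReal (ψ s.toNNReal) x

/-- The mean square amplitude `𝔼(|ψ_t(x)|²)` of a random wave function `Ψ`. -/
def meanSq (μ : Measure Ω) (P : Kernel Ω (RCPath Ω)) (Ψ : RCPath Ω → ℝ≥0 → Ell2 d) (t : ℝ≥0)
    (x : Site d) : ℝ :=
  ∫ ω, ‖Ψ ω t x‖ ^ 2 ∂(pathLaw μ P)

end MarkovPaths

/-- `sup_x e^{ν|x|} |ψ₀(x)| < ∞` for some `ν > 0`. -/
def ExpBounded {d : ℕ} (ψ₀ : Ell2 d) : Prop :=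
  ∃ ν C : ℝ, 0 < ν ∧ ∀ x : Site d, Real.exp (ν * ‖toSpace x‖) * ‖ψ₀ x‖ ≤ C

/-- `|f(y)| ≤ C (1 + |y|)^n` for some `C` and `n`. -/
def PolyBounded {d : ℕ} (f : EuclideanSpace ℝ (Fin d) → ℝ) : Prop :=
  ∃ (C : ℝ) (n : ℕ), ∀ y, |f y| ≤ C * (1 + ‖y‖) ^ n

/-- The density of the centered Gaussian with covariance `D`. -/
def gaussianDensity {d : ℕ} (D : Matrix (Fin d) (Fin d) ℝ) (y : EuclideanSpace ℝ (Fin d)) : ℝ :=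
  (Real.sqrt ((2 * Real.pi) ^ d * D.det))⁻¹ *
    Real.exp (-(1 / 2) * (y.ofLp ⬝ᵥ D⁻¹.mulVec y.ofLp))

end

end MarkovSchrodinger

open MarkovSchrodinger

/-! The density matrix `ψ_t(z) conj ψ_t(y)`, conditioned on the present state `ω_t` of the noise,
obeys a closed linear equation: the noise acts through the backward semigroup, the Schrödinger
dynamics through a commutator (`tendsto_corrL2`). Both commute with the joint translation of the two
sites and the noise, so a Fourier transform over joint translations splits the equation into fibers
on `ℓ²(ℤ^d; L²(μ))`, one for each momentum `k`: `f' = -(B + i A_k) f`, with `B` acting at each site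
and `A_k` the operator `fiberOp` (`isMild_fiberField`). The component of `f` along `q = δ_0 ⊗ 1` is
`∑_y e^{ik·y} 𝔼|ψ_t(y)|²`. The central limit theorem thus concerns this component at momentum `sκ`
and time `s⁻²`, as `s → 0`.

At `k = 0` the vector `q` is stationary, and everything orthogonal to it decays exponentially. The
gap of `B` damps only the part of mean zero over `Ω`. Let `Z` project onto fields constant in `Ω`.
On its range `A_0` is multiplication by `v_x - v_0`, which maps into the kernel of `Z`, and the
hypothesis on `B⁻¹(v_x - v_0)` bounds `B⁻¹ A_0` below there, away from `q`. Adding a small multiple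
of `Im⟨B⁻¹ A_0 Z g, B⁻¹ g⟩` to `‖g‖²` gives a Lyapunov function (`IsCoupling.exists_lyapunov`): this
is hypocoercivity.

At momentum `sκ` one has `A_{sκ} - A_0 = O(s)`, `A_{sκ} q = sφ + O(s²)` with `φ` the drift vector,
and `⟨q, A_{sκ} q⟩ = 0`. The equation `(B + i A_0) r = φ` is solved by integrating a decaying
solution over time (`IsCoupling.exists_resolvent`). Then `q - isr` is an approximate eigenvector for
the eigenvalue `s² Q` with `Q = ⟨φ, r⟩`, and comparison with it gives the limit `e^{-Q} ‖ψ₀‖²`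
(`IsCoupling.tendsto_inner_perturbed`). `Q` is quadratic in `κ`. It is real because characteristic
functions at `±κ` are conjugate, and its real part is positive because dissipation could vanish only
for `φ = 0`, which the nondegeneracy of `h` excludes. So `Q = ½ κ·Dκ`, which defines `D`
(`IsModel.exists_covariance`).

The growth bound `IsCoupling.exists_perturbed_bound` needs no symmetry of the perturbed operator. At
imaginary momenta it bounds exponential moments on the diffusive scale, and with Lévy's continuity
theorem this yields convergence for test functions of polynomial growth
(`tendsto_tsum_of_polyBounded`).

Domains of unbounded operators are avoided throughout: solutions are mild (`IsMild`), only the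
bounded inverse of `B` is used, and norms are controlled through Dini derivatives. The waves are
Picard series conjugated by `e^{η|x|}`, which makes them exponentially localized and adapted to the
past of the noise. -/

namespace MarkovSchrodinger

noncomputable section

set_option linter.unusedSectionVars false

/-! ### Contraction semigroups; decay from the numerical range of the generator. -/

section Semigroup

variable {H : Type*} [NormedAddCommGroup H] [InnerProductSpace ℂ H] [CompleteSpace H]

/-- A strongly continuous semigroup of contractions, indexed by the times `t ≥ 0`. -/
structure IsContractionSemigroup (S : ℝ → H →L[ℂ] H) : Prop where
  zero : ∀ f, S 0 f = f
  add : ∀ s t, 0 ≤ s → 0 ≤ t → ∀ f, S (s + t) f = S s (S t f)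
  norm_le : ∀ t, 0 ≤ t → ∀ f, ‖S t f‖ ≤ ‖f‖
  tendsto : ∀ f, Tendsto (fun t => S t f) (𝓝[>] 0) (𝓝 f)

namespace IsContractionSemigroup

variable {S : ℝ → H →L[ℂ] H}

theorem norm_sub_le (hS : IsContractionSemigroup S) {s t : ℝ} (hs : 0 ≤ s) (hst : s ≤ t) (f : H) :
    ‖S t f - S s f‖ ≤ ‖S (t - s) f - f‖ := by
  have h := hS.add s (t - s) hs (sub_nonneg.2 hst) f
  rw [add_sub_cancel] at h
  rw [h, ← map_sub]
  exact hS.norm_le s hs _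

theorem continuousOn (hS : IsContractionSemigroup S) (f : H) : ContinuousOn (fun t => S t f) (Set.Ici 0) := by
  rw [Metric.continuousOn_iff]
  intro s hs ε hε
  have h := Metric.tendsto_nhdsWithin_nhds.1 (hS.tendsto f) ε hε
  obtain ⟨δ, hδ, h⟩ := h
  refine ⟨δ, hδ, fun t ht hts => ?_⟩
  have key : ∀ u v : ℝ, 0 ≤ u → u ≤ v → dist v u < δ → ‖S v f - S u f‖ < ε := by
    intro u v hu huv hd
    refine (hS.norm_sub_le hu huv f).trans_lt ?_
    rcases huv.eq_or_lt with rfl | hlt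
    · simpa [hS.zero] using hε
    · have := h (x := v - u) (sub_pos.2 hlt) (by simpa [Real.dist_eq] using hd)
      rwa [dist_eq_norm] at this
  rcases le_total s t with hst | hst
  · rw [dist_eq_norm]; exact key s t hs hst hts
  · rw [dist_comm, dist_eq_norm]; exact key t s ht hst (by rwa [dist_comm])

theorem intervalIntegrable (hS : IsContractionSemigroup S) (f : H) {a b : ℝ} (ha : 0 ≤ a) (hb : 0 ≤ b) :
    IntervalIntegrable (fun t => S t f) volume a b :=
  ((hS.continuousOn f).mono fun _ hx => (le_min ha hb).trans hx.1).intervalIntegrable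

/-- The average of an orbit over `[0, h]` converges to its starting point. -/
theorem tendsto_average (hS : IsContractionSemigroup S) (f : H) :
    Tendsto (fun h : ℝ => h⁻¹ • ∫ s in (0 : ℝ)..h, S s f) (𝓝[>] 0) (𝓝 f) := by
  have hd : HasDerivWithinAt (fun u => ∫ s in (0 : ℝ)..u, S s f) (S 0 f) (Set.Ioi 0) 0 := by
    have hc := hS.continuousOn f
    refine (intervalIntegral.integral_hasDerivWithinAt_right (s := Set.Ici 0) (t := Set.Ioi 0)
      (by simp) ?_ ?_).mono Set.Ioi_subset_Ici_self
    · exact (hc.mono Set.Ioi_subset_Ici_self).stronglyMeasurableAtFilter_nhdsWithin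
        measurableSet_Ioi 0
    · exact (hc 0 Set.self_mem_Ici).mono Set.Ioi_subset_Ici_self
  rw [hasDerivWithinAt_iff_tendsto_slope' (by simp), hS.zero] at hd
  refine hd.congr fun h => ?_
  simp [slope]

theorem integral_shift (hS : IsContractionSemigroup S) (f : H) {h : ℝ} (hh : 0 ≤ h) (e : ℝ) (he : 0 ≤ e) :
    S h (∫ s in (0 : ℝ)..e, S s f) = ∫ s in h..(h + e), S s f := by
  rw [← ContinuousLinearMap.intervalIntegral_comp_comm _ (hS.intervalIntegrable f le_rfl he)]
  have : ∫ s in (0 : ℝ)..e, S h (S s f) = ∫ s in (0 : ℝ)..e, S (h + s) f := by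
    refine intervalIntegral.integral_congr fun s hs => ?_
    rw [Set.uIcc_of_le he] at hs
    exact (hS.add h s hh hs.1 f).symm
  rw [this, intervalIntegral.integral_comp_add_left (fun s => S s f)]
  simp

/-- Averages of orbits lie in the domain of the generator. -/
theorem tendsto_generator_average (hS : IsContractionSemigroup S) (f : H) {e : ℝ} (he : 0 < e) :
    Tendsto (fun h : ℝ => h⁻¹ • ((∫ s in (0 : ℝ)..e, S s f) - S h (∫ s in (0 : ℝ)..e, S s f)))
      (𝓝[>] 0) (𝓝 (f - S e f)) := by
  have h1 : Tendsto (fun h : ℝ => h⁻¹ • (∫ s in (0 : ℝ)..h, S s f)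
      - S e (h⁻¹ • ∫ s in (0 : ℝ)..h, S s f)) (𝓝[>] 0) (𝓝 (f - S e f)) :=
    (hS.tendsto_average f).sub ((S e).continuous.tendsto _ |>.comp (hS.tendsto_average f))
  refine h1.congr' ?_
  filter_upwards [self_mem_nhdsWithin] with h hh
  have hh' : 0 ≤ h := le_of_lt hh
  rw [hS.integral_shift f hh' e he.le, (S e).map_smul_of_tower, hS.integral_shift f he.le h hh',
    ← smul_sub]
  congr 1
  have i1 := hS.intervalIntegrable f (a := 0) (b := e) le_rfl he.le
  have i2 := hS.intervalIntegrable f (a := 0) (b := h) le_rfl hh'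
  have i3 := hS.intervalIntegrable f (a := e) (b := e + h) he.le (by positivity)
  have i4 := hS.intervalIntegrable f (a := h) (b := h + e) hh' (by positivity)
  have e1 := intervalIntegral.integral_add_adjacent_intervals i1 i3
  have e2 := intervalIntegral.integral_add_adjacent_intervals i2 i4
  rw [add_comm e h] at e1 i3 ⊢
  rw [sub_eq_sub_iff_add_eq_add, e2, e1]

/-- If the numerical range of the generator on an invariant closed subspace lies to the right of
`γ`, then the semigroup decays there at rate `γ`. -/
theorem norm_le_exp_of_generator (hS : IsContractionSemigroup S) {Z : H →L[ℂ] H} (hZ : ∀ t, 0 ≤ t → ∀ f, Z (S t f) = Z f) {γ : ℝ}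
    (hγ : ∀ f g, Tendsto (fun h : ℝ => h⁻¹ • (f - S h f)) (𝓝[>] 0) (𝓝 g) → Z f = 0 →
      γ * ‖f‖ ^ 2 ≤ (inner ℂ f g).re)
    {f : H} (hf : Z f = 0) {t : ℝ} (ht : 0 ≤ t) : ‖S t f‖ ≤ Real.exp (-γ * t) * ‖f‖ := by
  -- The energy estimate is made first on the domain of the generator. Averages of orbits lie in the
  -- domain, stay in the kernel of `Z` and converge to `f`, which extends the bound to all `f`.
  have dom : ∀ f g, Tendsto (fun h : ℝ => h⁻¹ • (f - S h f)) (𝓝[>] 0) (𝓝 g) → Z f = 0 →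
      ‖S t f‖ ≤ Real.exp (-γ * t) * ‖f‖ := by
    intro f g hfg hf
    have hderiv : ∀ s, 0 ≤ s → HasDerivWithinAt (fun s => S s f) (-(S s g)) (Set.Ici s) s := by
      intro s hs
      rw [← hasDerivWithinAt_Ioi_iff_Ici, hasDerivWithinAt_iff_tendsto_slope' (by simp)]
      have h1 := (((S s).continuous.tendsto _).comp hfg).neg
      have h2 : Tendsto (fun u : ℝ => u - s) (𝓝[>] s) (𝓝[>] 0) := by
        refine tendsto_nhdsWithin_iff.2 ⟨?_, ?_⟩
        · have : Tendsto (fun u : ℝ => u - s) (𝓝 s) (𝓝 (s - s)) := by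
            exact (continuous_id.sub continuous_const).tendsto s
          rw [sub_self] at this
          exact this.mono_left nhdsWithin_le_nhds
        · filter_upwards [self_mem_nhdsWithin] with u hu using sub_pos.2 (Set.mem_Ioi.1 hu)
      refine (h1.comp h2).congr' ?_
      filter_upwards [self_mem_nhdsWithin] with u hu
      have hu' : 0 ≤ u - s := (sub_pos.2 hu).le
      have := hS.add s (u - s) hs hu' f
      rw [add_sub_cancel] at this
      simp only [Function.comp_apply, slope, vsub_eq_sub, this, (S s).map_smul_of_tower, map_sub]
      rw [← smul_neg, neg_sub]
    have hgen : ∀ s, 0 ≤ s → γ * ‖S s f‖ ^ 2 ≤ (inner ℂ (S s f) (S s g)).re := by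
      intro s hs
      refine hγ _ _ ?_ (by rw [hZ s hs, hf])
      refine (((S s).continuous.tendsto _).comp hfg).congr' ?_
      filter_upwards [self_mem_nhdsWithin] with u hu
      have hu' : 0 ≤ u := le_of_lt hu
      simp only [Function.comp_apply, (S s).map_smul_of_tower, map_sub]
      rw [← hS.add s u hs hu', ← hS.add u s hu' hs, add_comm]
    have hsq : ∀ s ∈ Set.Ico 0 t, HasDerivWithinAt (fun s => ‖S s f‖ ^ 2)
        (2 * (inner ℂ (S s f) (-(S s g))).re) (Set.Ici s) s := by
      intro s hs
      let _ : InnerProductSpace ℝ H := InnerProductSpace.rclikeToReal ℂ H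
      have := (hderiv s hs.1).norm_sq
      simpa [real_inner_eq_re_inner] using this
    have hbound := le_gronwallBound_of_liminf_deriv_right_le (f := fun s => ‖S s f‖ ^ 2)
      (f' := fun s => 2 * (inner ℂ (S s f) (-(S s g))).re) (δ := ‖f‖ ^ 2) (K := -2 * γ) (ε := 0)
      (a := 0) (b := t)
      (((hS.continuousOn f).mono Set.Icc_subset_Ici_self).norm.pow 2)
      (fun s hs r hr => (hsq s hs).liminf_right_slope_le hr) (by simp [hS.zero])
      (fun s hs => by
        have := hgen s hs.1
        simp only [inner_neg_right, Complex.neg_re]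
        linarith) t ⟨ht, le_rfl⟩
    rw [gronwallBound_ε0, sub_zero] at hbound
    have : ‖S t f‖ ^ 2 ≤ (Real.exp (-γ * t) * ‖f‖) ^ 2 := by
      refine hbound.trans_eq ?_
      rw [mul_pow, ← Real.exp_nat_mul, mul_comm]
      congr 2
      push_cast; ring
    exact (sq_le_sq₀ (norm_nonneg _) (by positivity)).1 this
  have h1 := hS.tendsto_average f
  have h2 : Tendsto (fun h : ℝ => ‖S t (h⁻¹ • ∫ s in (0 : ℝ)..h, S s f)‖) (𝓝[>] 0)
      (𝓝 ‖S t f‖) := (((S t).continuous.tendsto _).comp h1).norm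
  refine le_of_tendsto_of_tendsto h2 (h1.norm.const_mul _) ?_
  filter_upwards [self_mem_nhdsWithin] with e he
  have hZe : Z (∫ s in (0 : ℝ)..e, S s f) = 0 := by
    rw [← ContinuousLinearMap.intervalIntegral_comp_comm _
      (hS.intervalIntegrable f le_rfl (le_of_lt he))]
    refine intervalIntegral.integral_zero_ae (ae_of_all _ fun s hs => ?_)
    rw [Set.uIoc_of_le (le_of_lt he)] at hs
    rw [hZ s hs.1.le, hf]
  have := dom _ _ (hS.tendsto_generator_average f he) hZe
  rw [(S t).map_smul_of_tower, norm_smul, norm_smul]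
  calc _ ≤ ‖e⁻¹‖ * (Real.exp (-γ * t) * ‖∫ s in (0 : ℝ)..e, S s f‖) := by gcongr
    _ = _ := by ring

end IsContractionSemigroup

end Semigroup

/-! ### Gapped semigroups and the bounded inverse of the generator. -/

section Gap

variable {H : Type*} [NormedAddCommGroup H] [InnerProductSpace ℂ H] [CompleteSpace H]

/-- A contraction semigroup that is the identity on the range of the orthogonal projection `Z`
and decays exponentially on its kernel. -/
structure IsGapped (S : ℝ → H →L[ℂ] H) (Z : H →L[ℂ] H) (γ : ℝ) : Prop
    extends IsContractionSemigroup S where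
  pos : 0 < γ
  proj_proj : ∀ f, Z (Z f) = Z f
  symm : ∀ f g, inner ℂ (Z f) g = inner ℂ f (Z g)
  apply_proj : ∀ t, 0 ≤ t → ∀ f, S t (Z f) = Z f
  proj_apply : ∀ t, 0 ≤ t → ∀ f, Z (S t f) = Z f
  decay : ∀ t, 0 ≤ t → ∀ f, Z f = 0 → ‖S t f‖ ≤ Real.exp (-γ * t) * ‖f‖

namespace IsGapped

variable {S : ℝ → H →L[ℂ] H} {Z : H →L[ℂ] H} {γ : ℝ}

theorem proj_sub (hS : IsGapped S Z γ) (f : H) : Z (f - Z f) = 0 := by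
  rw [map_sub, hS.proj_proj, sub_self]

theorem inner_eq_zero (hS : IsGapped S Z γ) (f : H) {g : H} (hg : Z g = 0) :
    inner ℂ (Z f) g = 0 := by
  rw [hS.symm, hg, inner_zero_right]

theorem norm_sq_eq (hS : IsGapped S Z γ) (f : H) : ‖f‖ ^ 2 = ‖Z f‖ ^ 2 + ‖f - Z f‖ ^ 2 := by
  have h := norm_add_sq (𝕜 := ℂ) (Z f) (f - Z f)
  rw [hS.inner_eq_zero f (hS.proj_sub f)] at h
  simpa using h

theorem norm_proj_le (hS : IsGapped S Z γ) (f : H) : ‖Z f‖ ≤ ‖f‖ := by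
  have := hS.norm_sq_eq f
  exact (sq_le_sq₀ (norm_nonneg _) (norm_nonneg _)).1 (by nlinarith [sq_nonneg ‖f - Z f‖])

theorem norm_sub_proj_le (hS : IsGapped S Z γ) (f : H) : ‖f - Z f‖ ≤ ‖f‖ := by
  have := hS.norm_sq_eq f
  exact (sq_le_sq₀ (norm_nonneg _) (norm_nonneg _)).1 (by nlinarith [sq_nonneg ‖Z f‖])

theorem integrable_orbit (hS : IsGapped S Z γ) {f : H} (hf : Z f = 0) :
    IntegrableOn (fun t => S t f) (Set.Ioi 0) := by
  have h1 : IntegrableOn (fun t => Real.exp (-γ * t) * ‖f‖) (Set.Ioi 0) :=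
    (integrableOn_exp_mul_Ioi (neg_neg_of_pos hS.pos) 0).mul_const _
  refine h1.mono' (((hS.continuousOn f).mono
    Set.Ioi_subset_Ici_self).aestronglyMeasurable measurableSet_Ioi) ?_
  filter_upwards [ae_restrict_mem measurableSet_Ioi] with t ht
  exact hS.decay t (le_of_lt ht) f hf

theorem norm_integral_orbit_le (hS : IsGapped S Z γ) {f : H} (hf : Z f = 0) :
    ‖∫ t in Set.Ioi (0 : ℝ), S t f‖ ≤ γ⁻¹ * ‖f‖ := by
  have h1 : IntegrableOn (fun t => Real.exp (-γ * t) * ‖f‖) (Set.Ioi 0) :=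
    (integrableOn_exp_mul_Ioi (neg_neg_of_pos hS.pos) 0).mul_const _
  refine (norm_integral_le_of_norm_le h1 ?_).trans_eq ?_
  · filter_upwards [ae_restrict_mem measurableSet_Ioi] with t ht
    exact hS.decay t (le_of_lt ht) f hf
  · rw [integral_mul_const, integral_exp_mul_Ioi (neg_neg_of_pos hS.pos)]
    simp [neg_div_neg_eq]

/-- The potential operator `∫_0^∞ S_t (1 - Z) dt`, the inverse of the generator on the kernel of
`Z`. -/
def potential (hS : IsGapped S Z γ) : H →L[ℂ] H :=
  LinearMap.mkContinuous
    { toFun := fun f => ∫ t in Set.Ioi (0 : ℝ), S t (f - Z f)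
      map_add' := fun f g => by
        rw [← integral_add (hS.integrable_orbit (hS.proj_sub f))
          (hS.integrable_orbit (hS.proj_sub g))]
        simp only [← map_add (S _)]
        rw [map_add, add_sub_add_comm]
      map_smul' := fun c f => by
        simp only [map_smul, ← smul_sub, RingHom.id_apply]
        exact integral_smul c _ }
    γ⁻¹ fun f => (hS.norm_integral_orbit_le (hS.proj_sub f)).trans
      (mul_le_mul_of_nonneg_left (hS.norm_sub_proj_le f) (inv_nonneg.2 hS.pos.le))

theorem potential_apply (hS : IsGapped S Z γ) (f : H) :
    hS.potential f = ∫ t in Set.Ioi (0 : ℝ), S t (f - Z f) := rfl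

theorem norm_potential_le (hS : IsGapped S Z γ) (f : H) :
    ‖hS.potential f‖ ≤ γ⁻¹ * ‖f - Z f‖ :=
  hS.norm_integral_orbit_le (hS.proj_sub f)

theorem proj_potential (hS : IsGapped S Z γ) (f : H) : Z (hS.potential f) = 0 := by
  rw [potential_apply, ← ContinuousLinearMap.integral_comp_comm _
    (hS.integrable_orbit (hS.proj_sub f))]
  refine setIntegral_eq_zero_of_forall_eq_zero fun t ht => ?_
  rw [hS.proj_apply t (le_of_lt ht), hS.proj_sub]

theorem integral_Ioi_orbit (hS : IsGapped S Z γ) {f : H} (hf : Z f = 0) {h : ℝ} (hh : 0 ≤ h) :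
    ∫ t in Set.Ioi (0 : ℝ), S (t + h) f
      = (∫ t in Set.Ioi (0 : ℝ), S t f) - ∫ t in (0 : ℝ)..h, S t f := by
  have e1 : ∫ t in Set.Ioi (0 : ℝ), S (t + h) f = ∫ t in Set.Ioi h, S t f := by
    have := (measurePreserving_add_right volume h).setIntegral_preimage_emb
      (measurableEmbedding_addRight h) (fun t => S t f) (Set.Ioi h)
    simpa using this
  rw [e1, intervalIntegral.integral_of_le hh, eq_sub_iff_add_eq, add_comm,
    ← setIntegral_union (Set.Ioc_disjoint_Ioi le_rfl) measurableSet_Ioi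
      ((hS.integrable_orbit hf).mono_set Set.Ioc_subset_Ioi_self)
      ((hS.integrable_orbit hf).mono_set (Set.Ioi_subset_Ioi hh)), Set.Ioc_union_Ioi_eq_Ioi hh]

/-- Here and in `semigroup_potential` the left side is the orbit integral over `(h, ∞)`; the missing
piece over `(0, h)` is what survives in the difference quotients below. -/
theorem potential_semigroup (hS : IsGapped S Z γ) (f : H) {h : ℝ} (hh : 0 ≤ h) :
    hS.potential (S h f) = hS.potential f - ∫ t in (0 : ℝ)..h, S t (f - Z f) := by
  rw [potential_apply, potential_apply, ← hS.integral_Ioi_orbit (hS.proj_sub f) hh]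
  refine setIntegral_congr_fun measurableSet_Ioi fun t ht => ?_
  rw [hS.proj_apply h hh, hS.add t h (le_of_lt ht) hh, map_sub (S h), hS.apply_proj h hh]

theorem semigroup_potential (hS : IsGapped S Z γ) (f : H) {h : ℝ} (hh : 0 ≤ h) :
    S h (hS.potential f) = hS.potential f - ∫ t in (0 : ℝ)..h, S t (f - Z f) := by
  rw [potential_apply, ← ContinuousLinearMap.integral_comp_comm _
    (hS.integrable_orbit (hS.proj_sub f)), ← hS.integral_Ioi_orbit (hS.proj_sub f) hh]
  refine setIntegral_congr_fun measurableSet_Ioi fun t ht => ?_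
  rw [← hS.add h t hh (le_of_lt ht), add_comm]

/-- The limit exists for every `f`, in the domain of the generator or not. This is why mild
solutions become differentiable once the bounded inverse is applied. -/
theorem tendsto_potential (hS : IsGapped S Z γ) (f : H) :
    Tendsto (fun h : ℝ => h⁻¹ • (hS.potential (S h f) - hS.potential f)) (𝓝[>] 0)
      (𝓝 (-(f - Z f))) := by
  refine (hS.tendsto_average (f - Z f)).neg.congr' ?_
  filter_upwards [self_mem_nhdsWithin] with h hh
  rw [hS.potential_semigroup f (le_of_lt hh), sub_sub_cancel_left, smul_neg]

theorem tendsto_generator_potential (hS : IsGapped S Z γ) (f : H) :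
    Tendsto (fun h : ℝ => h⁻¹ • (hS.potential f - S h (hS.potential f))) (𝓝[>] 0)
      (𝓝 (f - Z f)) := by
  refine (hS.tendsto_average (f - Z f)).congr' ?_
  filter_upwards [self_mem_nhdsWithin] with h hh
  rw [hS.semigroup_potential f (le_of_lt hh), sub_sub_cancel]

end IsGapped

/-! ### Upper right Dini derivatives -/

/-- The upper right Dini derivative of `φ` at `t` is at most `L`. -/
def DiniLE (φ : ℝ → ℝ) (L t : ℝ) : Prop :=
  ∀ r, L < r → ∀ᶠ z in 𝓝[>] t, (z - t)⁻¹ * (φ z - φ t) < r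

namespace DiniLE

variable {φ ψ : ℝ → ℝ} {L M t : ℝ}

theorem of_hasDerivWithinAt (h : HasDerivWithinAt φ L (Set.Ici t) t) : DiniLE φ L t := by
  intro r hr
  rw [← hasDerivWithinAt_Ioi_iff_Ici, hasDerivWithinAt_iff_tendsto_slope' (by simp)] at h
  filter_upwards [h.eventually_lt_const hr] with z hz
  simpa [slope] using hz

theorem mono (h : DiniLE φ L t) (hLM : L ≤ M) : DiniLE φ M t :=
  fun r hr => h r (hLM.trans_lt hr)

theorem add (h : DiniLE φ L t) (h' : DiniLE ψ M t) : DiniLE (fun s => φ s + ψ s) (L + M) t := by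
  intro r hr
  have e : L + M < r := hr
  filter_upwards [h (L + (r - (L + M)) / 2) (by linarith),
    h' (M + (r - (L + M)) / 2) (by linarith)] with z h1 h2
  have : (z - t)⁻¹ * (φ z + ψ z - (φ t + ψ t))
    = (z - t)⁻¹ * (φ z - φ t) + (z - t)⁻¹ * (ψ z - ψ t) := by ring
  rw [this]; linarith

theorem const_mul (h : DiniLE φ L t) {c : ℝ} (hc : 0 < c) :
    DiniLE (fun s => c * φ s) (c * L) t := by
  intro r hr
  filter_upwards [h (r / c) (by rwa [lt_div_iff₀ hc, mul_comm])] with z hz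
  have : (z - t)⁻¹ * (c * φ z - c * φ t) = c * ((z - t)⁻¹ * (φ z - φ t)) := by ring
  rw [this]
  rwa [lt_div_iff₀ hc, mul_comm] at hz

theorem gronwall {δ K ε a b : ℝ} (hc : ContinuousOn φ (Set.Icc a b))
    (h : ∀ t ∈ Set.Ico a b, DiniLE φ (K * φ t + ε) t) (ha : φ a ≤ δ) :
    ∀ t ∈ Set.Icc a b, φ t ≤ gronwallBound δ K ε (t - a) :=
  le_gronwallBound_of_liminf_deriv_right_le hc
    (fun t ht r hr => (h t ht r hr).frequently) ha fun _ _ => le_rfl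

end DiniLE

/-! ### Mild solutions -/

/-- `f` is a mild solution of `f' = -B f + g`, where `-B` is the generator of `S`. -/
structure IsMild (S : ℝ → H →L[ℂ] H) (f g : ℝ → H) : Prop where
  continuousOn : ContinuousOn f (Set.Ici 0)
  tendsto : ∀ t, 0 ≤ t → Tendsto (fun h : ℝ => h⁻¹ • (f (t + h) - S h (f t))) (𝓝[>] 0) (𝓝 (g t))

theorem tendsto_sub_nhdsGT (t : ℝ) : Tendsto (fun u : ℝ => u - t) (𝓝[>] t) (𝓝[>] 0) := by
  refine tendsto_nhdsWithin_iff.2 ⟨?_, ?_⟩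
  · have : Tendsto (fun u : ℝ => u - t) (𝓝 t) (𝓝 (t - t)) :=
      (continuous_id.sub continuous_const).tendsto t
    rw [sub_self] at this
    exact this.mono_left nhdsWithin_le_nhds
  · filter_upwards [self_mem_nhdsWithin] with u hu using sub_pos.2 (Set.mem_Ioi.1 hu)

theorem hasDerivWithinAt_of_tendsto {E : Type*} [NormedAddCommGroup E] [NormedSpace ℝ E]
    {φ : ℝ → E} {φ' : E} {t : ℝ}
    (h : Tendsto (fun h : ℝ => h⁻¹ • (φ (t + h) - φ t)) (𝓝[>] 0) (𝓝 φ')) :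
    HasDerivWithinAt φ φ' (Set.Ici t) t := by
  rw [← hasDerivWithinAt_Ioi_iff_Ici, hasDerivWithinAt_iff_tendsto_slope' (by simp)]
  refine (h.comp (tendsto_sub_nhdsGT t)).congr fun u => ?_
  simp [slope]

namespace IsMild

variable {S : ℝ → H →L[ℂ] H} {Z : H →L[ℂ] H} {γ : ℝ} {f g f₁ g₁ : ℝ → H}

theorem congr_right (hf : IsMild S f g) (h : ∀ t, 0 ≤ t → g t = g₁ t) : IsMild S f g₁ :=
  ⟨hf.continuousOn, fun t ht => h t ht ▸ hf.tendsto t ht⟩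

theorem sub (hf : IsMild S f g) (hf₁ : IsMild S f₁ g₁) :
    IsMild S (fun t => f t - f₁ t) (fun t => g t - g₁ t) := by
  refine ⟨hf.continuousOn.sub hf₁.continuousOn, fun t ht => ?_⟩
  refine ((hf.tendsto t ht).sub (hf₁.tendsto t ht)).congr fun h => ?_
  rw [← smul_sub, map_sub]
  congr 1
  abel

theorem comp_add (hf : IsMild S f g) {t₀ : ℝ} (ht₀ : 0 ≤ t₀) :
    IsMild S (fun t => f (t₀ + t)) (fun t => g (t₀ + t)) := by
  refine ⟨hf.continuousOn.comp (by fun_prop) fun t ht => add_nonneg ht₀ ht, fun t ht => ?_⟩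
  simpa only [add_assoc] using hf.tendsto (t₀ + t) (add_nonneg ht₀ ht)

/-- Apply an operator that commutes with the semigroup. -/
theorem map (hf : IsMild S f g) {R : H →L[ℂ] H} (hR : ∀ t, 0 ≤ t → ∀ x, R (S t x) = S t (R x)) :
    IsMild S (fun t => R (f t)) (fun t => R (g t)) := by
  refine ⟨R.continuous.comp_continuousOn hf.continuousOn, fun t ht => ?_⟩
  refine ((R.continuous.tendsto _).comp (hf.tendsto t ht)).congr' ?_
  filter_upwards [self_mem_nhdsWithin] with h hh
  simp only [Function.comp_apply]
  rw [R.map_smul_of_tower, map_sub, hR h (le_of_lt hh)]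

/-- A mild solution need not lie in the domain of the generator, and so need not be differentiable.
It is differentiable after any `ℓ` for which `ℓ (S h (f t))` has a right derivative at `h = 0`, in
particular for `ℓ = Z` and for the potential operator. -/
theorem hasDerivWithinAt (hf : IsMild S f g) {E : Type*} [NormedAddCommGroup E]
    [NormedSpace ℂ E] {ℓ : H →L[ℂ] E} {t : ℝ} (ht : 0 ≤ t) {m : E}
    (hm : Tendsto (fun h : ℝ => h⁻¹ • (ℓ (S h (f t)) - ℓ (f t))) (𝓝[>] 0) (𝓝 m)) :
    HasDerivWithinAt (fun s => ℓ (f s)) (ℓ (g t) + m) (Set.Ici t) t := by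
  refine hasDerivWithinAt_of_tendsto ?_
  refine (((ℓ.continuous.tendsto _).comp (hf.tendsto t ht)).add hm).congr fun h => ?_
  simp only [Function.comp_apply]
  rw [ℓ.map_smul_of_tower, map_sub, ← smul_add]
  congr 1
  abel

theorem hasDerivWithinAt_of_invariant (hf : IsMild S f g) {E : Type*} [NormedAddCommGroup E]
    [NormedSpace ℂ E] {ℓ : H →L[ℂ] E} (hℓ : ∀ t, 0 ≤ t → ∀ x, ℓ (S t x) = ℓ x)
    {t : ℝ} (ht : 0 ≤ t) : HasDerivWithinAt (fun s => ℓ (f s)) (ℓ (g t)) (Set.Ici t) t := by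
  have := hf.hasDerivWithinAt (ℓ := ℓ) ht (m := 0) (tendsto_const_nhds.congr' (by
    filter_upwards [self_mem_nhdsWithin] with h hh
    rw [hℓ h (le_of_lt hh), sub_self, smul_zero]))
  rwa [add_zero] at this

/-- Write `f (t + h) = S h (f t) + e` with `e ≈ h g t`. The cross term gives `2 Re⟨f, g⟩`, while `S
h` fixes `Z f` and contracts the rest by `e^{-γh}`. The contraction is only an inequality, hence a
Dini derivative. -/
theorem diniLE_norm_sq (hf : IsMild S f g) (hS : IsGapped S Z γ) {t : ℝ} (ht : 0 ≤ t) :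
    DiniLE (fun s => ‖f s‖ ^ 2)
      (-(2 * γ) * ‖f t - Z (f t)‖ ^ 2 + 2 * (inner ℂ (f t) (g t)).re) t := by
  have hS0 := hS.tendsto (f t)
  have hq := hf.tendsto t ht
  have h0 : Tendsto (fun h : ℝ => h) (𝓝[>] 0) (𝓝 0) := nhdsWithin_le_nhds
  have hexp : Tendsto (fun h : ℝ => h⁻¹ * (Real.exp (-(2 * γ) * h) - 1)) (𝓝[>] 0)
      (𝓝 (-(2 * γ))) := by
    have hd : HasDerivAt (fun h : ℝ => Real.exp (-(2 * γ) * h)) (-(2 * γ)) 0 := by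
      simpa using ((hasDerivAt_id (0 : ℝ)).const_mul (-(2 * γ))).exp
    have := (hasDerivWithinAt_iff_tendsto_slope' (by simp)).1 (hd.hasDerivWithinAt (s := Set.Ioi 0))
    refine this.congr fun h => ?_
    simp [slope]
  have hin : Tendsto (fun h : ℝ => 2 * (inner ℂ (S h (f t)) (h⁻¹ • (f (t + h) - S h (f t)))).re)
      (𝓝[>] 0) (𝓝 (2 * (inner ℂ (f t) (g t)).re)) :=
    ((Complex.continuous_re.tendsto _).comp (hS0.inner hq)).const_mul 2
  have hsq : Tendsto (fun h : ℝ => h * ‖h⁻¹ • (f (t + h) - S h (f t))‖ ^ 2) (𝓝[>] 0) (𝓝 0) := by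
    simpa using h0.mul (hq.norm.pow 2)
  have htot := ((hexp.mul_const (‖f t - Z (f t)‖ ^ 2)).add hin).add hsq
  rw [add_zero] at htot
  intro r hr
  have hev := (htot.eventually_lt_const hr).and self_mem_nhdsWithin
  filter_upwards [(tendsto_sub_nhdsGT t).eventually hev] with z hz
  obtain ⟨hz, hpos⟩ := hz
  refine lt_of_le_of_lt ?_ hz
  set h := z - t with hh
  have hpos' : 0 < h := hpos
  have hzt : z = t + h := by rw [hh]; ring
  rw [hzt]
  set e := f (t + h) - S h (f t) with he
  have e1 : ‖f (t + h)‖ ^ 2 = ‖S h (f t)‖ ^ 2 + 2 * (inner ℂ (S h (f t)) e).re + ‖e‖ ^ 2 := by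
    have := norm_add_sq (𝕜 := ℂ) (S h (f t)) e
    rw [he, add_sub_cancel] at this
    rw [this]; rfl
  have e2 : ‖S h (f t)‖ ^ 2 ≤ ‖Z (f t)‖ ^ 2
      + Real.exp (-(2 * γ) * h) * ‖f t - Z (f t)‖ ^ 2 := by
    rw [hS.norm_sq_eq (S h (f t)), hS.proj_apply h hpos'.le]
    have h1 := hS.decay h hpos'.le _ (hS.proj_sub (f t))
    rw [map_sub, hS.apply_proj h hpos'.le] at h1
    have h2 := pow_le_pow_left₀ (norm_nonneg _) h1 2
    rw [mul_pow, ← Real.exp_nat_mul] at h2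
    refine add_le_add le_rfl (h2.trans_eq ?_)
    congr 2
    push_cast; ring
  have e3 := hS.norm_sq_eq (f t)
  have e4 : (inner ℂ (S h (f t)) (h⁻¹ • e)).re = h⁻¹ * (inner ℂ (S h (f t)) e).re := by
    rw [← Complex.coe_smul, inner_smul_right, Complex.re_ofReal_mul]
  have e5 : h * ‖h⁻¹ • e‖ ^ 2 = h⁻¹ * ‖e‖ ^ 2 := by
    rw [norm_smul, mul_pow, norm_inv, Real.norm_eq_abs, abs_of_pos hpos']
    field_simp
  rw [e4, e5]
  have : (h⁻¹ * (Real.exp (-(2 * γ) * h) - 1) * ‖f t - Z (f t)‖ ^ 2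
      + 2 * (h⁻¹ * (inner ℂ (S h (f t)) e).re)) + h⁻¹ * ‖e‖ ^ 2
      = h⁻¹ * ((Real.exp (-(2 * γ) * h) - 1) * ‖f t - Z (f t)‖ ^ 2
      + 2 * (inner ℂ (S h (f t)) e).re + ‖e‖ ^ 2) := by ring
  rw [this]
  refine mul_le_mul_of_nonneg_left ?_ (inv_nonneg.2 hpos'.le)
  linarith

end IsMild

end Gap

/-! ### Hypocoercivity: transferring the dissipation to the range of the projection. -/

section Hypocoercivity

variable {H : Type*} [NormedAddCommGroup H] [InnerProductSpace ℂ H] [CompleteSpace H]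
variable {S : ℝ → H →L[ℂ] H} {Z : H →L[ℂ] H} {γ : ℝ}

/-- The bounded self-adjoint operator `A` couples the range of `Z`, apart from the unit vector `q`,
to the kernel of `Z`, where the semigroup dissipates. -/
structure IsCoupling (hS : IsGapped S Z γ) (A : H →L[ℂ] H) (q : H) (χ : ℝ) : Prop where
  symm : ∀ f g, inner ℂ (A f) g = inner ℂ f (A g)
  proj_apply_proj : ∀ f, Z (A (Z f)) = 0
  norm_eq_one : ‖q‖ = 1
  proj_eq : Z q = q
  apply_eq_zero : A q = 0
  pos : 0 < χ
  coercive : ∀ g, Z g = g → inner ℂ q g = 0 → χ * ‖g‖ ≤ ‖hS.potential (A g)‖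

/-- The norm squared, modified by a small cross term that transfers the dissipation to the range
of `Z`. -/
def hypoEnergy (hS : IsGapped S Z γ) (A : H →L[ℂ] H) (ε : ℝ) (g : H) : ℝ :=
  ‖g‖ ^ 2 + 2 * ε * (inner ℂ (hS.potential (A (Z g))) (hS.potential g)).im

theorem continuous_hypoEnergy (hS : IsGapped S Z γ) (A : H →L[ℂ] H) (ε : ℝ) :
    Continuous (hypoEnergy hS A ε) := by
  unfold hypoEnergy
  exact (continuous_norm.pow 2).add (continuous_const.mul (Complex.continuous_im.comp
    (((hS.potential.continuous.comp (A.continuous.comp Z.continuous))).inner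
      hS.potential.continuous)))

/-- In the application `a`, `b`, `n` are the norms of `Z g`, of `g - Z g` and of the source. The
cross term, of weight `ε`, supplies the missing `-χ² a²`; its cost in `b²` is absorbed by `-2γ b²`
when `ε` is small. -/
theorem exists_dissipation_constants {γ χ M : ℝ} (hγ : 0 < γ) (hχ : 0 < χ) (hM : 1 ≤ M) :
    ∃ ε c : ℝ, 0 < ε ∧ 0 < c ∧ ε * M ≤ 1 / 2 ∧ ∀ a b n : ℝ, 0 ≤ a → 0 ≤ b → 0 ≤ n →
      -(2 * γ) * b ^ 2 + 2 * (a + b) * n + 2 * ε * (-(χ ^ 2 * a ^ 2) + M * b ^ 2 + M * (a * b)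
        + M * (n * (a + b))) ≤ -(2 * c) * (a ^ 2 + b ^ 2) + 4 / c * n ^ 2 := by
  have hM0 : 0 < M := by linarith
  -- `D` collects the `b²` terms of the cross term; the second summand comes from Young's inequality
  -- `2 M a b ≤ χ² a² + (M²/χ²) b²`. The other bound on `ε` also makes the modified energy
  -- equivalent to the norm squared.
  set D := 2 * M + M ^ 2 / χ ^ 2 with hD
  have hD0 : 0 < D := by positivity
  set ε := min (γ / D) (1 / (2 * M)) with hε
  have hε0 : 0 < ε := by positivity
  have h1 : ε * D ≤ γ := by
    have : ε ≤ γ / D := min_le_left _ _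
    rwa [le_div_iff₀ hD0] at this
  have h2 : ε * M ≤ 1 / 2 := by
    have : ε ≤ 1 / (2 * M) := min_le_right _ _
    rw [le_div_iff₀ (by positivity)] at this
    linarith
  -- A dissipation of `4c (a² + b²)` is available. Half of it absorbs the source, by `3 x n ≤ 2c x²
  -- + (2/c) n²` with `x = a` and `x = b`.
  set c := min (ε * χ ^ 2) γ / 4 with hc
  have hc0 : 0 < c := by positivity
  have hc1 : 4 * c ≤ ε * χ ^ 2 := by
    have := min_le_left (ε * χ ^ 2) γ; rw [hc]; linarith
  have hc2 : 4 * c ≤ γ := by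
    have := min_le_right (ε * χ ^ 2) γ; rw [hc]; linarith
  refine ⟨ε, c, hε0, hc0, h2, fun a b n ha hb hn => ?_⟩
  have hab : 2 * M * (a * b) ≤ χ ^ 2 * a ^ 2 + M ^ 2 / χ ^ 2 * b ^ 2 := by
    have := sq_nonneg (χ * a - M / χ * b)
    have e : (χ * a - M / χ * b) ^ 2
      = χ ^ 2 * a ^ 2 + M ^ 2 / χ ^ 2 * b ^ 2 - 2 * M * (a * b) := by
      field_simp
      ring
    linarith
  have s1 : 2 * ε * (-(χ ^ 2 * a ^ 2) + M * b ^ 2 + M * (a * b))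
      ≤ -(ε * χ ^ 2) * a ^ 2 + ε * D * b ^ 2 := by
    have := mul_le_mul_of_nonneg_left hab hε0.le
    rw [hD]
    linarith
  have s2 : ε * D * b ^ 2 ≤ γ * b ^ 2 := mul_le_mul_of_nonneg_right h1 (sq_nonneg b)
  have s3 : 2 * ε * (M * (n * (a + b))) ≤ n * (a + b) := by
    have : 0 ≤ n * (a + b) := by positivity
    nlinarith
  have s4 : -(ε * χ ^ 2) * a ^ 2 - γ * b ^ 2 ≤ -(4 * c) * (a ^ 2 + b ^ 2) := by
    nlinarith [mul_le_mul_of_nonneg_right hc1 (sq_nonneg a),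
      mul_le_mul_of_nonneg_right hc2 (sq_nonneg b)]
  have yng : ∀ x : ℝ, 3 * (x * n) ≤ 2 * c * x ^ 2 + 2 / c * n ^ 2 := by
    intro x
    have e : 2 * c * x ^ 2 + 2 / c * n ^ 2 - 3 * (x * n)
      = 2 / c * (c * x - 3 / 4 * n) ^ 2 + (7 / 8) / c * n ^ 2 := by
      field_simp
      ring
    have : 0 ≤ 2 / c * (c * x - 3 / 4 * n) ^ 2 + (7 / 8) / c * n ^ 2 := by positivity
    linarith
  have ya := yng a
  have yb := yng b
  have e4 : 4 / c * n ^ 2 = 2 / c * n ^ 2 + 2 / c * n ^ 2 := by ring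
  rw [e4]
  linarith

/-- This bounds the derivative of the cross term. Put `u = -i A g + η` and let `B⁻¹` be
`hS.potential`. The part `-i B⁻¹ A Z g` of the second slot pairs with `B⁻¹ A Z g` to give `-‖B⁻¹ A Z
g‖² ≤ -χ² ‖Z g‖²`, which is the gain. Since `Z A Z = 0`, `Z u` involves only `g - Z g` and `η`, so
no other term is quadratic in `‖Z g‖`. -/
theorem IsCoupling.im_inner_le {hS : IsGapped S Z γ} {A : H →L[ℂ] H} {q : H} {χ : ℝ}
    (hA : IsCoupling hS A q χ) {M : ℝ} (hM₁ : (γ⁻¹ * ‖A‖) ^ 2 + γ⁻¹ * ‖A‖ ≤ M)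
    (hM₂ : γ⁻¹ * ‖A‖ * γ⁻¹ ≤ M) {g u : H} (hg : inner ℂ q g = 0) :
    (inner ℂ (hS.potential (A (Z u))) (hS.potential g)
      + inner ℂ (hS.potential (A (Z g))) (hS.potential u - (g - Z g))).im
    ≤ -(χ ^ 2 * ‖Z g‖ ^ 2) + M * ‖g - Z g‖ ^ 2 + M * (‖Z g‖ * ‖g - Z g‖)
        + M * (‖u + Complex.I • A g‖ * (‖Z g‖ + ‖g - Z g‖)) := by
  set η := u + Complex.I • A g with hη
  have hu : u = -(Complex.I • A g) + η := by rw [hη]; abel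
  set θ := γ⁻¹ with hθ
  have hθ0 : 0 ≤ θ := inv_nonneg.2 hS.pos.le
  set a := ‖Z g‖ with ha
  set b := ‖g - Z g‖ with hb
  set n := ‖η‖ with hn
  have ha0 : 0 ≤ a := norm_nonneg _
  have hb0 : 0 ≤ b := norm_nonneg _
  have hn0 : 0 ≤ n := norm_nonneg _
  have hN : 0 ≤ ‖A‖ := norm_nonneg _
  have hpot : ∀ x, ‖hS.potential x‖ ≤ θ * ‖x‖ := fun x => (hS.norm_potential_le x).trans
    (mul_le_mul_of_nonneg_left (hS.norm_sub_proj_le x) hθ0)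
  have hpA : ∀ x, ‖hS.potential (A x)‖ ≤ θ * ‖A‖ * ‖x‖ := fun x => (hpot _).trans (by
    rw [mul_assoc]; exact mul_le_mul_of_nonneg_left (A.le_opNorm x) hθ0)
  have hpg : ‖hS.potential g‖ ≤ θ * b := hS.norm_potential_le g
  have hsplit : A g = A (Z g) + A (g - Z g) := by rw [← map_add, add_sub_cancel]
  have hZu : Z u = -(Complex.I • Z (A (g - Z g))) + Z η := by
    rw [hu, map_add, map_neg, map_smul, hsplit, map_add, hA.proj_apply_proj, zero_add]
  have hZu_norm : ‖Z u‖ ≤ ‖A‖ * b + n := by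
    rw [hZu]
    refine (norm_add_le _ _).trans (add_le_add ?_ (hS.norm_proj_le η))
    rw [norm_neg, norm_smul, Complex.norm_I, one_mul]
    exact (hS.norm_proj_le _).trans (A.le_opNorm _)
  have t1 : (inner ℂ (hS.potential (A (Z u))) (hS.potential g)).im
      ≤ θ * ‖A‖ * (‖A‖ * b + n) * (θ * b) := by
    refine (Complex.abs_im_le_norm _ |> (le_abs_self _).trans).trans ?_
    refine (norm_inner_le_norm _ _).trans ?_
    refine mul_le_mul ((hpA _).trans ?_) hpg (norm_nonneg _) (by positivity)
    exact mul_le_mul_of_nonneg_left hZu_norm (by positivity)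
  have hcoer : χ * a ≤ ‖hS.potential (A (Z g))‖ := by
    refine hA.coercive _ (hS.proj_proj g) ?_
    rw [← hS.symm, hA.proj_eq, hg]
  have e2 : hS.potential u - (g - Z g) = -(Complex.I • hS.potential (A (Z g)))
      + (-(Complex.I • hS.potential (A (g - Z g))) + hS.potential η - (g - Z g)) := by
    rw [hu, map_add, map_neg, map_smul, hsplit, map_add, smul_add]
    abel
  have t2 : (inner ℂ (hS.potential (A (Z g))) (hS.potential u - (g - Z g))).im
      ≤ -(χ ^ 2 * a ^ 2) + θ * ‖A‖ * a * (θ * ‖A‖ * b + θ * n + b) := by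
    rw [e2, inner_add_right, Complex.add_im]
    refine add_le_add ?_ ?_
    · rw [inner_neg_right, inner_smul_right, inner_self_eq_norm_sq_to_K, ← mul_pow]
      have : (-(Complex.I * ((‖hS.potential (A (Z g))‖ : ℂ)) ^ 2)).im
          = -‖hS.potential (A (Z g))‖ ^ 2 := by
        rw [← Complex.ofReal_pow, Complex.neg_im, mul_comm, Complex.re_ofReal_mul |> fun _ =>
          Complex.im_ofReal_mul]
        simp
      refine this.trans_le ?_
      exact neg_le_neg (pow_le_pow_left₀ (by have := hA.pos; positivity) hcoer 2)
    · refine (Complex.abs_im_le_norm _ |> (le_abs_self _).trans).trans ?_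
      refine (norm_inner_le_norm _ _).trans ?_
      refine mul_le_mul (hpA _) ?_ (norm_nonneg _) (by positivity)
      refine (norm_sub_le _ _).trans (add_le_add ((norm_add_le _ _).trans (add_le_add ?_ (hpot _)))
        le_rfl)
      rw [norm_neg, norm_smul, Complex.norm_I, one_mul]
      exact hpA _
  rw [Complex.add_im]
  refine (add_le_add t1 t2).trans ?_
  set R := θ * ‖A‖ with hR
  have hR0 : 0 ≤ R := by positivity
  have e3 : R * (‖A‖ * b + n) * (θ * b) = R ^ 2 * b ^ 2 + R * θ * (n * b) := by rw [hR]; ring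
  have e4 : R * a * (R * b + θ * n + b) = (R ^ 2 + R) * (a * b) + R * θ * (n * a) := by ring
  rw [e3, e4]
  have k1 : R ^ 2 * b ^ 2 ≤ M * b ^ 2 :=
    mul_le_mul_of_nonneg_right (by linarith) (sq_nonneg _)
  have k2 : (R ^ 2 + R) * (a * b) ≤ M * (a * b) :=
    mul_le_mul_of_nonneg_right hM₁ (by positivity)
  have k3 : R * θ * (n * b) ≤ M * (n * b) := mul_le_mul_of_nonneg_right hM₂ (by positivity)
  have k4 : R * θ * (n * a) ≤ M * (n * a) := mul_le_mul_of_nonneg_right hM₂ (by positivity)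
  linarith

/-- Hypocoercivity: an energy equivalent to the norm squared that is strictly dissipated along
mild solutions orthogonal to `q`. -/
theorem IsCoupling.exists_lyapunov {hS : IsGapped S Z γ} {A : H →L[ℂ] H} {q : H} {χ : ℝ}
    (hA : IsCoupling hS A q χ) : ∃ (V : H → ℝ) (c C : ℝ), 0 < c ∧ 0 < C ∧ Continuous V ∧
      (∀ g, 1 / 2 * ‖g‖ ^ 2 ≤ V g) ∧ (∀ g, V g ≤ 2 * ‖g‖ ^ 2) ∧
      ∀ f u : ℝ → H, IsMild S f u → ∀ t, 0 ≤ t → inner ℂ q (f t) = 0 →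
        DiniLE (fun s => V (f s)) (-c * V (f t) + C * ‖u t + Complex.I • A (f t)‖ ^ 2) t := by
  set M := 1 + (γ⁻¹ * ‖A‖) ^ 2 + γ⁻¹ * ‖A‖ + γ⁻¹ * ‖A‖ * γ⁻¹ with hM
  have hγ' : 0 ≤ γ⁻¹ := inv_nonneg.2 hS.pos.le
  have p1 : 0 ≤ γ⁻¹ * ‖A‖ := by positivity
  have p2 : 0 ≤ γ⁻¹ * ‖A‖ * γ⁻¹ := by positivity
  have p3 : 0 ≤ (γ⁻¹ * ‖A‖) ^ 2 := by positivity
  obtain ⟨ε, c, hε, hc, hεM, hdiss⟩ := exists_dissipation_constants (M := M) hS.pos hA.pos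
    (by rw [hM]; linarith)
  have hcross : ∀ g, |2 * ε * (inner ℂ (hS.potential (A (Z g))) (hS.potential g)).im|
      ≤ 1 / 2 * ‖g‖ ^ 2 := by
    intro g
    have h1 : |(inner ℂ (hS.potential (A (Z g))) (hS.potential g)).im|
        ≤ γ⁻¹ * (‖A‖ * ‖Z g‖) * (γ⁻¹ * ‖g - Z g‖) := by
      refine (Complex.abs_im_le_norm _).trans ((norm_inner_le_norm _ _).trans ?_)
      refine mul_le_mul ((hS.norm_potential_le _).trans ?_) (hS.norm_potential_le g)
        (norm_nonneg _) (by positivity)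
      exact mul_le_mul_of_nonneg_left ((hS.norm_sub_proj_le _).trans (A.le_opNorm _)) hγ'
    rw [abs_mul, abs_of_pos (by positivity : 0 < 2 * ε)]
    have h2 := hS.norm_sq_eq g
    have h3 : 2 * (‖Z g‖ * ‖g - Z g‖) ≤ ‖g‖ ^ 2 := by
      nlinarith [sq_nonneg (‖Z g‖ - ‖g - Z g‖)]
    calc 2 * ε * |(inner ℂ (hS.potential (A (Z g))) (hS.potential g)).im|
        ≤ 2 * ε * (γ⁻¹ * (‖A‖ * ‖Z g‖) * (γ⁻¹ * ‖g - Z g‖)) := by gcongr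
      _ = ε * (γ⁻¹ * ‖A‖ * γ⁻¹) * (2 * (‖Z g‖ * ‖g - Z g‖)) := by ring
      _ ≤ ε * M * ‖g‖ ^ 2 := by
          gcongr
          rw [hM]; linarith
      _ ≤ _ := by gcongr
  refine ⟨hypoEnergy hS A ε, c, 4 / c, hc, by positivity, continuous_hypoEnergy hS A ε,
    fun g => ?_, fun g => ?_, fun f u hf t ht hq => ?_⟩
  · have := neg_le_of_abs_le (hcross g)
    unfold hypoEnergy; linarith
  · have := le_of_abs_le (hcross g)
    unfold hypoEnergy; nlinarith [sq_nonneg ‖g‖]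
  · set g := f t with hg
    -- `Z f` and `B⁻¹ f` are differentiable although `f` need not be; the cross term is built from
    -- these two alone.
    have hd1 : HasDerivWithinAt (fun s => hS.potential (A (Z (f s)))) (hS.potential (A (Z (u t))))
        (Set.Ici t) t :=
      hf.hasDerivWithinAt_of_invariant (ℓ := hS.potential.comp (A.comp Z))
        (fun s hs x => by simp [hS.proj_apply s hs]) ht
    have hd2 : HasDerivWithinAt (fun s => hS.potential (f s))
        (hS.potential (u t) + -(g - Z g)) (Set.Ici t) t :=
      hf.hasDerivWithinAt ht (hS.tendsto_potential (f t))
    have hd3 := hd1.inner ℂ hd2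
    have hd4 := (Complex.imCLM.hasFDerivAt.comp_hasDerivWithinAt t hd3).const_mul (2 * ε)
    have hsum := (hf.diniLE_norm_sq hS ht).add (DiniLE.of_hasDerivWithinAt hd4)
    refine DiniLE.mono hsum ?_
    have him := hA.im_inner_le (M := M) (by rw [hM]; linarith) (by rw [hM]; linarith) (u := u t) hq
    -- `A` is symmetric, so `-i A` does not change the norm and only the remaining source enters.
    have hre : (inner ℂ g (u t)).re ≤ (‖Z g‖ + ‖g - Z g‖) * ‖u t + Complex.I • A g‖ := by
      have e : inner ℂ g (u t) = inner ℂ g (u t + Complex.I • A g)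
          - Complex.I * inner ℂ g (A g) := by
        rw [inner_add_right, inner_smul_right]; ring
      have e' : (Complex.I * inner ℂ g (A g)).re = 0 := by
        have h1 : (starRingEnd ℂ) (inner ℂ g (A g)) = inner ℂ g (A g) := by
          rw [inner_conj_symm, hA.symm]
        have h2 := Complex.conj_eq_iff_im.1 h1
        simp [h2]
      rw [e, Complex.sub_re, e', sub_zero]
      refine (Complex.re_le_norm _).trans ((norm_inner_le_norm _ _).trans ?_)
      refine mul_le_mul_of_nonneg_right ?_ (norm_nonneg _)
      calc ‖g‖ = ‖Z g + (g - Z g)‖ := by rw [add_sub_cancel]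
        _ ≤ _ := norm_add_le _ _
    have hV : hypoEnergy hS A ε g ≤ 2 * ‖g‖ ^ 2 := by
      have := le_of_abs_le (hcross g)
      unfold hypoEnergy; nlinarith [sq_nonneg ‖g‖]
    have hfin := hdiss ‖Z g‖ ‖g - Z g‖ ‖u t + Complex.I • A g‖ (norm_nonneg _) (norm_nonneg _)
      (norm_nonneg _)
    rw [← hS.norm_sq_eq g] at hfin
    rw [Complex.imCLM_apply, ← sub_eq_add_neg,
      add_comm (inner ℂ (hS.potential (A (Z (f t)))) _)]
    have := mul_le_mul_of_nonneg_left him (by positivity : 0 ≤ 2 * ε)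
    have hVc := mul_le_mul_of_nonneg_left hV hc.le
    linarith

end Hypocoercivity

/-! ### Perturbations of size `s`, up to the time scale `s⁻²`. -/

section Perturbation

variable {H : Type*} [NormedAddCommGroup H] [InnerProductSpace ℂ H] [CompleteSpace H]
variable {S : ℝ → H →L[ℂ] H} {Z : H →L[ℂ] H} {γ : ℝ}

theorem gronwallBound_le {δ K ε x : ℝ} (hK : 0 < K) (hε : 0 ≤ ε) :
    gronwallBound δ K ε x ≤ (δ + x * ε) * Real.exp (K * x) := by
  rw [gronwallBound_of_K_ne_0 hK.ne', add_mul]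
  refine add_le_add le_rfl ?_
  have h1 : Real.exp (K * x) - 1 ≤ K * x * Real.exp (K * x) := by
    have h2 := Real.add_one_le_exp (-(K * x))
    have h3 : Real.exp (-(K * x)) * Real.exp (K * x) = 1 := by rw [← Real.exp_add]; simp
    nlinarith [Real.exp_pos (K * x)]
  calc ε / K * (Real.exp (K * x) - 1) ≤ ε / K * (K * x * Real.exp (K * x)) := by gcongr
    _ = _ := by field_simp

theorem gronwallBound_neg_le {δ c ε x : ℝ} (hc : 0 < c) (hε : 0 ≤ ε) :
    gronwallBound δ (-c) ε x ≤ δ * Real.exp (-c * x) + ε / c := by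
  rw [gronwallBound_of_K_ne_0 (by simpa using hc.ne')]
  refine add_le_add le_rfl ?_
  have : ε / -c * (Real.exp (-c * x) - 1) = ε / c - ε / c * Real.exp (-c * x) := by
    rw [div_neg]; ring
  rw [this]
  have := Real.exp_pos (-c * x)
  have : 0 ≤ ε / c * Real.exp (-c * x) := by positivity
  linarith

/-- The orthogonal projection onto the complement of the unit vector `q`. -/
def orthProj (q : H) : H →L[ℂ] H :=
  ContinuousLinearMap.id ℂ H - (innerSL ℂ q).smulRight q

theorem orthProj_apply (q f : H) : orthProj q f = f - inner ℂ q f • q := by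
  simp [orthProj]

theorem inner_orthProj {q : H} (hq : ‖q‖ = 1) (f : H) : inner ℂ q (orthProj q f) = 0 := by
  rw [orthProj_apply, inner_sub_right, inner_smul_right, inner_self_eq_norm_sq_to_K, hq]
  simp

theorem orthProj_of_inner_eq_zero {q f : H} (h : inner ℂ q f = 0) : orthProj q f = f := by
  rw [orthProj_apply, h, zero_smul, sub_zero]

theorem norm_sq_eq_inner_add_orthProj {q : H} (hq : ‖q‖ = 1) (f : H) :
    ‖f‖ ^ 2 = ‖inner ℂ q f‖ ^ 2 + ‖orthProj q f‖ ^ 2 := by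
  have h := norm_add_sq (𝕜 := ℂ) (inner ℂ q f • q) (orthProj q f)
  rw [inner_smul_left, inner_orthProj hq, mul_zero, norm_smul, hq, mul_one] at h
  have e : inner ℂ q f • q + orthProj q f = f := by rw [orthProj_apply]; abel
  rw [e] at h
  simpa using h

theorem norm_orthProj_le {q : H} (hq : ‖q‖ = 1) (f : H) : ‖orthProj q f‖ ≤ ‖f‖ := by
  have := norm_sq_eq_inner_add_orthProj hq f
  exact (sq_le_sq₀ (norm_nonneg _) (norm_nonneg _)).1 (by nlinarith [sq_nonneg ‖inner ℂ q f‖])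

/-- Here `β` is the modulus of the component along `q` and `g` the norm of the rest; they are
coupled at strength `s`. Splitting `β s g` into `s² β²` and `g²` puts the large part on `g²`, where
the dissipation `-M c V` absorbs it if `M` is large. What remains grows at rate `s²`. -/
theorem perturbed_dissipation_le {c C C₀ M s β g V X d e₀ e₁ : ℝ} (hc : 0 < c) (hC : 0 < C)
    (hM : 0 < M) (hs : 0 < s) (hMc : 4 * C₀ ^ 2 ≤ M * c) (hs2 : 2 * C * C₀ ^ 2 * s ^ 2 ≤ c / 4)
    (hd : d ≤ 2 * (β * (C₀ * s * g + e₀)))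
    (hX : X ≤ 2 * (C₀ ^ 2 * s ^ 2 * (β ^ 2 + g ^ 2)) + 2 * e₁ ^ 2) (hV : 1 / 2 * g ^ 2 ≤ V) :
    d + M * (-c * V + C * X) ≤ (2 + 2 * M * C * C₀ ^ 2) * s ^ 2 * (β ^ 2 + M * V)
      + (e₀ ^ 2 / s ^ 2 + 2 * M * C * e₁ ^ 2) := by
  have hy1 : 2 * (β * (C₀ * s * g)) ≤ s ^ 2 * β ^ 2 + C₀ ^ 2 * g ^ 2 := by
    linarith [sq_nonneg (s * β - C₀ * g)]
  have hy2 : 2 * (β * e₀) ≤ s ^ 2 * β ^ 2 + e₀ ^ 2 / s ^ 2 := by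
    have e : (s * β - e₀ / s) ^ 2 = s ^ 2 * β ^ 2 + e₀ ^ 2 / s ^ 2 - 2 * (β * e₀) := by
      field_simp
      ring
    linarith [sq_nonneg (s * β - e₀ / s)]
  have hMV : M * c * (1 / 2 * g ^ 2) ≤ M * c * V :=
    mul_le_mul_of_nonneg_left hV (by positivity)
  have hMC := mul_le_mul_of_nonneg_left hX (by positivity : 0 ≤ M * C)
  have hgs := mul_le_mul_of_nonneg_left hs2 (by positivity : 0 ≤ M * g ^ 2)
  have hKV : 0 ≤ (2 + 2 * M * C * C₀ ^ 2) * s ^ 2 * (M * V) := by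
    have : 0 ≤ V := le_trans (by positivity) hV
    positivity
  have hgM := mul_le_mul_of_nonneg_right hMc (sq_nonneg g)
  linarith

namespace IsCoupling

variable {hS : IsGapped S Z γ} {A : H →L[ℂ] H} {q : H} {χ : ℝ}

theorem inner_apply_eq_zero (hA : IsCoupling hS A q χ) (f : H) : inner ℂ q (A f) = 0 := by
  rw [← hA.symm, hA.apply_eq_zero, inner_zero_left]

theorem semigroup_apply (hA : IsCoupling hS A q χ) {t : ℝ} (ht : 0 ≤ t) : S t q = q := by
  have := hS.apply_proj t ht q
  rwa [hA.proj_eq] at this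

theorem inner_semigroup (hA : IsCoupling hS A q χ) {t : ℝ} (ht : 0 ≤ t) (f : H) :
    inner ℂ q (S t f) = inner ℂ q f := by
  rw [← hA.proj_eq, hS.symm, hS.proj_apply t ht, ← hS.symm]

theorem orthProj_semigroup (hA : IsCoupling hS A q χ) {t : ℝ} (ht : 0 ≤ t) (f : H) :
    orthProj q (S t f) = S t (orthProj q f) := by
  rw [orthProj_apply, orthProj_apply, hA.inner_semigroup ht, map_sub, map_smul,
    hA.semigroup_apply ht]

theorem hasDerivWithinAt_inner (hA : IsCoupling hS A q χ) {f u : ℝ → H} (hf : IsMild S f u) {t : ℝ}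
    (ht : 0 ≤ t) : HasDerivWithinAt (fun s => inner ℂ q (f s)) (inner ℂ q (u t)) (Set.Ici t) t :=
  hf.hasDerivWithinAt_of_invariant (ℓ := innerSL ℂ q)
    (fun s hs x => by simpa using hA.inner_semigroup hs x) ht

theorem inner_eq (hA : IsCoupling hS A q χ) {f u : ℝ → H} (hf : IsMild S f u)
    (hu : ∀ t, 0 ≤ t → inner ℂ q (u t) = 0) {t : ℝ} (ht : 0 ≤ t) :
    inner ℂ q (f t) = inner ℂ q (f 0) := by
  refine constant_of_has_deriv_right_zero (a := 0) (b := t) (f := fun s => inner ℂ q (f s))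
    ?_ (fun s hs => ?_) t ⟨ht, le_rfl⟩
  · exact continuousOn_const.inner (hf.continuousOn.mono Set.Icc_subset_Ici_self)
  · have := hA.hasDerivWithinAt_inner hf hs.1
    rwa [hu s hs.1] at this

/-- Mild solutions of the unperturbed equation orthogonal to `q` decay exponentially. -/
theorem exists_decay (hA : IsCoupling hS A q χ) : ∃ c : ℝ, 0 < c ∧
    ∀ f : ℝ → H, IsMild S f (fun t => -(Complex.I • A (f t))) → inner ℂ q (f 0) = 0 →
      ∀ t, 0 ≤ t → ‖f t‖ ≤ 2 * ‖f 0‖ * Real.exp (-c * t) := by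
  obtain ⟨V, c, C, hc, -, hVc, hV1, hV2, hV⟩ := hA.exists_lyapunov
  refine ⟨c / 2, by positivity, fun f hf h0 t ht => ?_⟩
  have hq : ∀ s, 0 ≤ s → inner ℂ q (f s) = 0 := fun s hs =>
    (hA.inner_eq hf (fun s _ => by
      rw [inner_neg_right, inner_smul_right, hA.inner_apply_eq_zero]; simp) hs).trans h0
  have hg := DiniLE.gronwall (φ := fun s => V (f s)) (δ := 2 * ‖f 0‖ ^ 2) (K := -c) (ε := 0)
    (a := 0) (b := t) (hVc.comp_continuousOn (hf.continuousOn.mono Set.Icc_subset_Ici_self))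
    (fun s hs => by
      have := hV f _ hf s hs.1 (hq s hs.1)
      simpa using this) (hV2 _) t ⟨ht, le_rfl⟩
  rw [gronwallBound_ε0, sub_zero] at hg
  have h1 := hV1 (f t)
  have h2 : ‖f t‖ ^ 2 ≤ (2 * ‖f 0‖ * Real.exp (-(c / 2) * t)) ^ 2 := by
    rw [mul_pow, mul_pow, ← Real.exp_nat_mul]
    have : ((2 : ℕ) : ℝ) * (-(c / 2) * t) = -c * t := by push_cast; ring
    rw [this]
    linarith
  exact (sq_le_sq₀ (norm_nonneg _) (by positivity)).1 h2

/-- The time integral of a decaying mild solution solves the stationary equation. -/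
theorem exists_resolvent (hA : IsCoupling hS A q χ) {f : ℝ → H}
    (hf : IsMild S f (fun t => -(Complex.I • A (f t)))) (h0 : inner ℂ q (f 0) = 0) :
    ∃ r : H, inner ℂ q r = 0 ∧ Tendsto (fun h : ℝ => h⁻¹ • (r - S h r)) (𝓝[>] 0)
      (𝓝 (f 0 - Complex.I • A r)) := by
  obtain ⟨c, hc, hdec⟩ := hA.exists_decay
  have hdec := hdec f hf h0
  have hbd : IntegrableOn (fun t => 2 * ‖f 0‖ * Real.exp (-c * t)) (Set.Ioi 0) :=
    (integrableOn_exp_mul_Ioi (neg_neg_of_pos hc) 0).const_mul _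
  have hint : IntegrableOn f (Set.Ioi 0) := by
    refine hbd.mono' ((hf.continuousOn.mono
      Set.Ioi_subset_Ici_self).aestronglyMeasurable measurableSet_Ioi) ?_
    filter_upwards [ae_restrict_mem measurableSet_Ioi] with t ht
    exact hdec t (le_of_lt ht)
  have hlim : Tendsto f atTop (𝓝 0) := by
    refine squeeze_zero_norm' ((eventually_ge_atTop 0).mono fun t ht => hdec t ht) ?_
    have : Tendsto (fun t : ℝ => Real.exp (-c * t)) atTop (𝓝 0) :=
      Real.tendsto_exp_atBot.comp (tendsto_id.const_mul_atTop_of_neg (neg_neg_of_pos hc))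
    simpa using this.const_mul (2 * ‖f 0‖)
  set r := ∫ t in Set.Ioi (0 : ℝ), f t with hr
  -- Integrating `(ℓ f)' = D f` over `(0, ∞)`, with `f` vanishing at infinity, gives a linear
  -- relation for `r = ∫ f`. The choices `ℓ = Z` and `ℓ = B⁻¹` suffice.
  have key : ∀ ℓ D : H →L[ℂ] H,
      (∀ t, 0 ≤ t → HasDerivWithinAt (fun s => ℓ (f s)) (D (f t)) (Set.Ici t) t) →
      D r = -ℓ (f 0) := by
    intro ℓ D hD
    have hDint : IntegrableOn (fun t => D (f t)) (Set.Ioi 0) := D.integrable_comp hint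
    have h1 : ∀ t, 0 ≤ t → ∫ s in (0 : ℝ)..t, D (f s) = ℓ (f t) - ℓ (f 0) := by
      intro t ht
      refine intervalIntegral.integral_eq_sub_of_hasDeriv_right (f := fun s => ℓ (f s)) ?_ ?_ ?_
      · rw [Set.uIcc_of_le ht]
        exact ℓ.continuous.comp_continuousOn (hf.continuousOn.mono Set.Icc_subset_Ici_self)
      · intro s hs
        rw [min_eq_left ht] at hs
        exact (hD s hs.1.le).mono Set.Ioi_subset_Ici_self
      · exact (intervalIntegrable_iff_integrableOn_Ioc_of_le ht).2
          (hDint.mono_set Set.Ioc_subset_Ioi_self)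
    have h2 := intervalIntegral_tendsto_integral_Ioi 0 hDint tendsto_id
    have h3 : Tendsto (fun t => ℓ (f t) - ℓ (f 0)) atTop (𝓝 (0 - ℓ (f 0))) := by
      refine Tendsto.sub ?_ tendsto_const_nhds
      simpa [Function.comp_def] using (ℓ.continuous.tendsto 0).comp hlim
    have h4 := tendsto_nhds_unique (h2.congr' ((eventually_ge_atTop 0).mono fun t ht => h1 t ht)) h3
    rw [ContinuousLinearMap.integral_comp_comm _ hint] at h4
    rw [h4, zero_sub]
  have kZ := key Z (-(Complex.I • Z.comp A)) fun t ht => by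
    have := hf.hasDerivWithinAt_of_invariant (ℓ := Z) (fun s hs x => hS.proj_apply s hs x) ht
    simpa using this
  have kG := key hS.potential (-(Complex.I • hS.potential.comp A)
      - (ContinuousLinearMap.id ℂ H - Z)) fun t ht => by
    have := hf.hasDerivWithinAt ht (hS.tendsto_potential (f t))
    simpa [sub_eq_add_neg] using this
  have hqr : inner ℂ q r = 0 := by
    have := (innerSL ℂ q).integral_comp_comm hint
    simp only [innerSL_apply_apply] at this
    rw [← this]
    refine setIntegral_eq_zero_of_forall_eq_zero fun t ht => ?_
    exact (hA.inner_eq hf (fun s _ => by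
      rw [inner_neg_right, inner_smul_right, hA.inner_apply_eq_zero]; simp) (le_of_lt ht)).trans h0
  refine ⟨r, hqr, ?_⟩
  -- The two relations say `Z y = 0` and `r = Z r + B⁻¹ y`, so `r` lies in the domain of the
  -- generator and `B r = y`.
  set y := f 0 - Complex.I • A r with hy
  have hZy : Z y = 0 := by
    rw [hy, map_sub, map_smul]
    simp only [neg_apply, smul_apply,
      ContinuousLinearMap.comp_apply] at kZ
    rw [neg_inj] at kZ
    rw [kZ, sub_self]
  have hry : r = Z r + hS.potential y := by
    simp only [sub_apply, neg_apply,
      smul_apply, ContinuousLinearMap.comp_apply,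
      ContinuousLinearMap.id_apply] at kG
    have : hS.potential y = r - Z r := by
      rw [hy, map_sub, map_smul]
      rw [eq_neg_iff_add_eq_zero] at kG
      rw [← sub_eq_zero, ← kG]
      abel
    rw [this]; abel
  have ht := hS.tendsto_generator_potential y
  rw [hZy, sub_zero] at ht
  refine ht.congr' ?_
  filter_upwards [self_mem_nhdsWithin] with h hh
  congr 1
  rw [hry, map_add, hS.apply_proj h (le_of_lt hh)]
  abel

/-- Neither operator couples `q` to itself, so the component along `q` is driven only by the
orthogonal part, through the small difference `A' - A`. -/
theorem inner_perturbed (hA : IsCoupling hS A q χ) {A' : H →L[ℂ] H} (hq' : inner ℂ q (A' q) = 0)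
    (f : H) : inner ℂ q (A' f) = inner ℂ q (A' (orthProj q f) - A (orthProj q f)) := by
  rw [inner_sub_right, hA.inner_apply_eq_zero, sub_zero, orthProj_apply, map_sub, map_smul,
    inner_sub_right, inner_smul_right, hq', mul_zero, sub_zero]

theorem orthProj_source (hA : IsCoupling hS A q χ) (A' : H →L[ℂ] H) (f ζ : H) :
    orthProj q (-(Complex.I • A' f) + ζ) + Complex.I • A (orthProj q f)
      = -(Complex.I • orthProj q (A' f - A f)) + orthProj q ζ := by
  have h1 : A (orthProj q f) = A f := by
    rw [orthProj_apply, map_sub, map_smul, hA.apply_eq_zero, smul_zero, sub_zero]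
  have h2 : orthProj q (A f) = A f := orthProj_of_inner_eq_zero (hA.inner_apply_eq_zero f)
  rw [h1, map_add, map_neg, map_smul, map_sub (orthProj q), h2, smul_sub]
  abel

/-- Growth of mild solutions of the perturbed equation: a perturbation of size `s` acts on the
time scale `s⁻²`. -/
theorem exists_perturbed_bound (hA : IsCoupling hS A q χ) (C₀ : ℝ) :
    ∃ C K s₁ : ℝ, 0 < C ∧ 0 < K ∧ 0 < s₁ ∧ ∀ s, 0 < s → s ≤ s₁ → ∀ A' : H →L[ℂ] H,
      (∀ x, ‖A' x - A x‖ ≤ C₀ * s * ‖x‖) → inner ℂ q (A' q) = 0 →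
      ∀ (z ζ : ℝ → H) (e₀ e₁ τ : ℝ), 0 ≤ e₀ → 0 ≤ e₁ →
      IsMild S z (fun t => -(Complex.I • A' (z t)) + ζ t) →
      (∀ t ∈ Set.Ico 0 τ, ‖inner ℂ q (ζ t)‖ ≤ e₀ ∧ ‖ζ t‖ ≤ e₁) →
      ∀ t ∈ Set.Icc 0 τ, ‖z t‖ ^ 2
        ≤ C * (‖z 0‖ ^ 2 + t * (e₀ ^ 2 / s ^ 2 + e₁ ^ 2)) * Real.exp (K * s ^ 2 * t) := by
  obtain ⟨V, c, C, hc, hC, hVc, hV1, hV2, hV⟩ := hA.exists_lyapunov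
  -- The first summand lets half of the dissipation absorb the coupling to the component along `q`;
  -- the second makes `‖z‖² ≤ ‖a‖² + M V` hold.
  set M := 4 * C₀ ^ 2 / c + 2 with hM
  have hM2 : 2 ≤ M := by have : 0 ≤ 4 * C₀ ^ 2 / c := by positivity
                         rw [hM]; linarith
  have hMc : 4 * C₀ ^ 2 ≤ M * c := by
    rw [hM, add_mul, div_mul_cancel₀ _ hc.ne']; linarith
  set K := 2 + 2 * M * C * C₀ ^ 2 with hK
  have hK0 : 0 < K := by positivity
  -- Below this threshold for `s`, the source that `A' - A` creates in the orthogonal part uses at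
  -- most the other half of the dissipation.
  refine ⟨2 * M * (1 + C), K, Real.sqrt (c / (8 * C * C₀ ^ 2 + 1)), by positivity, hK0,
    Real.sqrt_pos.2 (by positivity), ?_⟩
  intro s hs hs₁ A' hA' hq' z ζ e₀ e₁ τ he₀ he₁ hz hζ t ht
  have hs2 : 2 * C * C₀ ^ 2 * s ^ 2 ≤ c / 4 := by
    have h1 : s ^ 2 ≤ c / (8 * C * C₀ ^ 2 + 1) := by
      rw [← Real.sq_sqrt (by positivity : 0 ≤ c / (8 * C * C₀ ^ 2 + 1))]
      exact pow_le_pow_left₀ hs.le hs₁ 2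
    rw [le_div_iff₀ (by positivity)] at h1
    nlinarith [sq_nonneg s]
  have hn := hA.norm_eq_one
  set a : ℝ → ℂ := fun t => inner ℂ q (z t) with ha
  set g : ℝ → H := fun t => orthProj q (z t) with hg
  have hgm : IsMild S g (fun t => orthProj q (-(Complex.I • A' (z t)) + ζ t)) :=
    hz.map fun t ht x => hA.orthProj_semigroup ht x
  have hcont : ContinuousOn (fun t => ‖a t‖ ^ 2 + M * V (g t)) (Set.Icc 0 τ) := by
    have hzc := hz.continuousOn.mono (Set.Icc_subset_Ici_self (a := τ) (b := 0))
    refine ((continuousOn_const.inner hzc).norm.pow 2).add (continuousOn_const.mul ?_)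
    exact hVc.comp_continuousOn ((orthProj q).continuous.comp_continuousOn hzc)
  set e := e₀ ^ 2 / s ^ 2 + 2 * M * C * e₁ ^ 2 with he
  have he0 : 0 ≤ e := by positivity
  have hdini : ∀ t ∈ Set.Ico 0 τ, DiniLE (fun t => ‖a t‖ ^ 2 + M * V (g t))
      (K * s ^ 2 * (‖a t‖ ^ 2 + M * V (g t)) + e) t := by
    intro t ht
    obtain ⟨hζ0, hζ1⟩ := hζ t ht
    have hda := hA.hasDerivWithinAt_inner hz ht.1
    have hda2 : HasDerivWithinAt (fun t => ‖a t‖ ^ 2) (2 * (inner ℝ (a t)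
        (inner ℂ q (-(Complex.I • A' (z t)) + ζ t)))) (Set.Ici t) t := hda.norm_sq
    have hdV := hV g _ hgm t ht.1 (inner_orthProj hn _)
    refine ((DiniLE.of_hasDerivWithinAt hda2).add
      (hdV.const_mul (by positivity : 0 < M))).mono ?_
    have hsrc : ‖orthProj q (-(Complex.I • A' (z t)) + ζ t) + Complex.I • A (g t)‖
        ≤ C₀ * s * ‖z t‖ + e₁ := by
      rw [hA.orthProj_source]
      refine (norm_add_le _ _).trans (add_le_add ?_ ((norm_orthProj_le hn _).trans hζ1))
      rw [norm_neg, norm_smul, Complex.norm_I, one_mul]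
      exact (norm_orthProj_le hn _).trans (hA' _)
    have hsrc2 : ‖orthProj q (-(Complex.I • A' (z t)) + ζ t) + Complex.I • A (g t)‖ ^ 2
        ≤ 2 * (C₀ ^ 2 * s ^ 2 * (‖a t‖ ^ 2 + ‖g t‖ ^ 2)) + 2 * e₁ ^ 2 := by
      have h1 := pow_le_pow_left₀ (norm_nonneg _) hsrc 2
      have h2 := norm_sq_eq_inner_add_orthProj hn (z t)
      refine h1.trans ?_
      rw [← h2]
      nlinarith [sq_nonneg (C₀ * s * ‖z t‖ - e₁)]
    have hderiv : 2 * (inner ℝ (a t) (inner ℂ q (-(Complex.I • A' (z t)) + ζ t)))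
        ≤ 2 * (‖a t‖ * (C₀ * s * ‖g t‖ + e₀)) := by
      refine mul_le_mul_of_nonneg_left ?_ (by norm_num)
      refine (real_inner_le_norm _ _).trans (mul_le_mul_of_nonneg_left ?_ (norm_nonneg _))
      rw [inner_add_right, inner_neg_right, inner_smul_right, hA.inner_perturbed hq']
      refine (norm_add_le _ _).trans (add_le_add ?_ hζ0)
      rw [norm_neg, norm_mul, Complex.norm_I, one_mul]
      refine (norm_inner_le_norm _ _).trans ?_
      rw [hn, one_mul]
      exact hA' _
    exact perturbed_dissipation_le hc hC (by positivity) hs hMc hs2 hderiv hsrc2 (hV1 (g t))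
  have hfin := DiniLE.gronwall hcont hdini le_rfl t ht
  rw [sub_zero] at hfin
  have hfin2 := hfin.trans (gronwallBound_le (by positivity) he0)
  have hn0 := norm_sq_eq_inner_add_orthProj hn (z 0)
  have hnt := norm_sq_eq_inner_add_orthProj hn (z t)
  have hlow : ‖z t‖ ^ 2 ≤ ‖a t‖ ^ 2 + M * V (g t) := by
    have := hV1 (g t)
    have h0 : 0 ≤ V (g t) := le_trans (by positivity) this
    have h1 := mul_le_mul_of_nonneg_right hM2 h0
    rw [hnt]
    linarith
  refine hlow.trans (hfin2.trans (mul_le_mul_of_nonneg_right ?_ (Real.exp_pos _).le))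
  have hup : ‖a 0‖ ^ 2 + M * V (g 0) ≤ 2 * M * ‖z 0‖ ^ 2 := by
    have := hV2 (g 0)
    have h3 : ‖a 0‖ ^ 2 ≤ 2 * M * ‖a 0‖ ^ 2 :=
      le_mul_of_one_le_left (sq_nonneg _) (by linarith)
    have h4 := mul_le_mul_of_nonneg_left this (by positivity : 0 ≤ M)
    rw [hn0]
    linarith
  have hte : t * e ≤ 2 * M * (1 + C) * (t * (e₀ ^ 2 / s ^ 2 + e₁ ^ 2)) := by
    have h5 : e ≤ 2 * M * (1 + C) * (e₀ ^ 2 / s ^ 2 + e₁ ^ 2) := by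
      rw [he]
      have h6 : 0 ≤ e₀ ^ 2 / s ^ 2 := by positivity
      have h7 : 0 ≤ e₁ ^ 2 := by positivity
      have hMC : 0 < M * C := by positivity
      have h8 : (1 : ℝ) ≤ 2 * M * (1 + C) := by linarith
      have h9 := le_mul_of_one_le_left h6 h8
      have h10 : 0 ≤ 2 * M * e₁ ^ 2 := by positivity
      linarith
    calc t * e ≤ t * (2 * M * (1 + C) * (e₀ ^ 2 / s ^ 2 + e₁ ^ 2)) :=
          mul_le_mul_of_nonneg_left h5 ht.1
      _ = _ := by ring
  have hz0 : 2 * M * ‖z 0‖ ^ 2 ≤ 2 * M * (1 + C) * ‖z 0‖ ^ 2 := by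
    have : 0 ≤ M * C * ‖z 0‖ ^ 2 := by positivity
    linarith
  rw [mul_add]
  linarith

/-- After an initial layer, the part of a solution orthogonal to `q` is of the order of the
perturbation. -/
theorem exists_perturbed_orthProj_bound (hA : IsCoupling hS A q χ) (C₀ : ℝ) :
    ∃ c C : ℝ, 0 < c ∧ 0 < C ∧ ∀ s, 0 < s → ∀ A' : H →L[ℂ] H,
      (∀ x, ‖A' x - A x‖ ≤ C₀ * s * ‖x‖) → ∀ (f : ℝ → H) (B τ : ℝ),
      IsMild S f (fun t => -(Complex.I • A' (f t))) → (∀ t ∈ Set.Icc 0 τ, ‖f t‖ ≤ B) →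
      ∀ t ∈ Set.Icc 0 τ, ‖orthProj q (f t)‖ ^ 2 ≤ C * B ^ 2 * (Real.exp (-c * t) + s ^ 2) := by
  obtain ⟨V, c, C, hc, hC, hVc, hV1, hV2, hV⟩ := hA.exists_lyapunov
  refine ⟨c, 4 + 2 * C * C₀ ^ 2 / c, hc, by positivity, ?_⟩
  intro s hs A' hA' f B τ hf hB t ht
  have hn := hA.norm_eq_one
  set g : ℝ → H := fun t => orthProj q (f t) with hg
  have hgm : IsMild S g (fun t => orthProj q (-(Complex.I • A' (f t)) + 0)) := by
    simpa only [add_zero] using hf.map (R := orthProj q) fun t ht x => hA.orthProj_semigroup ht x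
  have hfc := hf.continuousOn.mono (Set.Icc_subset_Ici_self (a := τ) (b := 0))
  have hb0 := hB 0 ⟨le_rfl, ht.1.trans ht.2⟩
  have hB0 : 0 ≤ B := (norm_nonneg _).trans hb0
  -- For the orthogonal part the whole perturbation is a source of size at most `C₀ s B`; the
  -- Lyapunov decay balances it at level `s²` for the squared norm.
  have hgr := DiniLE.gronwall (φ := fun t => V (g t)) (δ := 2 * B ^ 2) (K := -c)
    (ε := C * (C₀ * s * B) ^ 2) (a := 0) (b := τ)
    (hVc.comp_continuousOn ((orthProj q).continuous.comp_continuousOn hfc))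
    (fun t ht => (hV g _ hgm t ht.1 (inner_orthProj hn _)).mono (by
      refine add_le_add le_rfl (mul_le_mul_of_nonneg_left ?_ hC.le)
      refine pow_le_pow_left₀ (norm_nonneg _) ?_ 2
      rw [hA.orthProj_source, map_zero, add_zero, norm_neg, norm_smul, Complex.norm_I, one_mul]
      refine (norm_orthProj_le hn _).trans ((hA' _).trans ?_)
      have h1 : 0 ≤ C₀ * s * ‖f t‖ := (norm_nonneg _).trans (hA' _)
      rcases (norm_nonneg (f t)).eq_or_lt with h2 | h2
      · rw [← h2, mul_zero]
        have h3 : 0 ≤ C₀ * s * ‖q‖ := (norm_nonneg _).trans (hA' q)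
        rw [hn, mul_one] at h3
        positivity
      · have h3 : 0 ≤ C₀ * s := nonneg_of_mul_nonneg_left h1 h2
        exact mul_le_mul_of_nonneg_left (hB t ⟨ht.1, ht.2.le⟩) h3))
    ((hV2 _).trans (by
      have := (norm_orthProj_le hn (f 0)).trans hb0
      have := pow_le_pow_left₀ (norm_nonneg _) this 2
      linarith)) t ht
  rw [sub_zero] at hgr
  have h1 := hgr.trans (gronwallBound_neg_le hc (by positivity))
  have h2 := hV1 (g t)
  have h3 : C * (C₀ * s * B) ^ 2 / c = C * C₀ ^ 2 / c * B ^ 2 * s ^ 2 := by ring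
  rw [h3] at h1
  have h4 : 0 ≤ C * C₀ ^ 2 / c * B ^ 2 * Real.exp (-c * t) := by positivity
  have h5 : (4 + 2 * C * C₀ ^ 2 / c) * B ^ 2 * (Real.exp (-c * t) + s ^ 2)
      = 2 * (2 * B ^ 2 * Real.exp (-c * t) + C * C₀ ^ 2 / c * B ^ 2 * s ^ 2)
        + (2 * (C * C₀ ^ 2 / c * B ^ 2 * Real.exp (-c * t)) + 4 * B ^ 2 * s ^ 2) := by ring
  rw [h5]
  have h6 : 0 ≤ 4 * B ^ 2 * s ^ 2 := by positivity
  linarith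

end IsCoupling

end Perturbation

/-! ### Second-order perturbation theory and the diffusive limit. -/

section Asymptotics

variable {H : Type*} [NormedAddCommGroup H] [InnerProductSpace ℂ H] [CompleteSpace H]
variable {S : ℝ → H →L[ℂ] H} {Z : H →L[ℂ] H} {γ : ℝ}

/-- The exponential `e^{-λ t} p` of a vector in the domain of the generator is a mild solution. -/
theorem isMild_exp_smul (l : ℂ) {p Bp : H}
    (hp : Tendsto (fun h : ℝ => h⁻¹ • (p - S h p)) (𝓝[>] 0) (𝓝 Bp)) :
    IsMild S (fun t => Complex.exp (-l * t) • p)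
      (fun t => Complex.exp (-l * t) • (-(l • p) + Bp)) := by
  refine ⟨by fun_prop, fun t _ => ?_⟩
  have hd : Tendsto (fun h : ℝ => h⁻¹ • (Complex.exp (-l * h) - 1)) (𝓝[>] 0) (𝓝 (-l)) := by
    have h1 : HasDerivAt (fun h : ℝ => Complex.exp (-l * h)) (-l) 0 := by
      have := ((Complex.ofRealCLM.hasDerivAt (x := (0 : ℝ))).const_mul (-l)).cexp
      simpa using this
    have := (hasDerivWithinAt_iff_tendsto_slope' (by simp)).1 (h1.hasDerivWithinAt (s := Set.Ioi 0))
    refine this.congr fun h => ?_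
    simp [slope]
  have h2 := ((hd.smul_const p).add hp).const_smul (Complex.exp (-l * t))
  rw [neg_smul] at h2
  refine h2.congr fun h => ?_
  have e1 : Complex.exp (-l * ((t + h : ℝ) : ℂ)) = Complex.exp (-l * t) * Complex.exp (-l * h) := by
    rw [← Complex.exp_add]; push_cast; ring_nf
  rw [e1, map_smul, smul_assoc, ← smul_add, smul_comm (Complex.exp (-l * t)) h⁻¹]
  congr 1
  rw [mul_smul, ← smul_sub]
  congr 1
  rw [sub_smul, one_smul]
  abel

namespace IsCoupling

variable {hS : IsGapped S Z γ} {A : H →L[ℂ] H} {q : H} {χ : ℝ}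

/-- Before the time scale `s⁻²`, the component along `q` barely moves. -/
theorem exists_inner_sub_bound (hA : IsCoupling hS A q χ) {C₀ : ℝ} (hC₀ : 0 ≤ C₀) :
    ∃ C : ℝ, 0 < C ∧ ∀ s, 0 < s → ∀ A' : H →L[ℂ] H,
      (∀ x, ‖A' x - A x‖ ≤ C₀ * s * ‖x‖) → inner ℂ q (A' q) = 0 → ∀ (f : ℝ → H) (B τ : ℝ),
      IsMild S f (fun t => -(Complex.I • A' (f t))) → (∀ t ∈ Set.Icc 0 τ, ‖f t‖ ≤ B) →
      ∀ t ∈ Set.Icc 0 τ, ‖inner ℂ q (f t) - inner ℂ q (f 0)‖ ≤ C * B * (s + s ^ 2 * t) := by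
  obtain ⟨c, C, hc, hC, hbd⟩ := hA.exists_perturbed_orthProj_bound C₀
  set L := C₀ * Real.sqrt C with hL
  refine ⟨L * (2 / c) + L + 1, by positivity, ?_⟩
  intro s hs A' hA' hq' f B τ hf hB t ht
  have hB0 : 0 ≤ B := (norm_nonneg _).trans (hB 0 ⟨le_rfl, ht.1.trans ht.2⟩)
  have hn := hA.norm_eq_one
  have hg : ∀ u ∈ Set.Icc 0 τ, ‖orthProj q (f u)‖
      ≤ Real.sqrt C * B * (Real.exp (-(c / 2) * u) + s) := by
    intro u hu
    have h1 := hbd s hs A' hA' f B τ hf hB u hu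
    refine (sq_le_sq₀ (norm_nonneg _) (by positivity)).1 (h1.trans ?_)
    rw [mul_pow, mul_pow, Real.sq_sqrt hC.le]
    refine mul_le_mul_of_nonneg_left ?_ (by positivity)
    have h2 : Real.exp (-(c / 2) * u) ^ 2 = Real.exp (-c * u) := by
      rw [← Real.exp_nat_mul]; congr 1; push_cast; ring
    rw [← h2]
    have : 0 ≤ Real.exp (-(c / 2) * u) * s := by positivity
    linarith [sq_nonneg (Real.exp (-(c / 2) * u)), add_sq (Real.exp (-(c / 2) * u)) s]
  have hcont : ContinuousOn (fun u => inner ℂ q (f u) - inner ℂ q (f 0)) (Set.Icc 0 τ) :=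
    (continuousOn_const.inner (hf.continuousOn.mono
      (Set.Icc_subset_Ici_self (a := τ) (b := 0)))).sub continuousOn_const
  -- The majorant integrates `s (e^{-cu/2} + s)`, the coupling times the bound on the orthogonal
  -- part. The exponential contributes `O(s)` in total, the constant `s² t`.
  have hexp : ∀ u : ℝ, HasDerivAt
      (fun u => L * B * s * (2 / c * (1 - Real.exp (-(c / 2) * u)) + s * u))
      (L * B * s * (Real.exp (-(c / 2) * u) + s)) u := by
    intro u
    have h1 : HasDerivAt (fun u : ℝ => Real.exp (-(c / 2) * u))
        (Real.exp (-(c / 2) * u) * (-(c / 2) * 1)) u :=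
      ((hasDerivAt_id u).const_mul (-(c / 2))).exp
    have h2 := ((((h1.const_sub 1).const_mul (2 / c)).add
      ((hasDerivAt_id u).const_mul s)).const_mul (L * B * s))
    convert! h2 using 1
    field_simp
  have key := image_norm_le_of_norm_deriv_right_le_deriv_boundary (a := 0) (b := τ)
    (f := fun u => inner ℂ q (f u) - inner ℂ q (f 0))
    (f' := fun u => inner ℂ q (-(Complex.I • A' (f u))))
    (B := fun u => L * B * s * (2 / c * (1 - Real.exp (-(c / 2) * u)) + s * u))
    (B' := fun u => L * B * s * (Real.exp (-(c / 2) * u) + s)) hcont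
    (fun u hu => (hA.hasDerivWithinAt_inner hf hu.1).sub_const _) (by simp) hexp
    (fun u hu => by
      rw [inner_neg_right, inner_smul_right, hA.inner_perturbed hq', norm_neg, norm_mul,
        Complex.norm_I, one_mul]
      refine (norm_inner_le_norm _ _).trans ?_
      rw [hn, one_mul]
      refine (hA' _).trans ?_
      have := mul_le_mul_of_nonneg_left (hg u ⟨hu.1, hu.2.le⟩)
        (mul_nonneg hC₀ hs.le)
      refine this.trans_eq ?_
      rw [hL]; ring) ht
  refine key.trans ?_
  have h3 : 1 - Real.exp (-(c / 2) * t) ≤ 1 := by linarith [Real.exp_pos (-(c / 2) * t)]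
  have hL0 : 0 ≤ L := by positivity
  have ht0 := ht.1
  calc L * B * s * (2 / c * (1 - Real.exp (-(c / 2) * t)) + s * t)
      ≤ L * B * s * (2 / c * 1 + s * t) := by gcongr
    _ = L * (2 / c) * B * s + L * B * (s ^ 2 * t) := by ring
    _ ≤ _ := by
      have h4 : 0 ≤ (L + 1) * B * s := by positivity
      have h5 : 0 ≤ (L * (2 / c) + 1) * B * (s ^ 2 * t) := by positivity
      linarith

/-- The diffusive limit of the component along `q`: the effective rate is given by the second order
of perturbation theory. -/
theorem tendsto_inner_perturbed (hA : IsCoupling hS A q χ) {A' : ℝ → H →L[ℂ] H} {C₀ C₁ s₀ : ℝ}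
    (hC₀ : 0 ≤ C₀) (hC₁ : 0 ≤ C₁) (hs₀ : 0 < s₀)
    (hA' : ∀ s, 0 < s → s ≤ s₀ → ∀ x, ‖A' s x - A x‖ ≤ C₀ * s * ‖x‖)
    (hsymm : ∀ s, 0 < s → s ≤ s₀ → ∀ x, inner ℂ (A' s q) x = inner ℂ q (A' s x))
    (hq' : ∀ s, 0 < s → s ≤ s₀ → inner ℂ q (A' s q) = 0) {φ r : H}
    (hφ : ∀ s, 0 < s → s ≤ s₀ → ‖A' s q - (s : ℂ) • φ‖ ≤ C₁ * s ^ 2) (hqφ : inner ℂ q φ = 0)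
    (hr : Tendsto (fun h : ℝ => h⁻¹ • (r - S h r)) (𝓝[>] 0) (𝓝 (φ - Complex.I • A r)))
    (hqr : inner ℂ q r = 0) {f : ℝ → ℝ → H}
    (hf : ∀ s, 0 < s → s ≤ s₀ → IsMild S (f s) (fun t => -(Complex.I • A' s (f s t)))) {B : ℝ}
    (hB : ∀ s, 0 < s → s ≤ s₀ → ‖f s 0‖ ≤ B) {a₀ : ℂ}
    (ha₀ : Tendsto (fun s => inner ℂ q (f s 0)) (𝓝[>] 0) (𝓝 a₀)) :
    Tendsto (fun s : ℝ => inner ℂ q (f s ((s ^ 2)⁻¹))) (𝓝[>] 0)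
      (𝓝 (Complex.exp (-inner ℂ φ r) * a₀)) := by
  obtain ⟨C, K, s₁, hC, hK, hs₁, hbound⟩ := hA.exists_perturbed_bound C₀
  obtain ⟨c, C₂, hc, hC₂, horth⟩ := hA.exists_perturbed_orthProj_bound C₀
  obtain ⟨C₃, hC₃, hinner⟩ := hA.exists_inner_sub_bound hC₀
  set Q := inner ℂ φ r with hQ
  have hn := hA.norm_eq_one
  have hqq : inner ℂ q q = 1 := by rw [inner_self_eq_norm_sq_to_K, hn]; simp
  -- a uniform bound up to the time scale of interest
  set B₁ := Real.sqrt (C * B ^ 2 * Real.exp K) with hB₁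
  have hB₁0 : 0 ≤ B₁ := Real.sqrt_nonneg _
  have hsmall : ∀ᶠ s in 𝓝[>] (0 : ℝ), 0 < s ∧ s ≤ s₀ ∧ s ≤ s₁ ∧ s ≤ 1 := by
    filter_upwards [self_mem_nhdsWithin, Ioc_mem_nhdsGT hs₀, Ioc_mem_nhdsGT hs₁,
      Ioc_mem_nhdsGT one_pos] with s h0 h1 h2 h3 using ⟨h0, h1.2, h2.2, h3.2⟩
  have hfB : ∀ s, 0 < s → s ≤ s₀ → s ≤ s₁ → ∀ t ∈ Set.Icc 0 ((s ^ 2)⁻¹), ‖f s t‖ ≤ B₁ := by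
    intro s h0 h1 h2 t ht
    have := hbound s h0 h2 (A' s) (hA' s h0 h1) (hq' s h0 h1) (f s) (fun _ => 0) 0 0 ((s ^ 2)⁻¹)
      le_rfl le_rfl (by simpa using hf s h0 h1) (by simp) t ht
    refine Real.le_sqrt_of_sq_le (this.trans ?_)
    have hst : K * s ^ 2 * t ≤ K := by
      have h3 := mul_le_mul_of_nonneg_left ht.2 (sq_nonneg s)
      rw [mul_inv_cancel₀ (by positivity)] at h3
      rw [mul_assoc]
      exact mul_le_of_le_one_right hK.le h3
    have hb2 := pow_le_pow_left₀ (norm_nonneg _) (hB s h0 h1) 2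
    simp only [ne_eq, OfNat.ofNat_ne_zero, not_false_eq_true, zero_pow, zero_div, add_zero,
      mul_zero]
    gcongr
  -- the component along `q` after the initial layer
  set a : ℝ → ℂ := fun s => inner ℂ q (f s s⁻¹) with ha
  -- The time `s⁻¹` lies between the relaxation time, of order one, and the diffusive time `s⁻²`:
  -- the orthogonal part has decayed, but the component along `q` has hardly moved.
  have hmem : ∀ s : ℝ, 0 < s → s ≤ 1 → s⁻¹ ∈ Set.Icc 0 ((s ^ 2)⁻¹) := by
    intro s h0 h1
    refine ⟨by positivity, inv_anti₀ (by positivity) ?_⟩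
    nlinarith
  have hid : Tendsto (fun s : ℝ => s) (𝓝[>] 0) (𝓝 0) := nhdsWithin_le_nhds
  have ha_lim : Tendsto a (𝓝[>] 0) (𝓝 a₀) := by
    have hz : Tendsto (fun s => a s - inner ℂ q (f s 0)) (𝓝[>] 0) (𝓝 0) := by
      refine squeeze_zero_norm' (a := fun s => C₃ * B₁ * (s + s)) ?_ ?_
      · filter_upwards [hsmall] with s ⟨h0, h1, h2, h3⟩
        refine (hinner s h0 (A' s) (hA' s h0 h1) (hq' s h0 h1) (f s) B₁ _ (hf s h0 h1)
          (hfB s h0 h1 h2) s⁻¹ (hmem s h0 h3)).trans_eq ?_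
        congr 2
        field_simp
      · simpa using (hid.add hid).const_mul (C₃ * B₁)
    simpa using hz.add ha₀
  -- the approximate eigenvector
  set p : ℝ → H := fun s => q - (Complex.I * s) • r with hp
  set l : ℝ → ℂ := fun s => (s : ℂ) ^ 2 * Q with hl
  -- `w` is the defect of `p` as an eigenvector of `B + i A'` for the eigenvalue `l = s² Q`. Its
  -- terms of order `s` cancel because `(B + i A) r = φ`.
  set w : ℝ → H := fun s => -(l s • p s) + Complex.I • (A' s q - (s : ℂ) • φ)
    + (s : ℂ) • (A' s r - A r) with hw
  set D₁ := ‖Q‖ * (1 + ‖r‖) + C₁ + C₀ * ‖r‖ with hD₁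
  have hD₁0 : 0 ≤ D₁ := by positivity
  have hwn : ∀ s, 0 < s → s ≤ s₀ → s ≤ 1 → ‖w s‖ ≤ D₁ * s ^ 2 := by
    intro s h0 h1 h3
    have hps : ‖p s‖ ≤ 1 + ‖r‖ := by
      refine (norm_sub_le _ _).trans ?_
      rw [hn, norm_smul, norm_mul, Complex.norm_I, one_mul, Complex.norm_real,
        Real.norm_eq_abs, abs_of_pos h0]
      have := mul_le_mul_of_nonneg_right h3 (norm_nonneg r)
      linarith
    have e1 : ‖l s • p s‖ ≤ ‖Q‖ * (1 + ‖r‖) * s ^ 2 := by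
      rw [norm_smul, norm_mul, norm_pow, Complex.norm_real, Real.norm_eq_abs, abs_of_pos h0]
      calc s ^ 2 * ‖Q‖ * ‖p s‖ ≤ s ^ 2 * ‖Q‖ * (1 + ‖r‖) := by gcongr
        _ = _ := by ring
    have e2 : ‖Complex.I • (A' s q - (s : ℂ) • φ)‖ ≤ C₁ * s ^ 2 := by
      rw [norm_smul, Complex.norm_I, one_mul]; exact hφ s h0 h1
    have e3 : ‖(s : ℂ) • (A' s r - A r)‖ ≤ C₀ * ‖r‖ * s ^ 2 := by
      rw [norm_smul, Complex.norm_real, Real.norm_eq_abs, abs_of_pos h0]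
      calc s * ‖A' s r - A r‖ ≤ s * (C₀ * s * ‖r‖) := by gcongr; exact hA' s h0 h1 r
        _ = _ := by ring
    refine (norm_add_le _ _).trans ?_
    refine (add_le_add ((norm_add_le _ _).trans (add_le_add ((norm_neg _).le.trans e1) e2))
      e3).trans_eq ?_
    rw [hD₁]; ring
  have hqp : ∀ s, inner ℂ q (p s) = 1 := fun s => by
    rw [hp, inner_sub_right, inner_smul_right, hqr, mul_zero, sub_zero, hqq]
  -- Along `q` the terms of order `s²` cancel as well, by the choice `Q = ⟨φ, r⟩`. This is what
  -- determines the effective rate.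
  have hwq : ∀ s, 0 < s → s ≤ s₀ → ‖inner ℂ q (w s)‖ ≤ C₁ * ‖r‖ * s ^ 3 := by
    intro s h0 h1
    have e : inner ℂ q (w s) = s * inner ℂ (A' s q - (s : ℂ) • φ) r := by
      simp only [hw]
      rw [inner_add_right, inner_add_right, inner_neg_right, inner_smul_right, hqp,
        inner_smul_right, inner_sub_right, hq' s h0 h1, inner_smul_right, hqφ, inner_smul_right,
        inner_sub_right, hA.inner_apply_eq_zero, inner_sub_left, hsymm s h0 h1, inner_smul_left,
        ← hQ, Complex.conj_ofReal]
      simp only [hl]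
      ring
    rw [e, norm_mul, Complex.norm_real, Real.norm_eq_abs, abs_of_pos h0]
    calc s * ‖inner ℂ (A' s q - (s : ℂ) • φ) r‖ ≤ s * (C₁ * s ^ 2 * ‖r‖) := by
          gcongr
          exact (norm_inner_le_norm _ _).trans (by gcongr; exact hφ s h0 h1)
      _ = _ := by ring
  -- comparison of the solution with the approximate eigenvector
  set z : ℝ → ℝ → H := fun s u => f s (s⁻¹ + u) - a s • (Complex.exp (-l s * u) • p s) with hz
  have hzm : ∀ s, 0 < s → s ≤ s₀ → IsMild S (z s) (fun u => -(Complex.I • A' s (z s u))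
      + -((a s * Complex.exp (-l s * u)) • w s)) := by
    intro s h0 h1
    have h2 := (hf s h0 h1).comp_add (inv_nonneg.2 h0.le)
    have hps : Tendsto (fun h : ℝ => h⁻¹ • (p s - S h (p s))) (𝓝[>] 0)
        (𝓝 (-((Complex.I * s) • (φ - Complex.I • A r)))) := by
      refine ((hr.const_smul (Complex.I * s)).neg).congr' ?_
      filter_upwards [self_mem_nhdsWithin] with h hh
      rw [hp, map_sub, map_smul, hA.semigroup_apply (le_of_lt hh), smul_comm, ← smul_neg]
      congr 1
      module
    have h3 := (isMild_exp_smul (l s) hps).map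
      (R := a s • ContinuousLinearMap.id ℂ H) (fun t _ x => by simp)
    refine (h2.sub h3).congr_right fun u _ => ?_
    have e : ∀ F : H, ∀ c : ℂ, -(Complex.I • F) - c • (-(l s • p s)
        + -((Complex.I * s) • (φ - Complex.I • A r)))
        = -(Complex.I • (F - c • (A' s q - (Complex.I * s) • A' s r))) + -(c • w s) := by
      intro F c
      simp only [hw]
      match_scalars <;> ring_nf <;> simp only [Complex.I_sq] <;> ring
    have e2 := e (A' s (f s (s⁻¹ + u))) (a s * Complex.exp (-l s * u))
    have e3 : A' s (z s u) = A' s (f s (s⁻¹ + u))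
        - (a s * Complex.exp (-l s * u)) • (A' s q - (Complex.I * s) • A' s r) := by
      simp only [hz, hp, smul_smul, map_sub, map_smul]
    rw [e3, ← e2]
    simp only [smul_apply, ContinuousLinearMap.id_apply, smul_smul]
  -- conclusion
  set E := Real.exp ‖Q‖ with hE
  -- Over a time `s⁻²`, a source `O(s³)` along `q` and `O(s²)` in norm contributes `O(s²)` to the
  -- squared error.
  set X : ℝ → ℝ := fun s => C * (‖z s 0‖ ^ 2 + (s ^ 2)⁻¹ * ((B₁ * E * (C₁ * ‖r‖ * s ^ 3)) ^ 2 / s ^ 2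
      + (B₁ * E * (D₁ * s ^ 2)) ^ 2)) * Real.exp K with hX
  have haB : ∀ s, 0 < s → s ≤ s₀ → s ≤ s₁ → s ≤ 1 → ‖a s‖ ≤ B₁ := by
    intro s h0 h1 h2 h3
    refine (norm_inner_le_norm _ _).trans ?_
    rw [hn, one_mul]
    exact hfB s h0 h1 h2 _ (hmem s h0 h3)
  have hzfin : ∀ s, 0 < s → s ≤ s₀ → s ≤ s₁ → s ≤ 1 →
      ‖z s ((s ^ 2)⁻¹ - s⁻¹)‖ ^ 2 ≤ X s := by
    intro s h0 h1 h2 h3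
    have hτ : 0 ≤ (s ^ 2)⁻¹ - s⁻¹ := sub_nonneg.2 (hmem s h0 h3).2
    have hτ' : (s ^ 2)⁻¹ - s⁻¹ ≤ (s ^ 2)⁻¹ := by linarith [inv_pos.2 h0]
    have hexpb : ∀ u ∈ Set.Ico 0 ((s ^ 2)⁻¹ - s⁻¹), ‖a s * Complex.exp (-l s * u)‖ ≤ B₁ * E := by
      intro u hu
      rw [norm_mul]
      refine mul_le_mul (haB s h0 h1 h2 h3) ?_ (norm_nonneg _) hB₁0
      rw [Complex.norm_exp]
      refine Real.exp_le_exp.2 ((Complex.re_le_norm _).trans ?_)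
      rw [norm_mul, norm_neg, norm_mul, norm_pow, Complex.norm_real, Complex.norm_real,
        Real.norm_eq_abs, Real.norm_eq_abs, abs_of_pos h0, abs_of_nonneg hu.1]
      have h4 := mul_le_mul_of_nonneg_left (hu.2.le.trans hτ') (by positivity : 0 ≤ s ^ 2 * ‖Q‖)
      refine h4.trans_eq ?_
      field_simp
    have := hbound s h0 h2 (A' s) (hA' s h0 h1) (hq' s h0 h1) (z s) _
      (B₁ * E * (C₁ * ‖r‖ * s ^ 3)) (B₁ * E * (D₁ * s ^ 2)) ((s ^ 2)⁻¹ - s⁻¹)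
      (by positivity) (by positivity) (hzm s h0 h1) (fun u hu => by
        constructor
        · rw [inner_neg_right, inner_smul_right, norm_neg, norm_mul]
          exact mul_le_mul (hexpb u hu) (hwq s h0 h1) (norm_nonneg _) (by positivity)
        · rw [norm_neg, norm_smul]
          exact mul_le_mul (hexpb u hu) (hwn s h0 h1 h3) (norm_nonneg _) (by positivity))
      _ ⟨hτ, le_rfl⟩
    refine this.trans ?_
    have hst : K * s ^ 2 * ((s ^ 2)⁻¹ - s⁻¹) ≤ K := by
      have h4 := mul_le_mul_of_nonneg_left hτ' (sq_nonneg s)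
      rw [mul_inv_cancel₀ (by positivity)] at h4
      rw [mul_assoc]
      exact mul_le_of_le_one_right hK.le h4
    simp only [hX]
    gcongr
  have hz0 : Tendsto (fun s => ‖z s 0‖ ^ 2) (𝓝[>] 0) (𝓝 0) := by
    have hz0' : Tendsto (fun s => orthProj q (f s s⁻¹) + (a s * (Complex.I * s)) • r) (𝓝[>] 0)
        (𝓝 (0 + (a₀ * (Complex.I * (0 : ℝ))) • r)) := by
      refine Tendsto.add ?_ ?_
      · have h1 : Tendsto (fun s => ‖orthProj q (f s s⁻¹)‖ ^ 2) (𝓝[>] 0) (𝓝 0) := by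
          refine squeeze_zero' (.of_forall fun s => by positivity)
            (g := fun s => C₂ * B₁ ^ 2 * (Real.exp (-c * s⁻¹) + s ^ 2)) ?_ ?_
          · filter_upwards [hsmall] with s ⟨h0, h1, h2, h3⟩
            exact horth s h0 (A' s) (hA' s h0 h1) (f s) B₁ _ (hf s h0 h1) (hfB s h0 h1 h2) _
              (hmem s h0 h3)
          · have h4 : Tendsto (fun s : ℝ => Real.exp (-c * s⁻¹)) (𝓝[>] 0) (𝓝 0) :=
              Real.tendsto_exp_atBot.comp (tendsto_inv_nhdsGT_zero.const_mul_atTop_of_neg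
                (neg_neg_of_pos hc))
            simpa using (h4.add (hid.pow 2)).const_mul (C₂ * B₁ ^ 2)
        rw [tendsto_zero_iff_norm_tendsto_zero]
        have h5 := h1.sqrt
        simpa using h5
      · exact (ha_lim.mul (tendsto_const_nhds.mul
          ((Complex.continuous_ofReal.tendsto _).comp hid))).smul_const r
    have hz0n := (hz0'.norm.pow 2)
    simp only [Complex.ofReal_zero, mul_zero, zero_smul, add_zero, norm_zero, ne_eq,
      OfNat.ofNat_ne_zero, not_false_eq_true, zero_pow] at hz0n
    refine hz0n.congr fun s => ?_
    congr 2
    simp only [hz, hp, orthProj_apply, add_zero, Complex.ofReal_zero, mul_zero, Complex.exp_zero,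
      smul_sub, smul_smul]
    have has : a s = inner ℂ q (f s s⁻¹) := rfl
    rw [← has]
    module
  have hXlim : Tendsto X (𝓝[>] 0) (𝓝 0) := by
    have h1 : Tendsto (fun s : ℝ => C * (‖z s 0‖ ^ 2 + ((B₁ * E * (C₁ * ‖r‖)) ^ 2
        + (B₁ * E * D₁) ^ 2) * s ^ 2) * Real.exp K) (𝓝[>] 0) (𝓝 0) := by
      simpa using ((hz0.add ((hid.pow 2).const_mul ((B₁ * E * (C₁ * ‖r‖)) ^ 2
        + (B₁ * E * D₁) ^ 2))).const_mul C).mul_const (Real.exp K)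
    refine h1.congr' ?_
    filter_upwards [self_mem_nhdsWithin] with s hs
    have hs0 : s ≠ 0 := (Set.mem_Ioi.1 hs).ne'
    simp only [hX]
    congr 3
    field_simp
  have hzlim : Tendsto (fun s => inner ℂ q (z s ((s ^ 2)⁻¹ - s⁻¹))) (𝓝[>] 0) (𝓝 0) := by
    have h1 := hXlim.sqrt
    rw [Real.sqrt_zero] at h1
    refine squeeze_zero_norm' ?_ h1
    filter_upwards [hsmall] with s ⟨h0, h1, h2, h3⟩
    refine (norm_inner_le_norm _ _).trans ?_
    rw [hn, one_mul]
    exact Real.le_sqrt_of_sq_le (hzfin s h0 h1 h2 h3)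
  have hexplim : Tendsto (fun s : ℝ => Complex.exp (-(1 - s) * Q) * a s) (𝓝[>] 0)
      (𝓝 (Complex.exp (-Q) * a₀)) := by
    refine Tendsto.mul ((Complex.continuous_exp.tendsto _).comp ?_) ha_lim
    have h1 : Tendsto (fun s : ℝ => (s : ℂ)) (𝓝[>] 0) (𝓝 ((0 : ℝ) : ℂ)) :=
      (Complex.continuous_ofReal.tendsto _).comp hid
    have h2 := ((tendsto_const_nhds (x := (1 : ℂ))).sub h1).neg.mul_const Q
    simpa using h2
  have hfinal := hzlim.add hexplim
  rw [zero_add] at hfinal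
  refine hfinal.congr' ?_
  filter_upwards [self_mem_nhdsWithin] with s hs
  have hs0 : (s : ℂ) ≠ 0 := by exact_mod_cast (Set.mem_Ioi.1 hs).ne'
  simp only [hz]
  rw [inner_sub_right, inner_smul_right, inner_smul_right, hqp, mul_one, add_sub_cancel]
  have e : -l s * (((s ^ 2)⁻¹ - s⁻¹ : ℝ) : ℂ) = -(1 - s) * Q := by
    simp only [hl]
    push_cast
    field_simp
  rw [e]
  ring

/-- The effective rate has positive real part. -/
theorem re_inner_pos (hA : IsCoupling hS A q χ) {φ r : H} (hφ : Z φ = φ) (hφ0 : φ ≠ 0)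
    (hr : Tendsto (fun h : ℝ => h⁻¹ • (r - S h r)) (𝓝[>] 0) (𝓝 (φ - Complex.I • A r))) :
    0 < (inner ℂ φ r).re := by
  -- For `l = 0` the mild solution is the constant `r`, whose norm has derivative zero; the
  -- dissipation bound becomes `γ ‖r - Z r‖² ≤ Re⟨φ, r⟩`.
  have hm := isMild_exp_smul 0 hr
  have hd := hm.diniLE_norm_sq hS le_rfl
  simp only [neg_zero, zero_mul, Complex.exp_zero, one_smul, zero_smul, zero_add] at hd
  have hL : 0 ≤ -(2 * γ) * ‖r - Z r‖ ^ 2 + 2 * (inner ℂ r (φ - Complex.I • A r)).re := by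
    by_contra! hneg
    obtain ⟨z, hz⟩ := (hd 0 hneg).exists
    simp at hz
  have hre : (inner ℂ r (φ - Complex.I • A r)).re = (inner ℂ φ r).re := by
    have h1 : (starRingEnd ℂ) (inner ℂ r (A r)) = inner ℂ r (A r) := by
      rw [inner_conj_symm, hA.symm]
    have h2 := Complex.conj_eq_iff_im.1 h1
    have h3 : (inner ℂ r φ).re = (inner ℂ φ r).re := by
      rw [← inner_conj_symm, Complex.conj_re]
    rw [inner_sub_right, inner_smul_right, Complex.sub_re, h3]
    simp [h2]
  rw [hre] at hL
  have hγ := hS.pos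
  have hsq : 0 ≤ γ * ‖r - Z r‖ ^ 2 := by positivity
  rcases (show 0 ≤ (inner ℂ φ r).re by linarith).eq_or_lt with h0 | h0
  -- Equality would force `Z r = r`, hence `Z (φ - i A r) = φ` by `Z A Z = 0`, whereas `Z` kills the
  -- range of the generator.
  · exfalso
    have h1 : ‖r - Z r‖ ^ 2 = 0 := by
      have h2 : γ * ‖r - Z r‖ ^ 2 = 0 := by linarith
      exact (mul_eq_zero.1 h2).resolve_left hγ.ne'
    have h2 : Z r = r := (sub_eq_zero.1 (norm_eq_zero.1 (pow_eq_zero_iff two_ne_zero |>.1 h1))).symm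
    have h3 : Z (φ - Complex.I • A r) = 0 := by
      refine tendsto_nhds_unique ((Z.continuous.tendsto _).comp hr) ?_
      refine tendsto_const_nhds.congr' ?_
      filter_upwards [self_mem_nhdsWithin] with h hh
      simp only [Function.comp_apply]
      rw [Z.map_smul_of_tower, map_sub, hS.proj_apply h (le_of_lt hh), sub_self, smul_zero]
    rw [map_sub, map_smul, hφ, ← h2, hA.proj_apply_proj, smul_zero, sub_zero] at h3
    exact hφ0 h3
  · exact h0

end IsCoupling

end Asymptotics

/-! ### Path space and the Markov property. -/

section PathSpace

variable {d : ℕ} {Ω : Type*} [TopologicalSpace Ω] [MeasurableSpace Ω] {μ : Measure Ω}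
  {σ : Site d → Ω → Ω} {P : Kernel Ω (RCPath Ω)}

theorem measurable_timeShift (s : ℝ≥0) : Measurable (timeShift s : RCPath Ω → RCPath Ω) :=
  Measurable.subtype_mk (measurable_pi_lambda _ fun t => measurable_eval (t + s))

theorem timeShift_zero (ω : RCPath Ω) : timeShift 0 ω = ω :=
  Subtype.ext (funext fun t => by simp [timeShift])

instance [IsProbabilityMeasure μ] [IsMarkovKernel P] : IsProbabilityMeasure (pathLaw μ P) := by
  unfold pathLaw; infer_instance

theorem stronglyMeasurable_integral_kernel {Φ : RCPath Ω → ℂ} (hΦ : Measurable Φ) :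
    Measurable fun a => ∫ ω, Φ ω ∂(P a) :=
  hΦ.stronglyMeasurable.integral_kernel.measurable

theorem integrable_of_measurable_bounded {α : Type*} [MeasurableSpace α] {ν : Measure α}
    [IsFiniteMeasure ν] {Φ : α → ℂ} (hΦ : Measurable Φ) {C : ℝ} (hC : ∀ ω, ‖Φ ω‖ ≤ C) :
    Integrable Φ ν :=
  (integrable_const C).mono' hΦ.aestronglyMeasurable (ae_of_all _ hC)

theorem norm_integral_kernel_le [IsMarkovKernel P] {Φ : RCPath Ω → ℂ} {C : ℝ}
    (hC : ∀ ω, ‖Φ ω‖ ≤ C) (a : Ω) : ‖∫ ω, Φ ω ∂(P a)‖ ≤ C := by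
  have := norm_integral_le_of_norm_le_const (μ := P a) (ae_of_all _ hC)
  simpa using this

theorem integral_bind_kernel {α β : Type*} [MeasurableSpace α] [MeasurableSpace β] {ν : Measure α}
    [SFinite ν] {κ : Kernel α β} [IsSFiniteKernel κ] {f : β → ℂ} (hf : Integrable f (ν.bind κ)) :
    ∫ b, f b ∂(ν.bind κ) = ∫ a, ∫ b, f b ∂(κ a) ∂ν := by
  rw [Measure.comp_eq_comp_const_apply] at hf ⊢
  rw [Kernel.integral_comp hf]
  simp

namespace IsMarkovProcess

/-- The event `ω₀ = a` need not be measurable in a general `Ω`, so the initial condition is used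
through measurable functions only. -/
theorem ae_initial (hP : IsMarkovProcess μ σ P) (f : Ω → ℂ) (hf : Measurable f) (a : Ω) :
    ∀ᵐ ω ∂(P a), f (ω.1 0) = f a := by
  have hs : MeasurableSet {b | f b = f a} := measurableSet_eq_fun hf measurable_const
  have h := Measure.map_apply (μ := P a) (measurable_eval 0) hs.compl
  rw [hP.initial a, Measure.dirac_apply' a hs.compl] at h
  refine ae_iff.2 (h.symm.trans ?_)
  simp

/-- The Markov property for bounded functions on path space. -/
theorem integral_timeShift [IsMarkovKernel P] (hP : IsMarkovProcess μ σ P) (s : ℝ≥0) (a : Ω)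
    {Φ : RCPath Ω → ℂ} (hΦ : Measurable Φ) {C : ℝ} (hC : ∀ ω, ‖Φ ω‖ ≤ C) :
    ∫ ω, Φ (timeShift s ω) ∂(P a) = ∫ ω, ∫ ω', Φ ω' ∂(P (ω.1 s)) ∂(P a) := by
  rcases eq_or_lt_of_le (zero_le : 0 ≤ s) with rfl | hs
  · rw [integral_congr_ae (hP.ae_initial _ (stronglyMeasurable_integral_kernel hΦ) a)]
    simp [timeShift_zero]
  · have hK : Measurable fun ω : RCPath Ω => P (ω.1 s) := P.measurable.comp (measurable_eval s)
    set K : Kernel (RCPath Ω) (RCPath Ω) := ⟨fun ω => P (ω.1 s), hK⟩ with hKdef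
    have hm : (P a).map (timeShift s) = (P a).bind K := by
      refine Measure.ext fun A hA => ?_
      rw [Measure.map_apply (measurable_timeShift s) hA, hP.markov s hs a A hA,
        Measure.bind_apply hA K.measurable.aemeasurable]
      rfl
    have : IsMarkovKernel K := ⟨fun ω => inferInstanceAs (IsProbabilityMeasure (P (ω.1 s)))⟩
    rw [← integral_map (measurable_timeShift s).aemeasurable hΦ.aestronglyMeasurable, hm,
      integral_bind_kernel (integrable_of_measurable_bounded hΦ hC)]
    rfl

end IsMarkovProcess

/-! ### Functions of the past -/

/-- `G` depends on the path up to time `s` only, as far as the Markov property is concerned: given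
`G`, the path after time `s` has the law of the process started at `ω_s`. -/
def PastDep (μ : Measure Ω) (P : Kernel Ω (RCPath Ω)) (s : ℝ≥0) (G : RCPath Ω → ℂ) : Prop :=
  ∀ Φ : RCPath Ω → ℂ, Measurable Φ → ∀ C : ℝ, (∀ ω, ‖Φ ω‖ ≤ C) →
    ∫ ω, Φ (timeShift s ω) * G ω ∂(pathLaw μ P)
      = ∫ ω, (∫ ω', Φ ω' ∂(P (ω.1 s))) * G ω ∂(pathLaw μ P)

namespace PastDep

theorem congr {s : ℝ≥0} {G G' : RCPath Ω → ℂ} (hG : PastDep μ P s G)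
    (h : G =ᵐ[pathLaw μ P] G') : PastDep μ P s G' := by
  intro Φ hΦ C hC
  have e1 : ∀ᵐ ω ∂(pathLaw μ P), Φ (timeShift s ω) * G' ω = Φ (timeShift s ω) * G ω :=
    h.mono fun ω hω => by rw [hω]
  have e2 : ∀ᵐ ω ∂(pathLaw μ P), (∫ ω', Φ ω' ∂(P (ω.1 s))) * G' ω
      = (∫ ω', Φ ω' ∂(P (ω.1 s))) * G ω := h.mono fun ω hω => by rw [hω]
  rw [integral_congr_ae e1, integral_congr_ae e2]
  exact hG Φ hΦ C hC

variable [IsProbabilityMeasure μ] [IsMarkovKernel P]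

theorem integrable_shift_mul {s : ℝ≥0} {G Φ : RCPath Ω → ℂ} (hG : Integrable G (pathLaw μ P))
    (hΦ : Measurable Φ) {C : ℝ} (hC : ∀ ω, ‖Φ ω‖ ≤ C) :
    Integrable (fun ω => Φ (timeShift s ω) * G ω) (pathLaw μ P) :=
  hG.bdd_mul (hΦ.comp (measurable_timeShift s)).aestronglyMeasurable
    (ae_of_all _ fun ω => hC (timeShift s ω))

theorem integrable_expect_mul {s : ℝ≥0} {G Φ : RCPath Ω → ℂ} (hG : Integrable G (pathLaw μ P))
    (hΦ : Measurable Φ) {C : ℝ} (hC : ∀ ω, ‖Φ ω‖ ≤ C) :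
    Integrable (fun ω => (∫ ω', Φ ω' ∂(P (ω.1 s))) * G ω) (pathLaw μ P) :=
  hG.bdd_mul (((stronglyMeasurable_integral_kernel hΦ).comp
    (measurable_eval s)).aestronglyMeasurable)
    (ae_of_all _ fun ω => norm_integral_kernel_le hC (ω.1 s))

theorem initial (hP : IsMarkovProcess μ σ P) {f : Ω → ℂ} (hf : Measurable f)
    (hfi : Integrable f μ) : PastDep μ P 0 fun ω => f (ω.1 0) := by
  have hint : Integrable (fun ω : RCPath Ω => f (ω.1 0)) (pathLaw μ P) :=
    (hP.measurePreserving_eval 0).integrable_comp_of_integrable hfi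
  intro Φ hΦ C hC
  have h1 := integrable_shift_mul (s := 0) hint hΦ hC
  have h2 := integrable_expect_mul (s := 0) hint hΦ hC
  unfold pathLaw at h1 h2 ⊢
  rw [integral_bind_kernel h1, integral_bind_kernel h2]
  congr 1
  funext a
  have e1 : ∀ᵐ ω ∂(P a), Φ (timeShift 0 ω) * f (ω.1 0) = Φ ω * f a := by
    filter_upwards [hP.ae_initial f hf a] with ω hω
    rw [timeShift_zero, hω]
  have e2 : ∀ᵐ ω ∂(P a), (∫ ω', Φ ω' ∂(P (ω.1 0))) * f (ω.1 0) = (∫ ω', Φ ω' ∂(P a)) * f a := by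
    filter_upwards [hP.ae_initial f hf a,
      hP.ae_initial _ (stronglyMeasurable_integral_kernel hΦ) a] with ω hω hω'
    rw [hω, hω']
  rw [integral_congr_ae e1, integral_congr_ae e2, integral_mul_const]
  simp

/-- Products of observables at increasing times are reached one factor at a time. The property at
`r` is used twice, for `v(ω_u) Φ(𝒯_u ω)` and for `v(ω_u) 𝔼_{ω_u} Φ`; these have the same expectation
under every `P b` by the Markov property at `u`. -/
theorem eval_mul (hP : IsMarkovProcess μ σ P) {r s : ℝ≥0} (hrs : r ≤ s) {G : RCPath Ω → ℂ}
    (hG : PastDep μ P r G) {v : Ω → ℂ} (hv : Measurable v) {M : ℝ} (hM : ∀ a, ‖v a‖ ≤ M) :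
    PastDep μ P s fun ω => v (ω.1 s) * G ω := by
  intro Φ hΦ C hC
  obtain ⟨u, rfl⟩ := exists_add_of_le hrs
  set e : Ω → ℂ := fun c => ∫ ω', Φ ω' ∂(P c) with he
  have hem : Measurable e := stronglyMeasurable_integral_kernel hΦ
  have heC : ∀ c, ‖e c‖ ≤ C := fun c => norm_integral_kernel_le hC c
  have hC0 : ∀ c : Ω, 0 ≤ C := fun c => (norm_nonneg _).trans (heC c)
  have hvec : ∀ c, ‖v c * e c‖ ≤ M * C := fun c => by
    rw [norm_mul]; exact mul_le_mul (hM c) (heC c) (norm_nonneg _) ((norm_nonneg _).trans (hM c))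
  -- the product `v(ω_u) Φ(shift)` as a function of the path after time `r`
  have hΞm : Measurable fun ω : RCPath Ω => v (ω.1 0) * Φ ω :=
    (hv.comp (measurable_eval 0)).mul hΦ
  have hΞC : ∀ ω : RCPath Ω, ‖v (ω.1 0) * Φ ω‖ ≤ M * C := fun ω => by
    rw [norm_mul]
    exact mul_le_mul (hM _) (hC _) (norm_nonneg _) ((norm_nonneg _).trans (hM (ω.1 0)))
  have hA := hG (fun ω => v (ω.1 u) * Φ (timeShift u ω))
    ((hv.comp (measurable_eval u)).mul (hΦ.comp (measurable_timeShift u))) (M * C) (fun ω => by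
      rw [norm_mul]
      exact mul_le_mul (hM _) (hC _) (norm_nonneg _) ((norm_nonneg _).trans (hM (ω.1 u))))
  have hB := hG (fun ω => v (ω.1 u) * e (ω.1 u))
    ((hv.comp (measurable_eval u)).mul (hem.comp (measurable_eval u))) (M * C)
    (fun ω => hvec (ω.1 u))
  have hAB : ∀ b, ∫ ω, v (ω.1 u) * Φ (timeShift u ω) ∂(P b)
      = ∫ ω, v (ω.1 u) * e (ω.1 u) ∂(P b) := by
    intro b
    have h1 := hP.integral_timeShift u b hΞm hΞC
    have h2 : ∀ ω : RCPath Ω, v ((timeShift u ω).1 0) * Φ (timeShift u ω)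
        = v (ω.1 u) * Φ (timeShift u ω) := fun ω => by simp [timeShift]
    have h3 : ∀ c, ∫ ω', v (ω'.1 0) * Φ ω' ∂(P c) = v c * e c := by
      intro c
      have : ∀ᵐ ω' ∂(P c), v (ω'.1 0) * Φ ω' = v c * Φ ω' := by
        filter_upwards [hP.ae_initial v hv c] with ω' hω'
        rw [hω']
      rw [integral_congr_ae this, integral_const_mul]
    simp only [h2, h3] at h1
    exact h1
  have hsh : ∀ ω : RCPath Ω, timeShift u (timeShift r ω) = timeShift (r + u) ω := fun ω =>
    Subtype.ext (funext fun t => by simp [timeShift, add_comm r u, add_assoc])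
  have hev : ∀ ω : RCPath Ω, (timeShift r ω).1 u = ω.1 (r + u) := fun ω => by
    simp [timeShift, add_comm]
  simp only [hsh, hev] at hA hB
  simp only [hAB] at hA
  rw [← hA] at hB
  calc ∫ ω, Φ (timeShift (r + u) ω) * (v (ω.1 (r + u)) * G ω) ∂(pathLaw μ P)
      = ∫ ω, v (ω.1 (r + u)) * Φ (timeShift (r + u) ω) * G ω ∂(pathLaw μ P) := by
        congr 1; funext ω; ring
    _ = ∫ ω, v (ω.1 (r + u)) * e (ω.1 (r + u)) * G ω ∂(pathLaw μ P) := hB.symm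
    _ = _ := by congr 1; funext ω; ring

theorem mono (hP : IsMarkovProcess μ σ P) {r s : ℝ≥0} (hrs : r ≤ s) {G : RCPath Ω → ℂ}
    (hG : PastDep μ P r G) : PastDep μ P s G := by
  simpa using hG.eval_mul hP hrs (v := fun _ => 1) measurable_const (M := 1) (by simp)

theorem const (hP : IsMarkovProcess μ σ P) (s : ℝ≥0) (c : ℂ) : PastDep μ P s fun _ => c :=
  (initial hP (f := fun _ => c) measurable_const (integrable_const c)).mono hP zero_le

theorem const_mul {s : ℝ≥0} {G : RCPath Ω → ℂ} (hG : PastDep μ P s G) (c : ℂ) :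
    PastDep μ P s fun ω => c * G ω := by
  intro Φ hΦ C hC
  have := hG Φ hΦ C hC
  simp only [mul_left_comm _ c]
  rw [integral_const_mul, integral_const_mul, this]

theorem add {s : ℝ≥0} {G G' : RCPath Ω → ℂ} (hG : PastDep μ P s G) (hG' : PastDep μ P s G')
    (hGi : Integrable G (pathLaw μ P)) (hGi' : Integrable G' (pathLaw μ P)) :
    PastDep μ P s fun ω => G ω + G' ω := by
  intro Φ hΦ C hC
  simp only [mul_add]
  rw [integral_add (integrable_shift_mul hGi hΦ hC) (integrable_shift_mul hGi' hΦ hC),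
    integral_add (integrable_expect_mul hGi hΦ hC) (integrable_expect_mul hGi' hΦ hC),
    hG Φ hΦ C hC, hG' Φ hΦ C hC]

theorem of_tendsto {s : ℝ≥0} {ι : Type*} {l : Filter ι} [l.IsCountablyGenerated] [l.NeBot]
    {G : ι → RCPath Ω → ℂ} {G' : RCPath Ω → ℂ} (hG : ∀ n, PastDep μ P s (G n))
    (hm : ∀ n, AEStronglyMeasurable (G n) (pathLaw μ P)) {b : ℝ} (hb : ∀ n ω, ‖G n ω‖ ≤ b)
    (hlim : ∀ᵐ ω ∂(pathLaw μ P), Tendsto (fun n => G n ω) l (𝓝 (G' ω))) :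
    PastDep μ P s G' := by
  intro Φ hΦ C hC
  have h1 : Tendsto (fun n => ∫ ω, Φ (timeShift s ω) * G n ω ∂(pathLaw μ P)) l
      (𝓝 (∫ ω, Φ (timeShift s ω) * G' ω ∂(pathLaw μ P))) := by
    refine tendsto_integral_filter_of_dominated_convergence (fun _ => C * b)
      (.of_forall fun n => (hΦ.comp (measurable_timeShift s)).aestronglyMeasurable.mul (hm n))
      (.of_forall fun n => ae_of_all _ fun ω => ?_) (integrable_const _)
      (hlim.mono fun ω hω => hω.const_mul _)
    rw [norm_mul]
    exact mul_le_mul (hC _) (hb n ω) (norm_nonneg _) ((norm_nonneg _).trans (hC ω))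
  have h2 : Tendsto (fun n => ∫ ω, (∫ ω', Φ ω' ∂(P (ω.1 s))) * G n ω ∂(pathLaw μ P)) l
      (𝓝 (∫ ω, (∫ ω', Φ ω' ∂(P (ω.1 s))) * G' ω ∂(pathLaw μ P))) := by
    refine tendsto_integral_filter_of_dominated_convergence (fun _ => C * b)
      (.of_forall fun n => ((stronglyMeasurable_integral_kernel hΦ).comp
        (measurable_eval s)).aestronglyMeasurable.mul (hm n))
      (.of_forall fun n => ae_of_all _ fun ω => ?_) (integrable_const _)
      (hlim.mono fun ω hω => hω.const_mul _)
    rw [norm_mul]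
    exact mul_le_mul (norm_integral_kernel_le hC _) (hb n ω) (norm_nonneg _)
      ((norm_nonneg _).trans (hC ω))
  refine tendsto_nhds_unique h1 (h2.congr fun n => ?_)
  exact (hG n Φ hΦ C hC).symm

end PastDep

end PathSpace

/-! ### Conditional expectation on `ω_t` and the backward semigroup. -/

section Conditioning

variable {d : ℕ} {Ω : Type*} [TopologicalSpace Ω] [MeasurableSpace Ω] {μ : Measure Ω}
  {σ : Site d → Ω → Ω} {P : Kernel Ω (RCPath Ω)}

theorem evalL2_coe (hP : IsMarkovProcess μ σ P) (t : ℝ≥0) (f : Lp ℂ 2 μ) :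
    evalL2 hP t f =ᵐ[pathLaw μ P] fun ω => f (ω.1 t) :=
  Lp.coeFn_compMeasurePreserving f (hP.measurePreserving_eval t)

theorem norm_evalL2 (hP : IsMarkovProcess μ σ P) (t : ℝ≥0) (f : Lp ℂ 2 μ) :
    ‖evalL2 hP t f‖ = ‖f‖ :=
  LinearIsometry.norm_map _ f

theorem evalL2_toLp (hP : IsMarkovProcess μ σ P) (t : ℝ≥0) {f : Ω → ℂ} (hf : MemLp f 2 μ) :
    evalL2 hP t (hf.toLp f) =ᵐ[pathLaw μ P] fun ω => f (ω.1 t) :=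
  (evalL2_coe hP t _).trans
    ((hP.measurePreserving_eval t).quasiMeasurePreserving.ae_eq_comp hf.coeFn_toLp)

/-- The adjoint of `f ↦ f(ω_t)`: conditional expectation given `ω_t`. -/
def condL2 (hP : IsMarkovProcess μ σ P) (t : ℝ≥0) : Lp ℂ 2 (pathLaw μ P) →L[ℂ] Lp ℂ 2 μ :=
  ContinuousLinearMap.adjoint (evalL2 hP t)

theorem backwardSemigroup_apply (hP : IsMarkovProcess μ σ P) (t : ℝ≥0) (f : Lp ℂ 2 μ) :
    backwardSemigroup hP t f = condL2 hP t (evalL2 hP 0 f) := rfl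

theorem norm_condL2_le (hP : IsMarkovProcess μ σ P) (t : ℝ≥0) (G : Lp ℂ 2 (pathLaw μ P)) :
    ‖condL2 hP t G‖ ≤ ‖G‖ := by
  have h : ‖condL2 hP t‖ ≤ 1 := by
    rw [condL2, LinearIsometryEquiv.norm_map]
    exact ContinuousLinearMap.opNorm_le_bound _ zero_le_one fun f => by simp [norm_evalL2]
  simpa using (condL2 hP t).le_of_opNorm_le h G

theorem condL2_evalL2 (hP : IsMarkovProcess μ σ P) (t : ℝ≥0) (f : Lp ℂ 2 μ) :
    condL2 hP t (evalL2 hP t f) = f := by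
  refine ext_inner_left ℂ fun g => ?_
  rw [condL2, ContinuousLinearMap.adjoint_inner_right]
  exact LinearIsometry.inner_map_map _ g f

theorem memLp_of_measurable_bounded {α : Type*} [MeasurableSpace α] {ν : Measure α}
    [IsFiniteMeasure ν] {p : ℝ≥0∞} {φ : α → ℂ} (hφ : Measurable φ) {C : ℝ} (hC : ∀ a, ‖φ a‖ ≤ C) :
    MemLp φ p ν :=
  MemLp.of_bound hφ.aestronglyMeasurable C (ae_of_all _ hC)

theorem integral_mul_condL2 [IsProbabilityMeasure μ] [IsMarkovKernel P]
    (hP : IsMarkovProcess μ σ P) (t : ℝ≥0)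
    (G : Lp ℂ 2 (pathLaw μ P)) {φ : Ω → ℂ} (hφ : Measurable φ) {C : ℝ} (hC : ∀ a, ‖φ a‖ ≤ C) :
    ∫ a, φ a * condL2 hP t G a ∂μ = ∫ ω, φ (ω.1 t) * G ω ∂(pathLaw μ P) := by
  have hm : MemLp (fun a => (starRingEnd ℂ) (φ a)) 2 μ :=
    memLp_of_measurable_bounded (Complex.continuous_conj.measurable.comp hφ) (C := C)
      (by simpa using hC)
  have h := ContinuousLinearMap.adjoint_inner_right (evalL2 hP t) (hm.toLp _) G
  rw [L2.inner_def, L2.inner_def] at h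
  refine Eq.trans ?_ (h.trans ?_)
  · refine integral_congr_ae (hm.coeFn_toLp.mono fun a ha => ?_)
    simp only [RCLike.inner_apply, ha]
    simp [condL2, mul_comm]
  · refine integral_congr_ae ((evalL2_toLp hP t hm).mono fun ω hω => ?_)
    simp only [RCLike.inner_apply, hω]
    simp [mul_comm]

/-- Identities in `L²` are tested on bounded measurable functions, for which the Markov property is
available. -/
theorem Lp_ext_of_integral_mul {α : Type*} [MeasurableSpace α] {ν : Measure α} [IsFiniteMeasure ν]
    {g g' : Lp ℂ 2 ν} (h : ∀ φ : α → ℂ, Measurable φ → (∀ a, ‖φ a‖ ≤ 1) →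
      ∫ a, φ a * g a ∂ν = ∫ a, φ a * g' a ∂ν) : g = g' := by
  have hi : ∀ f : Lp ℂ 2 ν, Integrable f ν := fun f => (Lp.memLp f).integrable (by norm_num)
  refine Lp.ext (ae_eq_of_forall_setIntegral_eq_of_sigmaFinite (fun s _ _ => (hi g).integrableOn)
    (fun s _ _ => (hi g').integrableOn) fun s hs _ => ?_)
  have := h (s.indicator 1) (measurable_one.indicator hs) (fun a => by
    by_cases ha : a ∈ s <;> simp [ha])
  rw [← integral_indicator hs, ← integral_indicator hs]
  convert this using 2 <;> (funext a; by_cases ha : a ∈ s <;> simp [ha])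

theorem pastDep_evalL2 [IsProbabilityMeasure μ] [IsMarkovKernel P] (hP : IsMarkovProcess μ σ P)
    (f : Lp ℂ 2 μ) : PastDep μ P 0 (evalL2 hP 0 f) := by
  have hm : AEStronglyMeasurable f μ := Lp.aestronglyMeasurable f
  have hi : Integrable (hm.mk f) μ := ((Lp.memLp f).integrable (by norm_num)).congr hm.ae_eq_mk
  refine (PastDep.initial hP hm.stronglyMeasurable_mk.measurable hi).congr ?_
  exact ((evalL2_coe hP 0 f).trans
    ((hP.measurePreserving_eval 0).quasiMeasurePreserving.ae_eq_comp hm.ae_eq_mk)).symm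

variable [IsProbabilityMeasure μ] [IsMarkovKernel P]

/-- Duality: against a test function the backward semigroup becomes the forward expectation `𝔼_a
φ(ω_u)`, where the kernel `P` can be used. -/
theorem integral_mul_backwardSemigroup (hP : IsMarkovProcess μ σ P) (u : ℝ≥0) (f : Lp ℂ 2 μ)
    {φ : Ω → ℂ} (hφ : Measurable φ) {C : ℝ} (hC : ∀ a, ‖φ a‖ ≤ C) :
    ∫ a, φ a * backwardSemigroup hP u f a ∂μ
      = ∫ a, (∫ ω, φ (ω.1 u) ∂(P a)) * f a ∂μ := by
  have hΦ : Measurable fun ω : RCPath Ω => φ (ω.1 u) := hφ.comp (measurable_eval u)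
  rw [backwardSemigroup_apply, integral_mul_condL2 hP u _ hφ hC]
  have h := pastDep_evalL2 hP f _ hΦ C fun ω => hC _
  rw [← integral_mul_condL2 hP 0 _ (stronglyMeasurable_integral_kernel hΦ)
    (fun a => norm_integral_kernel_le (fun ω => hC _) a), condL2_evalL2] at h
  rw [← h]
  simp [timeShift]

/-- The Markov property: conditioning a function of the past. -/
theorem PastDep.condL2_add (hP : IsMarkovProcess μ σ P) {s : ℝ≥0} (u : ℝ≥0)
    {G : Lp ℂ 2 (pathLaw μ P)} (hG : PastDep μ P s G) :
    condL2 hP (s + u) G = backwardSemigroup hP u (condL2 hP s G) := by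
  refine Lp_ext_of_integral_mul fun φ hφ hC => ?_
  have hΦ : Measurable fun ω : RCPath Ω => φ (ω.1 u) := hφ.comp (measurable_eval u)
  rw [integral_mul_backwardSemigroup hP u _ hφ hC, integral_mul_condL2 hP _ _ hφ hC,
    integral_mul_condL2 hP s _ (stronglyMeasurable_integral_kernel hΦ)
    (fun a => norm_integral_kernel_le (fun ω => hC _) a), ← hG _ hΦ 1 fun ω => hC _]
  simp [timeShift, add_comm]

theorem backwardSemigroup_add (hP : IsMarkovProcess μ σ P) (s u : ℝ≥0) (f : Lp ℂ 2 μ) :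
    backwardSemigroup hP (s + u) f = backwardSemigroup hP u (backwardSemigroup hP s f) :=
  ((pastDep_evalL2 hP f).mono hP (zero_le : 0 ≤ s)).condL2_add hP u

/-- Stationarity of the whole path law: the Markov property at time `s` with a constant past,
together with the invariance of `μ`. -/
theorem measurePreserving_timeShift (hP : IsMarkovProcess μ σ P) (s : ℝ≥0) :
    MeasurePreserving (timeShift s) (pathLaw μ P) (pathLaw μ P) := by
  refine ⟨measurable_timeShift s, Measure.ext fun A hA => ?_⟩
  have h := PastDep.const hP s 1 (A.indicator 1) (measurable_one.indicator hA) 1 (fun ω => by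
    by_cases h : ω ∈ A <;> simp [h])
  have hAi : ∀ a, ∫ ω, A.indicator (1 : RCPath Ω → ℂ) ω ∂(P a) = ((P a).real A : ℂ) := fun a => by
    rw [integral_indicator hA]; simp
  have e1 : ∀ ω : RCPath Ω, A.indicator (1 : RCPath Ω → ℂ) (timeShift s ω)
      = (timeShift s ⁻¹' A).indicator 1 ω := fun ω => rfl
  simp only [mul_one, hAi, e1] at h
  rw [integral_indicator (measurable_timeShift s hA)] at h
  have hm : Measurable fun a => ((P a).real A : ℂ) := by
    simp only [← hAi]
    exact stronglyMeasurable_integral_kernel (measurable_one.indicator hA)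
  rw [← integral_map (φ := fun ω : RCPath Ω => ω.1 s) (f := fun a => ((P a).real A : ℂ))
    (measurable_eval s).aemeasurable hm.aestronglyMeasurable,
    (hP.measurePreserving_eval s).map_eq] at h
  have h2 := integral_bind_kernel (ν := μ) (κ := P) (f := A.indicator (1 : RCPath Ω → ℂ))
    (integrable_of_measurable_bounded (measurable_one.indicator hA) (C := 1) (fun ω => by
      by_cases h : ω ∈ A <;> simp [h]))
  simp only [hAi] at h2
  rw [← h2, integral_indicator hA] at h
  simp only [Pi.one_apply, integral_const, smul_eq_mul, mul_one] at h
  rw [Measure.map_apply (measurable_timeShift s) hA]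
  have h3 : (pathLaw μ P).real (timeShift s ⁻¹' A) = (pathLaw μ P).real A := by
    have := h
    simp only [measureReal_restrict_apply_univ, Complex.real_smul, mul_one] at this
    exact_mod_cast this
  exact (measureReal_eq_measureReal_iff).1 h3

end Conditioning

/-! ### Strong continuity of the semigroup from right-continuity of the paths. -/

section StrongContinuity

variable {d : ℕ} {Ω : Type*} [TopologicalSpace Ω] [MeasurableSpace Ω] {μ : Measure Ω}
  {σ : Site d → Ω → Ω} {P : Kernel Ω (RCPath Ω)} [IsProbabilityMeasure μ] [IsMarkovKernel P]

/-- The events `ω₀ ∈ A` and `ω_t ∈ A` have the same probability, so as much mass leaves `A` as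
enters it. Exit probabilities of `A` and of its complement therefore agree. -/
theorem measureReal_exit_eq (hP : IsMarkovProcess μ σ P) (t : ℝ≥0) {A : Set Ω}
    (hA : MeasurableSet A) :
    (pathLaw μ P).real {ω | ω.1 0 ∈ A ∧ ω.1 t ∉ A}
      = (pathLaw μ P).real {ω | ω.1 0 ∉ A ∧ ω.1 t ∈ A} := by
  have h0 : MeasurableSet {ω : RCPath Ω | ω.1 0 ∈ A} := measurable_eval 0 hA
  have ht : MeasurableSet {ω : RCPath Ω | ω.1 t ∈ A} := measurable_eval t hA
  have e0 : (pathLaw μ P).real {ω | ω.1 0 ∈ A} = μ.real A :=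
    (hP.measurePreserving_eval 0).measureReal_preimage hA.nullMeasurableSet
  have et : (pathLaw μ P).real {ω | ω.1 t ∈ A} = μ.real A :=
    (hP.measurePreserving_eval t).measureReal_preimage hA.nullMeasurableSet
  have d0 := measureReal_inter_add_diff (μ := pathLaw μ P) (s := {ω : RCPath Ω | ω.1 0 ∈ A}) ht
  have dt := measureReal_inter_add_diff (μ := pathLaw μ P) (s := {ω : RCPath Ω | ω.1 t ∈ A}) h0
  rw [Set.inter_comm] at dt
  have s0 : {ω : RCPath Ω | ω.1 0 ∈ A} \ {ω | ω.1 t ∈ A} = {ω | ω.1 0 ∈ A ∧ ω.1 t ∉ A} := by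
    ext ω; simp
  have st : {ω : RCPath Ω | ω.1 t ∈ A} \ {ω | ω.1 0 ∈ A} = {ω | ω.1 0 ∉ A ∧ ω.1 t ∈ A} := by
    ext ω; simp [and_comm]
  rw [s0] at d0
  rw [st] at dt
  linarith

/-- A π-λ argument: from an open set a right-continuous path does not exit immediately; complements
are `measureReal_exit_eq`; disjoint unions follow by dominated convergence of the series. No metric
on `Ω` is needed. -/
theorem tendsto_measureReal_exit [BorelSpace Ω] (hP : IsMarkovProcess μ σ P) {A : Set Ω}
    (hA : MeasurableSet A) :
    Tendsto (fun t : ℝ≥0 => (pathLaw μ P).real {ω | ω.1 0 ∈ A ∧ ω.1 t ∉ A}) (𝓝[>] 0) (𝓝 0) := by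
  have hmeas : ∀ {A : Set Ω} (t : ℝ≥0), MeasurableSet A →
      MeasurableSet {ω : RCPath Ω | ω.1 0 ∈ A ∧ ω.1 t ∉ A} := fun t hA =>
    (measurable_eval 0 hA).inter (measurable_eval t hA).compl
  refine MeasurableSpace.induction_on_inter (C := fun A _ =>
    Tendsto (fun t : ℝ≥0 => (pathLaw μ P).real {ω | ω.1 0 ∈ A ∧ ω.1 t ∉ A}) (𝓝[>] 0) (𝓝 0))
    (BorelSpace.measurable_eq (α := Ω)) isPiSystem_isOpen (by simp) ?_ ?_ ?_ A hA
  · intro A hA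
    have hA' : IsOpen A := hA
    have hdc : Tendsto (fun t : ℝ≥0 => ∫ ω, {ω : RCPath Ω | ω.1 0 ∈ A ∧ ω.1 t ∉ A}.indicator
        (1 : RCPath Ω → ℝ) ω ∂(pathLaw μ P)) (𝓝[>] 0) (𝓝 (∫ _ω, (0 : ℝ) ∂(pathLaw μ P))) := by
      refine tendsto_integral_filter_of_dominated_convergence (fun _ => 1)
        (.of_forall fun t => ((measurable_one.indicator
          (hmeas t hA'.measurableSet)).aestronglyMeasurable))
        (.of_forall fun t => ae_of_all _ fun ω => ?_) (integrable_const _)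
        (ae_of_all _ fun ω => ?_)
      · by_cases h : ω ∈ {ω : RCPath Ω | ω.1 0 ∈ A ∧ ω.1 t ∉ A} <;> simp [h]
      · refine tendsto_const_nhds.congr' ?_
        by_cases h : ω.1 0 ∈ A
        · have h1 := ω.2 0 (hA'.mem_nhds h)
          filter_upwards [nhdsWithin_mono 0 Set.Ioi_subset_Ici_self h1] with t ht
          have : ω ∉ {ω : RCPath Ω | ω.1 0 ∈ A ∧ ω.1 t ∉ A} := fun hc => hc.2 ht
          simp [Set.indicator_of_notMem this]
        · refine .of_forall fun t => ?_
          have : ω ∉ {ω : RCPath Ω | ω.1 0 ∈ A ∧ ω.1 t ∉ A} := fun hc => h hc.1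
          simp [Set.indicator_of_notMem this]
    simp only [integral_zero] at hdc
    refine hdc.congr fun t => ?_
    rw [integral_indicator (hmeas t hA'.measurableSet)]
    simp
  · intro A hA h
    refine h.congr fun t => ?_
    rw [measureReal_exit_eq hP t hA]
    simp
  · intro A hdis hA h
    have hsum : Summable fun i => μ.real (A i) := by
      have h1 : ∑' i, μ (A i) ≠ ⊤ := by
        rw [← measure_iUnion hdis hA]; exact measure_ne_top _ _
      exact ENNReal.summable_toReal h1
    have hle : ∀ i (t : ℝ≥0), (pathLaw μ P).real {ω | ω.1 0 ∈ A i ∧ ω.1 t ∉ A i}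
        ≤ μ.real (A i) := fun i t => by
      rw [← (hP.measurePreserving_eval 0).measureReal_preimage (hA i).nullMeasurableSet]
      exact measureReal_mono fun ω hω => hω.1
    have htan := tendsto_tsum_of_dominated_convergence (𝓕 := 𝓝[>] (0 : ℝ≥0)) hsum h
      (.of_forall fun t i => by simpa [abs_of_nonneg] using hle i t)
    simp only [tsum_zero] at htan
    refine squeeze_zero (fun t => measureReal_nonneg) (fun t => ?_) htan
    have hs : Summable fun i => (pathLaw μ P).real {ω | ω.1 0 ∈ A i ∧ ω.1 t ∉ A i} :=
      hsum.of_nonneg_of_le (fun _ => measureReal_nonneg) fun i => hle i t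
    have hsub : {ω : RCPath Ω | ω.1 0 ∈ ⋃ i, A i ∧ ω.1 t ∉ ⋃ i, A i}
        ⊆ ⋃ i, {ω : RCPath Ω | ω.1 0 ∈ A i ∧ ω.1 t ∉ A i} := by
      intro ω hω
      obtain ⟨i, hi⟩ := Set.mem_iUnion.1 hω.1
      exact Set.mem_iUnion.2 ⟨i, hi, fun hc => hω.2 (Set.mem_iUnion.2 ⟨i, hc⟩)⟩
    refine (measureReal_mono hsub).trans ?_
    have h2 : pathLaw μ P (⋃ i, {ω : RCPath Ω | ω.1 0 ∈ A i ∧ ω.1 t ∉ A i})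
        ≤ ∑' i, pathLaw μ P {ω : RCPath Ω | ω.1 0 ∈ A i ∧ ω.1 t ∉ A i} := measure_iUnion_le _
    have h3 : ∑' i, pathLaw μ P {ω : RCPath Ω | ω.1 0 ∈ A i ∧ ω.1 t ∉ A i}
        = ENNReal.ofReal (∑' i, (pathLaw μ P).real {ω | ω.1 0 ∈ A i ∧ ω.1 t ∉ A i}) := by
      rw [ENNReal.ofReal_tsum_of_nonneg (fun _ => measureReal_nonneg) hs]
      simp
    rw [h3] at h2
    exact ENNReal.toReal_le_of_le_ofReal (tsum_nonneg fun _ => measureReal_nonneg) h2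

theorem tendsto_evalL2_zero_of_indicator [BorelSpace Ω] (hP : IsMarkovProcess μ σ P) {A : Set Ω}
    (hA : MeasurableSet A) (c : ℂ) {f : Lp ℂ 2 μ} (hfc : f =ᵐ[μ] A.indicator fun _ => c) :
    Tendsto (fun t : ℝ≥0 => evalL2 hP t f) (𝓝[>] 0) (𝓝 (evalL2 hP 0 f)) := by
  have hcoe : ∀ t : ℝ≥0, evalL2 hP t f =ᵐ[pathLaw μ P]
      fun ω => A.indicator (fun _ => c) (ω.1 t) := fun t => by
    filter_upwards [evalL2_coe hP t f,
      (hP.measurePreserving_eval t).quasiMeasurePreserving.ae hfc] with ω h1 h2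
    rw [h1, h2]
  have hE : ∀ t : ℝ≥0, MeasurableSet {ω : RCPath Ω | ω.1 0 ∈ A ∧ ω.1 t ∉ A} := fun t =>
    (measurable_eval 0 hA).inter (measurable_eval t hA).compl
  have hE' : ∀ t : ℝ≥0, MeasurableSet {ω : RCPath Ω | ω.1 0 ∉ A ∧ ω.1 t ∈ A} := fun t =>
    (measurable_eval 0 hA).compl.inter (measurable_eval t hA)
  have hnorm : ∀ t : ℝ≥0, ‖evalL2 hP t f - evalL2 hP 0 f‖ ^ 2
      = ‖c‖ ^ 2 * (2 * (pathLaw μ P).real {ω | ω.1 0 ∈ A ∧ ω.1 t ∉ A}) := by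
    intro t
    rw [@norm_sq_eq_re_inner ℂ, L2.inner_def]
    have : ∀ᵐ ω ∂(pathLaw μ P), inner ℂ ((evalL2 hP t f - evalL2 hP 0 f) ω)
        ((evalL2 hP t f - evalL2 hP 0 f) ω)
        = (({ω : RCPath Ω | ω.1 0 ∈ A ∧ ω.1 t ∉ A}.indicator (fun _ => ‖c‖ ^ 2) ω
          + {ω : RCPath Ω | ω.1 0 ∉ A ∧ ω.1 t ∈ A}.indicator (fun _ => ‖c‖ ^ 2) ω : ℝ) : ℂ) := by
      filter_upwards [hcoe t, hcoe 0, Lp.coeFn_sub (evalL2 hP t f) (evalL2 hP 0 f)]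
        with ω h1 h2 h3
      rw [inner_self_eq_norm_sq_to_K, h3, Pi.sub_apply, h1, h2]
      by_cases h0 : ω.1 0 ∈ A <;> by_cases ht : ω.1 t ∈ A <;> simp [h0, ht]
    rw [integral_congr_ae this, integral_complex_ofReal, integral_add
      ((integrable_const _).indicator (hE t)) ((integrable_const _).indicator (hE' t)),
      integral_indicator_const _ (hE t), integral_indicator_const _ (hE' t),
      ← measureReal_exit_eq hP t hA]
    simp only [smul_eq_mul, RCLike.re_to_complex, Complex.ofReal_re]
    ring
  rw [tendsto_iff_norm_sub_tendsto_zero]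
  have h2 : Tendsto (fun t : ℝ≥0 => ‖evalL2 hP t f - evalL2 hP 0 f‖ ^ 2) (𝓝[>] 0) (𝓝 0) := by
    simp only [hnorm]
    simpa using ((tendsto_measureReal_exit hP hA).const_mul 2).const_mul (‖c‖ ^ 2)
  have h3 := h2.sqrt
  simpa [Real.sqrt_sq] using h3

/-- From indicators to simple functions by linearity, then to all of `L²` by density, as every
`evalL2 hP t` is an isometry. -/
theorem tendsto_evalL2_zero [BorelSpace Ω] (hP : IsMarkovProcess μ σ P) (f : Lp ℂ 2 μ) :
    Tendsto (fun t : ℝ≥0 => evalL2 hP t f) (𝓝[>] 0) (𝓝 (evalL2 hP 0 f)) := by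
  refine Lp.induction (by norm_num) (fun f : Lp ℂ 2 μ => Tendsto (fun t : ℝ≥0 => evalL2 hP t f)
    (𝓝[>] 0) (𝓝 (evalL2 hP 0 f))) ?_ ?_ ?_ f
  · intro c A hA hμA
    rw [Lp.simpleFunc.coe_indicatorConst]
    exact tendsto_evalL2_zero_of_indicator hP hA c indicatorConstLp_coeFn
  · intro f g hf hg _ h1 h2
    simp only [map_add]
    exact h1.add h2
  · rw [← isSeqClosed_iff_isClosed]
    intro u f hu hlim
    refine Metric.tendsto_nhds.2 fun ε hε => ?_
    obtain ⟨n, hn⟩ := (Metric.tendsto_nhds.1 hlim (ε / 3) (by positivity)).exists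
    filter_upwards [Metric.tendsto_nhds.1 (hu n) (ε / 3) (by positivity)] with t ht
    have hd : ∀ s : ℝ≥0, dist (evalL2 hP s f) (evalL2 hP s (u n)) < ε / 3 := fun s => by
      rw [dist_eq_norm, ← map_sub, norm_evalL2, ← dist_eq_norm, dist_comm]; exact hn
    calc dist (evalL2 hP t f) (evalL2 hP 0 f)
        ≤ dist (evalL2 hP t f) (evalL2 hP t (u n)) + dist (evalL2 hP t (u n)) (evalL2 hP 0 (u n))
          + dist (evalL2 hP 0 (u n)) (evalL2 hP 0 f) := dist_triangle4 _ _ _ _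
      _ < ε := by
        have := hd t; have := hd 0; rw [dist_comm] at this
        linarith

/-- Right continuity of `s ↦ f(ω_s)` in `L²`. -/
theorem tendsto_evalL2 [BorelSpace Ω] (hP : IsMarkovProcess μ σ P) (f : Lp ℂ 2 μ) (t : ℝ≥0) :
    Tendsto (fun u : ℝ≥0 => ‖evalL2 hP (t + u) f - evalL2 hP t f‖) (𝓝[>] 0) (𝓝 0) := by
  refine (tendsto_iff_norm_sub_tendsto_zero.1 (tendsto_evalL2_zero hP f)).congr fun u => ?_
  have hs := measurePreserving_timeShift hP t
  have hcomp : ∀ s : ℝ≥0, Lp.compMeasurePreserving (timeShift t) hs (evalL2 hP s f)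
      = evalL2 hP (t + s) f := fun s => by
    refine Lp.ext ?_
    refine (Lp.coeFn_compMeasurePreserving _ hs).trans
      ((hs.quasiMeasurePreserving.ae_eq_comp (evalL2_coe hP s f)).trans ?_)
    refine Filter.EventuallyEq.trans ?_ (evalL2_coe hP (t + s) f).symm
    exact .of_forall fun ω => by simp [timeShift, add_comm]
  have h0 := hcomp 0
  rw [add_zero] at h0
  rw [← hcomp u, ← h0, ← map_sub]
  exact (Lp.norm_compMeasurePreserving _ hs).symm

/-- Conditioning at time `t` sends `f(ω_t)` back to `f`, so only `f(ω₀) - f(ω_t)` has to be small.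
-/
theorem tendsto_backwardSemigroup [BorelSpace Ω] (hP : IsMarkovProcess μ σ P) (f : Lp ℂ 2 μ) :
    Tendsto (fun t : ℝ≥0 => backwardSemigroup hP t f) (𝓝[>] 0) (𝓝 f) := by
  rw [tendsto_iff_norm_sub_tendsto_zero]
  refine squeeze_zero (fun _ => norm_nonneg _) (fun t => ?_)
    (tendsto_iff_norm_sub_tendsto_zero.1 (tendsto_evalL2_zero hP f))
  calc ‖backwardSemigroup hP t f - f‖
      = ‖condL2 hP t (evalL2 hP 0 f - evalL2 hP t f)‖ := by
        rw [map_sub, condL2_evalL2, backwardSemigroup_apply]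
    _ ≤ _ := (norm_condL2_le hP t _).trans_eq (norm_sub_rev _ _)

theorem tendsto_toNNReal_nhdsGT_zero :
    Tendsto (fun t : ℝ => t.toNNReal) (𝓝[>] 0) (𝓝[>] (0 : ℝ≥0)) := by
  refine tendsto_nhdsWithin_iff.2 ⟨?_, ?_⟩
  · have := (continuous_real_toNNReal.tendsto 0).mono_left (nhdsWithin_le_nhds (s := Set.Ioi 0))
    simpa using this
  · filter_upwards [self_mem_nhdsWithin] with t ht
    simpa using ht

theorem tendsto_coe_nhdsGT_zero :
    Tendsto (fun t : ℝ≥0 => (t : ℝ)) (𝓝[>] 0) (𝓝[>] (0 : ℝ)) := by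
  refine tendsto_nhdsWithin_iff.2 ⟨?_, ?_⟩
  · have := (NNReal.continuous_coe.tendsto 0).mono_left (nhdsWithin_le_nhds (s := Set.Ioi 0))
    simpa using this
  · filter_upwards [self_mem_nhdsWithin] with t ht
    simpa using ht

theorem isContractionSemigroup_backward [BorelSpace Ω] (hP : IsMarkovProcess μ σ P) :
    IsContractionSemigroup fun t : ℝ => backwardSemigroup hP t.toNNReal where
  zero f := by simp [backwardSemigroup_apply, condL2_evalL2]
  add s t hs ht f := by
    rw [add_comm s t, Real.toNNReal_add ht hs, backwardSemigroup_add]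
  norm_le t _ f := (norm_condL2_le hP _ _).trans_eq (norm_evalL2 hP 0 f)
  tendsto f := (tendsto_backwardSemigroup hP f).comp tendsto_toNNReal_nhdsGT_zero

theorem isGenerator_iff (hP : IsMarkovProcess μ σ P) (f g : Lp ℂ 2 μ) :
    IsGenerator hP f g ↔ Tendsto (fun h : ℝ => h⁻¹ • (f - backwardSemigroup hP h.toNNReal f))
      (𝓝[>] 0) (𝓝 g) := by
  constructor
  · intro h
    refine (Tendsto.comp h tendsto_toNNReal_nhdsGT_zero).congr' ?_
    filter_upwards [self_mem_nhdsWithin] with t ht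
    rw [Function.comp_apply, Real.coe_toNNReal _ (le_of_lt ht), ← Complex.ofReal_inv]
    exact (RCLike.real_smul_eq_coe_smul (K := ℂ) _ _).symm
  · intro h
    refine (Tendsto.comp h tendsto_coe_nhdsGT_zero).congr fun t => ?_
    rw [Function.comp_apply, Real.toNNReal_coe, ← Complex.ofReal_inv]
    exact RCLike.real_smul_eq_coe_smul (K := ℂ) _ _

end StrongContinuity

/-! ### Multiplication operators on `L²`. -/

section Multiplication

variable {α : Type*} [MeasurableSpace α] {ν : Measure α}

theorem memLp_bdd_mul {φ : α → ℂ} (hφ : Measurable φ) {C : ℝ} (hC : ∀ a, ‖φ a‖ ≤ C)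
    (f : Lp ℂ 2 ν) : MemLp (fun a => φ a * f a) 2 ν :=
  (Lp.memLp f).of_le_mul (c := C) (hφ.aestronglyMeasurable.mul (Lp.aestronglyMeasurable f))
    (ae_of_all _ fun a => by rw [norm_mul]; gcongr; exact hC a)

/-- Multiplication by a bounded measurable function. -/
def mulL2 (ν : Measure α) (φ : α → ℂ) (hφ : Measurable φ) (C : ℝ) (hC : ∀ a, ‖φ a‖ ≤ C) :
    Lp ℂ 2 ν →L[ℂ] Lp ℂ 2 ν :=
  have hm := memLp_bdd_mul (ν := ν) hφ hC
  LinearMap.mkContinuous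
    { toFun := fun f => (hm f).toLp _
      map_add' := fun f g => by
        refine Lp.ext ?_
        filter_upwards [(hm (f + g)).coeFn_toLp, (hm f).coeFn_toLp, (hm g).coeFn_toLp,
          Lp.coeFn_add f g, Lp.coeFn_add ((hm f).toLp _) ((hm g).toLp _)] with a h1 h2 h3 h4 h5
        rw [h1, h5, Pi.add_apply, h2, h3, h4, Pi.add_apply, mul_add]
      map_smul' := fun c f => by
        refine Lp.ext ?_
        filter_upwards [(hm (c • f)).coeFn_toLp, (hm f).coeFn_toLp, Lp.coeFn_smul c f,
          Lp.coeFn_smul c ((hm f).toLp _)] with a h1 h2 h3 h4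
        rw [h1, RingHom.id_apply, h4, Pi.smul_apply, h2, h3, Pi.smul_apply, smul_eq_mul,
          smul_eq_mul, mul_left_comm] }
    C fun f => by
      refine Lp.norm_le_mul_norm_of_ae_le_mul ((hm f).coeFn_toLp.mono fun a ha => ?_)
      rw [LinearMap.coe_mk, AddHom.coe_mk, ha, norm_mul]
      gcongr
      exact hC a

variable {φ : α → ℂ} {hφ : Measurable φ} {C : ℝ} {hC : ∀ a, ‖φ a‖ ≤ C}

theorem mulL2_coe (f : Lp ℂ 2 ν) : mulL2 ν φ hφ C hC f =ᵐ[ν] fun a => φ a * f a :=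
  MemLp.coeFn_toLp (memLp_bdd_mul hφ hC f)

theorem norm_mulL2_apply_le (f : Lp ℂ 2 ν) : ‖mulL2 ν φ hφ C hC f‖ ≤ C * ‖f‖ :=
  Lp.norm_le_mul_norm_of_ae_le_mul ((mulL2_coe f).mono fun a ha => by
    rw [ha, norm_mul]; gcongr; exact hC a)

theorem norm_mulL2_le (hC0 : 0 ≤ C) : ‖mulL2 ν φ hφ C hC‖ ≤ C :=
  ContinuousLinearMap.opNorm_le_bound _ hC0 norm_mulL2_apply_le

theorem mulL2_symm (hr : ∀ a, (starRingEnd ℂ) (φ a) = φ a) (f g : Lp ℂ 2 ν) :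
    inner ℂ (mulL2 ν φ hφ C hC f) g = inner ℂ f (mulL2 ν φ hφ C hC g) := by
  rw [L2.inner_def, L2.inner_def]
  refine integral_congr_ae ?_
  filter_upwards [mulL2_coe (hφ := hφ) (hC := hC) f, mulL2_coe (hφ := hφ) (hC := hC) g] with a h1 h2
  simp only [RCLike.inner_apply, h1, h2, map_mul, hr]
  ring

end Multiplication

/-! ### The noise at a single site: conditioning, mean values and the gap. -/

section OneSite

variable {d : ℕ} {Ω : Type*} [TopologicalSpace Ω] [MeasurableSpace Ω] {μ : Measure Ω}
  {σ : Site d → Ω → Ω} {P : Kernel Ω (RCPath Ω)} [IsProbabilityMeasure μ] [IsMarkovKernel P]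

/-- A factor that depends on `ω_t` alone is known at time `t` and passes through the conditioning.
-/
theorem condL2_mulL2 (hP : IsMarkovProcess μ σ P) (t : ℝ≥0) {φ : Ω → ℂ} (hφ : Measurable φ)
    {C : ℝ} (hC : ∀ a, ‖φ a‖ ≤ C) (G : Lp ℂ 2 (pathLaw μ P)) :
    condL2 hP t (mulL2 (pathLaw μ P) (fun ω => φ (ω.1 t)) (hφ.comp (measurable_eval t)) C
      (fun ω => hC _) G) = mulL2 μ φ hφ C hC (condL2 hP t G) := by
  refine Lp_ext_of_integral_mul fun θ hθ hθ1 => ?_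
  rw [integral_mul_condL2 hP t _ hθ hθ1]
  have h1 : ∀ᵐ a ∂μ, θ a * mulL2 μ φ hφ C hC (condL2 hP t G) a
      = (θ a * φ a) * condL2 hP t G a :=
    (mulL2_coe _).mono fun a ha => by rw [ha, mul_assoc]
  rw [integral_congr_ae h1, integral_mul_condL2 hP t (φ := fun a => θ a * φ a) _ (hθ.mul hφ) (C := C)
    fun a => by
      rw [norm_mul]
      exact (mul_le_of_le_one_left (norm_nonneg _) (hθ1 a)).trans (hC a)]
  refine integral_congr_ae ((mulL2_coe (φ := fun ω : RCPath Ω => φ (ω.1 t))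
    (hφ := hφ.comp (measurable_eval t)) (hC := fun ω => hC _) G).mono fun ω hω => ?_)
  beta_reduce
  rw [hω, mul_assoc]

/-- The constant function `1` in `L²(μ)`. -/
def oneL2 (μ : Measure Ω) [IsProbabilityMeasure μ] : Lp ℂ 2 μ := Lp.const 2 μ 1

theorem oneL2_coe : oneL2 μ =ᵐ[μ] fun _ => 1 := Lp.coeFn_const ..

theorem inner_oneL2 (f : Lp ℂ 2 μ) : inner ℂ (oneL2 μ) f = ∫ a, f a ∂μ := by
  rw [L2.inner_def]
  refine integral_congr_ae (oneL2_coe.mono fun a ha => ?_)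
  simp [ha]

theorem norm_oneL2 : ‖oneL2 μ‖ = 1 := by
  have h := inner_self_eq_norm_sq_to_K (𝕜 := ℂ) (oneL2 μ)
  rw [inner_oneL2, integral_congr_ae oneL2_coe] at h
  simp only [integral_const, probReal_univ, one_smul] at h
  have h2 : ‖oneL2 μ‖ ^ 2 = 1 := by
    have h3 : ((‖oneL2 μ‖ ^ 2 : ℝ) : ℂ) = 1 := by rw [h]; simp
    exact_mod_cast h3
  nlinarith [norm_nonneg (oneL2 μ)]

theorem inner_oneL2_self : inner ℂ (oneL2 μ) (oneL2 μ) = 1 := by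
  rw [inner_self_eq_norm_sq_to_K, norm_oneL2]; simp

theorem evalL2_oneL2 (hP : IsMarkovProcess μ σ P) (t : ℝ≥0) :
    evalL2 hP t (oneL2 μ) = oneL2 (Ω := RCPath Ω) (pathLaw μ P) := by
  refine Lp.ext ?_
  filter_upwards [evalL2_coe hP t (oneL2 μ), oneL2_coe (μ := pathLaw μ P),
    (hP.measurePreserving_eval t).quasiMeasurePreserving.ae oneL2_coe] with ω h1 h2 h3
  rw [h1, h2, h3]

theorem inner_oneL2_condL2 (hP : IsMarkovProcess μ σ P) (t : ℝ≥0) (G : Lp ℂ 2 (pathLaw μ P)) :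
    inner ℂ (oneL2 μ) (condL2 hP t G) = ∫ ω, G ω ∂(pathLaw μ P) := by
  rw [condL2, ContinuousLinearMap.adjoint_inner_right, evalL2_oneL2, inner_oneL2]

theorem condL2_oneL2 (hP : IsMarkovProcess μ σ P) (t : ℝ≥0) :
    condL2 hP t (oneL2 (Ω := RCPath Ω) (pathLaw μ P)) = oneL2 μ := by
  rw [← evalL2_oneL2 hP t, condL2_evalL2]

theorem backwardSemigroup_oneL2 (hP : IsMarkovProcess μ σ P) (t : ℝ≥0) :
    backwardSemigroup hP t (oneL2 μ) = oneL2 μ := by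
  rw [backwardSemigroup_apply, evalL2_oneL2, condL2_oneL2]

theorem inner_oneL2_backwardSemigroup (hP : IsMarkovProcess μ σ P) (t : ℝ≥0) (f : Lp ℂ 2 μ) :
    inner ℂ (oneL2 μ) (backwardSemigroup hP t f) = inner ℂ (oneL2 μ) f := by
  rw [backwardSemigroup_apply, condL2, ContinuousLinearMap.adjoint_inner_right, evalL2_oneL2,
    ← evalL2_oneL2 hP 0]
  exact LinearIsometry.inner_map_map _ _ _

/-- The projection onto the constants in `L²(μ)`. -/
def meanL2 (μ : Measure Ω) [IsProbabilityMeasure μ] : Lp ℂ 2 μ →L[ℂ] Lp ℂ 2 μ :=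
  (innerSL ℂ (oneL2 μ)).smulRight (oneL2 μ)

theorem meanL2_apply (f : Lp ℂ 2 μ) : meanL2 μ f = inner ℂ (oneL2 μ) f • oneL2 μ := rfl

theorem meanL2_eq_zero_iff (f : Lp ℂ 2 μ) : meanL2 μ f = 0 ↔ ∫ a, f a ∂μ = 0 := by
  have h1 : oneL2 μ ≠ 0 := by rw [← norm_ne_zero_iff, norm_oneL2]; exact one_ne_zero
  rw [meanL2_apply, smul_eq_zero, or_iff_left h1, inner_oneL2]

/-- The gap hypothesis bounds the numerical range of `B` on mean-zero functions;
`norm_le_exp_of_generator` turns it into decay at rate `1 / T`. -/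
theorem isGapped_backward [BorelSpace Ω] (hP : IsMarkovProcess μ σ P) (hB : HasGapSectorial hP) :
    ∃ γ : ℝ, IsGapped (fun t : ℝ => backwardSemigroup hP t.toNNReal) (meanL2 μ) γ := by
  obtain ⟨T, hT, hgap⟩ := hB.gap
  have hS := isContractionSemigroup_backward hP
  have hZS : ∀ t : ℝ, 0 ≤ t → ∀ f, meanL2 μ (backwardSemigroup hP t.toNNReal f) = meanL2 μ f :=
    fun t _ f => by rw [meanL2_apply, inner_oneL2_backwardSemigroup, meanL2_apply]
  refine ⟨1 / T, ⟨hS, by positivity, fun f => ?_, fun f g => ?_, fun t _ f => ?_, hZS,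
    fun t ht f hf => hS.norm_le_exp_of_generator hZS (fun f g hfg hf => ?_) hf ht⟩⟩
  · rw [meanL2_apply, meanL2_apply, inner_smul_right, inner_oneL2_self, mul_one]
  · rw [meanL2_apply, meanL2_apply, inner_smul_left, inner_smul_right, inner_conj_symm, mul_comm]
  · rw [meanL2_apply, map_smul, backwardSemigroup_oneL2]
  · exact hgap f g ((isGenerator_iff hP f g).2 hfg) ((meanL2_eq_zero_iff f).1 hf)

/-! ### Shifts -/

theorem IsShiftAction.apply_neg (hσ : IsShiftAction μ σ) (y : Site d) (a : Ω) :
    σ y (σ (-y) a) = a := by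
  have := congrFun (hσ.add y (-y)) a
  simpa [hσ.zero] using this

theorem IsShiftAction.neg_apply (hσ : IsShiftAction μ σ) (y : Site d) (a : Ω) :
    σ (-y) (σ y a) = a := by
  simpa using hσ.apply_neg (-y) a

/-- `T_y f = f ∘ σ_{-y}`. -/
def shiftL2 (hσ : IsShiftAction μ σ) (y : Site d) : Lp ℂ 2 μ →L[ℂ] Lp ℂ 2 μ :=
  (Lp.compMeasurePreservingₗᵢ ℂ (σ (-y)) (hσ.preserving (-y))).toContinuousLinearMap

theorem shiftL2_coe (hσ : IsShiftAction μ σ) (y : Site d) (f : Lp ℂ 2 μ) :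
    shiftL2 hσ y f =ᵐ[μ] fun a => f (σ (-y) a) :=
  Lp.coeFn_compMeasurePreserving f (hσ.preserving (-y))

theorem norm_shiftL2 (hσ : IsShiftAction μ σ) (y : Site d) (f : Lp ℂ 2 μ) :
    ‖shiftL2 hσ y f‖ = ‖f‖ := LinearIsometry.norm_map _ f

theorem shiftL2_zero (hσ : IsShiftAction μ σ) (f : Lp ℂ 2 μ) : shiftL2 hσ 0 f = f := by
  refine Lp.ext ((shiftL2_coe hσ 0 f).trans ?_)
  simp [hσ.zero]

theorem shiftL2_add (hσ : IsShiftAction μ σ) (x y : Site d) (f : Lp ℂ 2 μ) :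
    shiftL2 hσ (x + y) f = shiftL2 hσ x (shiftL2 hσ y f) := by
  refine Lp.ext ?_
  filter_upwards [shiftL2_coe hσ (x + y) f, shiftL2_coe hσ x (shiftL2 hσ y f),
    (hσ.preserving (-x)).quasiMeasurePreserving.ae (shiftL2_coe hσ y f)] with a h1 h2 h3
  rw [h1, h2, h3]
  have := congrFun (hσ.add (-y) (-x)) a
  rw [neg_add_rev, ← this, Function.comp_apply]

theorem shiftL2_oneL2 (hσ : IsShiftAction μ σ) (y : Site d) :
    shiftL2 hσ y (oneL2 μ) = oneL2 μ := by
  refine Lp.ext ?_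
  filter_upwards [shiftL2_coe hσ y (oneL2 μ), oneL2_coe (μ := μ),
    (hσ.preserving (-y)).quasiMeasurePreserving.ae oneL2_coe] with a h1 h2 h3
  rw [h1, h2, h3]

theorem inner_shiftL2_left (hσ : IsShiftAction μ σ) (y : Site d) (f g : Lp ℂ 2 μ) :
    inner ℂ (shiftL2 hσ y f) g = inner ℂ f (shiftL2 hσ (-y) g) := by
  have h : g = shiftL2 hσ y (shiftL2 hσ (-y) g) := by
    rw [← shiftL2_add, add_neg_cancel, shiftL2_zero]
  conv_lhs => rw [h]
  exact LinearIsometry.inner_map_map _ _ _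

theorem inner_oneL2_shiftL2 (hσ : IsShiftAction μ σ) (y : Site d) (f : Lp ℂ 2 μ) :
    inner ℂ (oneL2 μ) (shiftL2 hσ y f) = inner ℂ (oneL2 μ) f := by
  conv_lhs => rw [← shiftL2_oneL2 hσ y]
  exact LinearIsometry.inner_map_map _ _ _

theorem integral_mul_shiftL2 (hσ : IsShiftAction μ σ) (y : Site d) (f : Lp ℂ 2 μ)
    {φ : Ω → ℂ} (hφ : Measurable φ) :
    ∫ a, φ a * shiftL2 hσ y f a ∂μ = ∫ a, φ (σ y a) * f a ∂μ := by
  have hm : AEStronglyMeasurable (fun a => φ a * shiftL2 hσ y f a) μ :=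
    hφ.aestronglyMeasurable.mul (Lp.aestronglyMeasurable _)
  have h := integral_map (μ := μ) (φ := σ y) (hσ.preserving y).measurable.aemeasurable
    (f := fun a => φ a * shiftL2 hσ y f a) (by rwa [(hσ.preserving y).map_eq])
  rw [(hσ.preserving y).map_eq] at h
  rw [h]
  refine integral_congr_ae ?_
  filter_upwards [(hσ.preserving y).quasiMeasurePreserving.ae (shiftL2_coe hσ y f)] with a ha
  rw [ha, hσ.neg_apply]

theorem integral_kernel_shift (hσ : IsShiftAction μ σ) (hP : IsMarkovProcess μ σ P) (x : Site d)
    (t : ℝ≥0) {φ : Ω → ℂ} (hφ : Measurable φ) (a : Ω) :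
    ∫ ω, φ (ω.1 t) ∂(P (σ x a)) = ∫ ω, φ (σ x (ω.1 t)) ∂(P a) := by
  have hm1 : Measurable fun (ω : RCPath Ω) (t : ℝ≥0) => ω.1 t := measurable_subtype_coe
  have hm2 : Measurable fun (ω : RCPath Ω) (t : ℝ≥0) => σ x (ω.1 t) :=
    measurable_pi_lambda _ fun t => (hσ.preserving x).measurable.comp (measurable_eval t)
  have hf : Measurable fun p : ℝ≥0 → Ω => φ (p t) := hφ.comp (measurable_pi_apply t)
  have h1 := integral_map (μ := P (σ x a)) hm1.aemeasurable (f := fun p : ℝ≥0 → Ω => φ (p t))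
    hf.aestronglyMeasurable
  have h2 := integral_map (μ := P a) hm2.aemeasurable (f := fun p : ℝ≥0 → Ω => φ (p t))
    hf.aestronglyMeasurable
  rw [hP.shift a x] at h1
  exact h1.symm.trans h2

/-- Dual form, against test functions, of the shift covariance of the law of the process. -/
theorem shiftL2_backwardSemigroup (hσ : IsShiftAction μ σ) (hP : IsMarkovProcess μ σ P)
    (y : Site d) (t : ℝ≥0) (f : Lp ℂ 2 μ) :
    shiftL2 hσ y (backwardSemigroup hP t f) = backwardSemigroup hP t (shiftL2 hσ y f) := by
  refine Lp_ext_of_integral_mul fun φ hφ hC => ?_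
  rw [integral_mul_shiftL2 hσ y _ hφ, integral_mul_backwardSemigroup hP t _ hφ hC,
    integral_mul_backwardSemigroup hP t (φ := fun a => φ (σ y a)) _
      (hφ.comp (hσ.preserving y).measurable) (fun a => hC _),
    integral_mul_shiftL2 hσ y (φ := fun a => ∫ ω, φ (ω.1 t) ∂(P a)) _
      (stronglyMeasurable_integral_kernel (hφ.comp (measurable_eval t)))]
  refine integral_congr_ae (ae_of_all _ fun a => ?_)
  simp only [integral_kernel_shift hσ hP y t hφ]

end OneSite

/-! ### Diagonal operators on vector-valued `ℓ²`. -/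

section LpOperators

variable {ι E F : Type*} [NormedAddCommGroup E] [NormedSpace ℂ E] [NormedAddCommGroup F]
  [NormedSpace ℂ F]

theorem lp_norm_le_mul {f : lp (fun _ : ι => E) 2} {g : lp (fun _ : ι => F) 2} {c : ℝ} (hc : 0 ≤ c)
    (h : ∀ i, ‖f i‖ ≤ c * ‖g i‖) : ‖f‖ ≤ c * ‖g‖ := by
  have h1 : ‖f‖ ≤ ‖(c : ℂ) • g‖ := lp.norm_mono (by norm_num) fun i => by
    rw [lp.coeFn_smul, Pi.smul_apply, norm_smul]
    simpa [abs_of_nonneg hc] using h i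
  rwa [norm_smul, Complex.norm_real, Real.norm_of_nonneg hc] at h1

theorem lp_hasSum_norm_sq (f : lp (fun _ : ι => E) 2) : HasSum (fun i => ‖f i‖ ^ 2) (‖f‖ ^ 2) := by
  have := lp.hasSum_norm (p := 2) (by norm_num) f
  simpa using this

/-- The diagonal action of an operator. -/
def liftL (ι : Type*) (T : E →L[ℂ] E) : lp (fun _ : ι => E) 2 →L[ℂ] lp (fun _ : ι => E) 2 :=
  lp.mapCLM 2 (fun _ => T) (norm_nonneg T) fun _ => le_rfl

@[simp]
theorem liftL_apply (T : E →L[ℂ] E) (f : lp (fun _ : ι => E) 2) (i : ι) :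
    liftL ι T f i = T (f i) := rfl

/-- Dominated convergence for the `ℓ²` sum; it lifts strong continuity from one site to the lattice.
-/
theorem tendsto_lp_of_dominated {l : Filter ℝ} {f : ℝ → lp (fun _ : ι => E) 2}
    {f₀ g : lp (fun _ : ι => E) 2} (hle : ∀ᶠ t in l, ∀ i, ‖f t i - f₀ i‖ ≤ ‖g i‖)
    (h : ∀ i, Tendsto (fun t => f t i) l (𝓝 (f₀ i))) : Tendsto f l (𝓝 f₀) := by
  rw [tendsto_iff_norm_sub_tendsto_zero]
  have h1 : Tendsto (fun t => ∑' i, ‖f t i - f₀ i‖ ^ 2) l (𝓝 (∑' _ : ι, (0 : ℝ))) := by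
    refine tendsto_tsum_of_dominated_convergence (lp_hasSum_norm_sq g).summable (fun i => ?_)
      (hle.mono fun t ht i => ?_)
    · simpa using (tendsto_iff_norm_sub_tendsto_zero.1 (h i)).pow 2
    · rw [norm_pow, norm_norm]
      exact pow_le_pow_left₀ (norm_nonneg _) (ht i) 2
  rw [tsum_zero] at h1
  have h2 : ∀ t, ‖f t - f₀‖ = Real.sqrt (∑' i, ‖f t i - f₀ i‖ ^ 2) := fun t => by
    have := (lp_hasSum_norm_sq (f t - f₀)).tsum_eq
    simp only [lp.coeFn_sub, Pi.sub_apply] at this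
    rw [this, Real.sqrt_sq (norm_nonneg _)]
  simp only [h2]
  simpa using h1.sqrt

variable {E : Type*} [NormedAddCommGroup E] [InnerProductSpace ℂ E]

theorem IsGapped.lift {S : ℝ → E →L[ℂ] E} {Z : E →L[ℂ] E} {γ : ℝ} [CompleteSpace E]
    (hS : IsGapped S Z γ) (ι : Type*) : IsGapped (fun t => liftL ι (S t)) (liftL ι Z) γ where
  zero f := by ext i; simp [hS.zero]
  add s t hs ht f := by ext i; simp [hS.add s t hs ht]
  norm_le t ht f := lp.norm_mono (by norm_num) fun i => hS.norm_le t ht (f i)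
  tendsto f := by
    refine tendsto_lp_of_dominated (g := (2 : ℂ) • f) ?_ fun i => hS.tendsto (f i)
    filter_upwards [self_mem_nhdsWithin] with t ht i
    rw [liftL_apply, lp.coeFn_smul, Pi.smul_apply, norm_smul]
    have := norm_sub_le (S t (f i)) (f i)
    have := hS.norm_le t (le_of_lt ht) (f i)
    simp
    linarith
  pos := hS.pos
  proj_proj f := by ext i; simp [hS.proj_proj]
  symm f g := by
    rw [lp.inner_eq_tsum, lp.inner_eq_tsum]
    exact tsum_congr fun i => hS.symm (f i) (g i)
  apply_proj t ht f := by ext i; simp [hS.apply_proj t ht]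
  proj_apply t ht f := by ext i; simp [hS.proj_apply t ht]
  decay t ht f hf := lp_norm_le_mul (Real.exp_nonneg _) fun i =>
    hS.decay t ht (f i) (by
      have := congrArg (fun g : lp (fun _ : ι => E) 2 => g i) hf
      simpa using this)

end LpOperators

/-! ### Translations and kernel operators on `ℓ²`. -/

section Kernel

variable {G κ E : Type*} [AddCommGroup G] [NormedAddCommGroup E] [NormedSpace ℂ E]

/-- Translation on `ℓ²(G; E)`. -/
def translateL (a : G) : lp (fun _ : G => E) 2 →L[ℂ] lp (fun _ : G => E) 2 :=
  have hs : ∀ f : lp (fun _ : G => E) 2, HasSum (fun x => ‖f (x - a)‖ ^ 2) (‖f‖ ^ 2) := fun f =>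
    (Equiv.subRight a).hasSum_iff.2 (lp_hasSum_norm_sq f)
  have hm : ∀ f : lp (fun _ : G => E) 2, Memℓp (fun x => f (x - a)) 2 := fun f =>
    memℓp_gen (by simpa using (hs f).summable)
  LinearMap.mkContinuous
    { toFun := fun f => ⟨fun x => f (x - a), hm f⟩
      map_add' := fun _ _ => rfl
      map_smul' := fun _ _ => rfl } 1 fun f => by
    have h1 := lp_hasSum_norm_sq (⟨fun x => f (x - a), hm f⟩ : lp (fun _ : G => E) 2)
    have h2 := h1.unique (hs f)
    rw [one_mul]
    exact (pow_le_pow_iff_left₀ (norm_nonneg _) (norm_nonneg _) two_ne_zero).1 h2.le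

@[simp]
theorem translateL_apply (a : G) (f : lp (fun _ : G => E) 2) (x : G) :
    translateL a f x = f (x - a) := rfl

theorem norm_translateL_apply_le (a : G) (f : lp (fun _ : G => E) 2) : ‖translateL a f‖ ≤ ‖f‖ := by
  have h1 := lp_hasSum_norm_sq (translateL a f)
  have h2 := h1.unique ((Equiv.subRight a).hasSum_iff.2 (lp_hasSum_norm_sq f))
  exact (pow_le_pow_iff_left₀ (norm_nonneg _) (norm_nonneg _) two_ne_zero).1 h2.le

theorem norm_translateL_le (a : G) : ‖(translateL a : _ →L[ℂ] lp (fun _ : G => E) 2)‖ ≤ 1 :=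
  ContinuousLinearMap.opNorm_le_bound _ zero_le_one fun f => by
    simpa using norm_translateL_apply_le a f

/-- The data of a kernel operator `f ↦ ∑_j c_j(x) f(x - a_j)` with `∑_j sup_x ‖c_j(x)‖ < ∞`. -/
structure IsKernel (c : κ → G → E →L[ℂ] E) (b : κ → ℝ) : Prop where
  norm_le : ∀ j x, ‖c j x‖ ≤ b j
  summable : Summable b

namespace IsKernel

variable {c : κ → G → E →L[ℂ] E} {b : κ → ℝ}

theorem nonneg (hc : IsKernel c b) (j : κ) : 0 ≤ b j := (norm_nonneg _).trans (hc.norm_le j 0)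

/-- One term of a kernel operator. -/
def term (a : κ → G) (hc : IsKernel c b) (j : κ) :
    lp (fun _ : G => E) 2 →L[ℂ] lp (fun _ : G => E) 2 :=
  (lp.mapCLM 2 (c j) (hc.nonneg j) (hc.norm_le j)).comp (translateL (a j))

theorem norm_term_le (a : κ → G) (hc : IsKernel c b) (j : κ) : ‖hc.term a j‖ ≤ b j := by
  refine (ContinuousLinearMap.opNorm_comp_le _ _).trans ?_
  have h1 := lp.norm_mapCLM_le 2 (c j) (hc.nonneg j) (hc.norm_le j)
  exact (mul_le_of_le_one_right (norm_nonneg _) (norm_translateL_le _)).trans h1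

variable [CompleteSpace E]

theorem summable_term (a : κ → G) (hc : IsKernel c b) : Summable (hc.term a) :=
  Summable.of_norm_bounded hc.summable (hc.norm_term_le a)

/-- The kernel operator `f ↦ ∑_j c_j(x) f(x - a_j)`. -/
def op (a : κ → G) (hc : IsKernel c b) : lp (fun _ : G => E) 2 →L[ℂ] lp (fun _ : G => E) 2 :=
  ∑' j, hc.term a j

theorem norm_op_le (a : κ → G) (hc : IsKernel c b) : ‖hc.op a‖ ≤ ∑' j, b j :=
  tsum_of_norm_bounded hc.summable.hasSum (hc.norm_term_le a)

theorem hasSum_op (a : κ → G) (hc : IsKernel c b) (f : lp (fun _ : G => E) 2) :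
    HasSum (fun j => hc.term a j f) (hc.op a f) :=
  (hc.summable_term a).hasSum.mapL (ContinuousLinearMap.apply ℂ _ f)

theorem hasSum_op_apply (a : κ → G) (hc : IsKernel c b) (f : lp (fun _ : G => E) 2) (x : G) :
    HasSum (fun j => c j x (f (x - a j))) (hc.op a f x) :=
  (hc.hasSum_op a f).mapL (lp.evalCLM ℂ (fun _ : G => E) 2 x)

theorem op_apply (a : κ → G) (hc : IsKernel c b) (f : lp (fun _ : G => E) 2) (x : G) :
    hc.op a f x = ∑' j, c j x (f (x - a j)) := (hc.hasSum_op_apply a f x).tsum_eq.symm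

end IsKernel

end Kernel

/-! ### Phases at complex momenta and their Taylor bounds. -/

section Phases

variable {d : ℕ}

/-- `k · x` for complex `k`. -/
def dotC (k : Fin d → ℂ) (x : Site d) : ℂ := ∑ i, k i * (x i : ℂ)

/-- The `ℓ¹` norm of a complex momentum. -/
def absSum (k : Fin d → ℂ) : ℝ := ∑ i, ‖k i‖

theorem absSum_nonneg (k : Fin d → ℂ) : 0 ≤ absSum k := Finset.sum_nonneg fun _ _ => norm_nonneg _

theorem abs_apply_le_norm_toSpace (x : Site d) (i : Fin d) : |(x i : ℝ)| ≤ ‖toSpace x‖ :=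
  PiLp.norm_apply_le (toSpace x) i

theorem norm_dotC_le (k : Fin d → ℂ) (x : Site d) : ‖dotC k x‖ ≤ absSum k * ‖toSpace x‖ := by
  rw [dotC, absSum, Finset.sum_mul]
  refine (norm_sum_le _ _).trans (Finset.sum_le_sum fun i _ => ?_)
  rw [norm_mul]
  gcongr
  simpa using abs_apply_le_norm_toSpace x i

theorem dotC_add (k : Fin d → ℂ) (x y : Site d) : dotC k (x + y) = dotC k x + dotC k y := by
  simp [dotC, mul_add, Finset.sum_add_distrib]

theorem dotC_neg (k : Fin d → ℂ) (x : Site d) : dotC k (-x) = -dotC k x := by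
  simp [dotC, Finset.sum_neg_distrib]

theorem dotC_zero (k : Fin d → ℂ) : dotC k 0 = 0 := by simp [dotC]

theorem dotC_smul (s : ℝ) (k : Fin d → ℂ) (x : Site d) : dotC (s • k) x = s * dotC k x := by
  simp [dotC, Finset.mul_sum, mul_assoc]

theorem absSum_smul {s : ℝ} (hs : 0 ≤ s) (k : Fin d → ℂ) : absSum (s • k) = s * absSum k := by
  simp [absSum, Finset.mul_sum, abs_of_nonneg hs]

/-- The phase `e^{-i k·x}`. -/
def phase (k : Fin d → ℂ) (x : Site d) : ℂ := Complex.exp (-(Complex.I * dotC k x))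

theorem phase_zero_left (x : Site d) : phase (0 : Fin d → ℂ) x = 1 := by simp [phase, dotC]

theorem phase_add (k : Fin d → ℂ) (x y : Site d) : phase k (x + y) = phase k x * phase k y := by
  rw [phase, phase, phase, ← Complex.exp_add, dotC_add]; ring_nf

theorem phase_zero (k : Fin d → ℂ) : phase k 0 = 1 := by simp [phase, dotC_zero]

theorem norm_phase_le (k : Fin d → ℂ) (x : Site d) :
    ‖phase k x‖ ≤ Real.exp (absSum k * ‖toSpace x‖) := by
  rw [phase, Complex.norm_exp]
  refine Real.exp_le_exp.2 ((Complex.re_le_norm _).trans ?_)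
  simpa using norm_dotC_le k x

theorem conj_phase {k : Fin d → ℂ} (hk : ∀ i, (starRingEnd ℂ) (k i) = k i) (x : Site d) :
    (starRingEnd ℂ) (phase k x) = phase k (-x) := by
  have : (starRingEnd ℂ) (dotC k x) = dotC k x := by simp [dotC, map_sum, hk]
  rw [phase, ← Complex.exp_conj, phase, dotC_neg]
  simp [this]

theorem norm_one_sub_exp_neg_le (z : ℂ) : ‖1 - Complex.exp (-z)‖ ≤ ‖z‖ * Real.exp ‖z‖ := by
  have := Complex.norm_exp_sub_sum_le_norm_mul_exp (-z) 1
  simpa [norm_sub_rev] using this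

theorem norm_one_sub_exp_neg_sub_le (z : ℂ) :
    ‖1 - Complex.exp (-z) - z‖ ≤ ‖z‖ ^ 2 * Real.exp ‖z‖ := by
  have := Complex.norm_exp_sub_sum_le_norm_mul_exp (-z) 2
  rw [norm_sub_rev] at this
  simp only [Finset.sum_range_succ, Finset.sum_range_zero, norm_neg] at this
  have e : 1 - Complex.exp (-z) - z = 0 + (-z) ^ 0 / ↑(Nat.factorial 0)
      + (-z) ^ 1 / ↑(Nat.factorial 1) - Complex.exp (-z) := by
    simp only [Nat.factorial]; push_cast; ring
  rwa [e]

/-- The weight `e^{m|x|}` is split in halves: one pays for the growth of the phase at complex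
momentum, the other for the factor `|k·x|`. -/
theorem norm_one_sub_phase_le {m s : ℝ} (hm : 0 < m) (hs : 0 ≤ s) (k : Fin d → ℂ)
    (hsk : s * absSum k ≤ m / 2) (x : Site d) :
    ‖1 - phase (s • k) x‖ ≤ 2 * absSum k / m * s * Real.exp (m * ‖toSpace x‖) := by
  have hN := absSum_nonneg k
  set n := ‖toSpace x‖
  have hn : 0 ≤ n := norm_nonneg _
  have hz : ‖Complex.I * dotC (s • k) x‖ ≤ s * absSum k * n := by
    simpa [absSum_smul hs] using norm_dotC_le (s • k) x
  have h1 := norm_one_sub_exp_neg_le (Complex.I * dotC (s • k) x)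
  have h2 : absSum k * n ≤ 2 * absSum k / m * Real.exp (m / 2 * n) := by
    have : m / 2 * n ≤ Real.exp (m / 2 * n) := by linarith [Real.add_one_le_exp (m / 2 * n)]
    calc absSum k * n = 2 * absSum k / m * (m / 2 * n) := by field_simp
      _ ≤ _ := by gcongr
  have h3 : Real.exp (s * absSum k * n) ≤ Real.exp (m / 2 * n) :=
    Real.exp_le_exp.2 (mul_le_mul_of_nonneg_right hsk hn)
  have h4 : Real.exp (m * n) = Real.exp (m / 2 * n) * Real.exp (m / 2 * n) := by
    rw [← Real.exp_add]; ring_nf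
  calc ‖1 - phase (s • k) x‖ ≤ _ := h1
    _ ≤ (s * absSum k * n) * Real.exp (s * absSum k * n) := by gcongr
    _ = s * (absSum k * n) * Real.exp (s * absSum k * n) := by ring
    _ ≤ s * (2 * absSum k / m * Real.exp (m / 2 * n)) * Real.exp (m / 2 * n) := by gcongr
    _ = _ := by rw [h4]; ring

/-- As for the first-order bound, but the factor `|k·x|` is squared, so each copy is given a quarter
of the weight. -/
theorem norm_one_sub_phase_sub_le {m s : ℝ} (hm : 0 < m) (hs : 0 ≤ s) (k : Fin d → ℂ)
    (hsk : s * absSum k ≤ m / 2) (x : Site d) :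
    ‖1 - phase (s • k) x - s * (Complex.I * dotC k x)‖
      ≤ (4 * absSum k / m) ^ 2 * s ^ 2 * Real.exp (m * ‖toSpace x‖) := by
  have hN := absSum_nonneg k
  set n := ‖toSpace x‖
  have hn : 0 ≤ n := norm_nonneg _
  have hz : ‖Complex.I * dotC (s • k) x‖ ≤ s * absSum k * n := by
    simpa [absSum_smul hs] using norm_dotC_le (s • k) x
  have h1 := norm_one_sub_exp_neg_sub_le (Complex.I * dotC (s • k) x)
  have h2 : absSum k * n ≤ 4 * absSum k / m * Real.exp (m / 4 * n) := by
    have : m / 4 * n ≤ Real.exp (m / 4 * n) := by linarith [Real.add_one_le_exp (m / 4 * n)]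
    calc absSum k * n = 4 * absSum k / m * (m / 4 * n) := by field_simp
      _ ≤ _ := by gcongr
  have h3 : Real.exp (s * absSum k * n) ≤ Real.exp (m / 2 * n) :=
    Real.exp_le_exp.2 (mul_le_mul_of_nonneg_right hsk hn)
  have h4 : Real.exp (m * n) = Real.exp (m / 4 * n) ^ 2 * Real.exp (m / 2 * n) := by
    rw [← Real.exp_nat_mul, ← Real.exp_add]; push_cast; ring_nf
  have h5 : (s : ℂ) * (Complex.I * dotC k x) = Complex.I * dotC (s • k) x := by
    rw [dotC_smul]; ring
  rw [h5]
  calc ‖1 - phase (s • k) x - Complex.I * dotC (s • k) x‖ ≤ _ := h1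
    _ ≤ (s * absSum k * n) ^ 2 * Real.exp (s * absSum k * n) := by gcongr
    _ = s ^ 2 * (absSum k * n) ^ 2 * Real.exp (s * absSum k * n) := by ring
    _ ≤ s ^ 2 * (4 * absSum k / m * Real.exp (m / 4 * n)) ^ 2 * Real.exp (m / 2 * n) := by gcongr
    _ = _ := by rw [h4]; ring

end Phases

/-- A measurable function bounded by `M`. -/
structure IsBddMeasurable {α : Type*} [MeasurableSpace α] (w : α → ℝ) (M : ℝ) : Prop where
  measurable : Measurable w
  abs_le : ∀ a, |w a| ≤ M

/-! ### The fiber operators. -/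

section Fiber

variable {d : ℕ} {Ω : Type*} [TopologicalSpace Ω] [MeasurableSpace Ω] {μ : Measure Ω}
  {σ : Site d → Ω → Ω} {P : Kernel Ω (RCPath Ω)} [IsProbabilityMeasure μ] [IsMarkovKernel P]

theorem IsBddMeasurable.nonneg {w : Ω → ℝ} {M : ℝ} (hw : IsBddMeasurable w M) (μ : Measure Ω)
    [IsProbabilityMeasure μ] : 0 ≤ M := by
  obtain ⟨a⟩ := nonempty_of_isProbabilityMeasure μ
  exact (abs_nonneg _).trans (hw.abs_le a)

theorem IsBddMeasurable.comp_shift {w : Ω → ℝ} {M : ℝ} (hw : IsBddMeasurable w M)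
    (hσ : IsShiftAction μ σ) (x : Site d) : IsBddMeasurable (fun a => w (σ x a)) M :=
  ⟨hw.measurable.comp (hσ.preserving x).measurable, fun _ => hw.abs_le _⟩

theorem IsBddMeasurable.sub {α : Type*} [MeasurableSpace α] {w w' : α → ℝ} {M M' : ℝ}
    (hw : IsBddMeasurable w M) (hw' : IsBddMeasurable w' M') :
    IsBddMeasurable (fun a => w a - w' a) (M + M') :=
  ⟨hw.measurable.sub hw'.measurable, fun a =>
    (abs_sub _ _).trans (add_le_add (hw.abs_le a) (hw'.abs_le a))⟩

/-- Multiplication by a bounded real function. -/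
def IsBddMeasurable.mulL {α : Type*} [MeasurableSpace α] (ν : Measure α) {w : α → ℝ} {M : ℝ}
    (hw : IsBddMeasurable w M) : Lp ℂ 2 ν →L[ℂ] Lp ℂ 2 ν :=
  mulL2 ν (fun a => (w a : ℂ)) (Complex.measurable_ofReal.comp hw.measurable) M
    fun a => by simpa using hw.abs_le a

/-- The Hilbert space `ℓ²(ℤ^d; L²(μ))`. -/
abbrev FiberSpace (d : ℕ) (μ : Measure Ω) : Type _ := lp (fun _ : Site d => Lp ℂ 2 μ) 2

/-- The vector `δ_0 ⊗ 1`. -/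
def vacuum (d : ℕ) (μ : Measure Ω) [IsProbabilityMeasure μ] : FiberSpace d μ :=
  lp.single 2 0 (oneL2 μ)

/-- One hopping term of the fiber operator. -/
def fiberTerm (hσ : IsShiftAction μ σ) (h : Site d → ℂ) (k : Fin d → ℂ) (ζ : Site d) :
    FiberSpace d μ →L[ℂ] FiberSpace d μ :=
  h ζ • (translateL ζ - phase k ζ • (liftL (Site d) (shiftL2 hσ (-ζ))).comp (translateL ζ))

/-- The potential difference `v_x - v_0`. -/
def potentialL (hσ : IsShiftAction μ σ) {w : Ω → ℝ} {M : ℝ} (hw : IsBddMeasurable w M) :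
    FiberSpace d μ →L[ℂ] FiberSpace d μ :=
  lp.mapCLM 2 (fun x => ((hw.comp_shift hσ x).sub hw).mulL μ)
    (add_nonneg (hw.nonneg μ) (hw.nonneg μ))
    (fun _ => norm_mulL2_le (add_nonneg (hw.nonneg μ) (hw.nonneg μ)))

/-- The commutator with the Hamiltonian in the fiber over the momentum `k`. -/
def fiberOp (hσ : IsShiftAction μ σ) (h : Site d → ℂ) {w : Ω → ℝ} {M : ℝ}
    (hw : IsBddMeasurable w M) (k : Fin d → ℂ) : FiberSpace d μ →L[ℂ] FiberSpace d μ :=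
  ∑' ζ, fiberTerm hσ h k ζ + potentialL hσ hw

theorem norm_shift_translate_le (hσ : IsShiftAction μ σ) (y ζ : Site d) (f : FiberSpace d μ) :
    ‖liftL (Site d) (shiftL2 hσ y) (translateL ζ f)‖ ≤ ‖f‖ := by
  have h1 : ‖liftL (Site d) (shiftL2 hσ y) (translateL ζ f)‖ ≤ ‖translateL ζ f‖ :=
    lp.norm_mono (by norm_num) fun i => by rw [liftL_apply, norm_shiftL2]
  exact h1.trans (norm_translateL_apply_le ζ f)

variable {h : Site d → ℂ} {m : ℝ}

theorem summable_fiberTerm (hσ : IsShiftAction μ σ)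
    (hs : Summable fun y : Site d => Real.exp (m * ‖toSpace y‖) * ‖h y‖) (hm : 0 < m)
    {k : Fin d → ℂ} (hk : absSum k ≤ m) : Summable (fiberTerm hσ h k) := by
  refine Summable.of_norm_bounded (hs.mul_left 2) fun ζ => ?_
  refine ContinuousLinearMap.opNorm_le_bound _ (by positivity) fun f => ?_
  have h1 : ‖translateL ζ f‖ ≤ ‖f‖ := norm_translateL_apply_le ζ f
  have h2 := norm_shift_translate_le hσ (-ζ) ζ f
  have h3 : ‖phase k ζ‖ ≤ Real.exp (m * ‖toSpace ζ‖) := (norm_phase_le k ζ).trans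
    (Real.exp_le_exp.2 (mul_le_mul_of_nonneg_right hk (norm_nonneg _)))
  have h4 : 1 ≤ Real.exp (m * ‖toSpace ζ‖) := Real.one_le_exp (by positivity)
  simp only [fiberTerm, smul_apply, sub_apply,
    ContinuousLinearMap.comp_apply, norm_smul]
  calc ‖h ζ‖ * ‖translateL ζ f - phase k ζ • liftL (Site d) (shiftL2 hσ (-ζ)) (translateL ζ f)‖
      ≤ ‖h ζ‖ * (‖translateL ζ f‖
        + ‖phase k ζ‖ * ‖liftL (Site d) (shiftL2 hσ (-ζ)) (translateL ζ f)‖) := by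
        gcongr; rw [← norm_smul]; exact norm_sub_le _ _
    _ ≤ ‖h ζ‖ * (Real.exp (m * ‖toSpace ζ‖) * ‖f‖ + Real.exp (m * ‖toSpace ζ‖) * ‖f‖) := by
        gcongr
        exact h1.trans (le_mul_of_one_le_left (norm_nonneg _) h4)
    _ = _ := by ring

/-- The potential cancels in the difference, and the hopping terms differ only in the phase. -/
theorem norm_fiberOp_sub_le (hσ : IsShiftAction μ σ)
    (hs : Summable fun y : Site d => Real.exp (m * ‖toSpace y‖) * ‖h y‖) (hm : 0 < m) {w : Ω → ℝ}
    {M : ℝ} (hw : IsBddMeasurable w M) (k : Fin d → ℂ) {s : ℝ} (hs0 : 0 ≤ s)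
    (hsk : s * absSum k ≤ m / 2) (f : FiberSpace d μ) :
    ‖fiberOp hσ h hw (s • k) f - fiberOp hσ h hw 0 f‖
      ≤ (2 * absSum k / m * ∑' y, Real.exp (m * ‖toSpace y‖) * ‖h y‖) * s * ‖f‖ := by
  have hN := absSum_nonneg k
  have s1 := summable_fiberTerm hσ hs hm (k := s • k) (by rw [absSum_smul hs0]; linarith)
  have s0 := summable_fiberTerm hσ hs hm (k := 0) (by simp [absSum, hm.le])
  have e : fiberOp hσ h hw (s • k) - fiberOp hσ h hw 0
      = ∑' ζ, (fiberTerm hσ h (s • k) ζ - fiberTerm hσ h 0 ζ) := by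
    rw [s1.tsum_sub s0, fiberOp, fiberOp]; abel
  rw [← sub_apply, e]
  have hb : ∀ ζ, ‖fiberTerm hσ h (s • k) ζ - fiberTerm hσ h 0 ζ‖
      ≤ 2 * absSum k / m * s * (Real.exp (m * ‖toSpace ζ‖) * ‖h ζ‖) := by
    intro ζ
    refine ContinuousLinearMap.opNorm_le_bound _ (by positivity) fun f => ?_
    have e2 : (fiberTerm hσ h (s • k) ζ - fiberTerm hσ h 0 ζ) f
        = (h ζ * (1 - phase (s • k) ζ)) • liftL (Site d) (shiftL2 hσ (-ζ)) (translateL ζ f) := by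
      simp only [fiberTerm, smul_apply, sub_apply,
        ContinuousLinearMap.comp_apply, phase_zero_left, one_smul]
      module
    rw [e2, norm_smul, norm_mul]
    calc ‖h ζ‖ * ‖1 - phase (s • k) ζ‖ * ‖liftL (Site d) (shiftL2 hσ (-ζ)) (translateL ζ f)‖
        ≤ ‖h ζ‖ * (2 * absSum k / m * s * Real.exp (m * ‖toSpace ζ‖)) * ‖f‖ := by
          gcongr
          · exact norm_one_sub_phase_le hm hs0 k hsk ζ
          · exact norm_shift_translate_le hσ (-ζ) ζ f
      _ = _ := by ring
  have hn := tsum_of_norm_bounded ((hs.hasSum).mul_left (2 * absSum k / m * s)) hb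
  refine (ContinuousLinearMap.le_opNorm _ f).trans ?_
  refine (mul_le_mul_of_nonneg_right hn (norm_nonneg _)).trans_eq ?_
  ring

theorem inner_translateL (ζ : Site d) (f g : FiberSpace d μ) :
    inner ℂ (translateL ζ f) g = inner ℂ f (translateL (-ζ) g) := by
  rw [lp.inner_eq_tsum, lp.inner_eq_tsum, ← (Equiv.addRight ζ).tsum_eq]
  exact tsum_congr fun x => by simp

theorem inner_liftL_shiftL2 (hσ : IsShiftAction μ σ) (y : Site d) (f g : FiberSpace d μ) :
    inner ℂ (liftL (Site d) (shiftL2 hσ y) f) g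
      = inner ℂ f (liftL (Site d) (shiftL2 hσ (-y)) g) := by
  rw [lp.inner_eq_tsum, lp.inner_eq_tsum]
  exact tsum_congr fun x => inner_shiftL2_left hσ y _ _

/-- The adjoint of a hop by `ζ` is the hop by `-ζ`. Conjugation inverts the phase only at real `k`;
at complex momenta the fiber operator need not be symmetric. -/
theorem inner_fiberTerm (hσ : IsShiftAction μ σ) (hh : ∀ ζ, h ζ = star (h (-ζ))) {k : Fin d → ℂ}
    (hk : ∀ i, (starRingEnd ℂ) (k i) = k i) (ζ : Site d) (f g : FiberSpace d μ) :
    inner ℂ (fiberTerm hσ h k ζ f) g = inner ℂ f (fiberTerm hσ h k (-ζ) g) := by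
  have hc : liftL (Site d) (shiftL2 hσ ζ) (translateL (-ζ) g)
      = translateL (-ζ) (liftL (Site d) (shiftL2 hσ ζ) g) := rfl
  have e : (starRingEnd ℂ) (h ζ) = h (-ζ) := by rw [hh ζ]; simp
  simp only [fiberTerm, smul_apply, sub_apply,
    ContinuousLinearMap.comp_apply, inner_smul_left, inner_smul_right, inner_sub_left,
    inner_sub_right, conj_phase hk, e, neg_neg, hc]
  rw [inner_translateL, inner_liftL_shiftL2, neg_neg, inner_translateL]

theorem inner_tsum_apply_comm {H κ : Type*} [NormedAddCommGroup H] [InnerProductSpace ℂ H]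
    {B : κ → H →L[ℂ] H} (hB : Summable B) (e : κ ≃ κ)
    (he : ∀ j f g, inner ℂ (B j f) g = inner ℂ f (B (e j) g)) (f g : H) :
    inner ℂ ((∑' j, B j) f) g = inner ℂ f ((∑' j, B j) g) := by
  have h1 : HasSum (fun j => inner ℂ g (B j f)) (inner ℂ g ((∑' j, B j) f)) :=
    (hB.hasSum.mapL (ContinuousLinearMap.apply ℂ H f)).mapL (innerSL ℂ g)
  have h2 : HasSum (fun j => inner ℂ f (B j g)) (inner ℂ f ((∑' j, B j) g)) :=
    (hB.hasSum.mapL (ContinuousLinearMap.apply ℂ H g)).mapL (innerSL ℂ f)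
  have h3 : HasSum (fun j => inner ℂ f (B (e j) g)) (inner ℂ f ((∑' j, B j) g)) :=
    e.hasSum_iff.2 h2
  have h4 := Complex.hasSum_conj'.2 h1
  simp only [inner_conj_symm, he] at h4
  exact h4.unique h3

theorem fiberOp_symm (hσ : IsShiftAction μ σ) (hh : ∀ ζ, h ζ = star (h (-ζ)))
    (hs : Summable fun y : Site d => Real.exp (m * ‖toSpace y‖) * ‖h y‖) (hm : 0 < m) {w : Ω → ℝ}
    {M : ℝ} (hw : IsBddMeasurable w M) {k : Fin d → ℂ}
    (hkr : ∀ i, (starRingEnd ℂ) (k i) = k i) (hk : absSum k ≤ m) (f g : FiberSpace d μ) :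
    inner ℂ (fiberOp hσ h hw k f) g = inner ℂ f (fiberOp hσ h hw k g) := by
  have sm := summable_fiberTerm hσ hs hm hk
  rw [fiberOp, add_apply, add_apply, inner_add_left,
    inner_add_right]
  congr 1
  · exact inner_tsum_apply_comm sm (Equiv.neg _) (inner_fiberTerm hσ hh hkr) f g
  · rw [lp.inner_eq_tsum, lp.inner_eq_tsum]
    exact tsum_congr fun x => mulL2_symm (fun a => Complex.conj_ofReal _) _ _

end Fiber

/-! ### The vacuum, the drift vector, and the coupling conditions at zero momentum. -/

section Coupling

variable {d : ℕ} {Ω : Type*} [TopologicalSpace Ω] [MeasurableSpace Ω] {μ : Measure Ω}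
  {σ : Site d → Ω → Ω} {P : Kernel Ω (RCPath Ω)} [IsProbabilityMeasure μ] [IsMarkovKernel P]
  {h : Site d → ℂ} {m : ℝ} {w : Ω → ℝ} {M : ℝ}

/-- The vector `δ_x ⊗ 1`. -/
def siteVec (μ : Measure Ω) [IsProbabilityMeasure μ] (x : Site d) : FiberSpace d μ :=
  lp.single 2 x (oneL2 μ)

theorem norm_siteVec (x : Site d) : ‖siteVec μ x‖ = 1 := by
  rw [siteVec, lp.norm_single (by norm_num), norm_oneL2]

theorem inner_vacuum (f : FiberSpace d μ) :
    inner ℂ (vacuum d μ) f = inner ℂ (oneL2 μ) (f 0) := lp.inner_single_left ..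

theorem norm_vacuum : ‖vacuum d μ‖ = 1 := norm_siteVec 0

theorem siteVec_apply (x y : Site d) : siteVec μ x y = if y = x then oneL2 μ else 0 := by
  rw [siteVec, lp.single_apply]
  by_cases hxy : y = x
  · subst hxy; simp
  · simp [hxy]

theorem vacuum_apply (y : Site d) : vacuum d μ y = if y = 0 then oneL2 μ else 0 :=
  siteVec_apply 0 y

theorem translateL_vacuum (ζ : Site d) : translateL ζ (vacuum d μ) = siteVec μ ζ := by
  ext1
  funext x
  rw [translateL_apply, siteVec_apply, vacuum_apply]
  simp only [sub_eq_zero]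

theorem liftL_shiftL2_siteVec (hσ : IsShiftAction μ σ) (y ζ : Site d) :
    liftL (Site d) (shiftL2 hσ y) (siteVec μ ζ) = siteVec μ ζ := by
  ext1
  funext x
  rw [liftL_apply, siteVec_apply]
  split_ifs
  · exact shiftL2_oneL2 hσ y
  · exact map_zero _

theorem meanL2_oneL2 : meanL2 μ (oneL2 μ) = oneL2 μ := by
  rw [meanL2_apply, inner_oneL2_self, one_smul]

theorem liftL_meanL2_siteVec (ζ : Site d) :
    liftL (Site d) (meanL2 μ) (siteVec μ ζ) = siteVec μ ζ := by
  ext1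
  funext x
  rw [liftL_apply, siteVec_apply]
  split_ifs
  · exact meanL2_oneL2
  · exact map_zero _

theorem inner_vacuum_siteVec (ζ : Site d) :
    inner ℂ (vacuum d μ) (siteVec μ ζ) = if ζ = 0 then 1 else 0 := by
  rw [inner_vacuum, siteVec_apply]
  by_cases hζ : ζ = 0
  · simp [hζ, norm_oneL2]
  · simp [hζ, Ne.symm hζ]

/-- Shifts fix the constants, so on the vacuum the two halves of a hopping term differ only by the
phase. -/
theorem fiberTerm_vacuum (hσ : IsShiftAction μ σ) (k : Fin d → ℂ) (ζ : Site d) :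
    fiberTerm hσ h k ζ (vacuum d μ) = (h ζ * (1 - phase k ζ)) • siteVec μ ζ := by
  simp only [fiberTerm, smul_apply, sub_apply, ContinuousLinearMap.comp_apply, translateL_vacuum,
    liftL_shiftL2_siteVec]
  module

theorem potentialL_apply (hσ : IsShiftAction μ σ) (hw : IsBddMeasurable w M) (f : FiberSpace d μ)
    (x : Site d) : potentialL hσ hw f x = ((hw.comp_shift hσ x).sub hw).mulL μ (f x) := rfl

theorem mulL_eq_zero {α : Type*} [MeasurableSpace α] {ν : Measure α} {w : α → ℝ} {M : ℝ}
    (hw : IsBddMeasurable w M) (h0 : ∀ a, w a = 0) (f : Lp ℂ 2 ν) : hw.mulL ν f = 0 := by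
  refine Lp.ext ?_
  filter_upwards [mulL2_coe (φ := fun a => (w a : ℂ))
    (hφ := Complex.measurable_ofReal.comp hw.measurable)
    (hC := fun a => by simpa using hw.abs_le a) f, Lp.coeFn_zero ℂ 2 ν] with a h1 h2
  rw [h2, IsBddMeasurable.mulL, h1]
  simp [h0]

theorem potentialL_vacuum (hσ : IsShiftAction μ σ) (hw : IsBddMeasurable w M) :
    potentialL hσ hw (vacuum d μ) = 0 := by
  ext1
  funext x
  rw [potentialL_apply, vacuum_apply]
  split_ifs with hx
  · exact mulL_eq_zero _ (fun a => by simp [hx, hσ.zero]) _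
  · exact map_zero _

theorem hasSum_fiberOp_vacuum (hσ : IsShiftAction μ σ)
    (hs : Summable fun y : Site d => Real.exp (m * ‖toSpace y‖) * ‖h y‖) (hm : 0 < m)
    (hw : IsBddMeasurable w M) {k : Fin d → ℂ} (hk : absSum k ≤ m) :
    HasSum (fun ζ => (h ζ * (1 - phase k ζ)) • siteVec μ ζ) (fiberOp hσ h hw k (vacuum d μ)) := by
  have h1 := (summable_fiberTerm hσ hs hm hk).hasSum.mapL
    (ContinuousLinearMap.apply ℂ (FiberSpace d μ) (vacuum d μ))
  simp only [ContinuousLinearMap.apply_apply, fiberTerm_vacuum] at h1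
  rwa [fiberOp, add_apply, potentialL_vacuum, add_zero]

theorem inner_vacuum_fiberOp_vacuum (hσ : IsShiftAction μ σ)
    (hs : Summable fun y : Site d => Real.exp (m * ‖toSpace y‖) * ‖h y‖) (hm : 0 < m)
    (hw : IsBddMeasurable w M) {k : Fin d → ℂ} (hk : absSum k ≤ m) :
    inner ℂ (vacuum d μ) (fiberOp hσ h hw k (vacuum d μ)) = 0 := by
  have h1 := (hasSum_fiberOp_vacuum hσ hs hm hw hk).mapL (innerSL ℂ (vacuum d μ))
  refine h1.unique ?_
  convert hasSum_zero with ζ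
  rw [innerSL_apply_apply, inner_smul_right, inner_vacuum_siteVec]
  by_cases hζ : ζ = 0
  · simp [hζ, phase_zero]
  · simp [hζ]

/-- The vector `∑_y i (k·y) h(y) δ_y ⊗ 1`, the derivative of the fiber operator at the vacuum. -/
def driftVec (μ : Measure Ω) [IsProbabilityMeasure μ] (h : Site d → ℂ) (k : Fin d → ℂ) :
    FiberSpace d μ := ∑' ζ, (h ζ * (Complex.I * dotC k ζ)) • siteVec μ ζ

theorem summable_driftVec (hs : Summable fun y : Site d => Real.exp (m * ‖toSpace y‖) * ‖h y‖)
    (hm : 0 < m) (k : Fin d → ℂ) :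
    Summable fun ζ => (h ζ * (Complex.I * dotC k ζ)) • siteVec μ ζ := by
  refine Summable.of_norm_bounded (hs.mul_left (absSum k / m)) fun ζ => ?_
  have h1 : m * ‖toSpace ζ‖ ≤ Real.exp (m * ‖toSpace ζ‖) := by
    linarith [Real.add_one_le_exp (m * ‖toSpace ζ‖)]
  rw [norm_smul, norm_siteVec, mul_one, norm_mul, norm_mul, Complex.norm_I, one_mul]
  calc ‖h ζ‖ * ‖dotC k ζ‖ ≤ ‖h ζ‖ * (absSum k * ‖toSpace ζ‖) := by
        gcongr; exact norm_dotC_le k ζ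
    _ = absSum k / m * ((m * ‖toSpace ζ‖) * ‖h ζ‖) := by field_simp
    _ ≤ _ := by have := absSum_nonneg k; gcongr

theorem hasSum_driftVec (hs : Summable fun y : Site d => Real.exp (m * ‖toSpace y‖) * ‖h y‖)
    (hm : 0 < m) (k : Fin d → ℂ) :
    HasSum (fun ζ => (h ζ * (Complex.I * dotC k ζ)) • siteVec μ ζ) (driftVec μ h k) :=
  (summable_driftVec hs hm k).hasSum

theorem norm_fiberOp_vacuum_sub_le (hσ : IsShiftAction μ σ)
    (hs : Summable fun y : Site d => Real.exp (m * ‖toSpace y‖) * ‖h y‖) (hm : 0 < m)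
    (hw : IsBddMeasurable w M) (k : Fin d → ℂ) {s : ℝ} (hs0 : 0 ≤ s)
    (hsk : s * absSum k ≤ m / 2) :
    ‖fiberOp hσ h hw (s • k) (vacuum d μ) - (s : ℂ) • driftVec μ h k‖
      ≤ ((4 * absSum k / m) ^ 2 * ∑' y, Real.exp (m * ‖toSpace y‖) * ‖h y‖) * s ^ 2 := by
  have h1 := (hasSum_fiberOp_vacuum hσ hs hm hw (k := s • k)
    (by rw [absSum_smul hs0]; linarith)).sub ((hasSum_driftVec (μ := μ) hs hm k).const_smul (s : ℂ))
  rw [← h1.tsum_eq]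
  refine (tsum_of_norm_bounded ((hs.hasSum).mul_left ((4 * absSum k / m) ^ 2 * s ^ 2))
    fun ζ => ?_).trans_eq (by ring)
  have e : (h ζ * (1 - phase (s • k) ζ)) • siteVec μ ζ
      - (s : ℂ) • (h ζ * (Complex.I * dotC k ζ)) • siteVec μ ζ
      = (h ζ * (1 - phase (s • k) ζ - s * (Complex.I * dotC k ζ))) • siteVec μ ζ := by module
  rw [e, norm_smul, norm_siteVec, mul_one, norm_mul]
  calc _ ≤ ‖h ζ‖ * ((4 * absSum k / m) ^ 2 * s ^ 2 * Real.exp (m * ‖toSpace ζ‖)) := by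
        gcongr; exact norm_one_sub_phase_sub_le hm hs0 k hsk ζ
    _ = _ := by ring

theorem inner_vacuum_driftVec
    (hs : Summable fun y : Site d => Real.exp (m * ‖toSpace y‖) * ‖h y‖) (hm : 0 < m)
    (k : Fin d → ℂ) : inner ℂ (vacuum d μ) (driftVec μ h k) = 0 := by
  have h1 := (hasSum_driftVec (μ := μ) hs hm k).mapL (innerSL ℂ (vacuum d μ))
  refine h1.unique ?_
  convert hasSum_zero with ζ
  rw [innerSL_apply_apply, inner_smul_right, inner_vacuum_siteVec]
  by_cases hζ : ζ = 0
  · simp [hζ, dotC_zero]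
  · simp [hζ]

theorem liftL_meanL2_driftVec
    (hs : Summable fun y : Site d => Real.exp (m * ‖toSpace y‖) * ‖h y‖) (hm : 0 < m)
    (k : Fin d → ℂ) : liftL (Site d) (meanL2 μ) (driftVec μ h k) = driftVec μ h k := by
  have h1 := (hasSum_driftVec (μ := μ) hs hm k).mapL (liftL (Site d) (meanL2 μ))
  simp only [map_smul, liftL_meanL2_siteVec] at h1
  exact h1.unique (hasSum_driftVec hs hm k)

theorem driftVec_apply (hs : Summable fun y : Site d => Real.exp (m * ‖toSpace y‖) * ‖h y‖)
    (hm : 0 < m) (k : Fin d → ℂ) (x : Site d) :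
    driftVec μ h k x = (h x * (Complex.I * dotC k x)) • oneL2 μ := by
  have h1 := (hasSum_driftVec (μ := μ) hs hm k).mapL
    (lp.evalCLM ℂ (fun _ : Site d => Lp ℂ 2 μ) 2 x)
  refine h1.unique ?_
  have h2 := hasSum_ite_eq x ((h x * (Complex.I * dotC k x)) • oneL2 μ)
  refine h2.congr_fun fun ζ => ?_
  change (h ζ * (Complex.I * dotC k ζ)) • siteVec μ ζ x = _
  rw [siteVec_apply]
  by_cases hζ : ζ = x
  · subst hζ; simp
  · simp [hζ, Ne.symm hζ]

/-- Shifts are invisible on fields constant in `Ω`, so at `k = 0` the two halves of every hop cancel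
and only the potential remains. -/
theorem fiberOp_zero_apply_of_mean (hσ : IsShiftAction μ σ)
    (hs : Summable fun y : Site d => Real.exp (m * ‖toSpace y‖) * ‖h y‖) (hm : 0 < m)
    (hw : IsBddMeasurable w M) {g : FiberSpace d μ} (hg : liftL (Site d) (meanL2 μ) g = g) :
    fiberOp hσ h hw 0 g = potentialL hσ hw g := by
  have hgx : ∀ x, g x = inner ℂ (oneL2 μ) (g x) • oneL2 μ := fun x => by
    rw [← meanL2_apply, ← liftL_apply, hg]
  have h1 := (summable_fiberTerm hσ hs hm (k := 0) (by simp [absSum, hm.le])).hasSum.mapL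
    (ContinuousLinearMap.apply ℂ (FiberSpace d μ) g)
  have h2 : ∀ ζ, fiberTerm hσ h 0 ζ g = 0 := fun ζ => by
    ext1
    funext x
    simp only [fiberTerm, smul_apply, sub_apply, ContinuousLinearMap.comp_apply, phase_zero_left,
      one_smul, lp.coeFn_smul, lp.coeFn_sub, Pi.smul_apply, Pi.sub_apply, liftL_apply,
      translateL_apply]
    rw [hgx (x - ζ), map_smul, shiftL2_oneL2, sub_self, smul_zero]
    rfl
  simp only [ContinuousLinearMap.apply_apply, h2] at h1
  rw [fiberOp, add_apply, h1.unique hasSum_zero, zero_add]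

theorem inner_oneL2_mulL (hw : IsBddMeasurable w M) :
    inner ℂ (oneL2 μ) (hw.mulL μ (oneL2 μ)) = ((∫ a, w a ∂μ : ℝ) : ℂ) := by
  rw [inner_oneL2, ← integral_complex_ofReal]
  refine integral_congr_ae ?_
  filter_upwards [mulL2_coe (φ := fun a => (w a : ℂ))
    (hφ := Complex.measurable_ofReal.comp hw.measurable)
    (hC := fun a => by simpa using hw.abs_le a) (oneL2 μ), oneL2_coe (μ := μ)] with a h1 h2
  rw [IsBddMeasurable.mulL, h1, h2, mul_one]

theorem integral_sub_shift (hσ : IsShiftAction μ σ) (hw : IsBddMeasurable w M) (x : Site d) :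
    ∫ a, (w (σ x a) - w a) ∂μ = 0 := by
  have hi : ∀ {w' : Ω → ℝ}, IsBddMeasurable w' M → Integrable w' μ := fun hw' =>
    (integrable_const M).mono' hw'.measurable.aestronglyMeasurable (ae_of_all _ hw'.abs_le)
  rw [integral_sub (hi (hw.comp_shift hσ x)) (hi hw)]
  have := integral_map (μ := μ) (φ := σ x) (hσ.preserving x).measurable.aemeasurable (f := w)
    (hw.measurable.aestronglyMeasurable)
  rw [(hσ.preserving x).map_eq] at this
  rw [this, sub_self]

/-- `v_x - v_0` has mean zero because `σ_x` preserves `μ`. Together with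
`fiberOp_zero_apply_of_mean` this is `Z A Z = 0`. -/
theorem mean_potentialL (hσ : IsShiftAction μ σ) (hw : IsBddMeasurable w M) {g : FiberSpace d μ}
    (hg : liftL (Site d) (meanL2 μ) g = g) : liftL (Site d) (meanL2 μ) (potentialL hσ hw g) = 0 := by
  ext1
  funext x
  rw [← hg, liftL_apply, potentialL_apply, liftL_apply, meanL2_apply, meanL2_apply, map_smul,
    inner_smul_right, inner_oneL2_mulL, integral_sub_shift hσ hw]
  simp

/-- The lifted semigroup on `ℓ²(ℤ^d; L²(μ))`. -/
def fiberSemigroup (hP : IsMarkovProcess μ σ P) (t : ℝ) : FiberSpace d μ →L[ℂ] FiberSpace d μ :=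
  liftL (Site d) (backwardSemigroup hP t.toNNReal)

theorem le_norm_of_generator (hσ : IsShiftAction μ σ) (hP : IsMarkovProcess μ σ P)
    (hw : IsBddMeasurable w M) {χ : ℝ}
    {x : Site d} (hχ : ∀ u w' : Lp ℂ 2 μ, (w' =ᵐ[μ] fun a => ((w (σ x a) - w a : ℝ) : ℂ)) →
      IsGenerator hP u w' → ∫ a, u a ∂μ = 0 → χ ≤ ‖u‖) {u : Lp ℂ 2 μ} {c : ℂ}
    (hu : meanL2 μ u = 0)
    (hgen : IsGenerator hP u (((hw.comp_shift hσ x).sub hw).mulL μ (c • oneL2 μ))) :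
    χ * ‖c‖ ≤ ‖u‖ := by
  by_cases hc : c = 0
  · simp [hc]
  have h1 := hχ (c⁻¹ • u) (((hw.comp_shift hσ x).sub hw).mulL μ (oneL2 μ)) ?_ ?_ ?_
  · rw [norm_smul, norm_inv, ← div_eq_inv_mul, le_div_iff₀ (norm_pos_iff.2 hc)] at h1
    exact h1
  · have hb := (hw.comp_shift hσ x).sub hw
    filter_upwards [mulL2_coe (φ := fun a => ((w (σ x a) - w a : ℝ) : ℂ))
      (hφ := Complex.measurable_ofReal.comp hb.measurable)
      (hC := fun a => (Complex.norm_real _).trans_le (hb.abs_le a)) (oneL2 μ), oneL2_coe (μ := μ)] with a h1 h2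
    rw [IsBddMeasurable.mulL, h1, h2, mul_one]
  · have h2 := Tendsto.const_smul hgen c⁻¹
    rw [map_smul, smul_smul, inv_mul_cancel₀ hc, one_smul] at h2
    refine h2.congr fun t => ?_
    rw [map_smul, ← smul_sub, smul_comm]
  · rw [← meanL2_eq_zero_iff, map_smul, hu, smul_zero]

/-- Coercivity is checked site by site. A field in the range of `Z` and orthogonal to the vacuum is
`g x = c_x 1` with `c_0 = 0`, and for `x ≠ 0` the vector `B⁻¹ A g` is `c_x B⁻¹(v_x - v_0)` at `x`,
of norm at least `χ |c_x|` by hypothesis. -/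
theorem isCoupling_fiberOp [BorelSpace Ω] (hσ : IsShiftAction μ σ) (hP : IsMarkovProcess μ σ P)
    (hh : ∀ ζ, h ζ = star (h (-ζ)))
    (hs : Summable fun y : Site d => Real.exp (m * ‖toSpace y‖) * ‖h y‖) (hm : 0 < m)
    (hw : IsBddMeasurable w M) {γ χ : ℝ} (hχ0 : 0 < χ)
    (hχ : ∀ x : Site d, x ≠ 0 → ∀ u w' : Lp ℂ 2 μ,
      (w' =ᵐ[μ] fun a => ((w (σ x a) - w a : ℝ) : ℂ)) →
      IsGenerator hP u w' → ∫ a, u a ∂μ = 0 → χ ≤ ‖u‖)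
    (hS : IsGapped (fiberSemigroup hP) (liftL (Site d) (meanL2 μ)) γ) :
    IsCoupling hS (fiberOp hσ h hw 0) (vacuum d μ) χ where
  symm := fiberOp_symm hσ hh hs hm hw (by simp) (by simp [absSum, hm.le])
  proj_apply_proj f := by
    rw [fiberOp_zero_apply_of_mean hσ hs hm hw (hS.proj_proj f),
      mean_potentialL hσ hw (hS.proj_proj f)]
  norm_eq_one := norm_vacuum
  proj_eq := liftL_meanL2_siteVec 0
  apply_eq_zero := by
    have h1 := hasSum_fiberOp_vacuum hσ hs hm hw (k := 0) (by simp [absSum, hm.le])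
    simp only [phase_zero_left, sub_self, mul_zero, zero_smul] at h1
    exact h1.unique hasSum_zero
  pos := hχ0
  coercive g hg hqg := by
    set f := fiberOp hσ h hw 0 g with hf
    set u := hS.potential f
    have hZu : liftL (Site d) (meanL2 μ) u = 0 := hS.proj_potential f
    have hpot : f = potentialL hσ hw g := fiberOp_zero_apply_of_mean hσ hs hm hw hg
    have hZf : liftL (Site d) (meanL2 μ) f = 0 := by rw [hpot]; exact mean_potentialL hσ hw hg
    have hgen := hS.tendsto_generator_potential f
    rw [hZf, sub_zero] at hgen
    have hgx : ∀ x, g x = inner ℂ (oneL2 μ) (g x) • oneL2 μ := fun x => by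
      rw [← meanL2_apply, ← liftL_apply, hg]
    refine (mul_comm _ _).trans_le ((le_div_iff₀ hχ0).1 ?_)
    rw [div_eq_inv_mul]
    refine lp_norm_le_mul (inv_nonneg.2 hχ0.le) fun x => ?_
    rw [← div_eq_inv_mul, le_div_iff₀ hχ0, mul_comm]
    by_cases hx : x = 0
    · have : g x = 0 := by
        rw [hgx x, hx, ← inner_vacuum, hqg, zero_smul]
      rw [this, norm_zero, mul_zero]
      exact norm_nonneg _
    have hnx : ‖g x‖ = ‖inner ℂ (oneL2 μ) (g x)‖ := by
      conv_lhs => rw [hgx x]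
      rw [norm_smul, norm_oneL2, mul_one]
    rw [hnx]
    refine le_norm_of_generator hσ hP hw (hχ x hx) ?_ ?_
    · have := congrArg (fun F : FiberSpace d μ => F x) hZu
      exact this
    · rw [isGenerator_iff, ← hgx x, ← potentialL_apply hσ hw g x, ← hpot]
      exact ((lp.evalCLM ℂ (fun _ : Site d => Lp ℂ 2 μ) 2 x).continuous.tendsto _).comp hgen

end Coupling

/-! ### Functions of the path up to time `s`. -/

section Past

variable {d : ℕ} {Ω : Type*} [TopologicalSpace Ω] [mΩ : MeasurableSpace Ω] {μ : Measure Ω}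
  {σ : Site d → Ω → Ω} {P : Kernel Ω (RCPath Ω)}

/-- The `σ`-algebra of the path up to time `s`. -/
def pastSpace (Ω : Type*) [TopologicalSpace Ω] [mΩ : MeasurableSpace Ω] (s : ℝ≥0) :
    MeasurableSpace (RCPath Ω) :=
  ⨆ u ∈ Set.Iic s, mΩ.comap fun ω : RCPath Ω => ω.1 u

theorem pastSpace_le (s : ℝ≥0) : pastSpace Ω s ≤ Subtype.instMeasurableSpace :=
  iSup₂_le fun u _ => (measurable_eval u).comap_le

theorem pastSpace_mono {s t : ℝ≥0} (hst : s ≤ t) : pastSpace Ω s ≤ pastSpace Ω t :=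
  biSup_mono fun _ hu => le_trans hu hst

theorem measurable_eval_past {u s : ℝ≥0} (hus : u ≤ s) :
    Measurable[pastSpace Ω s] fun ω : RCPath Ω => ω.1 u :=
  Measurable.mono (comap_measurable _) (le_biSup (fun u => mΩ.comap fun ω : RCPath Ω => ω.1 u)
    (show u ∈ Set.Iic s from hus)) le_rfl

variable [IsProbabilityMeasure μ] [IsMarkovKernel P]

/-- Induction on the largest time: the earlier events lie in the past of that time, and
`PastDep.eval_mul` multiplies in one more indicator. -/
theorem pastDep_iInter (hP : IsMarkovProcess μ σ P) (F : Finset ℝ≥0) :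
    ∀ (s : ℝ≥0) (A : ℝ≥0 → Set (RCPath Ω)), (∀ u ∈ F, u ≤ s) →
    (∀ u ∈ F, MeasurableSet[mΩ.comap fun ω : RCPath Ω => ω.1 u] (A u)) →
    PastDep μ P s ((⋂ u ∈ F, A u).indicator 1) := by
  induction F using Finset.induction_on_max with
  | empty =>
    intro s A _ _
    exact (PastDep.const hP s 1).congr (.of_forall fun ω => by simp)
  | insert t F ht ih =>
    intro s A hs hA
    obtain ⟨B, hB, hBA⟩ := hA t (Finset.mem_insert_self t F)
    have h1 := ih t A (fun u hu => (ht u hu).le) fun u hu => hA u (Finset.mem_insert_of_mem hu)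
    have h2 := (h1.eval_mul hP le_rfl (v := B.indicator 1) (measurable_one.indicator hB) (M := 1)
      fun a => by by_cases ha : a ∈ B <;> simp [ha]).mono hP (hs t (Finset.mem_insert_self t F))
    refine h2.congr (.of_forall fun ω => ?_)
    have e : (⋂ u ∈ insert t F, A u) = A t ∩ ⋂ u ∈ F, A u := by simp
    rw [e, ← hBA]
    by_cases h3 : ω.1 t ∈ B <;> by_cases h4 : ω ∈ ⋂ u ∈ F, A u <;>
      simp [Set.indicator, h3, h4]

/-- A π-λ argument, the π-system being the finite intersections of events at single times. -/
theorem pastDep_indicator (hP : IsMarkovProcess μ σ P) (s : ℝ≥0) {A : Set (RCPath Ω)}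
    (hA : MeasurableSet[pastSpace Ω s] A) : PastDep μ P s (A.indicator 1) := by
  have hint : ∀ A : Set (RCPath Ω), MeasurableSet[pastSpace Ω s] A →
      Integrable (A.indicator (1 : RCPath Ω → ℂ)) (pathLaw μ P) := fun A hA =>
    (integrable_const (1 : ℂ)).indicator (pastSpace_le s A hA)
  refine MeasurableSpace.induction_on_inter (m := pastSpace Ω s)
    (C := fun A _ => PastDep μ P s (A.indicator 1))
    (generateFrom_piiUnionInter_measurableSet _ _).symm
    (isPiSystem_piiUnionInter _ (fun u => @MeasurableSpace.isPiSystem_measurableSet _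
      (mΩ.comap fun ω : RCPath Ω => ω.1 u)) _) ?_ ?_ ?_ ?_ A hA
  · simpa using PastDep.const hP s 0
  · rintro A ⟨F, hF, f, hf, rfl⟩
    exact pastDep_iInter hP F s f hF hf
  · intro A hA h
    have h1 := (PastDep.const hP s 1).add (h.const_mul (-1)) (integrable_const _)
      ((hint A hA).const_mul _)
    refine h1.congr (.of_forall fun ω => ?_)
    by_cases h : ω ∈ A <;> simp [h]
  · intro A hdis hA h
    have hfin : ∀ n : ℕ, PastDep μ P s ((⋃ i ∈ Finset.range n, A i).indicator 1) := by
      intro n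
      induction n with
      | zero => simpa using PastDep.const hP s 0
      | succ n ih =>
        refine (ih.add (h n) (hint _ (Finset.measurableSet_biUnion _ fun i _ => hA i))
          (hint _ (hA n))).congr (.of_forall fun ω => ?_)
        have e : (⋃ i ∈ Finset.range (n + 1), A i) = (⋃ i ∈ Finset.range n, A i) ∪ A n := by
          simp [Finset.range_add_one, Set.union_comm]
        have hd : Disjoint (⋃ i ∈ Finset.range n, A i) (A n) := by
          simp only [Set.disjoint_iUnion_left]
          intro i hi
          exact hdis (Finset.mem_range.1 hi).ne
        rw [e, Set.indicator_union_of_disjoint hd]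
    refine PastDep.of_tendsto (l := atTop) hfin (b := 1) (fun n => (hint _
      (Finset.measurableSet_biUnion _ fun i _ => hA i)).aestronglyMeasurable) (fun n ω => ?_)
      (.of_forall fun ω => ?_)
    · by_cases h : ω ∈ ⋃ i ∈ Finset.range n, A i
      · rw [Set.indicator_of_mem h]; simp
      · rw [Set.indicator_of_notMem h]; simp
    · by_cases h : ω ∈ ⋃ i, A i
      · obtain ⟨i, hi⟩ := Set.mem_iUnion.1 h
        rw [Set.indicator_of_mem h]
        refine tendsto_const_nhds.congr' ?_
        filter_upwards [eventually_gt_atTop i] with n hn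
        rw [Set.indicator_of_mem]
        exact Set.mem_biUnion (Finset.mem_coe.2 (Finset.mem_range.2 hn)) hi
      · rw [Set.indicator_of_notMem h]
        refine tendsto_const_nhds.congr fun n => ?_
        rw [Set.indicator_of_notMem]
        intro hc
        obtain ⟨i, _, hi⟩ := Set.mem_iUnion₂.1 hc
        exact h (Set.mem_iUnion.2 ⟨i, hi⟩)

/-- Bounded functions of the path up to time `s` satisfy the Markov property. -/
theorem pastDep_of_aestronglyMeasurable (hP : IsMarkovProcess μ σ P) {s : ℝ≥0}
    {G : RCPath Ω → ℂ} (hG : AEStronglyMeasurable[pastSpace Ω s] G (pathLaw μ P)) {b : ℝ}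
    (hb : ∀ᵐ ω ∂(pathLaw μ P), ‖G ω‖ ≤ b) : PastDep μ P s G := by
  obtain ⟨G', hG', hGG'⟩ := hG
  refine PastDep.congr ?_ hGG'.symm
  have hb' : ∀ᵐ ω ∂(pathLaw μ P), ‖G' ω‖ ≤ b := by
    filter_upwards [hb, hGG'] with ω h1 h2; rwa [← h2]
  have hb0 : 0 ≤ b := by
    obtain ⟨ω, hω⟩ := hb.exists; exact (norm_nonneg _).trans hω
  have hsimp : ∀ f : @SimpleFunc (RCPath Ω) (pastSpace Ω s) ℂ, PastDep μ P s f ∧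
      Integrable f (pathLaw μ P) := by
    intro f
    induction f using @SimpleFunc.induction _ _ (pastSpace Ω s) with
    | const c hA =>
      rename_i A
      have e : (A.indicator fun _ => c) = fun ω : RCPath Ω => c * A.indicator (1 : RCPath Ω → ℂ) ω := by
        funext ω; by_cases h : ω ∈ A <;> simp [h]
      have h1 := (pastDep_indicator hP s hA).const_mul c
      have h2 : Integrable (A.indicator fun _ => c) (pathLaw μ P) :=
        (integrable_const c).indicator (pastSpace_le s A hA)
      rw [← e] at h1
      have e2 : (A.indicator fun _ => c) =ᵐ[pathLaw μ P]
          (@SimpleFunc.piecewise _ _ (pastSpace Ω s) A hA (@SimpleFunc.const _ _ (pastSpace Ω s) c)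
            (@SimpleFunc.const _ _ (pastSpace Ω s) 0)) :=
        .of_forall fun ω => by by_cases h : ω ∈ A <;> simp [h]
      exact ⟨h1.congr e2, h2.congr e2⟩
    | add hd h1 h2 => exact ⟨h1.1.add h2.1 h1.2 h2.2, h1.2.add h2.2⟩
  exact PastDep.of_tendsto (l := atTop) (fun n => (hsimp (hG'.approxBounded b n)).1)
    (fun n => (hsimp (hG'.approxBounded b n)).2.aestronglyMeasurable)
    (fun n ω => StronglyMeasurable.norm_approxBounded_le hG' hb0 n ω)
    (hb'.mono fun ω hω => StronglyMeasurable.tendsto_approxBounded_of_norm_le hG' hω)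

end Past

/-- Integrals of functions that are measurable with respect to a sub-`σ`-algebra, for almost every
parameter and up to null sets, are measurable with respect to it up to null sets. -/
theorem aestronglyMeasurable_integral_of_sub {α : Type*} {m m0 : MeasurableSpace α} {ν : Measure α}
    [IsFiniteMeasure ν] (hm : m ≤ m0) {τ : Measure ℝ} [IsFiniteMeasure τ] {g : ℝ → α → ℂ}
    (hg : StronglyMeasurable (Function.uncurry g)) {b : ℝ} (hb : ∀ u a, ‖g u a‖ ≤ b)
    (hgm : ∀ᵐ u ∂τ, AEStronglyMeasurable[m] (g u) ν) :
    AEStronglyMeasurable[m] (fun a => ∫ u, g u a ∂τ) ν := by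
  have : Fact (m ≤ m0) := ⟨hm⟩
  have hGm : StronglyMeasurable fun a => ∫ u, g u a ∂τ :=
    (hg.comp_measurable measurable_swap).integral_prod_right'
  have hGL : MemLp (fun a => ∫ u, g u a ∂τ) 2 ν :=
    MemLp.of_bound hGm.aestronglyMeasurable (b * τ.real Set.univ)
      (ae_of_all _ fun a => norm_integral_le_of_norm_le_const (ae_of_all _ fun u => hb u a))
  have hgL : ∀ u, MemLp (g u) 2 ν := fun u =>
    MemLp.of_bound (hg.comp_measurable measurable_prodMk_left).aestronglyMeasurable b
      (ae_of_all _ (hb u))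
  set K := lpMeas ℂ ℂ m 2 ν
  -- Measurability is tested by orthogonality: `Kᗮᗮ = K` for this closed subspace, and Fubini
  -- reduces the test to almost every `g u`. No version of `g` that is jointly measurable for the
  -- sub-`σ`-algebra is needed.
  have hmem : hGL.toLp _ ∈ Kᗮᗮ := by
    rw [Submodule.mem_orthogonal]
    intro η hη
    rw [L2.inner_def]
    have hηi : Integrable η ν := (Lp.memLp η).integrable (by norm_num)
    have e1 : ∫ a, inner ℂ (η a) (hGL.toLp _ a) ∂ν
        = ∫ a, ∫ u, (starRingEnd ℂ) (η a) * g u a ∂τ ∂ν := by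
      refine integral_congr_ae (hGL.coeFn_toLp.mono fun a ha => ?_)
      beta_reduce
      rw [integral_const_mul, ha, RCLike.inner_apply, mul_comm]
    rw [e1, integral_integral_swap]
    · refine integral_eq_zero_of_ae (hgm.mono fun u hu => ?_)
      have hin : (hgL u).toLp _ ∈ K := mem_lpMeas_iff_aestronglyMeasurable.2
        (hu.congr (hgL u).coeFn_toLp.symm)
      have h0 := (Submodule.mem_orthogonal' _ _).1 hη _ hin
      rw [L2.inner_def] at h0
      refine Eq.trans ?_ h0
      refine integral_congr_ae ((hgL u).coeFn_toLp.mono fun a ha => ?_)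
      beta_reduce
      rw [ha, RCLike.inner_apply, mul_comm]
    · have hηc : Integrable (fun a => (starRingEnd ℂ) (η a)) ν :=
        (Complex.conjCLE.toContinuousLinearMap.integrable_comp hηi)
      refine ((hηc.comp_fst τ).mul_bdd (c := b) (g := fun p : α × ℝ => g p.2 p.1) ?_ ?_)
      · exact (hg.comp_measurable measurable_swap).aestronglyMeasurable
      · exact ae_of_all _ fun p => hb _ _
  rw [Submodule.orthogonal_orthogonal] at hmem
  exact (mem_lpMeas_iff_aestronglyMeasurable.1 hmem).congr hGL.coeFn_toLp

/-! ### Picard series for random linear equations. -/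

section Picard

variable {α X : Type*} [MeasurableSpace α] [NormedAddCommGroup X] [NormedSpace ℂ X]

/-- A bounded random time-dependent linear vector field, measurable in time and chance. -/
structure IsRandomGen (L : ℝ → α → X →L[ℂ] X) (C : ℝ) : Prop where
  nonneg : 0 ≤ C
  norm_le : ∀ s a u, ‖L s a u‖ ≤ C * ‖u‖
  meas : ∀ U : ℝ × α → X, StronglyMeasurable U → StronglyMeasurable fun p => L p.1 p.2 (U p)

theorem norm_setIntegral_pow_le {f : ℝ → X} {B C t : ℝ} (n : ℕ) (ht : 0 ≤ t)
    (hf : ∀ s ∈ Set.Ioc 0 t, ‖f s‖ ≤ C * (B * ((C * s) ^ n / n.factorial))) :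
    ‖∫ s in Set.Ioc 0 t, f s‖ ≤ B * ((C * t) ^ (n + 1) / (n + 1).factorial) := by
  have hg : IntegrableOn (fun s : ℝ => C * (B * ((C * s) ^ n / n.factorial))) (Set.Ioc 0 t) :=
    (Continuous.intervalIntegrable (by fun_prop) 0 t).1
  refine (norm_integral_le_of_norm_le hg
    ((ae_restrict_iff' measurableSet_Ioc).2 (ae_of_all _ hf))).trans_eq ?_
  rw [← intervalIntegral.integral_of_le ht]
  have e : ∀ s : ℝ, C * (B * ((C * s) ^ n / n.factorial))
      = (C ^ (n + 1) * B / n.factorial) * s ^ n := fun s => by ring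
  simp only [e]
  rw [intervalIntegral.integral_const_mul, integral_pow, Nat.factorial_succ]
  have : (n.factorial : ℝ) ≠ 0 := by positivity
  push_cast
  field_simp
  simp only [zero_pow (Nat.succ_ne_zero n), sub_zero]
  ring

theorem tendsto_pow_mul_div_factorial (B c : ℝ) :
    Tendsto (fun n : ℕ => B * (c ^ n / n.factorial)) atTop (𝓝 0) := by
  simpa using (FloorSemiring.tendsto_pow_div_factorial_atTop c).const_mul B

/-- Uniqueness for linear integral equations. -/
theorem eq_zero_of_integral_eq {L : ℝ → X →L[ℂ] X} {C : ℝ} (hC : 0 ≤ C)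
    (hL : ∀ s u, ‖L s u‖ ≤ C * ‖u‖) {U : ℝ → X} {T B : ℝ} (hB : ∀ t ∈ Set.Icc 0 T, ‖U t‖ ≤ B)
    (hU : ∀ t ∈ Set.Icc 0 T, U t = ∫ s in Set.Ioc 0 t, L s (U s)) {t : ℝ} (ht : t ∈ Set.Icc 0 T) :
    U t = 0 := by
  have key : ∀ n : ℕ, ∀ t ∈ Set.Icc 0 T, ‖U t‖ ≤ B * ((C * t) ^ n / n.factorial) := by
    intro n
    induction n with
    | zero => intro t ht; simpa using hB t ht
    | succ n ih =>
      intro t ht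
      rw [hU t ht]
      refine norm_setIntegral_pow_le n ht.1 fun s hs => (hL s _).trans ?_
      gcongr
      exact ih s ⟨hs.1.le, hs.2.trans ht.2⟩
  have h0 : ‖U t‖ ≤ 0 := ge_of_tendsto' (tendsto_pow_mul_div_factorial B (C * t)) fun n =>
    key n t ht
  simpa using h0

/-- The terms of the Picard series. -/
def picardTerm (L : ℝ → α → X →L[ℂ] X) (φ : X) : ℕ → ℝ → α → X
  | 0 => fun _ _ => φ
  | n + 1 => fun t a => ∫ s in Set.Ioc 0 t, L s a (picardTerm L φ n s a)

/-- The solution of `u_t = φ + ∫_0^t L_s u_s ds`. -/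
def picardSol (L : ℝ → α → X →L[ℂ] X) (φ : X) (t : ℝ) (a : α) : X := ∑' n, picardTerm L φ n t a

variable {L : ℝ → α → X →L[ℂ] X} {C : ℝ} {φ : X}

theorem stronglyMeasurable_setIntegral_Ioc {g : ℝ × α → X} (hg : StronglyMeasurable g) :
    StronglyMeasurable fun p : ℝ × α => ∫ s in Set.Ioc 0 p.1, g (s, p.2) := by
  have h1 : StronglyMeasurable fun q : (ℝ × α) × ℝ =>
      {q : (ℝ × α) × ℝ | 0 < q.2 ∧ q.2 ≤ q.1.1}.indicator (fun q => g (q.2, q.1.2)) q := by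
    refine StronglyMeasurable.indicator (hg.comp_measurable (by fun_prop)) ?_
    exact (measurableSet_lt measurable_const measurable_snd).inter
      (measurableSet_le measurable_snd (measurable_fst.comp measurable_fst))
  have h2 := h1.integral_prod_right' (ν := (volume : Measure ℝ))
  have e : (fun p : ℝ × α => ∫ s in Set.Ioc 0 p.1, g (s, p.2)) = fun p => ∫ s,
      {q : (ℝ × α) × ℝ | 0 < q.2 ∧ q.2 ≤ q.1.1}.indicator (fun q => g (q.2, q.1.2)) (p, s) := by
    funext p
    rw [← integral_indicator measurableSet_Ioc]
    rfl
  rwa [e]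

theorem stronglyMeasurable_picardTerm (hL : IsRandomGen L C) (n : ℕ) :
    StronglyMeasurable fun p : ℝ × α => picardTerm L φ n p.1 p.2 := by
  induction n with
  | zero => exact stronglyMeasurable_const
  | succ n ih => exact stronglyMeasurable_setIntegral_Ioc (hL.meas _ ih)

theorem norm_picardTerm_le (hL : IsRandomGen L C) (n : ℕ) (t : ℝ) (a : α) :
    ‖picardTerm L φ n t a‖ ≤ ‖φ‖ * ((C * |t|) ^ n / n.factorial) := by
  induction n generalizing t with
  | zero => simp [picardTerm]
  | succ n ih =>
    have hC := hL.nonneg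
    rcases le_or_gt 0 t with ht | ht
    · rw [abs_of_nonneg ht]
      refine norm_setIntegral_pow_le n ht fun s hs => (hL.norm_le s a _).trans ?_
      gcongr
      simpa [abs_of_pos hs.1] using ih s
    · have h0 : picardTerm L φ (n + 1) t a = 0 := by
        simp only [picardTerm, Set.Ioc_eq_empty_of_le ht.le, setIntegral_empty]
      rw [h0, norm_zero]
      positivity

theorem hasSum_exp_bound (B c : ℝ) :
    HasSum (fun n : ℕ => B * (c ^ n / n.factorial)) (B * Real.exp c) := by
  have h := NormedSpace.expSeries_div_hasSum_exp (𝔸 := ℝ) c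
  rw [← Real.exp_eq_exp_ℝ] at h
  exact h.mul_left B

variable [CompleteSpace X]

theorem hasSum_picardSol (hL : IsRandomGen L C) (t : ℝ) (a : α) :
    HasSum (fun n => picardTerm L φ n t a) (picardSol L φ t a) :=
  (Summable.of_norm_bounded (hasSum_exp_bound ‖φ‖ (C * |t|)).summable fun n =>
    norm_picardTerm_le hL n t a).hasSum

theorem norm_picardSol_le (hL : IsRandomGen L C) (t : ℝ) (a : α) :
    ‖picardSol L φ t a‖ ≤ ‖φ‖ * Real.exp (C * |t|) :=
  tsum_of_norm_bounded (hasSum_exp_bound ‖φ‖ (C * |t|)) fun n => norm_picardTerm_le hL n t a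

theorem stronglyMeasurable_picardSol (hL : IsRandomGen L C) :
    StronglyMeasurable fun p : ℝ × α => picardSol L φ p.1 p.2 :=
  stronglyMeasurable_of_tendsto atTop (f := fun (n : ℕ) (p : ℝ × α) =>
    ∑ i ∈ Finset.range n, picardTerm L φ i p.1 p.2)
    (fun _ => Finset.stronglyMeasurable_fun_sum _ fun i _ => stronglyMeasurable_picardTerm hL i)
    (tendsto_pi_nhds.2 fun p => (hasSum_picardSol hL p.1 p.2).tendsto_sum_nat)

theorem integrableOn_gen (hL : IsRandomGen L C) {U : ℝ × α → X} (hU : StronglyMeasurable U) {t B : ℝ}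
    (hB : ∀ s ∈ Set.Ioc 0 t, ∀ a, ‖U (s, a)‖ ≤ B) (a : α) :
    IntegrableOn (fun s => L s a (U (s, a))) (Set.Ioc 0 t) := by
  refine Integrable.mono' (g := fun _ => C * B) (integrable_const _)
    ((hL.meas U hU).comp_measurable measurable_prodMk_right).aestronglyMeasurable ?_
  refine (ae_restrict_iff' measurableSet_Ioc).2 (ae_of_all _ fun s hs => ?_)
  exact (hL.norm_le s a _).trans (mul_le_mul_of_nonneg_left (hB s hs a) hL.nonneg)

theorem norm_picardSol_le_of_mem (hL : IsRandomGen L C) {t s : ℝ} (hs : s ∈ Set.Icc 0 t) (a : α) :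
    ‖picardSol L φ s a‖ ≤ ‖φ‖ * Real.exp (C * t) := by
  refine (norm_picardSol_le hL s a).trans ?_
  have := hL.nonneg
  rw [abs_of_nonneg hs.1]
  gcongr
  exact hs.2

theorem integrableOn_picardSol (hL : IsRandomGen L C) (t : ℝ) (a : α) :
    IntegrableOn (fun s => L s a (picardSol L φ s a)) (Set.Ioc 0 t) :=
  integrableOn_gen hL (stronglyMeasurable_picardSol hL)
    (fun _ hs a => norm_picardSol_le_of_mem hL ⟨hs.1.le, hs.2⟩ a) a

/-- The factorial bounds allow summation under the time integral; the integral of the `n`-th term is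
the next term, so the series shifts by one index. -/
theorem picardSol_eq (hL : IsRandomGen L C) {t : ℝ} (ht : 0 ≤ t) (a : α) :
    picardSol L φ t a = φ + ∫ s in Set.Ioc 0 t, L s a (picardSol L φ s a) := by
  have hC := hL.nonneg
  have hle : ∀ n, ∀ s ∈ Set.Ioc 0 t, ‖picardTerm L φ n s a‖ ≤ ‖φ‖ * ((C * t) ^ n / n.factorial) := by
    intro n s hs
    refine (norm_picardTerm_le hL n s a).trans ?_
    rw [abs_of_pos hs.1]
    have := hs.1.le
    gcongr
    exact hs.2
  have hterm : ∀ n, IntegrableOn (fun s => L s a (picardTerm L φ n s a)) (Set.Ioc 0 t) := fun n =>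
    integrableOn_gen (B := ‖φ‖ * ((C * t) ^ n / n.factorial)) hL
      (stronglyMeasurable_picardTerm hL n)
      (fun s hs a => by
        refine (norm_picardTerm_le hL n s a).trans ?_
        rw [abs_of_pos hs.1]
        have := hs.1.le
        gcongr
        exact hs.2) a
  have hsum : HasSum (fun n => ∫ s in Set.Ioc 0 t, L s a (picardTerm L φ n s a))
      (∫ s in Set.Ioc 0 t, ∑' n, L s a (picardTerm L φ n s a)) := by
    refine hasSum_integral_of_summable_integral_norm hterm ?_
    refine Summable.of_nonneg_of_le (fun n => integral_nonneg fun s => norm_nonneg _) (fun n => ?_)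
      ((hasSum_exp_bound ‖φ‖ (C * t)).summable.mul_left (C * t))
    calc ∫ s in Set.Ioc 0 t, ‖L s a (picardTerm L φ n s a)‖
        ≤ ∫ _ in Set.Ioc 0 t, C * (‖φ‖ * ((C * t) ^ n / n.factorial)) := by
          refine setIntegral_mono_on (hterm n).norm (integrable_const _) measurableSet_Ioc
            fun s hs => (hL.norm_le s a _).trans (mul_le_mul_of_nonneg_left (hle n s hs) hC)
      _ = C * t * (‖φ‖ * ((C * t) ^ n / n.factorial)) := by
          rw [setIntegral_const, measureReal_def, Real.volume_Ioc, sub_zero,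
            ENNReal.toReal_ofReal ht, smul_eq_mul]
          ring
  have e : ∀ s, ∑' n, L s a (picardTerm L φ n s a) = L s a (picardSol L φ s a) := fun s =>
    ((hasSum_picardSol hL s a).mapL (L s a)).tsum_eq
  simp only [e] at hsum
  have h1 := (hasSum_nat_add_iff' 1).2 (hasSum_picardSol (φ := φ) hL t a)
  have h2 := h1.unique hsum
  simp only [Finset.range_one, Finset.sum_singleton, picardTerm] at h2
  rw [← h2]
  abel

end Picard

/-! ### Measurability of `ℓ²`-valued functions. -/

section LpMeasurable

variable {α ι : Type*} [Countable ι]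

theorem stronglyMeasurable_lp_of_apply {m : MeasurableSpace α} {f : α → lp (fun _ : ι => ℂ) 2}
    (hf : ∀ i, StronglyMeasurable fun a => f a i) : StronglyMeasurable f := by
  classical
  refine stronglyMeasurable_of_tendsto (atTop : Filter (Finset ι))
    (f := fun F a => ∑ i ∈ F, lp.single 2 i (f a i)) (fun F => ?_)
    (tendsto_pi_nhds.2 fun a => lp.hasSum_single (by norm_num) (f a))
  exact Finset.stronglyMeasurable_fun_sum _ fun i _ =>
    (lp.singleContinuousLinearMap ℂ (fun _ : ι => ℂ) 2 i).continuous.comp_stronglyMeasurable (hf i)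

theorem aestronglyMeasurable_sub_of_tendsto {κ E : Type*} [Countable κ] {m m0 : MeasurableSpace α}
    {ν : Measure α} [NormedAddCommGroup E] [CompleteSpace E] {l : Filter κ} [l.NeBot]
    [l.IsCountablyGenerated] {f : κ → α → E} {g : α → E}
    (hf : ∀ n, AEStronglyMeasurable[m] (f n) ν)
    (hlim : ∀ a, Tendsto (fun n => f n a) l (𝓝 (g a))) : AEStronglyMeasurable[m] g ν := by
  choose f' hf' hff' using hf
  refine ⟨fun a => limUnder l fun n => f' n a, @StronglyMeasurable.limUnder _ _ _ m _ _ _ _ _ _ _ hf', ?_⟩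
  filter_upwards [ae_all_iff.2 hff'] with a ha
  have : (fun n => f' n a) = fun n => f n a := funext fun n => (ha n).symm
  rw [this]
  exact (hlim a).limUnder_eq.symm

theorem aestronglyMeasurable_lp_of_apply {m m0 : MeasurableSpace α} {ν : Measure α}
    {f : α → lp (fun _ : ι => ℂ) 2} (hf : ∀ i, AEStronglyMeasurable[m] (fun a => f a i) ν) :
    AEStronglyMeasurable[m] f ν := by
  classical
  refine aestronglyMeasurable_sub_of_tendsto (l := (atTop : Filter (Finset ι)))
    (f := fun F a => ∑ i ∈ F, lp.single 2 i (f a i)) (fun F => ?_)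
    (fun a => lp.hasSum_single (by norm_num) (f a))
  induction F using Finset.induction_on with
  | empty => simpa using aestronglyMeasurable_const
  | insert i F hi ih =>
    simp only [Finset.sum_insert hi]
    exact AEStronglyMeasurable.add ((lp.singleContinuousLinearMap ℂ (fun _ : ι => ℂ) 2
      i).continuous.comp_aestronglyMeasurable (hf i)) ih

end LpMeasurable

/-! ### A jointly measurable version of the potential along paths. -/

section PotentialVersion

variable {d : ℕ} {Ω : Type*} [TopologicalSpace Ω] [MeasurableSpace Ω] {μ : Measure Ω}
  {σ : Site d → Ω → Ω} {P : Kernel Ω (RCPath Ω)}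

/-- `V x s ω` is a jointly measurable bounded version of `v_x(ω_s)`, where `w` is a bounded
measurable version of `v₀`. -/
structure IsPotentialVersion (μ : Measure Ω) (P : Kernel Ω (RCPath Ω)) (σ : Site d → Ω → Ω)
    (w : Ω → ℝ) (M : ℝ) (V : Site d → ℝ → RCPath Ω → ℝ) : Prop where
  meas : ∀ x, Measurable fun p : ℝ × RCPath Ω => V x p.1 p.2
  abs_le : ∀ x s ω, |V x s ω| ≤ M
  ae_eq : ∀ x, ∀ᵐ s ∂(volume.restrict (Set.Ici (0 : ℝ))), ∀ᵐ ω ∂(pathLaw μ P),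
    V x s ω = w (σ x (ω.1 s.toNNReal))

/-- The potential is jointly measurable only up to null sets. Clipping a measurable representative
at `±M` makes its bound hold everywhere; Fubini in one order identifies it at almost every fixed
time, in the other order along almost every path. -/
theorem exists_potentialVersion [IsProbabilityMeasure μ] [IsMarkovKernel P]
    (hσ : IsShiftAction μ σ) {hP : IsMarkovProcess μ σ P} {v₀ : Ω → ℝ}
    (hv : IsPotential hP v₀) :
    ∃ (w : Ω → ℝ) (M : ℝ) (V : Site d → ℝ → RCPath Ω → ℝ), IsBddMeasurable w M ∧ w =ᵐ[μ] v₀ ∧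
      IsPotentialVersion μ P σ w M V ∧
      ∀ᵐ ω ∂(pathLaw μ P), ∀ x, ∀ᵐ s ∂(volume.restrict (Set.Ici (0 : ℝ))),
        V x s ω = v₀ (σ x (ω.1 s.toNNReal)) := by
  obtain ⟨M, hM⟩ : ∃ M : ℝ, ∀ᵐ a ∂μ, |v₀ a| ≤ M :=
    ⟨_, (ae_le_eLpNormEssSup (f := v₀)).mono fun a ha => by
      have h1 : eLpNormEssSup v₀ μ ≠ ⊤ := by
        rw [← eLpNorm_exponent_top]; exact hv.memLp.2.ne
      have := ENNReal.toReal_mono h1 ha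
      simpa using this⟩
  have hM0 : 0 ≤ M := by obtain ⟨a, ha⟩ := hM.exists; exact (abs_nonneg _).trans ha
  set clip : ℝ → ℝ := fun r => max (-M) (min M r) with hclip
  have hclipm : Measurable clip := measurable_const.max (measurable_const.min measurable_id)
  have hclipb : ∀ r, |clip r| ≤ M := fun r => abs_le.2
    ⟨le_max_left _ _, max_le (by linarith) (min_le_left _ _)⟩
  have hclipe : ∀ r, |r| ≤ M → clip r = r := fun r hr => by
    rw [hclip]
    have := abs_le.1 hr
    simp [min_eq_right this.2, max_eq_right this.1]
  have hvm := hv.memLp.1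
  set w : Ω → ℝ := fun a => clip (hvm.mk v₀ a) with hw
  have hwv : w =ᵐ[μ] v₀ := by
    filter_upwards [hM, hvm.ae_eq_mk] with a h1 h2
    rw [hw]
    simp only
    rw [← h2, hclipe _ h1]
  set V0 : Site d → ℝ × RCPath Ω → ℝ := fun x => (hv.measurable x).mk _ with hV0
  set V : Site d → ℝ → RCPath Ω → ℝ := fun x s ω => clip (V0 x (s, ω)) with hV
  have hV0m : ∀ x, Measurable (V0 x) := fun x => (hv.measurable x).stronglyMeasurable_mk.measurable
  have hpt : ∀ x (s : ℝ), ∀ᵐ ω ∂(pathLaw μ P), v₀ (σ x (ω.1 s.toNNReal))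
      = w (σ x (ω.1 s.toNNReal)) ∧ |v₀ (σ x (ω.1 s.toNNReal))| ≤ M := fun x s => by
    have h1 := (hP.measurePreserving_eval s.toNNReal).quasiMeasurePreserving.ae
      ((hσ.preserving x).quasiMeasurePreserving.ae (hwv.and hM))
    exact h1.mono fun ω hω => ⟨hω.1.symm, hω.2⟩
  have hae : ∀ x, ∀ᵐ p ∂((volume.restrict (Set.Ici (0 : ℝ))).prod (pathLaw μ P)),
      v₀ (σ x (p.2.1 p.1.toNNReal)) = V0 x p := fun x => (hv.measurable x).ae_eq_mk
  have hbd : ∀ x, ∀ᵐ p ∂((volume.restrict (Set.Ici (0 : ℝ))).prod (pathLaw μ P)),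
      |V0 x p| ≤ M := fun x => by
    rw [Measure.ae_prod_iff_ae_ae (measurableSet_le (hV0m x).abs measurable_const)]
    filter_upwards [Measure.ae_ae_of_ae_prod (hae x)] with s hs
    filter_upwards [hs, hpt x s] with ω h1 h2
    rw [← h1]; exact h2.2
  refine ⟨w, M, V, ⟨hclipm.comp hvm.stronglyMeasurable_mk.measurable, fun a => hclipb _⟩, hwv,
    ⟨fun x => hclipm.comp (hV0m x), fun x s ω => hclipb _, fun x => ?_⟩, ?_⟩
  · filter_upwards [Measure.ae_ae_of_ae_prod (hae x)] with s hs
    filter_upwards [hs, hpt x s] with ω h1 h2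
    rw [hV]
    simp only
    rw [← h1, hclipe _ h2.2, h2.1]
  · rw [ae_all_iff]
    intro x
    have h1 := (Measure.measurePreserving_swap (μ := pathLaw μ P)
      (ν := volume.restrict (Set.Ici (0 : ℝ)))).quasiMeasurePreserving.ae ((hae x).and (hbd x))
    filter_upwards [Measure.ae_ae_of_ae_prod h1] with ω hω
    filter_upwards [hω] with s hs
    rw [hV]
    exact (hclipe _ hs.2).trans hs.1.symm

end PotentialVersion

/-! ### The weighted Schrödinger equation and adaptedness of its solutions. -/

section Waves

variable {d : ℕ}

theorem toSpace_sub (x y : Site d) : toSpace (x - y) = toSpace x - toSpace y := by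
  ext i; simp [toSpace]

theorem toSpace_neg (x : Site d) : toSpace (-x) = -toSpace x := by
  ext i; simp [toSpace]

/-- The coefficients of `-i e^{η|x|} K e^{-η|x|}`. -/
def hopCoef (h : Site d → ℂ) (η : ℝ) (ζ x : Site d) : ℂ →L[ℂ] ℂ :=
  (-Complex.I * h ζ * (Real.exp (η * (‖toSpace x‖ - ‖toSpace (x - ζ)‖)) : ℂ)) •
    ContinuousLinearMap.id ℂ ℂ

/-- As `|x| - |x - ζ| ≤ |ζ|`, conjugation by `e^{η|x|}` with `η ≤ m` costs at most `e^{m|ζ|}` per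
hop. The conjugated generator stays bounded, which keeps the solutions exponentially localized at
all times. -/
theorem isKernel_hopCoef {h : Site d → ℂ} {m η : ℝ}
    (hs : Summable fun y : Site d => Real.exp (m * ‖toSpace y‖) * ‖h y‖) (hη : 0 ≤ η)
    (hηm : η ≤ m) :
    IsKernel (hopCoef h η) fun y : Site d => Real.exp (m * ‖toSpace y‖) * ‖h y‖ where
  norm_le ζ x := by
    rw [hopCoef, norm_smul, ContinuousLinearMap.norm_id, mul_one, norm_mul, norm_mul, norm_neg,
      Complex.norm_I, one_mul, mul_comm, Complex.norm_real, Real.norm_of_nonneg (Real.exp_nonneg _)]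
    refine mul_le_mul_of_nonneg_right (Real.exp_le_exp.2 ?_) (norm_nonneg _)
    have h1 : ‖toSpace x‖ - ‖toSpace (x - ζ)‖ ≤ ‖toSpace ζ‖ := by
      have := norm_sub_norm_le (toSpace x) (toSpace (x - ζ))
      rwa [← toSpace_sub, sub_sub_cancel] at this
    exact (mul_le_mul_of_nonneg_left h1 hη).trans (mul_le_mul_of_nonneg_right hηm (norm_nonneg _))
  summable := hs

/-- Multiplication by `e^{-η|x|}`. -/
def weightL (d : ℕ) (η : ℝ) (hη : 0 ≤ η) : Ell2 d →L[ℂ] Ell2 d :=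
  lp.mapCLM 2 (fun x : Site d => (Real.exp (-(η * ‖toSpace x‖)) : ℂ) • ContinuousLinearMap.id ℂ ℂ)
    zero_le_one fun x => by
      rw [norm_smul, ContinuousLinearMap.norm_id, mul_one, Complex.norm_real,
        Real.norm_of_nonneg (Real.exp_nonneg _)]
      exact Real.exp_le_one_iff.2 (neg_nonpos.2 (by positivity))

theorem weightL_apply {η : ℝ} (hη : 0 ≤ η) (u : Ell2 d) (x : Site d) :
    weightL d η hη u x = Real.exp (-(η * ‖toSpace x‖)) * u x := rfl

variable {Ω : Type*} [TopologicalSpace Ω] [MeasurableSpace Ω] {μ : Measure Ω}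
  {σ : Site d → Ω → Ω} {P : Kernel Ω (RCPath Ω)} {w : Ω → ℝ} {M : ℝ}
  {V : Site d → ℝ → RCPath Ω → ℝ} {h : Site d → ℂ} {m η : ℝ}

/-- Multiplication by `-i V`. -/
def potGen (hV : IsPotentialVersion μ P σ w M V) (s : ℝ) (ω : RCPath Ω) : Ell2 d →L[ℂ] Ell2 d :=
  lp.mapCLM 2 (fun x : Site d => (-Complex.I * V x s ω) • ContinuousLinearMap.id ℂ ℂ)
    (abs_nonneg M) fun x => by
      rw [norm_smul, ContinuousLinearMap.norm_id, mul_one, norm_mul, norm_neg, Complex.norm_I,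
        one_mul, Complex.norm_real]
      exact (hV.abs_le x s ω).trans (le_abs_self M)

theorem potGen_apply (hV : IsPotentialVersion μ P σ w M V) (s : ℝ) (ω : RCPath Ω) (u : Ell2 d)
    (x : Site d) : potGen hV s ω u x = -Complex.I * V x s ω * u x := rfl

/-- The generator `-i (K + V)`, conjugated by the weight `e^{η|x|}`. -/
def waveGen (hV : IsPotentialVersion μ P σ w M V) {b : Site d → ℝ}
    (hK : IsKernel (hopCoef h η) b) (s : ℝ) (ω : RCPath Ω) : Ell2 d →L[ℂ] Ell2 d :=
  hK.op id + potGen hV s ω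

theorem isRandomGen_waveGen (hV : IsPotentialVersion μ P σ w M V) {b : Site d → ℝ}
    (hK : IsKernel (hopCoef h η) b) : IsRandomGen (waveGen hV hK) (∑' ζ, b ζ + |M|) where
  nonneg := add_nonneg (tsum_nonneg hK.nonneg) (abs_nonneg M)
  norm_le s ω u := by
    rw [waveGen, add_apply, add_mul]
    refine (norm_add_le _ _).trans (add_le_add ?_ ?_)
    · exact (hK.op id).le_of_opNorm_le (hK.norm_op_le id) u
    · exact (potGen hV s ω).le_of_opNorm_le (lp.norm_mapCLM_le _ _ _ _) u
  meas U hU := by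
    simp only [waveGen, add_apply]
    refine ((hK.op id).continuous.comp_stronglyMeasurable hU).add
      (stronglyMeasurable_lp_of_apply fun x => ?_)
    simp only [potGen_apply]
    refine StronglyMeasurable.mul ?_ ((lp.evalCLM ℂ (fun _ : Site d => ℂ) 2
      x).continuous.comp_stronglyMeasurable hU)
    exact (measurable_const.mul (Complex.measurable_ofReal.comp (hV.meas x))).stronglyMeasurable

variable [IsProbabilityMeasure μ] [IsMarkovKernel P]

theorem aestronglyMeasurable_potGen (hσ : IsShiftAction μ σ) (hw : IsBddMeasurable w M)
    (hV : IsPotentialVersion μ P σ w M V) (x : Site d) :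
    ∀ᵐ s ∂(volume.restrict (Set.Ici (0 : ℝ))),
      AEStronglyMeasurable[pastSpace Ω s.toNNReal] (fun ω => (V x s ω : ℂ)) (pathLaw μ P) := by
  filter_upwards [hV.ae_eq x] with s hs
  refine ⟨fun ω => (w (σ x (ω.1 s.toNNReal)) : ℂ), ?_, ?_⟩
  · exact (Complex.measurable_ofReal.comp ((hw.comp_shift hσ x).measurable.comp
      (measurable_eval_past le_rfl))).stronglyMeasurable
  · filter_upwards [hs] with ω hω
    rw [hω]

/-- Induction on `n`: the integrand at `s ≤ t` depends on the past of `s`, and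
`aestronglyMeasurable_integral_of_sub` handles the time integral one site at a time. -/
theorem aestronglyMeasurable_picardTerm (hσ : IsShiftAction μ σ) (hw : IsBddMeasurable w M)
    (hV : IsPotentialVersion μ P σ w M V) {b : Site d → ℝ} (hK : IsKernel (hopCoef h η) b)
    (φ : Ell2 d) (n : ℕ) : ∀ t : ℝ, 0 ≤ t → AEStronglyMeasurable[pastSpace Ω t.toNNReal]
      (picardTerm (waveGen hV hK) φ n t) (pathLaw μ P) := by
  have hL := isRandomGen_waveGen hV hK
  induction n with
  | zero => intro t _; exact aestronglyMeasurable_const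
  | succ n ih =>
    intro t ht
    refine aestronglyMeasurable_lp_of_apply fun x => ?_
    have hterm := stronglyMeasurable_picardTerm (φ := φ) hL n
    have hbd : ∀ s ∈ Set.Ioc 0 t, ∀ ω, ‖picardTerm (waveGen hV hK) φ n s ω‖
        ≤ ‖φ‖ * (((∑' ζ, b ζ + |M|) * t) ^ n / n.factorial) := fun s hs ω => by
      refine (norm_picardTerm_le hL n s ω).trans ?_
      rw [abs_of_pos hs.1]
      have := hs.1.le
      have := hL.nonneg
      gcongr
      exact hs.2
    set B := (∑' ζ, b ζ + |M|) * (‖φ‖ * (((∑' ζ, b ζ + |M|) * t) ^ n / n.factorial)) with hB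
    have hB0 : 0 ≤ B := by have := hL.nonneg; positivity
    set g : ℝ → RCPath Ω → ℂ := fun s ω => (Set.Ioc 0 t).indicator
      (fun s => waveGen hV hK s ω (picardTerm (waveGen hV hK) φ n s ω) x) s with hg
    have hgm : StronglyMeasurable (Function.uncurry g) := by
      have h1 : StronglyMeasurable fun p : ℝ × RCPath Ω =>
          waveGen hV hK p.1 p.2 (picardTerm (waveGen hV hK) φ n p.1 p.2) x :=
        (lp.evalCLM ℂ (fun _ : Site d => ℂ) 2 x).continuous.comp_stronglyMeasurable
          (hL.meas _ hterm)
      have h2 := h1.indicator (measurable_fst (measurableSet_Ioc (a := (0 : ℝ)) (b := t)))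
      exact h2
    have hgb : ∀ s ω, ‖g s ω‖ ≤ B := fun s ω => by
      by_cases hst : s ∈ Set.Ioc 0 t
      · rw [hg]
        simp only [Set.indicator_of_mem hst]
        refine (lp.norm_apply_le_norm (by norm_num) _ x).trans ((hL.norm_le s ω _).trans ?_)
        exact mul_le_mul_of_nonneg_left (hbd s hst ω) hL.nonneg
      · rw [hg]
        simpa only [Set.indicator_of_notMem hst, norm_zero] using hB0
    have hgp : ∀ᵐ s ∂(volume.restrict (Set.Ioc 0 t)),
        AEStronglyMeasurable[pastSpace Ω t.toNNReal] (g s) (pathLaw μ P) := by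
      have hsub : Set.Ioc 0 t ⊆ Set.Ici 0 := fun s hs => hs.1.le
      filter_upwards [ae_restrict_of_ae_restrict_of_subset hsub
        (aestronglyMeasurable_potGen hσ hw hV x), ae_restrict_mem measurableSet_Ioc] with s h1 hst
      have h2 := ih s hst.1.le
      refine AEStronglyMeasurable.mono (pastSpace_mono (Real.toNNReal_le_toNNReal hst.2)) ?_
      have e : g s = fun ω => hK.op id (picardTerm (waveGen hV hK) φ n s ω) x
          + -Complex.I * V x s ω * picardTerm (waveGen hV hK) φ n s ω x := by
        funext ω
        rw [hg]
        simp only [Set.indicator_of_mem hst]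
        rfl
      rw [e]
      have c1 : Continuous fun u : Ell2 d => hK.op id u x :=
        (lp.evalCLM ℂ (fun _ : Site d => ℂ) 2 x).continuous.comp (hK.op id).continuous
      have c2 : Continuous fun u : Ell2 d => u x :=
        (lp.evalCLM ℂ (fun _ : Site d => ℂ) 2 x).continuous
      exact (c1.comp_aestronglyMeasurable h2).add
        ((h1.const_mul _).mul (c2.comp_aestronglyMeasurable h2))
    have h3 := aestronglyMeasurable_integral_of_sub (pastSpace_le t.toNNReal) hgm hgb hgp
    refine h3.congr (.of_forall fun ω => ?_)
    have hint : IntegrableOn (fun s => waveGen hV hK s ω (picardTerm (waveGen hV hK) φ n s ω))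
        (Set.Ioc 0 t) := integrableOn_gen hL hterm hbd ω
    have h4 := ContinuousLinearMap.integral_comp_comm
      (lp.evalCLM ℂ (fun _ : Site d => ℂ) 2 x) hint
    refine Eq.trans ?_ h4
    refine setIntegral_congr_fun measurableSet_Ioc fun s hst => ?_
    rw [hg]
    simp only [Set.indicator_of_mem hst]
    rfl

theorem aestronglyMeasurable_picardSol (hσ : IsShiftAction μ σ) (hw : IsBddMeasurable w M)
    (hV : IsPotentialVersion μ P σ w M V) {b : Site d → ℝ} (hK : IsKernel (hopCoef h η) b)
    (φ : Ell2 d) {t : ℝ} (ht : 0 ≤ t) : AEStronglyMeasurable[pastSpace Ω t.toNNReal]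
      (picardSol (waveGen hV hK) φ t) (pathLaw μ P) := by
  refine aestronglyMeasurable_sub_of_tendsto (l := atTop)
    (f := fun (n : ℕ) ω => ∑ i ∈ Finset.range n, picardTerm (waveGen hV hK) φ i t ω) (fun n => ?_)
    fun ω => (hasSum_picardSol (isRandomGen_waveGen hV hK) t ω).tendsto_sum_nat
  induction n with
  | zero => simpa using aestronglyMeasurable_const
  | succ n ih =>
    simp only [Finset.sum_range_succ]
    exact AEStronglyMeasurable.add ih (aestronglyMeasurable_picardTerm hσ hw hV hK φ n t ht)

end Waves

/-! ### Exponential sums over the lattice. -/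

section LatticeSums

variable {d : ℕ}

theorem summable_exp_neg_abs_int {c : ℝ} (hc : 0 < c) :
    Summable fun n : ℤ => Real.exp (-(c * |(n : ℝ)|)) := by
  have h1 : Summable fun n : ℕ => Real.exp (-(c * n)) := by
    have := summable_geometric_of_lt_one (Real.exp_nonneg (-c)) 
      (Real.exp_lt_one_iff.2 (neg_lt_zero.2 hc))
    refine this.congr fun n => ?_
    rw [← Real.exp_nat_mul]; ring_nf
  refine Summable.of_nat_of_neg ?_ ?_
  · simpa using h1
  · simpa using h1

theorem sum_abs_le_mul_norm_toSpace (x : Site d) :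
    ∑ i, |(x i : ℝ)| ≤ d * ‖toSpace x‖ := by
  refine (Finset.sum_le_sum fun i _ => abs_apply_le_norm_toSpace x i).trans_eq ?_
  simp

/-- After comparison with the `ℓ¹` norm, at the price of a factor `d`, sums over boxes factor into
one-dimensional geometric series. -/
theorem summable_exp_neg_norm {c : ℝ} (hc : 0 < c) :
    Summable fun x : Site d => Real.exp (-(c * ‖toSpace x‖)) := by
  rcases Nat.eq_zero_or_pos d with rfl | hd
  · exact (hasSum_fintype _).summable
  have hd' : (0 : ℝ) < d := by exact_mod_cast hd
  have hf := summable_exp_neg_abs_int (div_pos hc hd')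
  refine summable_of_sum_le (c := ∏ _i : Fin d, ∑' n : ℤ, Real.exp (-(c / d * |(n : ℝ)|)))
    (fun x => Real.exp_nonneg _) fun F => ?_
  classical
  set G : Fin d → Finset ℤ := fun i => F.image fun x : Site d => x i with hG
  have hsub : F ⊆ Fintype.piFinset G := fun x hx =>
    Fintype.mem_piFinset.2 fun i => Finset.mem_image_of_mem _ hx
  calc ∑ x ∈ F, Real.exp (-(c * ‖toSpace x‖))
      ≤ ∑ x ∈ F, ∏ i, Real.exp (-(c / d * |(x i : ℝ)|)) := by
        refine Finset.sum_le_sum fun x _ => ?_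
        rw [← Real.exp_sum, Finset.sum_neg_distrib, ← Finset.mul_sum]
        refine Real.exp_le_exp.2 (neg_le_neg ?_)
        calc c / d * ∑ i, |(x i : ℝ)| ≤ c / d * (d * ‖toSpace x‖) := by
              gcongr; exact sum_abs_le_mul_norm_toSpace x
          _ = c * ‖toSpace x‖ := by field_simp
    _ ≤ ∑ x ∈ Fintype.piFinset G,
          ∏ i, Real.exp (-(c / d * |(x i : ℝ)|)) :=
        Finset.sum_le_sum_of_subset_of_nonneg hsub fun x _ _ =>
          Finset.prod_nonneg fun i _ => Real.exp_nonneg _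
    _ = ∏ i, ∑ n ∈ G i, Real.exp (-(c / d * |(n : ℝ)|)) :=
        (Finset.prod_univ_sum G fun _ n => Real.exp (-(c / d * |(n : ℝ)|))).symm
    _ ≤ _ := Finset.prod_le_prod (fun i _ => Finset.sum_nonneg fun _ _ => Real.exp_nonneg _)
        fun i _ => hf.sum_le_tsum _ fun _ _ => Real.exp_nonneg _

theorem exists_weighted {ψ₀ : Site d → ℂ} {ν C η : ℝ} (hη : 0 ≤ η) (hην : η < ν)
    (hψ : ∀ x : Site d, Real.exp (ν * ‖toSpace x‖) * ‖ψ₀ x‖ ≤ C) :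
    ∃ φ : Ell2 d, ∀ x, weightL d η hη φ x = ψ₀ x := by
  have hm : Memℓp (fun x : Site d => (Real.exp (η * ‖toSpace x‖) : ℂ) * ψ₀ x) 2 := by
    refine memℓp_gen ?_
    refine Summable.of_nonneg_of_le (fun x => by positivity) (fun x => ?_)
      ((summable_exp_neg_norm (d := d) (c := 2 * (ν - η)) (by linarith)).mul_left (C ^ 2))
    have h1 : ‖(Real.exp (η * ‖toSpace x‖) : ℂ) * ψ₀ x‖
        ≤ C * Real.exp (-((ν - η) * ‖toSpace x‖)) := by
      rw [norm_mul, Complex.norm_real, Real.norm_of_nonneg (Real.exp_nonneg _)]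
      have e : Real.exp (η * ‖toSpace x‖)
          = Real.exp (-((ν - η) * ‖toSpace x‖)) * Real.exp (ν * ‖toSpace x‖) := by
        rw [← Real.exp_add]; ring_nf
      rw [e, mul_assoc, mul_comm]
      exact mul_le_mul_of_nonneg_right (hψ x) (Real.exp_nonneg _)
    have e2 : Real.exp (-(2 * (ν - η) * ‖toSpace x‖))
        = Real.exp (-((ν - η) * ‖toSpace x‖)) ^ 2 := by
      rw [← Real.exp_nat_mul]; push_cast; ring_nf
    rw [e2, ← mul_pow]
    simpa using pow_le_pow_left₀ (norm_nonneg _) h1 2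
  refine ⟨⟨_, hm⟩, fun x => ?_⟩
  rw [weightL_apply]
  change (Real.exp (-(η * ‖toSpace x‖)) : ℂ) * ((Real.exp (η * ‖toSpace x‖) : ℂ) * ψ₀ x) = _
  rw [← mul_assoc, ← Complex.ofReal_mul, ← Real.exp_add]
  simp

end LatticeSums

/-! ### Pathwise existence and uniqueness. -/

section WaveSolution

variable {d : ℕ} {Ω : Type*} [TopologicalSpace Ω] [MeasurableSpace Ω] {μ : Measure Ω}
  {σ : Site d → Ω → Ω} {P : Kernel Ω (RCPath Ω)} {w : Ω → ℝ} {M : ℝ}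
  {V : Site d → ℝ → RCPath Ω → ℝ} {h : Site d → ℂ} {m η : ℝ}

/-- The right-hand side `-i (K u + V u)` of the Schrödinger equation. -/
def waveRhs (h : Site d → ℂ) (V : Site d → ℝ → RCPath Ω → ℝ) (s : ℝ) (ω : RCPath Ω)
    (u : Site d → ℂ) (x : Site d) : ℂ :=
  -Complex.I * (∑' ζ, h ζ * u (x - ζ) + V x s ω * u x)

/-- Random solutions of the Schrödinger equation with exponential decay. -/
structure IsWave (μ : Measure Ω) (P : Kernel Ω (RCPath Ω)) (h : Site d → ℂ)
    (V : Site d → ℝ → RCPath Ω → ℝ) (η : ℝ) (ψ₀ : Site d → ℂ)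
    (ψ : ℝ → RCPath Ω → Site d → ℂ) : Prop where
  meas : ∀ x, StronglyMeasurable fun p : ℝ × RCPath Ω => ψ p.1 p.2 x
  past : ∀ t, 0 ≤ t → ∀ x, AEStronglyMeasurable[pastSpace Ω t.toNNReal] (fun ω => ψ t ω x)
    (pathLaw μ P)
  bound : ∃ B C : ℝ, 0 ≤ B ∧ 0 ≤ C ∧ ∀ t ω x,
    ‖ψ t ω x‖ ≤ B * Real.exp (C * |t|) * Real.exp (-(η * ‖toSpace x‖))
  integrable : ∀ t, 0 ≤ t → ∀ ω x,
    IntegrableOn (fun s => waveRhs h V s ω (ψ s ω) x) (Set.Ioc 0 t)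
  eq : ∀ t, 0 ≤ t → ∀ ω x, ψ t ω x = ψ₀ x + ∫ s in Set.Ioc 0 t, waveRhs h V s ω (ψ s ω) x

/-- The solution with initial value `e^{-η|x|} φ(x)`. -/
def waveVec (hV : IsPotentialVersion μ P σ w M V) {b : Site d → ℝ}
    (hK : IsKernel (hopCoef h η) b) (hη : 0 ≤ η) (φ : Ell2 d) (t : ℝ) (ω : RCPath Ω) : Ell2 d :=
  weightL d η hη (picardSol (waveGen hV hK) φ t ω)

theorem weightL_waveGen (hV : IsPotentialVersion μ P σ w M V) {b : Site d → ℝ}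
    (hK : IsKernel (hopCoef h η) b) (hη : 0 ≤ η) (s : ℝ) (ω : RCPath Ω) (u : Ell2 d) (x : Site d) :
    weightL d η hη (waveGen hV hK s ω u) x = waveRhs h V s ω (weightL d η hη u) x := by
  rw [weightL_apply, waveGen, add_apply, lp.coeFn_add, Pi.add_apply, hK.op_apply, potGen_apply,
    waveRhs, mul_add, mul_add, ← tsum_mul_left, ← tsum_mul_left, weightL_apply]
  congr 1
  · refine tsum_congr fun ζ => ?_
    rw [weightL_apply, hopCoef]
    simp only [smul_apply, ContinuousLinearMap.id_apply, smul_eq_mul, id_eq]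
    have e : Real.exp (-(η * ‖toSpace (x - ζ)‖)) = Real.exp (-(η * ‖toSpace x‖))
        * Real.exp (η * (‖toSpace x‖ - ‖toSpace (x - ζ)‖)) := by
      rw [← Real.exp_add]; ring_nf
    rw [e]
    push_cast
    ring
  · ring

theorem waveGen_zero_apply (hV : IsPotentialVersion μ P σ w M V) {b : Site d → ℝ}
    (hK : IsKernel (hopCoef h 0) b) (s : ℝ) (ω : RCPath Ω) (u : Ell2 d) (x : Site d) :
    waveGen hV hK s ω u x = waveRhs h V s ω u x := by
  have h1 := weightL_waveGen hV hK le_rfl s ω u x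
  have h2 : ∀ u : Ell2 d, weightL d 0 le_rfl u = u := fun u => by
    ext x; rw [weightL_apply]; simp
  rwa [h2, h2] at h1

theorem setIntegral_waveVec (hV : IsPotentialVersion μ P σ w M V) {b : Site d → ℝ}
    (hK : IsKernel (hopCoef h η) b) (hη : 0 ≤ η) (φ : Ell2 d) {t : ℝ} (ht : 0 ≤ t) (ω : RCPath Ω)
    (x : Site d) :
    IntegrableOn (fun s => waveRhs h V s ω (waveVec hV hK hη φ s ω) x) (Set.Ioc 0 t) ∧
    waveVec hV hK hη φ t ω x = weightL d η hη φ x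
      + ∫ s in Set.Ioc 0 t, waveRhs h V s ω (waveVec hV hK hη φ s ω) x := by
  have hL := isRandomGen_waveGen hV hK
  set ev : Ell2 d →L[ℂ] ℂ := (lp.evalCLM ℂ (fun _ : Site d => ℂ) 2 x).comp (weightL d η hη)
  have hint := integrableOn_picardSol (φ := φ) hL t ω
  have e : (fun s => ev (waveGen hV hK s ω (picardSol (waveGen hV hK) φ s ω)))
      = fun s => waveRhs h V s ω (waveVec hV hK hη φ s ω) x := by
    funext s
    exact weightL_waveGen hV hK hη s ω _ x
  constructor
  · rw [← e]
    exact ev.integrable_comp hint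
  · rw [← e, ev.integral_comp_comm hint, waveVec, picardSol_eq hL ht ω, map_add]
    rfl

theorem isWave_waveVec [IsProbabilityMeasure μ] [IsMarkovKernel P] (hσ : IsShiftAction μ σ)
    (hw : IsBddMeasurable w M) (hV : IsPotentialVersion μ P σ w M V) {b : Site d → ℝ}
    (hK : IsKernel (hopCoef h η) b) (hη : 0 ≤ η) (φ : Ell2 d) :
    IsWave μ P h V η (weightL d η hη φ) fun t ω => waveVec hV hK hη φ t ω := by
  have hL := isRandomGen_waveGen hV hK
  have hc : ∀ x, Continuous fun u : Ell2 d => weightL d η hη u x := fun x =>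
    (lp.evalCLM ℂ (fun _ : Site d => ℂ) 2 x).continuous.comp (weightL d η hη).continuous
  refine ⟨fun x => (hc x).comp_stronglyMeasurable (stronglyMeasurable_picardSol hL),
    fun t ht x => (hc x).comp_aestronglyMeasurable
      (aestronglyMeasurable_picardSol hσ hw hV hK φ ht),
    ⟨‖φ‖, ∑' ζ, b ζ + |M|, norm_nonneg _, hL.nonneg, fun t ω x => ?_⟩,
    fun t ht ω x => (setIntegral_waveVec hV hK hη φ ht ω x).1,
    fun t ht ω x => (setIntegral_waveVec hV hK hη φ ht ω x).2⟩
  have h1 := norm_picardSol_le (φ := φ) hL t ω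
  simp only [waveVec, weightL_apply]
  rw [norm_mul, Complex.norm_real, Real.norm_of_nonneg (Real.exp_nonneg _), mul_comm]
  gcongr
  exact (lp.norm_apply_le_norm (by norm_num) _ x).trans h1

theorem continuous_waveVec (hV : IsPotentialVersion μ P σ w M V) {b : Site d → ℝ}
    (hK : IsKernel (hopCoef h η) b) (hη : 0 ≤ η) (φ : Ell2 d) (ω : RCPath Ω) :
    Continuous fun t : ℝ≥0 => waveVec hV hK hη φ t ω := by
  have hL := isRandomGen_waveGen hV hK
  refine (weightL d η hη).continuous.comp ?_
  have e : (fun t : ℝ≥0 => picardSol (waveGen hV hK) φ (t : ℝ) ω) = fun t : ℝ≥0 =>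
      φ + ∫ s in Set.Ioc 0 (t : ℝ), waveGen hV hK s ω (picardSol (waveGen hV hK) φ s ω) :=
    funext fun t => picardSol_eq hL t.2 ω
  rw [e]
  refine continuous_const.add (continuous_iff_continuousAt.2 fun t => ?_)
  have h1 := intervalIntegral.continuousOn_primitive (a := 0) (b := (t : ℝ) + 1) (μ := volume)
    (f := fun s => waveGen hV hK s ω (picardSol (waveGen hV hK) φ s ω))
    ((integrableOn_Icc_iff_integrableOn_Ioc).2 (integrableOn_picardSol hL _ ω))
  have h2 : ContinuousWithinAt _ _ (t : ℝ) := h1 (t : ℝ) ⟨t.2, by linarith⟩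
  have h3 : Tendsto (fun u : ℝ≥0 => (u : ℝ)) (𝓝 t) (𝓝[Set.Icc 0 ((t : ℝ) + 1)] (t : ℝ)) := by
    refine tendsto_nhdsWithin_iff.2 ⟨NNReal.continuous_coe.tendsto t, ?_⟩
    have : ∀ᶠ u : ℝ≥0 in 𝓝 t, (u : ℝ) < t + 1 :=
      NNReal.continuous_coe.continuousAt.eventually_lt continuousAt_const (by linarith)
    filter_upwards [this] with u hu using ⟨u.2, hu.le⟩
  exact h2.tendsto.comp h3

theorem neg_I_mul_hamiltonian {v₀ : Ω → ℝ} {ω : RCPath Ω} {x : Site d} {s : ℝ}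
    (hs : V x s ω = v₀ (σ x (ω.1 s.toNNReal))) (u : Ell2 d) :
    -Complex.I * hamiltonian h σ v₀ ω s.toNNReal u x = waveRhs h V s ω u x := by
  rw [hamiltonian, waveRhs, hs]
  congr 2
  rw [← (Equiv.subLeft x).tsum_eq]
  exact tsum_congr fun ζ => by simp

variable {v₀ : Ω → ℝ} {ω : RCPath Ω}

theorem isSolution_waveVec (hV : IsPotentialVersion μ P σ w M V) {b : Site d → ℝ}
    (hK : IsKernel (hopCoef h η) b) (hη : 0 ≤ η) (φ : Ell2 d)
    (hω : ∀ x, ∀ᵐ s ∂(volume.restrict (Set.Ici (0 : ℝ))), V x s ω = v₀ (σ x (ω.1 s.toNNReal))) :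
    IsSolution h σ v₀ ω (weightL d η hη φ) fun t => waveVec hV hK hη φ t ω := by
  have hsub : ∀ t : ℝ, Set.Ioc 0 t ⊆ Set.Ici 0 := fun t s hs => hs.1.le
  have hae : ∀ x (t : ℝ), ∀ᵐ s ∂(volume.restrict (Set.Ioc 0 t)),
      waveRhs h V s ω (waveVec hV hK hη φ s ω) x
      = -Complex.I * hamiltonian h σ v₀ ω s.toNNReal (waveVec hV hK hη φ s.toNNReal ω) x := by
    intro x t
    filter_upwards [ae_restrict_of_ae_restrict_of_subset (hsub t) (hω x),
      ae_restrict_mem measurableSet_Ioc] with s hs hst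
    rw [neg_I_mul_hamiltonian hs, Real.coe_toNNReal _ hst.1.le]
  refine ⟨continuous_waveVec hV hK hη φ ω, fun x t => ?_, fun x t => ?_⟩
  · refine (intervalIntegrable_iff_integrableOn_Ioc_of_le t.coe_nonneg).2 ?_
    have h1 := (setIntegral_waveVec hV hK hη φ t.2 ω x).1
    have h2 := (Integrable.congr h1 (hae x t)).const_mul Complex.I
    refine h2.congr (ae_of_all _ fun s => ?_)
    beta_reduce
    rw [← mul_assoc]; simp
  · refine (setIntegral_waveVec hV hK hη φ t.coe_nonneg ω x).2.trans ?_
    rw [intervalIntegral.integral_of_le t.coe_nonneg, integral_congr_ae (hae x t),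
      integral_const_mul]
    ring

/-- A given solution is only continuous in `ℓ²`, with no decay known, so uniqueness is proved for
the generator without weight, `η = 0`. -/
theorem IsSolution.eq_waveVec (hV : IsPotentialVersion μ P σ w M V) {b b₀ : Site d → ℝ}
    (hK : IsKernel (hopCoef h η) b) (hK0 : IsKernel (hopCoef h 0) b₀) (hη : 0 ≤ η) (φ : Ell2 d)
    (hω : ∀ x, ∀ᵐ s ∂(volume.restrict (Set.Ici (0 : ℝ))), V x s ω = v₀ (σ x (ω.1 s.toNNReal)))
    {ψ : ℝ≥0 → Ell2 d} (hψ : IsSolution h σ v₀ ω (weightL d η hη φ) ψ) (t : ℝ≥0) :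
    ψ t = waveVec hV hK hη φ t ω := by
  have hsol := isSolution_waveVec hV hK hη φ hω
  have hL := isRandomGen_waveGen hV hK0
  have hsub : ∀ t : ℝ, Set.Ioc 0 t ⊆ Set.Ici 0 := fun t s hs => hs.1.le
  -- every solution satisfies the integral equation in `ℓ²`
  have key : ∀ ψ : ℝ≥0 → Ell2 d, IsSolution h σ v₀ ω (weightL d η hη φ) ψ →
      ∀ t : ℝ, 0 ≤ t → IntegrableOn (fun s => waveGen hV hK0 s ω (ψ s.toNNReal)) (Set.Ioc 0 t) ∧
        ψ t.toNNReal = weightL d η hη φ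
          + ∫ s in Set.Ioc 0 t, waveGen hV hK0 s ω (ψ s.toNNReal) := by
    intro ψ hψ t ht
    have hc : Continuous fun s : ℝ => ψ s.toNNReal := hψ.continuous.comp continuous_real_toNNReal
    obtain ⟨B, hB⟩ := (isCompact_Icc (a := (0 : ℝ)) (b := t)).exists_bound_of_continuousOn
      hc.continuousOn
    have hint : IntegrableOn (fun s => waveGen hV hK0 s ω (ψ s.toNNReal)) (Set.Ioc 0 t) :=
      integrableOn_gen (U := fun p : ℝ × RCPath Ω => ψ p.1.toNNReal) hL
        (hc.stronglyMeasurable.comp_measurable measurable_fst)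
        (fun s hs _ => hB s ⟨hs.1.le, hs.2⟩) ω
    refine ⟨hint, ?_⟩
    ext x
    have h1 := hψ.equation x t.toNNReal
    rw [Real.coe_toNNReal _ ht, intervalIntegral.integral_of_le ht] at h1
    have h2 := ContinuousLinearMap.integral_comp_comm
      (lp.evalCLM ℂ (fun _ : Site d => ℂ) 2 x) hint
    have h3 : ∫ s in Set.Ioc 0 t, waveGen hV hK0 s ω (ψ s.toNNReal) x
        = ∫ s in Set.Ioc 0 t, -Complex.I * hamiltonian h σ v₀ ω s.toNNReal (ψ s.toNNReal) x := by
      refine integral_congr_ae ?_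
      filter_upwards [ae_restrict_of_ae_restrict_of_subset (hsub t) (hω x)] with s hs
      rw [neg_I_mul_hamiltonian hs, waveGen_zero_apply]
    rw [h1, lp.coeFn_add, Pi.add_apply]
    have h4 : (∫ s in Set.Ioc 0 t, waveGen hV hK0 s ω (ψ s.toNNReal)) x
        = ∫ s in Set.Ioc 0 t, waveGen hV hK0 s ω (ψ s.toNNReal) x := h2.symm
    rw [h4, h3, integral_const_mul]
    ring
  set δ : ℝ → Ell2 d := fun s => ψ s.toNNReal - waveVec hV hK hη φ (s.toNNReal : ℝ) ω with hδ
  have hc : Continuous δ := (hψ.continuous.comp continuous_real_toNNReal).sub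
    (hsol.continuous.comp continuous_real_toNNReal)
  obtain ⟨B, hB⟩ := (isCompact_Icc (a := (0 : ℝ)) (b := t)).exists_bound_of_continuousOn
    hc.continuousOn
  have h0 := eq_zero_of_integral_eq (L := fun s => waveGen hV hK0 s ω) (U := δ) hL.nonneg
    (fun s u => hL.norm_le s ω u) hB (fun s hs => ?_) (t := t) ⟨t.2, le_rfl⟩
  · rw [hδ] at h0
    simpa [sub_eq_zero] using h0
  · have k1 := key ψ hψ s hs.1
    have k2 := key _ hsol s hs.1
    have k3 := integral_sub k1.1 k2.1
    simp only [← map_sub] at k3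
    refine Eq.trans ?_ k3.symm
    refine (congrArg₂ (· - ·) k1.2 k2.2).trans ?_
    beta_reduce
    abel

end WaveSolution

/-! ### Time averages of the potential. -/

section Averages

variable {d : ℕ} {Ω : Type*} [TopologicalSpace Ω] [MeasurableSpace Ω] {μ : Measure Ω}
  {σ : Site d → Ω → Ω} {P : Kernel Ω (RCPath Ω)} {w : Ω → ℝ} {M : ℝ}
  {V : Site d → ℝ → RCPath Ω → ℝ} [IsProbabilityMeasure μ] [IsMarkovKernel P]

theorem integral_norm_le_norm_L2 {α : Type*} [MeasurableSpace α] {ν : Measure α}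
    [IsProbabilityMeasure ν] (G : Lp ℂ 2 ν) : ∫ a, ‖G a‖ ∂ν ≤ ‖G‖ := by
  rw [Lp.norm_def, integral_norm_eq_lintegral_enorm (Lp.aestronglyMeasurable G),
    ← eLpNorm_one_eq_lintegral_enorm]
  exact ENNReal.toReal_mono (Lp.eLpNorm_ne_top G)
    (eLpNorm_le_eLpNorm_of_exponent_le (by norm_num) (Lp.aestronglyMeasurable G))

theorem tendsto_integral_abs_eval_sub [BorelSpace Ω] (hP : IsMarkovProcess μ σ P)
    (hw : IsBddMeasurable w M) (t : ℝ≥0) :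
    Tendsto (fun u : ℝ => ∫ ω, |w (ω.1 (t + u.toNNReal)) - w (ω.1 t)| ∂(pathLaw μ P))
      (𝓝[>] 0) (𝓝 0) := by
  have hg : MemLp (fun a => (w a : ℂ)) 2 μ := memLp_of_measurable_bounded
    (Complex.measurable_ofReal.comp hw.measurable) (C := M) fun a => by simpa using hw.abs_le a
  refine squeeze_zero (fun u => integral_nonneg fun ω => abs_nonneg _) (fun u => ?_)
    ((tendsto_evalL2 hP (hg.toLp _) t).comp tendsto_toNNReal_nhdsGT_zero)
  refine le_trans (le_of_eq (integral_congr_ae ?_)) (integral_norm_le_norm_L2 _)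
  filter_upwards [Lp.coeFn_sub (evalL2 hP (t + u.toNNReal) (hg.toLp _)) (evalL2 hP t (hg.toLp _)),
    evalL2_toLp hP (t + u.toNNReal) hg, evalL2_toLp hP t hg] with ω h1 h2 h3
  rw [h1, Pi.sub_apply, h2, h3, ← Complex.ofReal_sub, Complex.norm_real, Real.norm_eq_abs]

/-- The time average of the potential over `(t, t + δ]`. -/
def potAvg (V : Site d → ℝ → RCPath Ω → ℝ) (x : Site d) (t δ : ℝ) (ω : RCPath Ω) : ℝ :=
  δ⁻¹ * ∫ s in Set.Ioc t (t + δ), V x s ω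

theorem integrableOn_potential (hV : IsPotentialVersion μ P σ w M V) (x : Site d) (s t : ℝ)
    (ω : RCPath Ω) : IntegrableOn (fun r => V x r ω) (Set.Ioc s t) :=
  Measure.integrableOn_of_bounded (M := M) (by simp)
    ((hV.meas x).comp measurable_prodMk_right).aestronglyMeasurable
    (ae_of_all _ fun r => hV.abs_le x r ω)

theorem measurable_potAvg (hV : IsPotentialVersion μ P σ w M V) (x : Site d) (t δ : ℝ) :
    Measurable (potAvg V x t δ) := by
  have h1 : StronglyMeasurable fun p : RCPath Ω × ℝ => V x p.2 p.1 :=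
    ((hV.meas x).comp measurable_swap).stronglyMeasurable
  exact (h1.integral_prod_right' (ν := volume.restrict (Set.Ioc t (t + δ)))).measurable.const_mul _

theorem abs_potAvg_le (hV : IsPotentialVersion μ P σ w M V) (x : Site d) (t : ℝ) {δ : ℝ}
    (hδ : 0 < δ) (ω : RCPath Ω) : |potAvg V x t δ ω| ≤ M := by
  have h1 : ‖∫ s in Set.Ioc t (t + δ), V x s ω‖ ≤ M * volume.real (Set.Ioc t (t + δ)) :=
    norm_setIntegral_le_of_norm_le_const (by simp) fun s _ => hV.abs_le x s ω
  rw [potAvg, abs_mul, abs_of_pos (inv_pos.2 hδ)]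
  rw [Real.norm_eq_abs, Real.volume_real_Ioc_of_le (by linarith), add_sub_cancel_left] at h1
  rw [inv_mul_le_iff₀ hδ]
  linarith

/-- `V` is a version only for almost every time, so its value at a given `t` says nothing. Its
averages over `(t, t + δ]` do converge in mean to `w(σ_x ω_t)`, by the right-continuity of `evalL2`.
-/
theorem tendsto_integral_abs_potAvg_sub [BorelSpace Ω] (hσ : IsShiftAction μ σ)
    (hP : IsMarkovProcess μ σ P) (hw : IsBddMeasurable w M) (hV : IsPotentialVersion μ P σ w M V)
    (x : Site d) {t : ℝ} (ht : 0 ≤ t) :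
    Tendsto (fun δ : ℝ => ∫ ω, |potAvg V x t δ ω - w (σ x (ω.1 t.toNNReal))| ∂(pathLaw μ P))
      (𝓝[>] 0) (𝓝 0) := by
  have hwx := hw.comp_shift hσ x
  have hlim := tendsto_integral_abs_eval_sub hP hwx t.toNNReal
  refine Metric.tendsto_nhdsWithin_nhds.2 fun ε hε => ?_
  obtain ⟨r, hr, hr'⟩ := Metric.tendsto_nhdsWithin_nhds.1 hlim (ε / 2) (half_pos hε)
  refine ⟨r, hr, fun {δ} hδ hδr => ?_⟩
  have hδ0 : 0 < δ := hδ
  rw [Real.dist_0_eq_abs, abs_of_nonneg (integral_nonneg fun ω => abs_nonneg _)]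
  rw [Real.dist_0_eq_abs, abs_of_pos hδ0] at hδr
  set I := Set.Ioc t (t + δ) with hI
  set W : RCPath Ω → ℝ := fun ω => w (σ x (ω.1 t.toNNReal)) with hWdef
  have hWm : Measurable W := hwx.measurable.comp (measurable_eval _)
  have hW : ∀ ω, |W ω| ≤ M := fun ω => hw.abs_le _
  have hvol : volume.real I = δ := by
    rw [hI, Real.volume_real_Ioc_of_le (by linarith)]; ring
  have h1 : ∀ ω, |potAvg V x t δ ω - W ω| ≤ δ⁻¹ * ∫ s in I, |V x s ω - W ω| := by
    intro ω
    have e : potAvg V x t δ ω - W ω = δ⁻¹ * ∫ s in I, (V x s ω - W ω) := by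
      rw [integral_sub (integrableOn_potential hV x _ _ ω) (integrable_const _), setIntegral_const,
        hvol, mul_sub, smul_eq_mul, inv_mul_cancel_left₀ hδ0.ne']
      rfl
    rw [e, abs_mul, abs_of_pos (inv_pos.2 hδ0)]
    exact mul_le_mul_of_nonneg_left abs_integral_le_integral_abs (inv_nonneg.2 hδ0.le)
  have hint : Integrable (fun p : RCPath Ω × ℝ => |V x p.2 p.1 - W p.1|)
      ((pathLaw μ P).prod (volume.restrict I)) := by
    have hm : Measurable fun p : RCPath Ω × ℝ => |V x p.2 p.1 - W p.1| :=
      (((hV.meas x).comp measurable_swap).sub (hWm.comp measurable_fst)).abs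
    refine (integrable_const (M + M)).mono' hm.aestronglyMeasurable (ae_of_all _ fun p => ?_)
    rw [Real.norm_eq_abs, abs_abs]
    exact (abs_sub _ _).trans (add_le_add (hV.abs_le x _ _) (hW _))
  have h2 : ∫ ω, |potAvg V x t δ ω - W ω| ∂(pathLaw μ P)
      ≤ δ⁻¹ * ∫ s in I, ∫ ω, |V x s ω - W ω| ∂(pathLaw μ P) := by
    rw [← integral_integral_swap hint, ← integral_const_mul]
    refine integral_mono_of_nonneg (ae_of_all _ fun ω => abs_nonneg _) ?_ (ae_of_all _ h1)
    exact hint.integral_prod_left.const_mul _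
  have h3 : ∀ᵐ s ∂(volume.restrict I), ∫ ω, |V x s ω - W ω| ∂(pathLaw μ P) ≤ ε / 2 := by
    have hsub : I ⊆ Set.Ici 0 := fun s hs => ht.trans hs.1.le
    filter_upwards [ae_restrict_of_ae_restrict_of_subset hsub (hV.ae_eq x),
      ae_restrict_mem measurableSet_Ioc] with s hs hsI
    have h4 := hr' (x := s - t) (sub_pos.2 hsI.1) (by
      rw [Real.dist_0_eq_abs, abs_of_pos (sub_pos.2 hsI.1)]; linarith [hsI.2])
    rw [Real.dist_0_eq_abs, abs_of_nonneg (integral_nonneg fun ω => abs_nonneg _),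
      ← Real.toNNReal_add ht (sub_pos.2 hsI.1).le, add_sub_cancel] at h4
    refine le_trans (le_of_eq (integral_congr_ae ?_)) h4.le
    filter_upwards [hs] with ω hω
    rw [hω]
  have h5 : ∫ s in I, ∫ ω, |V x s ω - W ω| ∂(pathLaw μ P) ≤ ∫ _ in I, ε / 2 :=
    integral_mono_of_nonneg (ae_of_all _ fun s => integral_nonneg fun ω => abs_nonneg _)
      (integrable_const _) h3
  rw [setIntegral_const, hvol, smul_eq_mul] at h5
  calc _ ≤ δ⁻¹ * (δ * (ε / 2)) := h2.trans (mul_le_mul_of_nonneg_left h5 (inv_nonneg.2 hδ0.le))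
    _ = ε / 2 := by rw [inv_mul_cancel_left₀ hδ0.ne']
    _ < ε := half_lt_self hε

end Averages

/-! ### Bounds and right derivatives of the waves. -/

section Rates

variable {d : ℕ} {Ω : Type*} [TopologicalSpace Ω] [MeasurableSpace Ω] {μ : Measure Ω}
  {σ : Site d → Ω → Ω} {P : Kernel Ω (RCPath Ω)} {w : Ω → ℝ} {M : ℝ}
  {V : Site d → ℝ → RCPath Ω → ℝ} [IsProbabilityMeasure μ] [IsMarkovKernel P]
  {h : Site d → ℂ} {m η : ℝ} {ψ₀ ψ₀' : Site d → ℂ} {ψ ψ' : ℝ → RCPath Ω → Site d → ℂ}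

/-- The decay profile `e^{-η|x|}`. -/
def decay (η : ℝ) (x : Site d) : ℝ := Real.exp (-(η * ‖toSpace x‖))

theorem decay_pos (η : ℝ) (x : Site d) : 0 < decay η x := Real.exp_pos _

theorem decay_sub_le (hη : 0 ≤ η) (hηm : η ≤ m) (x ζ : Site d) :
    decay η (x - ζ) ≤ Real.exp (m * ‖toSpace ζ‖) * decay η x := by
  rw [decay, decay, ← Real.exp_add]
  refine Real.exp_le_exp.2 ?_
  have h1 : ‖toSpace x‖ ≤ ‖toSpace (x - ζ)‖ + ‖toSpace ζ‖ := by
    rw [toSpace_sub]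
    simpa using norm_add_le (toSpace x - toSpace ζ) (toSpace ζ)
  nlinarith [mul_le_mul_of_nonneg_left h1 hη, mul_le_mul_of_nonneg_right hηm (norm_nonneg (toSpace ζ))]

/-- The total weight `∑ e^{m|ζ|} |h(ζ)|`. -/
def hopMass (h : Site d → ℂ) (m : ℝ) : ℝ := ∑' ζ : Site d, Real.exp (m * ‖toSpace ζ‖) * ‖h ζ‖

theorem hopMass_nonneg (h : Site d → ℂ) (m : ℝ) : 0 ≤ hopMass h m :=
  tsum_nonneg fun _ => by positivity

section Hop

variable {u : Site d → ℂ} {a : ℝ}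

theorem nonneg_of_norm_le_decay (hu : ∀ x, ‖u x‖ ≤ a * decay η x) : 0 ≤ a := by
  have := (norm_nonneg _).trans (hu 0)
  exact nonneg_of_mul_nonneg_left this (decay_pos η 0)

theorem norm_hop_le (hη : 0 ≤ η) (hηm : η ≤ m) (hu : ∀ x, ‖u x‖ ≤ a * decay η x) (x ζ : Site d) :
    ‖h ζ * u (x - ζ)‖ ≤ Real.exp (m * ‖toSpace ζ‖) * ‖h ζ‖ * (a * decay η x) := by
  have ha := nonneg_of_norm_le_decay hu
  rw [norm_mul]
  calc ‖h ζ‖ * ‖u (x - ζ)‖ ≤ ‖h ζ‖ * (a * (Real.exp (m * ‖toSpace ζ‖) * decay η x)) := by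
        gcongr
        exact (hu _).trans (mul_le_mul_of_nonneg_left (decay_sub_le hη hηm x ζ) ha)
    _ = _ := by ring

theorem summable_hop_mul (hs : Summable fun y : Site d => Real.exp (m * ‖toSpace y‖) * ‖h y‖)
    (hη : 0 ≤ η) (hηm : η ≤ m) (hu : ∀ x, ‖u x‖ ≤ a * decay η x) (x : Site d) :
    Summable fun ζ => h ζ * u (x - ζ) :=
  Summable.of_norm_bounded (hs.mul_right _) (norm_hop_le hη hηm hu x)

theorem norm_tsum_hop_le (hs : Summable fun y : Site d => Real.exp (m * ‖toSpace y‖) * ‖h y‖)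
    (hη : 0 ≤ η) (hηm : η ≤ m) (hu : ∀ x, ‖u x‖ ≤ a * decay η x) (x : Site d) :
    ‖∑' ζ, h ζ * u (x - ζ)‖ ≤ hopMass h m * (a * decay η x) :=
  tsum_of_norm_bounded (hs.hasSum.mul_right _) (norm_hop_le hη hηm hu x)

theorem norm_waveRhs_le (hs : Summable fun y : Site d => Real.exp (m * ‖toSpace y‖) * ‖h y‖)
    (hη : 0 ≤ η) (hηm : η ≤ m) (hu : ∀ x, ‖u x‖ ≤ a * decay η x)
    {s : ℝ} {ω : RCPath Ω} {x : Site d} (hV : |V x s ω| ≤ M) :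
    ‖waveRhs h V s ω u x‖ ≤ (hopMass h m + M) * (a * decay η x) := by
  rw [waveRhs, norm_mul, norm_neg, Complex.norm_I, one_mul, add_mul]
  refine (norm_add_le _ _).trans (add_le_add (norm_tsum_hop_le hs hη hηm hu x) ?_)
  rw [norm_mul, Complex.norm_real, Real.norm_eq_abs]
  exact mul_le_mul hV (hu x) (norm_nonneg _) ((abs_nonneg _).trans hV)

theorem waveRhs_sub (hs : Summable fun y : Site d => Real.exp (m * ‖toSpace y‖) * ‖h y‖)
    (hη : 0 ≤ η) (hηm : η ≤ m) (hu : ∀ x, ‖u x‖ ≤ a * decay η x) {u' : Site d → ℂ} {a' : ℝ}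
    (hu' : ∀ x, ‖u' x‖ ≤ a' * decay η x) (s : ℝ) (ω : RCPath Ω) (x : Site d) :
    waveRhs h V s ω u x - waveRhs h V s ω u' x = waveRhs h V s ω (fun x => u x - u' x) x := by
  have e := (summable_hop_mul hs hη hηm hu x).tsum_sub (summable_hop_mul hs hη hηm hu' x)
  simp only [← mul_sub] at e
  rw [waveRhs, waveRhs, waveRhs, e]
  ring

end Hop

/-- The right time derivative of a wave. -/
def waveRate (σ : Site d → Ω → Ω) (w : Ω → ℝ) (h : Site d → ℂ) (ψ : ℝ → RCPath Ω → Site d → ℂ)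
    (t : ℝ) (ω : RCPath Ω) (x : Site d) : ℂ :=
  waveRhs h (fun x s ω => w (σ x (ω.1 s.toNNReal))) t ω (ψ t ω) x

theorem IsWave.exists_bounds (hψ : IsWave μ P h V η ψ₀ ψ)
    (hV : IsPotentialVersion μ P σ w M V) (hM : 0 ≤ M)
    (hs : Summable fun y : Site d => Real.exp (m * ‖toSpace y‖) * ‖h y‖)
    (hη : 0 ≤ η) (hηm : η ≤ m) (T : ℝ) : ∃ A : ℝ, 0 ≤ A ∧
      (∀ t ∈ Set.Icc 0 T, ∀ ω x, ‖ψ t ω x‖ ≤ A * decay η x) ∧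
      ∀ s ∈ Set.Icc 0 T, ∀ t ∈ Set.Icc s T, ∀ ω x,
        ‖ψ t ω x - ψ s ω x‖ ≤ A * (t - s) * decay η x := by
  obtain ⟨B, C, hB, hC, hb⟩ := hψ.bound
  have hH := hopMass_nonneg h m
  set a := B * Real.exp (C * |T|)
  have ha : 0 ≤ a := by positivity
  have h1 : ∀ t ∈ Set.Icc 0 T, ∀ ω x, ‖ψ t ω x‖ ≤ a * decay η x := by
    intro t ht ω x
    refine (hb t ω x).trans ?_
    change B * Real.exp (C * |t|) * decay η x ≤ B * Real.exp (C * |T|) * decay η x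
    have := (decay_pos η x).le
    rw [abs_of_nonneg ht.1, abs_of_nonneg (ht.1.trans ht.2)]
    gcongr
    exact ht.2
  refine ⟨a + (hopMass h m + M) * a, by positivity, fun t ht ω x => (h1 t ht ω x).trans ?_,
    fun s hst t hts ω x => ?_⟩
  · have := (decay_pos η x).le
    gcongr
    exact le_add_of_nonneg_right (by positivity)
  · have ht0 := hst.1.trans hts.1
    have e : ψ t ω x - ψ s ω x = ∫ r in Set.Ioc s t, waveRhs h V r ω (ψ r ω) x := by
      rw [hψ.eq t ht0, hψ.eq s hst.1, add_sub_add_left_eq_sub, ← Set.Ioc_union_Ioc_eq_Ioc hst.1 hts.1,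
        setIntegral_union (Set.Ioc_disjoint_Ioc_of_le le_rfl) measurableSet_Ioc
          (hψ.integrable s hst.1 ω x)
          ((hψ.integrable t ht0 ω x).mono_set (Set.Ioc_subset_Ioc_left hst.1)), add_sub_cancel_left]
    have h2 : ‖∫ r in Set.Ioc s t, waveRhs h V r ω (ψ r ω) x‖
        ≤ ((hopMass h m + M) * (a * decay η x)) * volume.real (Set.Ioc s t) :=
      norm_setIntegral_le_of_norm_le_const (by simp) fun r hr =>
        norm_waveRhs_le hs hη hηm (h1 r ⟨hst.1.trans hr.1.le, hr.2.trans hts.2⟩ ω) (hV.abs_le x r ω)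
    rw [e]
    refine h2.trans ?_
    rw [Real.volume_real_Ioc_of_le hts.1]
    have := mul_nonneg (mul_nonneg ha (sub_nonneg.2 hts.1)) (decay_pos η x).le
    linarith

/-- Freezing the wave at `t` in the integral equation over `(t, t + δ]` gives the rate up to the
averaging error of the potential; unfreezing costs `O(δ)`. The constant is uniform in the path and
the decay in `x` is kept. -/
theorem IsWave.exists_rate_bound (hψ : IsWave μ P h V η ψ₀ ψ)
    (hw : IsBddMeasurable w M) (hV : IsPotentialVersion μ P σ w M V)
    (hs : Summable fun y : Site d => Real.exp (m * ‖toSpace y‖) * ‖h y‖)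
    (hη : 0 ≤ η) (hηm : η ≤ m) {t : ℝ} (ht : 0 ≤ t) : ∃ A : ℝ, 0 ≤ A ∧ ∀ ω x,
      ‖ψ t ω x‖ ≤ A * decay η x ∧ ‖waveRate σ w h ψ t ω x‖ ≤ A * decay η x ∧
      ∀ δ ∈ Set.Ioc (0 : ℝ) 1, ‖ψ (t + δ) ω x - ψ t ω x‖ ≤ A * δ * decay η x ∧
        ‖(δ : ℂ)⁻¹ * (ψ (t + δ) ω x - ψ t ω x) - waveRate σ w h ψ t ω x‖
          ≤ A * decay η x * (δ + |potAvg V x t δ ω - w (σ x (ω.1 t.toNNReal))|) := by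
  have hM : 0 ≤ M := hw.nonneg μ
  have hH := hopMass_nonneg h m
  obtain ⟨A, hA, h1, h2⟩ := hψ.exists_bounds hV hM hs hη hηm (t + 1)
  have htm : t ∈ Set.Icc 0 (t + 1) := ⟨ht, by linarith⟩
  have hA' : A ≤ A + (hopMass h m + M) * A := le_add_of_nonneg_right (by positivity)
  have hA'' : (hopMass h m + M) * A ≤ A + (hopMass h m + M) * A := le_add_of_nonneg_left hA
  refine ⟨A + (hopMass h m + M) * A, by positivity, fun ω x => ?_⟩
  have hE := (decay_pos η x).le
  refine ⟨(h1 t htm ω x).trans (by gcongr),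
    (norm_waveRhs_le (M := M) hs hη hηm (h1 t htm ω) (hw.abs_le _)).trans ?_,
    fun δ hδ => ⟨(h2 t htm (t + δ) ⟨by linarith [hδ.1], by linarith [hδ.2]⟩ ω x).trans ?_, ?_⟩⟩
  · rw [← mul_assoc]; gcongr
  · rw [add_sub_cancel_left]
    have := hδ.1
    gcongr
  have hδ0 := hδ.1
  have hvol : volume.real (Set.Ioc t (t + δ)) = δ := by
    rw [Real.volume_real_Ioc_of_le (by linarith)]; ring
  have hi1 : IntegrableOn (fun r => waveRhs h V r ω (ψ r ω) x) (Set.Ioc t (t + δ)) :=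
    (hψ.integrable (t + δ) (by linarith) ω x).mono_set (Set.Ioc_subset_Ioc_left ht)
  have hi3 : IntegrableOn (fun r => (V x r ω : ℂ)) (Set.Ioc t (t + δ)) :=
    (integrableOn_potential hV x _ _ ω).ofReal
  have hi2 : IntegrableOn (fun r => waveRhs h V r ω (ψ t ω) x) (Set.Ioc t (t + δ)) :=
    ((integrable_const _).add (hi3.mul_const _)).const_mul _
  have e1 : ψ (t + δ) ω x - ψ t ω x = ∫ r in Set.Ioc t (t + δ), waveRhs h V r ω (ψ r ω) x := by
    rw [hψ.eq (t + δ) (by linarith), hψ.eq t ht, add_sub_add_left_eq_sub,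
      ← Set.Ioc_union_Ioc_eq_Ioc ht (by linarith : t ≤ t + δ),
      setIntegral_union (Set.Ioc_disjoint_Ioc_of_le le_rfl) measurableSet_Ioc
        (hψ.integrable t ht ω x) hi1, add_sub_cancel_left]
  have e2 : ∫ r in Set.Ioc t (t + δ), waveRhs h V r ω (ψ t ω) x
      = (δ : ℂ) * (waveRate σ w h ψ t ω x
        + -Complex.I * ((potAvg V x t δ ω - w (σ x (ω.1 t.toNNReal)) : ℝ) * ψ t ω x)) := by
    have e3 : ∫ r in Set.Ioc t (t + δ), (V x r ω : ℂ) = δ * potAvg V x t δ ω := by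
      rw [integral_complex_ofReal, potAvg]
      push_cast
      rw [mul_inv_cancel_left₀ (by exact_mod_cast hδ0.ne')]
    simp only [waveRhs, waveRate]
    rw [integral_const_mul, integral_add (integrable_const _) (hi3.mul_const _), integral_mul_const,
      e3, setIntegral_const, hvol]
    push_cast
    rw [Complex.real_smul]
    ring
  have h3 : ‖∫ r in Set.Ioc t (t + δ), (waveRhs h V r ω (ψ r ω) x - waveRhs h V r ω (ψ t ω) x)‖
      ≤ ((hopMass h m + M) * (A * δ * decay η x)) * δ := by
    refine le_trans (norm_setIntegral_le_of_norm_le_const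
      (C := (hopMass h m + M) * (A * δ * decay η x)) (by simp) fun r hr => ?_) (by rw [hvol])
    have hrm : r ∈ Set.Icc 0 (t + 1) := ⟨ht.trans hr.1.le, by linarith [hr.2, hδ.2]⟩
    rw [waveRhs_sub hs hη hηm (h1 r hrm ω) (h1 t htm ω)]
    refine norm_waveRhs_le hs hη hηm (fun y => (h2 t htm r ⟨hr.1.le, hrm.2⟩ ω y).trans ?_)
      (hV.abs_le x r ω)
    have := (decay_pos η y).le
    gcongr
    linarith [hr.2]
  rw [integral_sub hi1 hi2, ← e1, e2] at h3
  set R := waveRate σ w h ψ t ω x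
  set D := ψ (t + δ) ω x - ψ t ω x
  set q : ℝ := potAvg V x t δ ω - w (σ x (ω.1 t.toNNReal))
  have hδc : (δ : ℂ) ≠ 0 := by exact_mod_cast hδ0.ne'
  have e4 : (δ : ℂ)⁻¹ * D - R = (δ : ℂ)⁻¹ * (D - δ * (R + -Complex.I * (q * ψ t ω x)))
      + -Complex.I * (q * ψ t ω x) := by
    field_simp
    ring
  rw [e4]
  refine (norm_add_le _ _).trans ?_
  have h4 : ‖(δ : ℂ)⁻¹ * (D - δ * (R + -Complex.I * (q * ψ t ω x)))‖
      ≤ (hopMass h m + M) * (A * δ * decay η x) := by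
    rw [norm_mul, norm_inv, Complex.norm_real, Real.norm_of_nonneg hδ0.le, inv_mul_le_iff₀ hδ0]
    linarith
  have h5 : ‖-Complex.I * (q * ψ t ω x)‖ ≤ |q| * (A * decay η x) := by
    rw [norm_mul, norm_neg, Complex.norm_I, one_mul, norm_mul, Complex.norm_real, Real.norm_eq_abs]
    gcongr
    exact h1 t htm ω x
  have h6 : 0 ≤ A * decay η x := by positivity
  have h7 : 0 ≤ (hopMass h m + M) * (A * decay η x) := by positivity
  nlinarith [mul_nonneg h6 hδ0.le, mul_nonneg h7 (abs_nonneg q)]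

end Rates

/-! ### Norm bounds and series in `L²`. -/

section BoundedSums

variable {α : Type*} [MeasurableSpace α] {ν : Measure α} [IsProbabilityMeasure ν]

theorem norm_le_of_ae_le {G : Lp ℂ 2 ν} {C : ℝ} (hC : 0 ≤ C) (h : ∀ᵐ a ∂ν, ‖G a‖ ≤ C) :
    ‖G‖ ≤ C := by
  have h1 := Lp.norm_le_of_ae_bound hC h
  have h2 : measureUnivNNReal ν = 1 := by simp [measureUnivNNReal]
  simpa [h2] using h1

/-- A uniform bound `b` upgrades smallness in mean to smallness in `L²`. -/
theorem norm_sq_le_mul_integral {G : Lp ℂ 2 ν} {Y : α → ℝ} {b : ℝ} (hG : ∀ᵐ a ∂ν, ‖G a‖ ≤ Y a)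
    (hY : Integrable Y ν) (hb : ∀ a, Y a ≤ b) : ‖G‖ ^ 2 ≤ b * ∫ a, Y a ∂ν := by
  have h1 : ‖G‖ ^ 2 = ∫ a, ‖G a‖ ^ 2 ∂ν := by
    have h2 := inner_self_eq_norm_sq_to_K (𝕜 := ℂ) G
    rw [L2.inner_def] at h2
    have h3 : ∀ a, inner ℂ (G a) (G a) = ((‖G a‖ ^ 2 : ℝ) : ℂ) := fun a => by
      rw [inner_self_eq_norm_sq_to_K]; simp
    simp only [h3] at h2
    rw [integral_complex_ofReal] at h2
    have h4 : ((∫ a, ‖G a‖ ^ 2 ∂ν : ℝ) : ℂ) = ((‖G‖ ^ 2 : ℝ) : ℂ) := by rw [h2]; simp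
    exact (Complex.ofReal_injective h4).symm
  rw [h1, ← integral_const_mul]
  refine integral_mono_of_nonneg (ae_of_all _ fun a => by positivity) (hY.const_mul b) ?_
  filter_upwards [hG] with a ha
  rw [sq]
  exact mul_le_mul (ha.trans (hb a)) ha (norm_nonneg _) ((norm_nonneg _).trans (ha.trans (hb a)))

theorem measurable_tsum_of_bounded {ι : Type*} [Countable ι] {g : ι → α → ℂ} {b : ι → ℝ}
    (hg : ∀ i, Measurable (g i)) (hb : Summable b) (hgb : ∀ i a, ‖g i a‖ ≤ b i) :
    Measurable fun a => ∑' i, g i a :=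
  (stronglyMeasurable_of_tendsto (atTop : Filter (Finset ι)) (f := fun F a => ∑ i ∈ F, g i a)
    (fun F => Finset.stronglyMeasurable_fun_sum F fun i _ => (hg i).stronglyMeasurable)
    (tendsto_pi_nhds.2 fun a => (Summable.of_norm_bounded hb fun i => hgb i a).hasSum)).measurable

theorem coeFn_tsum_ae_eq {ι : Type*} [Countable ι] {G : ι → Lp ℂ 2 ν} {g : ι → α → ℂ} {b : ι → ℝ}
    (hg : ∀ i, Measurable (g i)) (hb : Summable b) (hgb : ∀ i a, ‖g i a‖ ≤ b i)
    (hG : ∀ i, G i =ᵐ[ν] g i) : (∑' i, G i : Lp ℂ 2 ν) =ᵐ[ν] fun a => ∑' i, g i a := by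
  have hs : ∀ a, HasSum (fun i => g i a) (∑' i, g i a) := fun a =>
    (Summable.of_norm_bounded hb fun i => hgb i a).hasSum
  have hb0 : ∀ i, 0 ≤ b i := fun i => by
    obtain ⟨a⟩ := nonempty_of_isProbabilityMeasure ν
    exact (norm_nonneg _).trans (hgb i a)
  have hm : MemLp (fun a => ∑' i, g i a) 2 ν := memLp_of_measurable_bounded
    (measurable_tsum_of_bounded hg hb hgb) fun a => tsum_of_norm_bounded hb.hasSum (hgb · a)
  have h1 : HasSum G (hm.toLp _) := by
    refine tendsto_iff_norm_sub_tendsto_zero.2 (squeeze_zero (fun _ => norm_nonneg _) (fun F => ?_)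
      (tendsto_tsum_compl_atTop_zero b))
    refine norm_le_of_ae_le (tsum_nonneg fun _ => hb0 _) ?_
    have h2 : ∀ᵐ a ∂ν, ∀ i, G i a = g i a := ae_all_iff.2 hG
    have h3 : ∀ᵐ a ∂ν, (∑ i ∈ F, G i : Lp ℂ 2 ν) a = ∑ i ∈ F, G i a :=
      (Lp.coeFn_finsetSum F G).mono fun a ha => by rw [ha, Finset.sum_apply]
    filter_upwards [h2, h3, hm.coeFn_toLp, Lp.coeFn_sub (∑ i ∈ F, G i) (hm.toLp _)] with a e1 e2 e3 e4
    rw [e4, Pi.sub_apply, e2, e3, Finset.sum_congr rfl fun i _ => e1 i, norm_sub_rev,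
      ← (hs a).summable.sum_add_tsum_subtype_compl F, add_sub_cancel_left]
    exact tsum_of_norm_bounded (hb.subtype _).hasSum fun i => hgb i a
  rw [h1.tsum_eq]
  exact hm.coeFn_toLp

end BoundedSums

/-! ### Density matrices of pairs of waves. -/

section Pairs

variable {d : ℕ} {Ω : Type*} [TopologicalSpace Ω] [MeasurableSpace Ω] {μ : Measure Ω}
  {σ : Site d → Ω → Ω} {P : Kernel Ω (RCPath Ω)} {w : Ω → ℝ} {M : ℝ}
  {V : Site d → ℝ → RCPath Ω → ℝ} [IsProbabilityMeasure μ] [IsMarkovKernel P]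
  {h : Site d → ℂ} {m η : ℝ} {ψ₀ ψ₀' : Site d → ℂ} {ψ ψ' : ℝ → RCPath Ω → Site d → ℂ}

theorem IsWave.measurable (hψ : IsWave μ P h V η ψ₀ ψ) (t : ℝ) (x : Site d) :
    Measurable fun ω => ψ t ω x :=
  (hψ.meas x).measurable.comp measurable_prodMk_left

/-- The density matrix `ψ(z) conj ψ'(y)`. -/
def pairFn (ψ ψ' : ℝ → RCPath Ω → Site d → ℂ) (t : ℝ) (p : Site d × Site d) (ω : RCPath Ω) : ℂ :=
  ψ t ω p.1 * (starRingEnd ℂ) (ψ' t ω p.2)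

theorem IsWave.measurable_pairFn (hψ : IsWave μ P h V η ψ₀ ψ) (hψ' : IsWave μ P h V η ψ₀' ψ') (t : ℝ)
    (p : Site d × Site d) : Measurable (pairFn ψ ψ' t p) :=
  (hψ.measurable t p.1).mul (Complex.continuous_conj.measurable.comp (hψ'.measurable t p.2))

theorem IsWave.memLp_pairFn (hψ : IsWave μ P h V η ψ₀ ψ) (hψ' : IsWave μ P h V η ψ₀' ψ') (t : ℝ)
    (p : Site d × Site d) : MemLp (pairFn ψ ψ' t p) 2 (pathLaw μ P) := by
  obtain ⟨B, C, _, _, hb⟩ := hψ.bound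
  obtain ⟨B', C', _, _, hb'⟩ := hψ'.bound
  refine memLp_of_measurable_bounded (hψ.measurable_pairFn hψ' t p)
    (C := B * Real.exp (C * |t|) * Real.exp (-(η * ‖toSpace p.1‖))
      * (B' * Real.exp (C' * |t|) * Real.exp (-(η * ‖toSpace p.2‖)))) fun ω => ?_
  rw [pairFn, norm_mul, RCLike.norm_conj]
  exact mul_le_mul (hb t ω p.1) (hb' t ω p.2) (norm_nonneg _) ((norm_nonneg _).trans (hb t ω p.1))

/-- The density matrix as an element of `L²`. -/
def pairL2 (hψ : IsWave μ P h V η ψ₀ ψ) (hψ' : IsWave μ P h V η ψ₀' ψ') (t : ℝ)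
    (p : Site d × Site d) : Lp ℂ 2 (pathLaw μ P) := (hψ.memLp_pairFn hψ' t p).toLp _

theorem pairL2_coe (hψ : IsWave μ P h V η ψ₀ ψ) (hψ' : IsWave μ P h V η ψ₀' ψ') (t : ℝ)
    (p : Site d × Site d) : pairL2 hψ hψ' t p =ᵐ[pathLaw μ P] pairFn ψ ψ' t p :=
  MemLp.coeFn_toLp _

/-- The decay profile in two variables. -/
def decay₂ (η : ℝ) (p : Site d × Site d) : ℝ := decay η p.1 * decay η p.2

theorem decay₂_pos (η : ℝ) (p : Site d × Site d) : 0 < decay₂ η p :=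
  mul_pos (decay_pos _ _) (decay_pos _ _)

theorem IsWave.exists_pair_bounds (hψ : IsWave μ P h V η ψ₀ ψ) (hψ' : IsWave μ P h V η ψ₀' ψ')
    (hV : IsPotentialVersion μ P σ w M V) (hM : 0 ≤ M)
    (hs : Summable fun y : Site d => Real.exp (m * ‖toSpace y‖) * ‖h y‖)
    (hη : 0 ≤ η) (hηm : η ≤ m) (T : ℝ) : ∃ A : ℝ, 0 ≤ A ∧
      (∀ t ∈ Set.Icc 0 T, ∀ ω p, ‖pairFn ψ ψ' t p ω‖ ≤ A * decay₂ η p) ∧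
      ∀ s ∈ Set.Icc 0 T, ∀ t ∈ Set.Icc s T, ∀ ω p,
        ‖pairFn ψ ψ' t p ω - pairFn ψ ψ' s p ω‖ ≤ A * (t - s) * decay₂ η p := by
  obtain ⟨a, ha, h1, h2⟩ := hψ.exists_bounds hV hM hs hη hηm T
  obtain ⟨a', ha', h1', h2'⟩ := hψ'.exists_bounds hV hM hs hη hηm T
  refine ⟨2 * (a * a'), by positivity, fun t ht ω p => ?_, fun s hs t ht ω p => ?_⟩
  · have := mul_le_mul (h1 t ht ω p.1) (h1' t ht ω p.2) (norm_nonneg _)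
      (mul_nonneg ha (decay_pos _ _).le)
    rw [pairFn, norm_mul, RCLike.norm_conj]
    refine this.trans ?_
    rw [decay₂]
    have := mul_nonneg (mul_nonneg ha ha') (decay₂_pos η p).le
    rw [decay₂] at this
    linarith
  · have htT : t ∈ Set.Icc 0 T := ⟨hs.1.trans ht.1, ht.2⟩
    have e : pairFn ψ ψ' t p ω - pairFn ψ ψ' s p ω
        = (ψ t ω p.1 - ψ s ω p.1) * (starRingEnd ℂ) (ψ' t ω p.2)
          + ψ s ω p.1 * (starRingEnd ℂ) (ψ' t ω p.2 - ψ' s ω p.2) := by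
      simp only [pairFn, map_sub]; ring
    rw [e]
    refine (norm_add_le _ _).trans ?_
    rw [norm_mul, norm_mul, RCLike.norm_conj, RCLike.norm_conj]
    have k1 := mul_le_mul (h2 s hs t ht ω p.1) (h1' t htT ω p.2) (norm_nonneg _)
      (mul_nonneg (mul_nonneg ha (sub_nonneg.2 ht.1)) (decay_pos _ _).le)
    have k2 := mul_le_mul (h1 s hs ω p.1) (h2' s hs t ht ω p.2) (norm_nonneg _)
      (mul_nonneg ha (decay_pos _ _).le)
    rw [decay₂]
    linarith

theorem norm_pairL2_le (hψ : IsWave μ P h V η ψ₀ ψ) (hψ' : IsWave μ P h V η ψ₀' ψ') {t c : ℝ}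
    {p : Site d × Site d} (hc : ∀ ω, ‖pairFn ψ ψ' t p ω‖ ≤ c) : ‖pairL2 hψ hψ' t p‖ ≤ c := by
  obtain ⟨ω⟩ := nonempty_of_isProbabilityMeasure (pathLaw μ P)
  refine norm_le_of_ae_le ((norm_nonneg _).trans (hc ω)) ?_
  filter_upwards [pairL2_coe hψ hψ' t p] with ω hω
  rw [hω]; exact hc ω

theorem norm_pairL2_sub_le (hψ : IsWave μ P h V η ψ₀ ψ) (hψ' : IsWave μ P h V η ψ₀' ψ') {s t c : ℝ}
    {p : Site d × Site d} (hc : ∀ ω, ‖pairFn ψ ψ' t p ω - pairFn ψ ψ' s p ω‖ ≤ c) :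
    ‖pairL2 hψ hψ' t p - pairL2 hψ hψ' s p‖ ≤ c := by
  obtain ⟨ω⟩ := nonempty_of_isProbabilityMeasure (pathLaw μ P)
  refine norm_le_of_ae_le ((norm_nonneg _).trans (hc ω)) ?_
  filter_upwards [pairL2_coe hψ hψ' t p, pairL2_coe hψ hψ' s p,
    Lp.coeFn_sub (pairL2 hψ hψ' t p) (pairL2 hψ hψ' s p)] with ω h1 h2 h3
  rw [h3, Pi.sub_apply, h1, h2]; exact hc ω

/-- The potential difference `v_z - v_y` at a pair of sites. -/
theorem IsBddMeasurable.pair (hw : IsBddMeasurable w M) (hσ : IsShiftAction μ σ)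
    (p : Site d × Site d) : IsBddMeasurable (fun a => w (σ p.1 a) - w (σ p.2 a)) (M + M) :=
  (hw.comp_shift hσ p.1).sub (hw.comp_shift hσ p.2)

theorem IsBddMeasurable.eval {w : Ω → ℝ} (hw : IsBddMeasurable w M) (t : ℝ≥0) :
    IsBddMeasurable (fun ω : RCPath Ω => w (ω.1 t)) M :=
  ⟨hw.measurable.comp (measurable_eval t), fun _ => hw.abs_le _⟩

/-- The commutator of the Hamiltonian with a density matrix with values in a vector space. -/
def liouville {E : Type*} [NormedAddCommGroup E] [NormedSpace ℂ E] (h : Site d → ℂ)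
    (pot : Site d × Site d → E →L[ℂ] E) (F : Site d × Site d → E) (p : Site d × Site d) : E :=
  ∑' ζ, h ζ • F (p.1 - ζ, p.2) - ∑' ζ, (starRingEnd ℂ) (h ζ) • F (p.1, p.2 - ζ) + pot p (F p)

/-- The right time derivative of the density matrix in `L²`. -/
def rateL2 (hσ : IsShiftAction μ σ) (hw : IsBddMeasurable w M) (hψ : IsWave μ P h V η ψ₀ ψ)
    (hψ' : IsWave μ P h V η ψ₀' ψ') (t : ℝ) (p : Site d × Site d) : Lp ℂ 2 (pathLaw μ P) :=
  -(Complex.I • liouville h (fun p => ((hw.pair hσ p).eval t.toNNReal).mulL (pathLaw μ P))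
    (pairL2 hψ hψ' t) p)

theorem IsBddMeasurable.mulL_coe {α : Type*} [MeasurableSpace α] {ν : Measure α} {w : α → ℝ}
    (hw : IsBddMeasurable w M) (f : Lp ℂ 2 ν) : hw.mulL ν f =ᵐ[ν] fun a => w a * f a :=
  mulL2_coe f

/-- Identifies the commutator form of the rate with the product rule for `ψ(z) conj ψ'(y)`. The `L²`
sums over hops are dominated uniformly in the path, hence equal to the pointwise sums. -/
theorem rateL2_coe (hσ : IsShiftAction μ σ) (hw : IsBddMeasurable w M)
    (hV : IsPotentialVersion μ P σ w M V)
    (hs : Summable fun y : Site d => Real.exp (m * ‖toSpace y‖) * ‖h y‖)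
    (hη : 0 ≤ η) (hηm : η ≤ m) (hψ : IsWave μ P h V η ψ₀ ψ)
    (hψ' : IsWave μ P h V η ψ₀' ψ') {t : ℝ} (ht : 0 ≤ t) (p : Site d × Site d) :
    rateL2 hσ hw hψ hψ' t p =ᵐ[pathLaw μ P] fun ω =>
      waveRate σ w h ψ t ω p.1 * (starRingEnd ℂ) (ψ' t ω p.2)
        + ψ t ω p.1 * (starRingEnd ℂ) (waveRate σ w h ψ' t ω p.2) := by
  have hM : 0 ≤ M := hw.nonneg μ
  obtain ⟨a, ha, h1, -⟩ := hψ.exists_bounds hV hM hs hη hηm t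
  obtain ⟨a', ha', h1', -⟩ := hψ'.exists_bounds hV hM hs hη hηm t
  have htm : t ∈ Set.Icc 0 t := ⟨ht, le_rfl⟩
  have c1 : (∑' ζ, h ζ • pairL2 hψ hψ' t (p.1 - ζ, p.2) : Lp ℂ 2 (pathLaw μ P)) =ᵐ[pathLaw μ P]
      fun ω => ∑' ζ, h ζ * pairFn ψ ψ' t (p.1 - ζ, p.2) ω := by
    refine coeFn_tsum_ae_eq (fun ζ => (hψ.measurable_pairFn hψ' t _).const_mul _)
      (hs.mul_right (a * decay η p.1 * (a' * decay η p.2))) (fun ζ ω => ?_) fun ζ => ?_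
    · rw [pairFn, ← mul_assoc, norm_mul, RCLike.norm_conj, ← mul_assoc]
      exact mul_le_mul (norm_hop_le hη hηm (h1 t htm ω) p.1 ζ) (h1' t htm ω p.2) (norm_nonneg _)
        (by have := decay_pos η p.1; positivity)
    · filter_upwards [Lp.coeFn_smul (h ζ) (pairL2 hψ hψ' t (p.1 - ζ, p.2)),
        pairL2_coe hψ hψ' t (p.1 - ζ, p.2)] with ω e1 e2
      rw [e1, Pi.smul_apply, e2, smul_eq_mul]
  have c2 : (∑' ζ, (starRingEnd ℂ) (h ζ) • pairL2 hψ hψ' t (p.1, p.2 - ζ) :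
      Lp ℂ 2 (pathLaw μ P)) =ᵐ[pathLaw μ P]
      fun ω => ∑' ζ, (starRingEnd ℂ) (h ζ) * pairFn ψ ψ' t (p.1, p.2 - ζ) ω := by
    refine coeFn_tsum_ae_eq (fun ζ => (hψ.measurable_pairFn hψ' t _).const_mul _)
      (hs.mul_right (a' * decay η p.2 * (a * decay η p.1))) (fun ζ ω => ?_) fun ζ => ?_
    · have e : ‖(starRingEnd ℂ) (h ζ) * pairFn ψ ψ' t (p.1, p.2 - ζ) ω‖
          = ‖h ζ * ψ' t ω (p.2 - ζ)‖ * ‖ψ t ω p.1‖ := by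
        simp only [pairFn, norm_mul, RCLike.norm_conj]; ring
      rw [e, ← mul_assoc]
      exact mul_le_mul (norm_hop_le hη hηm (h1' t htm ω) p.2 ζ) (h1 t htm ω p.1) (norm_nonneg _)
        (by have := decay_pos η p.2; positivity)
    · filter_upwards [Lp.coeFn_smul ((starRingEnd ℂ) (h ζ)) (pairL2 hψ hψ' t (p.1, p.2 - ζ)),
        pairL2_coe hψ hψ' t (p.1, p.2 - ζ)] with ω e1 e2
      rw [e1, Pi.smul_apply, e2, smul_eq_mul]
  have c3 := ((hw.pair hσ p).eval t.toNNReal).mulL_coe (pairL2 hψ hψ' t p)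
  rw [rateL2, liouville]
  set X := (∑' ζ, h ζ • pairL2 hψ hψ' t (p.1 - ζ, p.2) : Lp ℂ 2 (pathLaw μ P))
  set Y := (∑' ζ, (starRingEnd ℂ) (h ζ) • pairL2 hψ hψ' t (p.1, p.2 - ζ) : Lp ℂ 2 (pathLaw μ P))
  set Z := ((hw.pair hσ p).eval t.toNNReal).mulL (pathLaw μ P) (pairL2 hψ hψ' t p)
  filter_upwards [c1, c2, c3, pairL2_coe hψ hψ' t p, Lp.coeFn_neg (Complex.I • (X - Y + Z)),
    Lp.coeFn_smul Complex.I (X - Y + Z), Lp.coeFn_add (X - Y) Z, Lp.coeFn_sub X Y]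
    with ω e1 e2 e3 e4 e5 e6 e7 e8
  rw [e5, Pi.neg_apply, e6, Pi.smul_apply, e7, Pi.add_apply, e8, Pi.sub_apply, e1, e2, e3, e4]
  simp only [waveRate, waveRhs, pairFn, map_mul, map_neg, Complex.conj_I, map_add,
    Complex.conj_tsum, Complex.conj_ofReal, smul_eq_mul]
  have t1 : ∑' ζ, h ζ * (ψ t ω (p.1 - ζ) * (starRingEnd ℂ) (ψ' t ω p.2))
      = (∑' ζ, h ζ * ψ t ω (p.1 - ζ)) * (starRingEnd ℂ) (ψ' t ω p.2) := by
    rw [← tsum_mul_right]; exact tsum_congr fun ζ => by ring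
  have t2 : ∑' ζ, (starRingEnd ℂ) (h ζ) * (ψ t ω p.1 * (starRingEnd ℂ) (ψ' t ω (p.2 - ζ)))
      = ψ t ω p.1 * ∑' ζ, (starRingEnd ℂ) (h ζ) * (starRingEnd ℂ) (ψ' t ω (p.2 - ζ)) := by
    rw [← tsum_mul_left]; exact tsum_congr fun ζ => by ring
  rw [t1, t2]
  push_cast
  ring

end Pairs

/-! ### The commutator on exponentially decaying density matrices. -/

section Liouville

variable {d : ℕ} {E E' : Type*} [NormedAddCommGroup E] [NormedSpace ℂ E] [CompleteSpace E]
  [NormedAddCommGroup E'] [NormedSpace ℂ E'] {h : Site d → ℂ} {m η A : ℝ}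
  {F : Site d × Site d → E}

theorem norm_hop_left_le (hη : 0 ≤ η) (hηm : η ≤ m) (hF : ∀ p, ‖F p‖ ≤ A * decay₂ η p)
    (p : Site d × Site d) (ζ : Site d) : ‖h ζ • F (p.1 - ζ, p.2)‖
      ≤ Real.exp (m * ‖toSpace ζ‖) * ‖h ζ‖ * (A * decay₂ η p) := by
  have hA : 0 ≤ A := nonneg_of_mul_nonneg_left ((norm_nonneg _).trans (hF 0)) (decay₂_pos η 0)
  have := (decay_pos η p.2).le
  rw [norm_smul]
  calc ‖h ζ‖ * ‖F (p.1 - ζ, p.2)‖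
      ≤ ‖h ζ‖ * (A * ((Real.exp (m * ‖toSpace ζ‖) * decay η p.1) * decay η p.2)) := by
        gcongr
        refine (hF _).trans ?_
        rw [decay₂]
        gcongr
        exact decay_sub_le hη hηm _ _
    _ = _ := by rw [decay₂]; ring

theorem norm_hop_right_le (hη : 0 ≤ η) (hηm : η ≤ m) (hF : ∀ p, ‖F p‖ ≤ A * decay₂ η p)
    (p : Site d × Site d) (ζ : Site d) : ‖(starRingEnd ℂ) (h ζ) • F (p.1, p.2 - ζ)‖
      ≤ Real.exp (m * ‖toSpace ζ‖) * ‖h ζ‖ * (A * decay₂ η p) := by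
  have := norm_hop_left_le (h := h) (F := fun q => F q.swap) (A := A) hη hηm
    (fun q => (hF _).trans_eq (by simp [decay₂, mul_comm])) p.swap ζ
  rw [norm_smul] at this ⊢
  rw [RCLike.norm_conj]
  refine this.trans_eq ?_
  simp only [decay₂, Prod.fst_swap, Prod.snd_swap]
  ring

theorem map_liouville (hs : Summable fun y : Site d => Real.exp (m * ‖toSpace y‖) * ‖h y‖)
    (hη : 0 ≤ η) (hηm : η ≤ m) (hF : ∀ p, ‖F p‖ ≤ A * decay₂ η p)
    (pot : Site d × Site d → E →L[ℂ] E) (T : E →L[ℂ] E') (p : Site d × Site d) :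
    T (liouville h pot F p) = ∑' ζ, h ζ • T (F (p.1 - ζ, p.2))
      - ∑' ζ, (starRingEnd ℂ) (h ζ) • T (F (p.1, p.2 - ζ)) + T (pot p (F p)) := by
  have s1 : Summable fun ζ => h ζ • F (p.1 - ζ, p.2) :=
    Summable.of_norm_bounded (hs.mul_right _) (norm_hop_left_le hη hηm hF p)
  have s2 : Summable fun ζ => (starRingEnd ℂ) (h ζ) • F (p.1, p.2 - ζ) :=
    Summable.of_norm_bounded (hs.mul_right _) (norm_hop_right_le hη hηm hF p)
  rw [liouville, map_add, map_sub, T.map_tsum s1, T.map_tsum s2]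
  simp only [map_smul]

end Liouville

/-! ### The closed equation for conditioned density matrices. -/

section Correlations

variable {d : ℕ} {Ω : Type*} [TopologicalSpace Ω] [MeasurableSpace Ω] {μ : Measure Ω}
  {σ : Site d → Ω → Ω} {P : Kernel Ω (RCPath Ω)} {w : Ω → ℝ} {M : ℝ}
  {V : Site d → ℝ → RCPath Ω → ℝ} [IsProbabilityMeasure μ] [IsMarkovKernel P]
  {h : Site d → ℂ} {m η : ℝ} {ψ₀ ψ₀' : Site d → ℂ} {ψ ψ' : ℝ → RCPath Ω → Site d → ℂ}

theorem aestronglyMeasurable_pairFn (hψ : IsWave μ P h V η ψ₀ ψ) (hψ' : IsWave μ P h V η ψ₀' ψ')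
    {t : ℝ} (ht : 0 ≤ t) (p : Site d × Site d) :
    AEStronglyMeasurable[pastSpace Ω t.toNNReal] (pairFn ψ ψ' t p) (pathLaw μ P) :=
  (hψ.past t ht p.1).mul (Complex.continuous_conj.comp_aestronglyMeasurable (hψ'.past t ht p.2))

theorem pastDep_of_memLp (hP : IsMarkovProcess μ σ P) {s : ℝ≥0} {G : Lp ℂ 2 (pathLaw μ P)}
    {g : RCPath Ω → ℂ} (hg : AEStronglyMeasurable[pastSpace Ω s] g (pathLaw μ P))
    (hG : G =ᵐ[pathLaw μ P] g) {b : ℝ} (hb : ∀ ω, ‖g ω‖ ≤ b) : PastDep μ P s G :=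
  (pastDep_of_aestronglyMeasurable hP hg (ae_of_all _ hb)).congr hG.symm

/-- The conditional expectation of the density matrix. -/
def corrL2 (hP : IsMarkovProcess μ σ P) (hψ : IsWave μ P h V η ψ₀ ψ)
    (hψ' : IsWave μ P h V η ψ₀' ψ') (t : ℝ) (p : Site d × Site d) : Lp ℂ 2 μ :=
  condL2 hP t.toNNReal (pairL2 hψ hψ' t p)

variable (hσ : IsShiftAction μ σ) (hP : IsMarkovProcess μ σ P) (hw : IsBddMeasurable w M)
  (hV : IsPotentialVersion μ P σ w M V)
  (hs : Summable fun y : Site d => Real.exp (m * ‖toSpace y‖) * ‖h y‖)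
  (hη : 0 ≤ η) (hηm : η ≤ m)
  (hψ : IsWave μ P h V η ψ₀ ψ) (hψ' : IsWave μ P h V η ψ₀' ψ')

theorem condL2_mulL (hw : IsBddMeasurable w M) (t : ℝ≥0) (G : Lp ℂ 2 (pathLaw μ P)) :
    condL2 hP t ((hw.eval t).mulL (pathLaw μ P) G) = hw.mulL μ (condL2 hP t G) :=
  condL2_mulL2 hP t (Complex.measurable_ofReal.comp hw.measurable)
    (fun a => by simpa using hw.abs_le a) G

theorem condL2_rateL2 (hV : IsPotentialVersion μ P σ w M V)
    (hs : Summable fun y : Site d => Real.exp (m * ‖toSpace y‖) * ‖h y‖)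
    (hη : 0 ≤ η) (hηm : η ≤ m) {t : ℝ} (ht : 0 ≤ t) (p : Site d × Site d) :
    condL2 hP t.toNNReal (rateL2 hσ hw hψ hψ' t p)
      = -(Complex.I • liouville h (fun p => (hw.pair hσ p).mulL μ) (corrL2 hP hψ hψ' t) p) := by
  obtain ⟨A, hA, h1, -⟩ := hψ.exists_pair_bounds hψ' hV (hw.nonneg μ) hs hη hηm t
  rw [rateL2, map_neg, map_smul, map_liouville hs hη hηm
    (fun q => norm_pairL2_le hψ hψ' fun ω => h1 t ⟨ht, le_rfl⟩ ω q),
    condL2_mulL hP (hw.pair hσ p)]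
  rfl

/-- The density matrix at `t` is a function of the past of `t`, so by the Markov property
conditioning later by `u` applies the semigroup for a time `u`. -/
theorem condL2_add_pairL2 {t : ℝ} (ht : 0 ≤ t) (u : ℝ≥0) (p : Site d × Site d) :
    condL2 hP (t.toNNReal + u) (pairL2 hψ hψ' t p)
      = backwardSemigroup hP u (corrL2 hP hψ hψ' t p) := by
  obtain ⟨B, C, hB, hC, hb⟩ := hψ.bound
  obtain ⟨B', C', hB', hC', hb'⟩ := hψ'.bound
  refine PastDep.condL2_add hP u (pastDep_of_memLp hP (aestronglyMeasurable_pairFn hψ hψ' ht p)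
    (pairL2_coe hψ hψ' t p) (b := B * Real.exp (C * |t|) * Real.exp (-(η * ‖toSpace p.1‖))
      * (B' * Real.exp (C' * |t|) * Real.exp (-(η * ‖toSpace p.2‖)))) fun ω => ?_)
  rw [pairFn, norm_mul, RCLike.norm_conj]
  exact mul_le_mul (hb t ω p.1) (hb' t ω p.2) (norm_nonneg _) ((norm_nonneg _).trans (hb t ω p.1))

theorem condL2_add_rateL2 (hV : IsPotentialVersion μ P σ w M V)
    (hs : Summable fun y : Site d => Real.exp (m * ‖toSpace y‖) * ‖h y‖)
    (hη : 0 ≤ η) (hηm : η ≤ m) {t : ℝ} (ht : 0 ≤ t) (u : ℝ≥0) (p : Site d × Site d) :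
    condL2 hP (t.toNNReal + u) (rateL2 hσ hw hψ hψ' t p)
      = backwardSemigroup hP u (condL2 hP t.toNNReal (rateL2 hσ hw hψ hψ' t p)) := by
  obtain ⟨A, hA, h1, -⟩ := hψ.exists_pair_bounds hψ' hV (hw.nonneg μ) hs hη hηm t
  have hb : ∀ q ω, ‖pairFn ψ ψ' t q ω‖ ≤ A * decay₂ η q := fun q ω => h1 t ⟨ht, le_rfl⟩ ω q
  have hF : ∀ q, ‖pairL2 hψ hψ' t q‖ ≤ A * decay₂ η q := fun q => norm_pairL2_le hψ hψ' (hb q)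
  rw [rateL2, map_neg, map_smul, map_neg, map_neg, map_smul, map_smul,
    map_liouville hs hη hηm hF,
    ← ContinuousLinearMap.comp_apply (backwardSemigroup hP u), map_liouville hs hη hηm hF]
  congr 3
  · simp only [condL2_add_pairL2 hP hψ hψ' ht u]
    rfl
  · have hwp := (hw.pair hσ p).eval t.toNNReal
    refine PastDep.condL2_add hP u (pastDep_of_memLp hP (b := (M + M) * (A * decay₂ η p))
      (g := fun ω => (w (σ p.1 (ω.1 t.toNNReal)) - w (σ p.2 (ω.1 t.toNNReal)) : ℝ)
        * pairFn ψ ψ' t p ω) ?_ ?_ fun ω => ?_)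
    · refine AEStronglyMeasurable.mul ?_ (aestronglyMeasurable_pairFn hψ hψ' ht p)
      exact ((Complex.measurable_ofReal.comp ((hw.pair hσ p).measurable.comp
        (measurable_eval_past le_rfl))).stronglyMeasurable).aestronglyMeasurable
    · filter_upwards [hwp.mulL_coe (pairL2 hψ hψ' t p), pairL2_coe hψ hψ' t p] with ω e1 e2
      rw [e1, e2]
    · rw [norm_mul, Complex.norm_real, Real.norm_eq_abs]
      exact mul_le_mul (hwp.abs_le ω) (hb p ω) (norm_nonneg _)
        ((abs_nonneg _).trans (hwp.abs_le ω))

theorem norm_corrL2_sub_le {s t c : ℝ} (hs0 : 0 ≤ s) (hst : s ≤ t) {p : Site d × Site d}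
    (hc : ∀ ω, ‖pairFn ψ ψ' t p ω - pairFn ψ ψ' s p ω‖ ≤ c) :
    ‖corrL2 hP hψ hψ' t p - backwardSemigroup hP (t - s).toNNReal (corrL2 hP hψ hψ' s p)‖ ≤ c := by
  have e : t.toNNReal = s.toNNReal + (t - s).toNNReal := by
    rw [← Real.toNNReal_add hs0 (sub_nonneg.2 hst), add_sub_cancel]
  rw [← condL2_add_pairL2 hP hψ hψ' hs0, corrL2, e, ← map_sub]
  exact (norm_condL2_le hP _ _).trans (norm_pairL2_sub_le hψ hψ' hc)

theorem tendsto_corrL2 [BorelSpace Ω] (hV : IsPotentialVersion μ P σ w M V)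
    (hs : Summable fun y : Site d => Real.exp (m * ‖toSpace y‖) * ‖h y‖)
    (hη : 0 ≤ η) (hηm : η ≤ m) {t : ℝ} (ht : 0 ≤ t) (p : Site d × Site d) :
    Tendsto (fun δ : ℝ => δ⁻¹ • (corrL2 hP hψ hψ' (t + δ) p
        - backwardSemigroup hP δ.toNNReal (corrL2 hP hψ hψ' t p))) (𝓝[>] 0)
      (𝓝 (-(Complex.I • liouville h (fun p => (hw.pair hσ p).mulL μ) (corrL2 hP hψ hψ' t) p))) := by
  have hM : 0 ≤ M := hw.nonneg μ
  obtain ⟨A, hA, hb⟩ := hψ.exists_rate_bound hw hV hs hη hηm ht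
  obtain ⟨A', hA', hb'⟩ := hψ'.exists_rate_bound hw hV hs hη hηm ht
  rw [← condL2_rateL2 hσ hP hw hψ hψ' hV hs hη hηm ht p]
  set R := rateL2 hσ hw hψ hψ' t p with hR
  set G : ℝ → Lp ℂ 2 (pathLaw μ P) := fun δ =>
    (δ : ℂ)⁻¹ • (pairL2 hψ hψ' (t + δ) p - pairL2 hψ hψ' t p) - R with hG
  -- Both terms on the left are conditionings at time `t + δ`, of the density matrices at `t + δ`
  -- and at `t`. Only the wave has to be differentiated; the motion of the noise is carried by the
  -- semigroup.
  have e : ∀ δ : ℝ, 0 < δ → δ⁻¹ • (corrL2 hP hψ hψ' (t + δ) p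
        - backwardSemigroup hP δ.toNNReal (corrL2 hP hψ hψ' t p))
      = condL2 hP (t.toNNReal + δ.toNNReal) (G δ)
        + backwardSemigroup hP δ.toNNReal (condL2 hP t.toNNReal R) := by
    intro δ hδ
    rw [← condL2_add_pairL2 hP hψ hψ' ht, ← condL2_add_rateL2 hσ hP hw hψ hψ' hV hs hη hηm ht,
      ← map_add, hG, ← hR]
    simp only [sub_add_cancel]
    rw [map_smul, map_sub, corrL2, Real.toNNReal_add ht hδ.le, ← Complex.ofReal_inv]
    exact RCLike.real_smul_eq_coe_smul (K := ℂ) _ _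
  have hlim2 : Tendsto (fun δ : ℝ => backwardSemigroup hP δ.toNNReal (condL2 hP t.toNNReal R))
      (𝓝[>] 0) (𝓝 (condL2 hP t.toNNReal R)) :=
    (tendsto_backwardSemigroup hP _).comp tendsto_toNNReal_nhdsGT_zero
  set q : Site d → ℝ → RCPath Ω → ℝ := fun x δ ω =>
    |potAvg V x t δ ω - w (σ x (ω.1 t.toNNReal))| with hq
  have hqm : ∀ x δ, Measurable (q x δ) := fun x δ =>
    ((measurable_potAvg hV x t δ).sub ((hw.comp_shift hσ x).measurable.comp (measurable_eval _))).abs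
  have hq0 : ∀ x δ ω, 0 ≤ q x δ ω := fun x δ ω => abs_nonneg _
  have hqb : ∀ x, ∀ δ > 0, ∀ ω, q x δ ω ≤ M + M := fun x δ hδ ω =>
    (abs_sub _ _).trans (add_le_add (abs_potAvg_le hV x t hδ ω) (hw.abs_le _))
  have hqi : ∀ x, ∀ δ > 0, Integrable (q x δ) (pathLaw μ P) := fun x δ hδ =>
    (integrable_const (M + M)).mono' (hqm x δ).aestronglyMeasurable (ae_of_all _ fun ω => by
      rw [Real.norm_of_nonneg (hq0 _ _ _)]; exact hqb x δ hδ ω)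
  set K := 3 * (A * A') * decay₂ η p with hK
  have hK0 : 0 ≤ K := by have := (decay₂_pos η p).le; positivity
  have hle : ∀ δ ∈ Set.Ioc (0 : ℝ) 1, ∀ᵐ ω ∂(pathLaw μ P),
      ‖G δ ω‖ ≤ K * (δ + q p.1 δ ω + q p.2 δ ω) := by
    intro δ hδ
    have hδ0 := hδ.1
    filter_upwards [rateL2_coe hσ hw hV hs hη hηm hψ hψ' ht p, pairL2_coe hψ hψ' (t + δ) p,
      pairL2_coe hψ hψ' t p, Lp.coeFn_sub (pairL2 hψ hψ' (t + δ) p) (pairL2 hψ hψ' t p),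
      Lp.coeFn_smul (δ : ℂ)⁻¹ (pairL2 hψ hψ' (t + δ) p - pairL2 hψ hψ' t p),
      Lp.coeFn_sub ((δ : ℂ)⁻¹ • (pairL2 hψ hψ' (t + δ) p - pairL2 hψ hψ' t p)) R]
      with ω e1 e2 e3 e4 e5 e6
    rw [e6, Pi.sub_apply, e5, Pi.smul_apply, e4, Pi.sub_apply, e2, e3, e1, smul_eq_mul]
    obtain ⟨b1, b2, b3⟩ := hb ω p.1
    obtain ⟨b4, b5⟩ := b3 δ hδ
    obtain ⟨b1', b2', b3'⟩ := hb' ω p.2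
    obtain ⟨b4', b5'⟩ := b3' δ hδ
    have b6 : ‖(δ : ℂ)⁻¹ * (ψ (t + δ) ω p.1 - ψ t ω p.1)‖ ≤ A * decay η p.1 := by
      rw [norm_mul, norm_inv, Complex.norm_real, Real.norm_of_nonneg hδ0.le, inv_mul_le_iff₀ hδ0]
      linarith
    have e7 : (δ : ℂ)⁻¹ * (pairFn ψ ψ' (t + δ) p ω - pairFn ψ ψ' t p ω)
        - (waveRate σ w h ψ t ω p.1 * (starRingEnd ℂ) (ψ' t ω p.2)
          + ψ t ω p.1 * (starRingEnd ℂ) (waveRate σ w h ψ' t ω p.2))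
        = (δ : ℂ)⁻¹ * (ψ (t + δ) ω p.1 - ψ t ω p.1)
            * (starRingEnd ℂ) (ψ' (t + δ) ω p.2 - ψ' t ω p.2)
          + ((δ : ℂ)⁻¹ * (ψ (t + δ) ω p.1 - ψ t ω p.1) - waveRate σ w h ψ t ω p.1)
            * (starRingEnd ℂ) (ψ' t ω p.2)
          + ψ t ω p.1 * (starRingEnd ℂ)
            ((δ : ℂ)⁻¹ * (ψ' (t + δ) ω p.2 - ψ' t ω p.2) - waveRate σ w h ψ' t ω p.2) := by
      simp only [pairFn, map_sub, map_mul, map_inv₀, Complex.conj_ofReal]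
      ring
    rw [e7]
    refine (norm_add₃_le ..).trans ?_
    simp only [norm_mul _ ((starRingEnd ℂ) _), RCLike.norm_conj]
    have d1 := (decay_pos η p.1).le
    have d2 := (decay_pos η p.2).le
    have c1 := mul_le_mul b6 b4' (norm_nonneg _) (by positivity)
    have c2 := mul_le_mul b5 b1' (norm_nonneg _)
      (mul_nonneg (by positivity) (add_nonneg hδ0.le (hq0 _ _ _)))
    have c3 := mul_le_mul b1 b5' (norm_nonneg _) (by positivity)
    refine (add_le_add (add_le_add c1 c2) c3).trans ?_
    have f0 : 0 ≤ A * A' * (decay η p.1 * decay η p.2) := by positivity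
    have f1 := mul_nonneg f0 (hq0 p.1 δ ω)
    have f2 := mul_nonneg f0 (hq0 p.2 δ ω)
    change A * decay η p.1 * (A' * δ * decay η p.2) + A * decay η p.1 * (δ + q p.1 δ ω)
        * (A' * decay η p.2) + A * decay η p.1 * (A' * decay η p.2 * (δ + q p.2 δ ω)) ≤ _
    rw [hK, decay₂]
    linarith
  -- The averaging errors `q` are small only in mean; their uniform bound `2M` makes `G δ` small in
  -- `L²`.
  have hsq : ∀ δ ∈ Set.Ioc (0 : ℝ) 1, ‖G δ‖ ^ 2 ≤ K * (1 + (M + M) + (M + M))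
      * (K * (δ + ∫ ω, q p.1 δ ω ∂(pathLaw μ P) + ∫ ω, q p.2 δ ω ∂(pathLaw μ P))) := by
    intro δ hδ
    have i1 := (integrable_const (μ := pathLaw μ P) δ).add (hqi p.1 δ hδ.1)
    refine (norm_sq_le_mul_integral (b := K * (1 + (M + M) + (M + M))) (hle δ hδ) ((i1.add (hqi p.2 δ hδ.1)).const_mul K)
      fun ω => ?_).trans_eq ?_
    · have := hqb p.1 δ hδ.1 ω
      have := hqb p.2 δ hδ.1 ω
      have := hδ.2
      gcongr
    · rw [integral_const_mul]
      have j1 := integral_add i1 (hqi p.2 δ hδ.1)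
      have j2 := integral_add (integrable_const (μ := pathLaw μ P) δ) (hqi p.1 δ hδ.1)
      rw [integral_const, probReal_univ, one_smul] at j2
      simp only [Pi.add_apply] at j1
      rw [j1, j2]
  have hGlim : Tendsto (fun δ => ‖G δ‖ ^ 2) (𝓝[>] 0) (𝓝 0) := by
    have l1 : Tendsto (fun δ : ℝ => δ) (𝓝[>] 0) (𝓝 0) := nhdsWithin_le_nhds
    have l2 := (((l1.add (tendsto_integral_abs_potAvg_sub hσ hP hw hV p.1 ht)).add
      (tendsto_integral_abs_potAvg_sub hσ hP hw hV p.2 ht)).const_mul K).const_mul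
        (K * (1 + (M + M) + (M + M)))
    rw [add_zero, add_zero, mul_zero, mul_zero] at l2
    refine squeeze_zero' (Eventually.of_forall fun δ => by positivity) ?_ l2
    filter_upwards [Ioc_mem_nhdsGT (zero_lt_one : (0 : ℝ) < 1)] with δ hδ using hsq δ hδ
  have hGlim' : Tendsto (fun δ => ‖G δ‖) (𝓝[>] 0) (𝓝 0) := by
    have := hGlim.sqrt
    simpa [Real.sqrt_sq (norm_nonneg _)] using this
  have hlim1 : Tendsto (fun δ : ℝ => condL2 hP (t.toNNReal + δ.toNNReal) (G δ)) (𝓝[>] 0) (𝓝 0) :=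
    squeeze_zero_norm (fun δ => norm_condL2_le hP _ _) hGlim'
  have hlim := hlim1.add hlim2
  rw [zero_add] at hlim
  refine hlim.congr' ?_
  filter_upwards [self_mem_nhdsWithin] with δ hδ
  exact (e δ hδ).symm

end Correlations

/-- The hypothesis compares forward in time only. Left continuity at `t₀` comes from a base point
`r` slightly before `t₀`: both `f s` and `f t₀` are close to one continuous orbit started at `f r`.
-/
theorem IsContractionSemigroup.continuousOn_of_norm_sub_le {H : Type*} [NormedAddCommGroup H]
    [InnerProductSpace ℂ H] [CompleteSpace H] {S : ℝ → H →L[ℂ] H} (hS : IsContractionSemigroup S) {f : ℝ → H}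
    (hf : ∀ T, 0 ≤ T → ∃ C, 0 ≤ C ∧ ∀ s ∈ Set.Icc 0 T, ∀ t ∈ Set.Icc s T,
      ‖f t - S (t - s) (f s)‖ ≤ C * (t - s)) : ContinuousOn f (Set.Ici 0) := by
  intro t₀ ht₀
  have ht₀' : 0 ≤ t₀ := ht₀
  obtain ⟨C, hC, hC'⟩ := hf (t₀ + 1) (by linarith)
  refine Metric.tendsto_nhds.2 fun ε hε => ?_
  set κ := ε / (4 * (C + 1)) with hκ
  have hκ0 : 0 < κ := by positivity
  have hCκ : C * (2 * κ) ≤ ε / 2 := by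
    have : (C + 1) * (2 * κ) = ε / 2 := by rw [hκ]; field_simp; ring
    nlinarith
  set r := max (t₀ - κ / 2) 0 with hr
  have hr0 : 0 ≤ r := le_max_right _ _
  have hrt : r ≤ t₀ := max_le (by linarith) ht₀'
  have hrκ : t₀ - κ / 2 ≤ r := le_max_left _ _
  have hge : ∀ᶠ s in 𝓝[Set.Ici 0] t₀, r ≤ s := by
    have h1 : ∀ᶠ s in 𝓝[Set.Ici 0] t₀, t₀ - κ / 2 < s :=
      nhdsWithin_le_nhds (lt_mem_nhds (by linarith))
    filter_upwards [h1, self_mem_nhdsWithin] with s hs hs0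
    exact max_le hs.le hs0
  have hlt : ∀ᶠ s in 𝓝[Set.Ici 0] t₀, s < t₀ + min (κ / 2) 1 :=
    nhdsWithin_le_nhds (gt_mem_nhds (by have : 0 < min (κ / 2) 1 := by positivity
                                        linarith))
  have hmap : Tendsto (fun s => s - r) (𝓝[Set.Ici 0] t₀ ⊓ 𝓟 (Set.Ici r)) (𝓝[Set.Ici 0] (t₀ - r)) := by
    refine tendsto_nhdsWithin_iff.2 ⟨?_, ?_⟩
    · exact ((continuous_id.sub continuous_const).tendsto t₀).mono_left
        (inf_le_left.trans nhdsWithin_le_nhds)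
    · filter_upwards [mem_inf_of_right (mem_principal_self _)] with s hs
      exact sub_nonneg.2 (Set.mem_Ici.1 hs)
  have hinf : 𝓝[Set.Ici 0] t₀ ⊓ 𝓟 (Set.Ici r) = 𝓝[Set.Ici 0] t₀ :=
    inf_eq_left.2 (le_principal_iff.2 hge)
  rw [hinf] at hmap
  have hcont := ((hS.continuousOn (f r)) (t₀ - r) (sub_nonneg.2 hrt)).tendsto.comp hmap
  filter_upwards [hge, hlt, Metric.tendsto_nhds.1 hcont (ε / 2) (half_pos hε)] with s h1 h2 h3
  have hm := min_le_left (κ / 2) 1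
  have hm' := min_le_right (κ / 2) 1
  have k1 := hC' r ⟨hr0, by linarith⟩ s ⟨h1, by linarith⟩
  have k2 := hC' r ⟨hr0, by linarith⟩ t₀ ⟨hrt, by linarith⟩
  rw [dist_eq_norm] at h3 ⊢
  have e : f s - f t₀ = (f s - S (s - r) (f r)) - (f t₀ - S (t₀ - r) (f r))
      + (S (s - r) (f r) - S (t₀ - r) (f r)) := by abel
  rw [e]
  have k3 := norm_add_le ((f s - S (s - r) (f r)) - (f t₀ - S (t₀ - r) (f r)))
    (S (s - r) (f r) - S (t₀ - r) (f r))
  have k4 := _root_.norm_sub_le (f s - S (s - r) (f r)) (f t₀ - S (t₀ - r) (f r))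
  have k5 : C * (s - r) + C * (t₀ - r) ≤ C * (2 * κ) := by
    rw [← mul_add]; exact mul_le_mul_of_nonneg_left (by linarith) hC
  have h3' : ‖S (s - r) (f r) - S (t₀ - r) (f r)‖ < ε / 2 := h3
  linarith

/-! ### The fiber field: Fourier transform over joint translations. -/

section FiberField

variable {d : ℕ} {Ω : Type*} [TopologicalSpace Ω] [MeasurableSpace Ω] {μ : Measure Ω}
  {σ : Site d → Ω → Ω} {P : Kernel Ω (RCPath Ω)} {w : Ω → ℝ} {M : ℝ}
  {V : Site d → ℝ → RCPath Ω → ℝ} [IsProbabilityMeasure μ] [IsMarkovKernel P]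
  {h : Site d → ℂ} {m η A : ℝ} {ψ₀ ψ₀' : Site d → ℂ} {ψ ψ' : ℝ → RCPath Ω → Site d → ℂ}
  {k : Fin d → ℂ}

/-- The contribution of the matrix element at `p = (z, y)` to the fiber over the momentum `k`. -/
def embed (hσ : IsShiftAction μ σ) (k : Fin d → ℂ) (p : Site d × Site d) :
    Lp ℂ 2 μ →L[ℂ] FiberSpace d μ :=
  phase k (-p.2) • (lp.singleContinuousLinearMap ℂ (fun _ : Site d => Lp ℂ 2 μ) 2 (p.1 - p.2)).comp
    (shiftL2 hσ p.2)

theorem embed_apply (hσ : IsShiftAction μ σ) (k : Fin d → ℂ) (p : Site d × Site d) (g : Lp ℂ 2 μ)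
    (x : Site d) : embed hσ k p g x
      = if x = p.1 - p.2 then phase k (-p.2) • shiftL2 hσ p.2 g else 0 := by
  change phase k (-p.2) • (lp.single 2 (p.1 - p.2) (shiftL2 hσ p.2 g) : FiberSpace d μ) x = _
  rw [lp.single_apply]
  by_cases hx : x = p.1 - p.2
  · subst hx; simp
  · simp [hx]

theorem norm_embed_le (hσ : IsShiftAction μ σ) (k : Fin d → ℂ) (p : Site d × Site d)
    (g : Lp ℂ 2 μ) : ‖embed hσ k p g‖ ≤ Real.exp (absSum k * ‖toSpace p.2‖) * ‖g‖ := by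
  change ‖phase k (-p.2) • (lp.single 2 (p.1 - p.2) (shiftL2 hσ p.2 g) : FiberSpace d μ)‖ ≤ _
  rw [norm_smul, lp.norm_single (by norm_num), norm_shiftL2]
  gcongr
  simpa [toSpace_neg] using norm_phase_le k (-p.2)

theorem fiberSemigroup_embed (hσ : IsShiftAction μ σ) (hP : IsMarkovProcess μ σ P) (k : Fin d → ℂ)
    (p : Site d × Site d) (t : ℝ) (g : Lp ℂ 2 μ) :
    fiberSemigroup hP t (embed hσ k p g) = embed hσ k p (backwardSemigroup hP t.toNNReal g) := by
  ext1
  funext x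
  rw [fiberSemigroup, liftL_apply, embed_apply, embed_apply]
  split_ifs
  · rw [map_smul, shiftL2_backwardSemigroup]
  · exact map_zero _

/-- A hop of the first site moves only the relative coordinate. A hop of the second site, treated in
`embed_translate_right`, also moves the base point, which produces the phase and the shift of the
noise. These are the two halves of `fiberTerm`. -/
theorem embed_translate_left (hσ : IsShiftAction μ σ) (k : Fin d → ℂ) (p : Site d × Site d)
    (ζ : Site d) (g : Lp ℂ 2 μ) :
    embed hσ k (p + (ζ, 0)) g = translateL ζ (embed hσ k p g) := by
  ext1
  funext x
  rw [translateL_apply, embed_apply, embed_apply]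
  have : x = (p + (ζ, 0)).1 - (p + (ζ, 0)).2 ↔ x - ζ = p.1 - p.2 := by
    simp only [Prod.fst_add, Prod.snd_add, add_zero]
    rw [sub_eq_iff_eq_add]
    constructor <;> rintro rfl <;> abel
  simp only [this]
  simp only [Prod.snd_add, add_zero]

theorem embed_translate_right (hσ : IsShiftAction μ σ) (k : Fin d → ℂ) (p : Site d × Site d)
    (ζ : Site d) (g : Lp ℂ 2 μ) :
    embed hσ k (p + (0, -ζ)) g
      = phase k ζ • liftL (Site d) (shiftL2 hσ (-ζ)) (translateL ζ (embed hσ k p g)) := by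
  ext1
  funext x
  rw [lp.coeFn_smul, Pi.smul_apply, liftL_apply, translateL_apply, embed_apply, embed_apply]
  have : x = (p + (0, -ζ)).1 - (p + (0, -ζ)).2 ↔ x - ζ = p.1 - p.2 := by
    simp only [Prod.fst_add, Prod.snd_add, add_zero]
    rw [sub_eq_iff_eq_add]
    constructor <;> rintro rfl <;> abel
  simp only [this]
  simp only [Prod.snd_add]
  split_ifs
  · rw [map_smul, smul_smul, ← shiftL2_add, ← phase_add, add_comm (-ζ) p.2]
    congr 2
    abel
  · rw [map_zero, smul_zero]

/-- Shifting the noise by the second site turns `v_z - v_y` into `v_{z-y} - v_0`, which depends on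
the relative coordinate only. -/
theorem embed_pot (hσ : IsShiftAction μ σ) (hw : IsBddMeasurable w M) (k : Fin d → ℂ)
    (p : Site d × Site d) (g : Lp ℂ 2 μ) :
    embed hσ k p ((hw.pair hσ p).mulL μ g) = potentialL hσ hw (embed hσ k p g) := by
  ext1
  funext x
  rw [potentialL_apply, embed_apply, embed_apply]
  split_ifs with hx
  · rw [map_smul]
    congr 1
    refine Lp.ext ?_
    filter_upwards [shiftL2_coe hσ p.2 ((hw.pair hσ p).mulL μ g), shiftL2_coe hσ p.2 g,
      (hσ.preserving (-p.2)).quasiMeasurePreserving.ae ((hw.pair hσ p).mulL_coe g),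
      ((hw.comp_shift hσ x).sub hw).mulL_coe (shiftL2 hσ p.2 g)] with a e1 e2 e3 e4
    rw [e1, e3, e4, e2]
    have f1 := congrFun (hσ.add p.1 (-p.2)) a
    have f2 := congrFun (hσ.add p.2 (-p.2)) a
    rw [add_neg_cancel, hσ.zero] at f2
    simp only [Function.comp_apply, id_eq] at f1 f2
    rw [f1, f2, hx, ← sub_eq_add_neg]
  · exact (map_zero _).symm

/-- The decay profile that controls the fiber field. -/
def fiberDecay (k : Fin d → ℂ) (η : ℝ) (p : Site d × Site d) : ℝ :=
  decay η p.1 * decay (η - absSum k) p.2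

theorem fiberDecay_pos (k : Fin d → ℂ) (η : ℝ) (p : Site d × Site d) : 0 < fiberDecay k η p :=
  mul_pos (decay_pos _ _) (decay_pos _ _)

theorem summable_fiberDecay (hk : absSum k < η) : Summable (fiberDecay k η) :=
  (summable_exp_neg_norm (d := d) ((absSum_nonneg k).trans_lt hk)).mul_of_nonneg
    (summable_exp_neg_norm (sub_pos.2 hk)) (fun _ => (Real.exp_pos _).le)
    fun _ => (Real.exp_pos _).le

theorem norm_embed_le_fiberDecay (hσ : IsShiftAction μ σ) {p : Site d × Site d} {g : Lp ℂ 2 μ}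
    {c : ℝ} (hg : ‖g‖ ≤ c * decay₂ η p) : ‖embed hσ k p g‖ ≤ c * fiberDecay k η p := by
  refine (norm_embed_le hσ k p g).trans
    ((mul_le_mul_of_nonneg_left hg (Real.exp_pos _).le).trans_eq ?_)
  have e : decay (η - absSum k) p.2 = Real.exp (absSum k * ‖toSpace p.2‖) * decay η p.2 := by
    rw [decay, decay, ← Real.exp_add]; ring_nf
  rw [decay₂, fiberDecay, e]
  ring

/-- The fiber field of a density matrix. -/
def fiberField (hσ : IsShiftAction μ σ) (k : Fin d → ℂ) (F : Site d × Site d → Lp ℂ 2 μ) :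
    FiberSpace d μ := ∑' p, embed hσ k p (F p)

theorem hasSum_fiberField (hσ : IsShiftAction μ σ) (hk : absSum k < η)
    {F : Site d × Site d → Lp ℂ 2 μ} (hF : ∀ p, ‖F p‖ ≤ A * decay₂ η p) :
    HasSum (fun p => embed hσ k p (F p)) (fiberField hσ k F) :=
  (Summable.of_norm_bounded ((summable_fiberDecay hk).mul_left A)
    fun p => norm_embed_le_fiberDecay hσ (hF p)).hasSum

/-- The double sums over hops and pairs converge absolutely, by the weight of `h` and the decay of
`F`, and may be exchanged. In the second one `ζ` is replaced by `-ζ`, which is where the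
self-adjointness of `h` enters. -/
theorem fiberOp_fiberField (hσ : IsShiftAction μ σ) (hh : ∀ ζ, h ζ = star (h (-ζ)))
    (hs : Summable fun y : Site d => Real.exp (m * ‖toSpace y‖) * ‖h y‖) (hm : 0 < m)
    (hw : IsBddMeasurable w M) (hηm : η ≤ m) (hk : absSum k < η)
    {F : Site d × Site d → Lp ℂ 2 μ} (hF : ∀ p, ‖F p‖ ≤ A * decay₂ η p) :
    fiberField hσ k (liouville h (fun p => (hw.pair hσ p).mulL μ) F)
      = fiberOp hσ h hw k (fiberField hσ k F) := by
  have hη : 0 ≤ η := (absSum_nonneg k).trans hk.le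
  have hf := hasSum_fiberField hσ hk hF
  set f := fiberField hσ k F with hfdef
  have hdec := summable_fiberDecay hk
  -- the two hopping contributions
  have b1 : ∀ ζ p, ‖h ζ • embed hσ k p (F (p.1 - ζ, p.2))‖
      ≤ Real.exp (m * ‖toSpace ζ‖) * ‖h ζ‖ * (A * fiberDecay k η p) := fun ζ p => by
    rw [← map_smul, ← mul_assoc]
    refine norm_embed_le_fiberDecay hσ ((norm_hop_left_le hη hηm hF p ζ).trans_eq (by ring))
  have b2 : ∀ ζ p, ‖(starRingEnd ℂ) (h ζ) • embed hσ k p (F (p.1, p.2 - ζ))‖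
      ≤ Real.exp (m * ‖toSpace ζ‖) * ‖h ζ‖ * (A * fiberDecay k η p) := fun ζ p => by
    rw [← map_smul, ← mul_assoc]
    refine norm_embed_le_fiberDecay hσ ((norm_hop_right_le hη hηm hF p ζ).trans_eq (by ring))
  have hA : 0 ≤ A := nonneg_of_mul_nonneg_left ((norm_nonneg _).trans (hF 0)) (decay₂_pos η 0)
  have hprod : Summable fun q : Site d × (Site d × Site d) =>
      Real.exp (m * ‖toSpace q.1‖) * ‖h q.1‖ * (A * fiberDecay k η q.2) :=
    hs.mul_of_nonneg (hdec.mul_left A) (fun _ => by positivity)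
      fun p => mul_nonneg hA (fiberDecay_pos k η p).le
  have s1 : Summable (Function.uncurry fun ζ p => h ζ • embed hσ k p (F (p.1 - ζ, p.2))) :=
    Summable.of_norm_bounded hprod fun q => b1 q.1 q.2
  have s2 : Summable (Function.uncurry fun ζ p =>
      (starRingEnd ℂ) (h ζ) • embed hσ k p (F (p.1, p.2 - ζ))) :=
    Summable.of_norm_bounded hprod fun q => b2 q.1 q.2
  have r1 : ∀ ζ, ∑' p, h ζ • embed hσ k p (F (p.1 - ζ, p.2)) = h ζ • translateL ζ f := fun ζ => by
    rw [tsum_const_smul'', ← (hf.mapL (translateL ζ)).tsum_eq]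
    congr 1
    rw [← (Equiv.addRight ((ζ, 0) : Site d × Site d)).tsum_eq]
    refine tsum_congr fun p => ?_
    rw [Equiv.coe_addRight, embed_translate_left]
    simp
  have r2 : ∀ ζ, ∑' p, (starRingEnd ℂ) (h (-ζ)) • embed hσ k p (F (p.1, p.2 - -ζ))
      = h ζ • phase k ζ • liftL (Site d) (shiftL2 hσ (-ζ)) (translateL ζ f) := fun ζ => by
    have e : (starRingEnd ℂ) (h (-ζ)) = h ζ := by rw [hh ζ]; rfl
    rw [tsum_const_smul'', e]
    congr 1
    have h3 := hf.mapL (phase k ζ • (liftL (Site d) (shiftL2 hσ (-ζ))).comp (translateL ζ))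
    refine Eq.trans ?_ h3.tsum_eq
    rw [← (Equiv.addRight ((0, -ζ) : Site d × Site d)).tsum_eq]
    refine tsum_congr fun p => ?_
    rw [Equiv.coe_addRight, embed_translate_right]
    simp
  have c1 : Summable fun p => ∑' ζ, h ζ • embed hσ k p (F (p.1 - ζ, p.2)) := s1.prod_symm.prod
  have c2 : Summable fun p => ∑' ζ, (starRingEnd ℂ) (h ζ) • embed hσ k p (F (p.1, p.2 - ζ)) :=
    s2.prod_symm.prod
  have c3 : HasSum (fun p => embed hσ k p ((hw.pair hσ p).mulL μ (F p))) (potentialL hσ hw f) := by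
    have := hf.mapL (potentialL hσ hw)
    exact (funext fun p => embed_pot hσ hw k p (F p)) ▸ this
  have d1 : Summable fun ζ => h ζ • translateL ζ f := by
    refine Summable.congr s1.prod fun ζ => r1 ζ
  have d2' : Summable fun ζ => ∑' p, (starRingEnd ℂ) (h ζ) • embed hσ k p (F (p.1, p.2 - ζ)) :=
    s2.prod
  have d2 : Summable fun ζ => h ζ • phase k ζ • liftL (Site d) (shiftL2 hσ (-ζ)) (translateL ζ f) := by
    have := (Equiv.neg (Site d)).summable_iff.2 d2'
    refine this.congr fun ζ => ?_
    exact r2 ζ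
  have e1 : fiberField hσ k (liouville h (fun p => (hw.pair hσ p).mulL μ) F)
      = ∑' p, ∑' ζ, h ζ • embed hσ k p (F (p.1 - ζ, p.2))
        - ∑' p, ∑' ζ, (starRingEnd ℂ) (h ζ) • embed hσ k p (F (p.1, p.2 - ζ))
        + potentialL hσ hw f := by
    rw [← c3.tsum_eq, ← c1.tsum_sub c2, ← (c1.sub c2).tsum_add c3.summable, fiberField]
    exact tsum_congr fun p => map_liouville hs hη hηm hF _ _ p
  have e2 : fiberOp hσ h hw k f = ∑' ζ, fiberTerm hσ h k ζ f + potentialL hσ hw f := by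
    rw [fiberOp, add_apply]
    congr 1
    exact ((summable_fiberTerm hσ hs hm (hk.le.trans hηm)).hasSum.mapL
      (ContinuousLinearMap.apply ℂ _ f)).tsum_eq.symm
  rw [e1, e2, s1.tsum_comm, s2.tsum_comm, tsum_congr r1]
  congr 1
  rw [← (Equiv.neg (Site d)).tsum_eq fun ζ =>
    ∑' p, (starRingEnd ℂ) (h ζ) • embed hσ k p (F (p.1, p.2 - ζ))]
  simp only [Equiv.neg_apply]
  rw [tsum_congr r2, ← d1.tsum_sub d2]
  refine tsum_congr fun ζ => ?_
  rw [fiberTerm, smul_apply, sub_apply, smul_sub]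
  rfl

theorem fiberSemigroup_fiberField (hσ : IsShiftAction μ σ) (hP : IsMarkovProcess μ σ P)
    (hk : absSum k < η) {F : Site d × Site d → Lp ℂ 2 μ} (hF : ∀ p, ‖F p‖ ≤ A * decay₂ η p)
    (t : ℝ) : HasSum (fun p => embed hσ k p (backwardSemigroup hP t.toNNReal (F p)))
      (fiberSemigroup hP t (fiberField hσ k F)) := by
  have := (hasSum_fiberField hσ hk hF).mapL (fiberSemigroup hP t)
  simpa only [fiberSemigroup_embed] using this

/-- The equations of the matrix elements are summed by dominated convergence: their difference
quotients, once embedded, are bounded by multiples of `fiberDecay`, summable for `absSum k < η`. -/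
theorem isMild_fiberField [BorelSpace Ω] (hσ : IsShiftAction μ σ) (hP : IsMarkovProcess μ σ P)
    (hS : IsContractionSemigroup (fiberSemigroup (d := d) hP))
    (hh : ∀ ζ, h ζ = star (h (-ζ)))
    (hs : Summable fun y : Site d => Real.exp (m * ‖toSpace y‖) * ‖h y‖) (hm : 0 < m)
    (hw : IsBddMeasurable w M) (hV : IsPotentialVersion μ P σ w M V) (hηm : η ≤ m)
    (hk : absSum k < η) (hψ : IsWave μ P h V η ψ₀ ψ) (hψ' : IsWave μ P h V η ψ₀' ψ') :
    IsMild (fiberSemigroup hP) (fun t => fiberField hσ k (corrL2 hP hψ hψ' t))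
      fun t => -(Complex.I • fiberOp hσ h hw k (fiberField hσ k (corrL2 hP hψ hψ' t))) := by
  have hη : 0 ≤ η := (absSum_nonneg k).trans hk.le
  have hM : 0 ≤ M := hw.nonneg μ
  have key : ∀ T, ∃ A, 0 ≤ A ∧ (∀ t ∈ Set.Icc 0 T, ∀ p, ‖corrL2 hP hψ hψ' t p‖ ≤ A * decay₂ η p) ∧
      ∀ s ∈ Set.Icc 0 T, ∀ t ∈ Set.Icc s T, ∀ p, ‖corrL2 hP hψ hψ' t p
        - backwardSemigroup hP (t - s).toNNReal (corrL2 hP hψ hψ' s p)‖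
          ≤ A * (t - s) * decay₂ η p := by
    intro T
    obtain ⟨A, hA, h1, h2⟩ := hψ.exists_pair_bounds hψ' hV hM hs hη hηm T
    exact ⟨A, hA, fun t ht p => (norm_condL2_le hP _ _).trans
      (norm_pairL2_le hψ hψ' fun ω => h1 t ht ω p), fun s hs t ht p =>
      norm_corrL2_sub_le hP hψ hψ' hs.1 ht.1 fun ω => h2 s hs t ht ω p⟩
  refine ⟨hS.continuousOn_of_norm_sub_le fun T hT => ?_, fun t ht => ?_⟩
  · obtain ⟨A, hA, h1, h2⟩ := key T
    refine ⟨A * ∑' p, fiberDecay k η p, mul_nonneg hA (tsum_nonneg fun p =>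
      (fiberDecay_pos k η p).le), fun s hs t ht => ?_⟩
    have h3 := (hasSum_fiberField hσ hk (h1 t ⟨hs.1.trans ht.1, ht.2⟩)).sub
      (fiberSemigroup_fiberField hσ hP hk (h1 s hs) (t - s))
    rw [← h3.tsum_eq]
    refine (tsum_of_norm_bounded ((summable_fiberDecay hk).hasSum.mul_left (A * (t - s)))
      fun p => ?_).trans_eq (by ring)
    rw [← map_sub]
    exact norm_embed_le_fiberDecay hσ (h2 s hs t ht p)
  · obtain ⟨A, hA, h1, h2⟩ := key (t + 1)
    have htm : t ∈ Set.Icc 0 (t + 1) := ⟨ht, by linarith⟩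
    have e : ∀ᶠ δ : ℝ in 𝓝[>] 0, ∑' p, embed hσ k p (δ⁻¹ • (corrL2 hP hψ hψ' (t + δ) p
          - backwardSemigroup hP δ.toNNReal (corrL2 hP hψ hψ' t p)))
        = δ⁻¹ • (fiberField hσ k (corrL2 hP hψ hψ' (t + δ))
          - fiberSemigroup hP δ (fiberField hσ k (corrL2 hP hψ hψ' t))) := by
      filter_upwards [Ioc_mem_nhdsGT (zero_lt_one : (0 : ℝ) < 1)] with δ hδ
      have h3 := ((hasSum_fiberField hσ hk (h1 (t + δ) ⟨by linarith [hδ.1], by linarith [hδ.2]⟩)).sub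
        (fiberSemigroup_fiberField hσ hP hk (h1 t htm) δ)).const_smul δ⁻¹
      rw [← h3.tsum_eq]
      refine tsum_congr fun p => ?_
      rw [← map_sub]
      exact ContinuousLinearMap.map_smul_of_tower _ _ _
    refine Tendsto.congr' e ?_
    have hlim : -(Complex.I • fiberOp hσ h hw k (fiberField hσ k (corrL2 hP hψ hψ' t)))
        = ∑' p, embed hσ k p (-(Complex.I • liouville h (fun p => (hw.pair hσ p).mulL μ)
          (corrL2 hP hψ hψ' t) p)) := by
      rw [← fiberOp_fiberField hσ hh hs hm hw hηm hk (h1 t htm), fiberField, ← tsum_const_smul'',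
        ← tsum_neg]
      exact tsum_congr fun p => by rw [map_neg, map_smul]
    rw [hlim]
    refine tendsto_tsum_of_dominated_convergence ((summable_fiberDecay hk).mul_left A) (fun p =>
      ((embed hσ k p).continuous.tendsto _).comp
        (tendsto_corrL2 hσ hP hw hψ hψ' hV hs hη hηm ht p)) ?_
    filter_upwards [Ioc_mem_nhdsGT (zero_lt_one : (0 : ℝ) < 1)] with δ hδ p
    refine norm_embed_le_fiberDecay hσ ?_
    have h3 := h2 t htm (t + δ) ⟨by linarith [hδ.1], by linarith [hδ.2]⟩ p
    rw [add_sub_cancel_left] at h3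
    rw [norm_smul, norm_inv, Real.norm_of_nonneg hδ.1.le, inv_mul_le_iff₀ hδ.1]
    linarith

end FiberField

/-! ### The standing model; the resolvent applied to the drift vector. -/

section Model

variable {d : ℕ} {Ω : Type*} [TopologicalSpace Ω] [MeasurableSpace Ω] {μ : Measure Ω}
  {σ : Site d → Ω → Ω} {P : Kernel Ω (RCPath Ω)} {w : Ω → ℝ} {M : ℝ}
  {V : Site d → ℝ → RCPath Ω → ℝ} [IsProbabilityMeasure μ] [IsMarkovKernel P]
  {h : Site d → ℂ} {m η : ℝ} {ψ₀ ψ₀' : Site d → ℂ} {ψ ψ' : ℝ → RCPath Ω → Site d → ℂ}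
  {k : Fin d → ℂ} {hσ : IsShiftAction μ σ} {hP : IsMarkovProcess μ σ P}

/-- The standing assumptions, with a bounded measurable representative `w` of the potential and a
jointly measurable version `V` of `w(σ_x ω_s)`. -/
structure IsModel (hσ : IsShiftAction μ σ) (hP : IsMarkovProcess μ σ P) (h : Site d → ℂ) (m : ℝ)
    (w : Ω → ℝ) (M : ℝ) (V : Site d → ℝ → RCPath Ω → ℝ) : Prop where
  selfAdjoint : ∀ ζ, h ζ = star (h (-ζ))
  pos : 0 < m
  summable : Summable fun y : Site d => Real.exp (m * ‖toSpace y‖) * ‖h y‖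
  bdd : IsBddMeasurable w M
  version : IsPotentialVersion μ P σ w M V
  coupling : ∃ (γ χ : ℝ) (hS : IsGapped (fiberSemigroup hP) (liftL (Site d) (meanL2 μ)) γ),
    IsCoupling hS (fiberOp hσ h bdd 0) (vacuum d μ) χ

theorem IsWave.zero (hψ : IsWave μ P h V η ψ₀ ψ) (ω : RCPath Ω) (x : Site d) :
    ψ 0 ω x = ψ₀ x := by
  rw [hψ.eq 0 le_rfl]; simp

/-- The fiber field of a pair of waves. -/
def waveField (hσ : IsShiftAction μ σ) (hP : IsMarkovProcess μ σ P) (hψ : IsWave μ P h V η ψ₀ ψ)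
    (hψ' : IsWave μ P h V η ψ₀' ψ') (k : Fin d → ℂ) (t : ℝ) : FiberSpace d μ :=
  fiberField hσ k (corrL2 hP hψ hψ' t)

theorem inner_vacuum_embed (hσ : IsShiftAction μ σ) (k : Fin d → ℂ) (p : Site d × Site d)
    (g : Lp ℂ 2 μ) : inner ℂ (vacuum d μ) (embed hσ k p g)
      = if p.1 = p.2 then phase k (-p.2) * inner ℂ (oneL2 μ) g else 0 := by
  rw [inner_vacuum, embed_apply]
  by_cases hp : p.1 = p.2
  · simp only [hp, sub_self, if_true]
    rw [inner_smul_right, inner_oneL2_shiftL2]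
  · have : ¬ (0 : Site d) = p.1 - p.2 := fun h => hp (sub_eq_zero.1 h.symm)
    simp [hp, this]

theorem corrL2_zero (hP : IsMarkovProcess μ σ P) (hψ : IsWave μ P h V η ψ₀ ψ)
    (hψ' : IsWave μ P h V η ψ₀' ψ') (p : Site d × Site d) :
    corrL2 hP hψ hψ' 0 p = (ψ₀ p.1 * (starRingEnd ℂ) (ψ₀' p.2)) • oneL2 μ := by
  have e : pairL2 hψ hψ' 0 p = (ψ₀ p.1 * (starRingEnd ℂ) (ψ₀' p.2)) •
      oneL2 (Ω := RCPath Ω) (pathLaw μ P) := by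
    refine Lp.ext ?_
    filter_upwards [pairL2_coe hψ hψ' 0 p, oneL2_coe (μ := pathLaw μ P),
      Lp.coeFn_smul (ψ₀ p.1 * (starRingEnd ℂ) (ψ₀' p.2)) (oneL2 (Ω := RCPath Ω) (pathLaw μ P))]
      with ω e1 e2 e3
    rw [e1, e3, Pi.smul_apply, e2, pairFn, hψ.zero, hψ'.zero]
    simp
  rw [corrL2, e, map_smul, condL2_oneL2]

namespace IsModel

variable (hD : IsModel hσ hP h m w M V)

theorem exists_corr_bound (hD : IsModel hσ hP h m w M V) (hη : 0 ≤ η) (hηm : η ≤ m)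
    (hψ : IsWave μ P h V η ψ₀ ψ) (hψ' : IsWave μ P h V η ψ₀' ψ') {t : ℝ} (ht : 0 ≤ t) :
    ∃ A, 0 ≤ A ∧ ∀ p, ‖corrL2 hP hψ hψ' t p‖ ≤ A * decay₂ η p := by
  obtain ⟨A, hA, h1, -⟩ :=
    hψ.exists_pair_bounds hψ' hD.version (hD.bdd.nonneg μ) hD.summable hη hηm t
  exact ⟨A, hA, fun p => (norm_condL2_le hP _ _).trans
    (norm_pairL2_le hψ hψ' fun ω => h1 t ⟨ht, le_rfl⟩ ω p)⟩

/-- Only diagonal pairs have relative coordinate zero, so for `ψ' = ψ` the vacuum component is the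
Fourier transform of the position distribution. -/
theorem hasSum_inner_vacuum (hD : IsModel hσ hP h m w M V) (hηm : η ≤ m) (hk : absSum k < η)
    (hψ : IsWave μ P h V η ψ₀ ψ) (hψ' : IsWave μ P h V η ψ₀' ψ') {t : ℝ} (ht : 0 ≤ t) :
    HasSum (fun y => phase k (-y) * ∫ ω, pairFn ψ ψ' t (y, y) ω ∂(pathLaw μ P))
      (inner ℂ (vacuum d μ) (waveField hσ hP hψ hψ' k t)) := by
  obtain ⟨A, hA, h1⟩ := hD.exists_corr_bound ((absSum_nonneg k).trans hk.le) hηm hψ hψ' ht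
  have h2 := (hasSum_fiberField hσ hk h1).mapL (innerSL ℂ (vacuum d μ))
  have hinj : Function.Injective fun y : Site d => (y, y) := fun y z hyz => congrArg Prod.fst hyz
  rw [← hinj.hasSum_iff] at h2
  · refine HasSum.congr_fun h2 fun y => ?_
    rw [Function.comp_apply, innerSL_apply_apply, inner_vacuum_embed, if_pos rfl, corrL2,
      inner_oneL2_condL2, integral_congr_ae (pairL2_coe hψ hψ' t (y, y))]
  · intro p hp
    rw [innerSL_apply_apply, inner_vacuum_embed, if_neg]
    rintro he
    exact hp ⟨p.1, Prod.ext rfl he⟩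

theorem isMild_waveField [BorelSpace Ω] (hD : IsModel hσ hP h m w M V) (hηm : η ≤ m)
    (hk : absSum k < η) (hψ : IsWave μ P h V η ψ₀ ψ) (hψ' : IsWave μ P h V η ψ₀' ψ') :
    IsMild (fiberSemigroup hP) (waveField hσ hP hψ hψ' k)
      fun t => -(Complex.I • fiberOp hσ h hD.bdd k (waveField hσ hP hψ hψ' k t)) := by
  obtain ⟨γ, χ, hS, -⟩ := hD.coupling
  exact isMild_fiberField hσ hP hS.toIsContractionSemigroup hD.selfAdjoint hD.summable hD.pos
    hD.bdd hD.version hηm hk hψ hψ'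

theorem exists_wave (hD : IsModel hσ hP h m w M V) (hη : 0 ≤ η) (hηm : η ≤ m) {ν C : ℝ}
    (hην : η < ν) (hψ₀ : ∀ x : Site d, Real.exp (ν * ‖toSpace x‖) * ‖ψ₀ x‖ ≤ C) :
    ∃ ψ, IsWave μ P h V η ψ₀ ψ := by
  obtain ⟨φ, hφ⟩ := exists_weighted hη hην hψ₀
  have hK := isKernel_hopCoef hD.summable hη hηm
  have h1 := isWave_waveVec hσ hD.bdd hD.version hK hη φ
  have e : ((weightL d η hη φ : Ell2 d) : Site d → ℂ) = ψ₀ := funext hφ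
  rw [e] at h1
  exact ⟨_, h1⟩

theorem exists_wave_delta (hD : IsModel hσ hP h m w M V) (hη : 0 ≤ η) (hηm : η ≤ m) :
    ∃ ψ, IsWave μ P h V η (Pi.single 0 1) ψ := by
  refine hD.exists_wave hη hηm (ν := η + 1) (C := 1) (by linarith) fun x => ?_
  by_cases hx : x = 0
  · have : toSpace (0 : Site d) = 0 := by ext i; simp [toSpace]
    subst hx; simp [this]
  · simp [Pi.single_eq_of_ne hx]

/-- Pairing with the wave started at `δ_0` turns the wave from `ψ₀` into a mild solution with
initial field `∑ ψ₀(z) δ_z ⊗ 1`. Solutions with such initial data thus come from waves, without a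
generation theorem for the perturbed semigroup. -/
theorem hasSum_waveField_zero (hD : IsModel hσ hP h m w M V) (hηm : η ≤ m) (hk : absSum k < η)
    (hψ : IsWave μ P h V η ψ₀ ψ) (hψ' : IsWave μ P h V η (Pi.single 0 1) ψ') :
    HasSum (fun z => ψ₀ z • siteVec μ z) (waveField hσ hP hψ hψ' k 0) := by
  obtain ⟨A, hA, h1⟩ := hD.exists_corr_bound ((absSum_nonneg k).trans hk.le) hηm hψ hψ' le_rfl
  have h2 := hasSum_fiberField hσ hk h1
  have hinj : Function.Injective fun z : Site d => (z, (0 : Site d)) :=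
    fun y z hyz => congrArg Prod.fst hyz
  rw [← hinj.hasSum_iff] at h2
  · refine HasSum.congr_fun h2 fun z => ?_
    rw [Function.comp_apply, corrL2_zero]
    ext1
    funext x
    rw [embed_apply, lp.coeFn_smul, Pi.smul_apply, siteVec_apply]
    simp only [sub_zero, neg_zero, phase_zero, shiftL2_zero, Pi.single_eq_same, map_one, mul_one,
      one_smul]
    split_ifs
    · rfl
    · rw [smul_zero]
  · intro p hp
    have : p.2 ≠ 0 := fun he => hp ⟨p.1, Prod.ext rfl he.symm⟩
    rw [corrL2_zero, Pi.single_eq_of_ne this]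
    simp

/-- The wave with initial value `h(x) i κ·x`, paired at `k = 0` with the wave from `δ_0`, gives a
decaying mild solution that starts at the drift vector; its time integral is `r`. Half of the weight
`e^{m|x|}` of `h` pays for the factor `κ·x`. -/
theorem exists_resolvent_drift [BorelSpace Ω] (hD : IsModel hσ hP h m w M V) (κ : Fin d → ℂ) :
    ∃ r : FiberSpace d μ, inner ℂ (vacuum d μ) r = 0 ∧
      Tendsto (fun u : ℝ => u⁻¹ • (r - fiberSemigroup hP u r)) (𝓝[>] 0)
        (𝓝 (driftVec μ h κ - Complex.I • fiberOp hσ h hD.bdd 0 r)) := by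
  have hm := hD.pos
  obtain ⟨γ, χ, hS, hA⟩ := hD.coupling
  have hη : (0 : ℝ) ≤ m / 4 := by positivity
  have hηm : m / 4 ≤ m := by linarith
  have hψ₀ : ∀ x : Site d, Real.exp (m / 2 * ‖toSpace x‖) * ‖h x * (Complex.I * dotC κ x)‖
      ≤ absSum κ * (2 / m) * hopMass h m := by
    intro x
    set n := ‖toSpace x‖
    have hn : 0 ≤ n := norm_nonneg _
    have h1 : m / 2 * n ≤ Real.exp (m / 2 * n) := by linarith [Real.add_one_le_exp (m / 2 * n)]
    have h2 : Real.exp (m * n) * ‖h x‖ ≤ hopMass h m :=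
      hD.summable.le_tsum x fun _ _ => by positivity
    have h3 : Real.exp (m * n) = Real.exp (m / 2 * n) * Real.exp (m / 2 * n) := by
      rw [← Real.exp_add]; ring_nf
    have h4 : n ≤ 2 / m * Real.exp (m / 2 * n) := by
      rw [div_mul_eq_mul_div, le_div_iff₀ hm]; linarith
    rw [norm_mul, norm_mul, Complex.norm_I, one_mul]
    have := absSum_nonneg κ
    calc Real.exp (m / 2 * n) * (‖h x‖ * ‖dotC κ x‖)
        ≤ Real.exp (m / 2 * n) * (‖h x‖ * (absSum κ * (2 / m * Real.exp (m / 2 * n)))) := by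
          gcongr
          exact (norm_dotC_le κ x).trans (by gcongr)
      _ = absSum κ * (2 / m) * (Real.exp (m * n) * ‖h x‖) := by rw [h3]; ring
      _ ≤ _ := by gcongr
  obtain ⟨ψ, hψ⟩ := hD.exists_wave hη hηm (by linarith) hψ₀
  obtain ⟨ψ', hψ'⟩ := hD.exists_wave_delta hη hηm
  have hk : absSum (0 : Fin d → ℂ) < m / 4 := by simp [absSum, hm]
  have hf := hD.isMild_waveField hηm hk hψ hψ'
  have h0 : waveField hσ hP hψ hψ' 0 0 = driftVec μ h κ :=
    (hD.hasSum_waveField_zero hηm hk hψ hψ').unique (hasSum_driftVec hD.summable hm κ)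
  have := hA.exists_resolvent hf (by rw [h0]; exact inner_vacuum_driftVec hD.summable hm κ)
  rwa [h0] at this

end IsModel

end Model

/-! ### Position distributions and characteristic functions on the diffusive scale. -/

section Transport

variable {d : ℕ} {Ω : Type*} [TopologicalSpace Ω] [MeasurableSpace Ω] {μ : Measure Ω}
  {σ : Site d → Ω → Ω} {P : Kernel Ω (RCPath Ω)} {w : Ω → ℝ} {M : ℝ}
  {V : Site d → ℝ → RCPath Ω → ℝ} [IsProbabilityMeasure μ] [IsMarkovKernel P]
  {h : Site d → ℂ} {m η : ℝ} {ψ₀ ψ₀' : Site d → ℂ} {ψ ψ' : ℝ → RCPath Ω → Site d → ℂ}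
  {k : Fin d → ℂ} {hσ : IsShiftAction μ σ} {hP : IsMarkovProcess μ σ P}

/-- The mean square amplitude of a wave. -/
def waveMass (μ : Measure Ω) (P : Kernel Ω (RCPath Ω)) (ψ : ℝ → RCPath Ω → Site d → ℂ) (t : ℝ)
    (x : Site d) : ℝ := ∫ ω, ‖ψ t ω x‖ ^ 2 ∂(pathLaw μ P)

theorem waveMass_nonneg (t : ℝ) (x : Site d) : 0 ≤ waveMass μ P ψ t x :=
  integral_nonneg fun _ => by positivity

theorem integral_pairFn_diag (t : ℝ) (x : Site d) :
    ∫ ω, pairFn ψ ψ t (x, x) ω ∂(pathLaw μ P) = waveMass μ P ψ t x := by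
  rw [waveMass, ← integral_complex_ofReal]
  refine integral_congr_ae (ae_of_all _ fun ω => ?_)
  simp only [pairFn, Complex.mul_conj, Complex.normSq_eq_norm_sq]

theorem IsWave.waveMass_zero (hψ : IsWave μ P h V η ψ₀ ψ) (x : Site d) :
    waveMass μ P ψ 0 x = ‖ψ₀ x‖ ^ 2 := by
  simp [waveMass, hψ.zero]

theorem absSum_smul_lt {κ : Fin d → ℂ} {s : ℝ} (hη : 0 < η) (hs : 0 ≤ s)
    (hs' : s ≤ η / (2 * (absSum κ + 1))) : absSum (s • κ) ≤ η / 2 := by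
  have hN := absSum_nonneg κ
  rw [absSum_smul hs]
  rw [le_div_iff₀ (by positivity)] at hs'
  nlinarith

namespace IsModel

theorem hasSum_phase_waveMass (hD : IsModel hσ hP h m w M V) (hηm : η ≤ m) (hk : absSum k < η)
    (hψ : IsWave μ P h V η ψ₀ ψ) {t : ℝ} (ht : 0 ≤ t) :
    HasSum (fun y => phase k (-y) * waveMass μ P ψ t y)
      (inner ℂ (vacuum d μ) (waveField hσ hP hψ hψ k t)) := by
  have := hD.hasSum_inner_vacuum hηm hk hψ hψ ht
  simpa only [integral_pairFn_diag] using this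

/-- At `k = 0` the vacuum component is the total mass; it is conserved because `q` is orthogonal to
the range of `A`. -/
theorem hasSum_waveMass [BorelSpace Ω] (hD : IsModel hσ hP h m w M V) (hη : 0 < η) (hηm : η ≤ m)
    (hψ : IsWave μ P h V η ψ₀ ψ) {t : ℝ} (ht : 0 ≤ t) :
    HasSum (waveMass μ P ψ t) (∑' y, ‖ψ₀ y‖ ^ 2) := by
  obtain ⟨γ, χ, hS, hA⟩ := hD.coupling
  have hk : absSum (0 : Fin d → ℂ) < η := by simp [absSum, hη]
  have hf := hD.isMild_waveField hηm hk hψ hψ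
  have key : ∀ t, 0 ≤ t → HasSum (fun y => (waveMass μ P ψ t y : ℂ))
      (inner ℂ (vacuum d μ) (waveField hσ hP hψ hψ 0 t)) := fun t ht => by
    simpa only [phase_zero_left, one_mul] using hD.hasSum_phase_waveMass hηm hk hψ ht
  have h1 := key t ht
  rw [hA.inner_eq hf (fun s _ => by
    rw [inner_neg_right, inner_smul_right, hA.inner_apply_eq_zero]; simp) ht] at h1
  have h0 := key 0 le_rfl
  simp only [hψ.waveMass_zero] at h0
  have h2 : HasSum (fun y => ‖ψ₀ y‖ ^ 2)
      (inner ℂ (vacuum d μ) (waveField hσ hP hψ hψ 0 0)).re := by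
    have := Complex.hasSum_re h0
    simpa only [Complex.ofReal_re] using this
  rw [h2.tsum_eq]
  simpa using Complex.hasSum_re h1

theorem exists_waveField_zero_bound (hD : IsModel hσ hP h m w M V) (hη : 0 < η) (hηm : η ≤ m)
    (hψ : IsWave μ P h V η ψ₀ ψ) : ∃ B, ∀ k : Fin d → ℂ, absSum k ≤ η / 2 →
      ‖waveField hσ hP hψ hψ k 0‖ ≤ B := by
  obtain ⟨A, hA, h1⟩ := hD.exists_corr_bound hη.le hηm hψ hψ le_rfl
  have hsum : Summable fun p : Site d × Site d => decay η p.1 * decay (η / 2) p.2 :=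
    (summable_exp_neg_norm (d := d) hη).mul_of_nonneg (summable_exp_neg_norm (half_pos hη))
      (fun _ => (Real.exp_pos _).le) fun _ => (Real.exp_pos _).le
  refine ⟨A * ∑' p : Site d × Site d, decay η p.1 * decay (η / 2) p.2, fun k hk => ?_⟩
  refine tsum_of_norm_bounded (hsum.hasSum.mul_left A) fun p =>
    (norm_embed_le_fiberDecay hσ (h1 p)).trans ?_
  rw [fiberDecay]
  have := (decay_pos η p.1).le
  have h2 : decay (η - absSum k) p.2 ≤ decay (η / 2) p.2 := by
    refine Real.exp_le_exp.2 (neg_le_neg ?_)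
    gcongr
    linarith
  gcongr

/-- The exponential moments on the diffusive scale stay bounded. -/
theorem exists_eventually_norm_le [BorelSpace Ω] (hD : IsModel hσ hP h m w M V) (hη : 0 < η)
    (hηm : η ≤ m) (hψ : IsWave μ P h V η ψ₀ ψ) (κ : Fin d → ℂ) : ∃ C, ∀ᶠ s : ℝ in 𝓝[>] 0,
      Summable (fun y => phase (s • κ) (-y) * waveMass μ P ψ ((s ^ 2)⁻¹) y) ∧
      ‖∑' y, phase (s • κ) (-y) * waveMass μ P ψ ((s ^ 2)⁻¹) y‖ ≤ C := by
  obtain ⟨γ, χ, hS, hA⟩ := hD.coupling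
  obtain ⟨B, hB⟩ := hD.exists_waveField_zero_bound hη hηm hψ
  have hN := absSum_nonneg κ
  have hm := hD.pos
  -- This bound asks for no symmetry of the perturbed operator, so `κ` may be complex.
  obtain ⟨C, K, s₁, hC, hK, hs₁, hbound⟩ :=
    hA.exists_perturbed_bound (2 * absSum κ / m * hopMass h m)
  have hpos : 0 < min s₁ (η / (2 * (absSum κ + 1))) := lt_min hs₁ (by positivity)
  refine ⟨Real.sqrt (C * B ^ 2 * Real.exp K), ?_⟩
  filter_upwards [Ioc_mem_nhdsGT hpos] with s hs
  have hs0 := hs.1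
  have hsk := absSum_smul_lt (κ := κ) hη hs0.le (hs.2.trans (min_le_right _ _))
  have hsη : absSum (s • κ) < η := by linarith
  have ht : (0 : ℝ) ≤ (s ^ 2)⁻¹ := by positivity
  have h1 := hD.hasSum_phase_waveMass hηm hsη hψ ht
  refine ⟨h1.summable, ?_⟩
  rw [h1.tsum_eq]
  have hn : ‖vacuum d μ‖ = 1 := norm_vacuum
  refine (norm_inner_le_norm _ _).trans ?_
  rw [hn, one_mul]
  refine Real.le_sqrt_of_sq_le ?_
  have hsm : s * absSum κ ≤ m / 2 := by rw [← absSum_smul hs0.le]; linarith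
  have h2 := hbound s hs0 (hs.2.trans (min_le_left _ _)) (fiberOp hσ h hD.bdd (s • κ))
    (fun x => norm_fiberOp_sub_le hσ hD.summable hm hD.bdd κ hs0.le hsm x)
    (inner_vacuum_fiberOp_vacuum hσ hD.summable hm hD.bdd (by linarith))
    (waveField hσ hP hψ hψ (s • κ)) (fun _ => 0) 0 0 ((s ^ 2)⁻¹) le_rfl le_rfl
    (by simpa using hD.isMild_waveField hηm hsη hψ hψ) (by simp) ((s ^ 2)⁻¹) ⟨ht, le_rfl⟩
  have e : K * s ^ 2 * (s ^ 2)⁻¹ = K := by field_simp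
  rw [e] at h2
  refine h2.trans ?_
  have h3 : ‖waveField hσ hP hψ hψ (s • κ) 0‖ ^ 2 ≤ B ^ 2 :=
    pow_le_pow_left₀ (norm_nonneg _) (hB _ hsk) 2
  gcongr
  simpa using h3

theorem norm_phase_of_real {k : Fin d → ℂ} (hk : ∀ i, (starRingEnd ℂ) (k i) = k i) (x : Site d) :
    ‖phase k x‖ = 1 := by
  have h1 : phase k x * (starRingEnd ℂ) (phase k x) = 1 := by
    rw [conj_phase hk, ← phase_add, add_neg_cancel, phase_zero]
  rw [Complex.mul_conj, Complex.normSq_eq_norm_sq] at h1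
  have h2 : ‖phase k x‖ ^ 2 = 1 := by exact_mod_cast h1
  exact (pow_eq_one_iff_of_nonneg (norm_nonneg _) two_ne_zero).1 h2

theorem tendsto_phase_waveMass [BorelSpace Ω] (hD : IsModel hσ hP h m w M V) (hη : 0 < η)
    (hηm : η ≤ m) (hψ : IsWave μ P h V η ψ₀ ψ) {κ : Fin d → ℂ}
    (hκ : ∀ i, (starRingEnd ℂ) (κ i) = κ i) {r : FiberSpace d μ}
    (hqr : inner ℂ (vacuum d μ) r = 0)
    (hr : Tendsto (fun u : ℝ => u⁻¹ • (r - fiberSemigroup hP u r)) (𝓝[>] 0)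
        (𝓝 (driftVec μ h κ - Complex.I • fiberOp hσ h hD.bdd 0 r))) :
    Tendsto (fun s : ℝ => ∑' y, phase (s • κ) (-y) * waveMass μ P ψ ((s ^ 2)⁻¹) y) (𝓝[>] 0)
      (𝓝 (Complex.exp (-inner ℂ (driftVec μ h κ) r) * (∑' y, ‖ψ₀ y‖ ^ 2 : ℝ))) := by
  obtain ⟨γ, χ, hS, hA⟩ := hD.coupling
  obtain ⟨B, hB⟩ := hD.exists_waveField_zero_bound hη hηm hψ
  have hN := absSum_nonneg κ
  have hm := hD.pos
  have hH := hopMass_nonneg h m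
  have hs₀ : 0 < η / (2 * (absSum κ + 1)) := by positivity
  have hsk : ∀ s, 0 < s → s ≤ η / (2 * (absSum κ + 1)) → absSum (s • κ) ≤ η / 2 :=
    fun s h1 h2 => absSum_smul_lt hη h1.le h2
  have hsm : ∀ s, 0 < s → s ≤ η / (2 * (absSum κ + 1)) → s * absSum κ ≤ m / 2 := fun s h1 h2 => by
    rw [← absSum_smul h1.le]; linarith [hsk s h1 h2]
  have hreal : ∀ s : ℝ, ∀ i, (starRingEnd ℂ) ((s • κ) i) = (s • κ) i := fun s i => by
    simp [hκ]
  have hfs : ∀ s, 0 < s → s ≤ η / (2 * (absSum κ + 1)) → ∀ t, 0 ≤ t →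
      HasSum (fun y => phase (s • κ) (-y) * waveMass μ P ψ t y)
        (inner ℂ (vacuum d μ) (waveField hσ hP hψ hψ (s • κ) t)) := fun s h1 h2 t ht =>
    hD.hasSum_phase_waveMass hηm (by linarith [hsk s h1 h2]) hψ ht
  have hmem := Ioc_mem_nhdsGT hs₀
  -- The initial field depends on `s` through the momentum; its vacuum component tends to the total
  -- mass by dominated convergence, the phases having modulus one.
  have ha₀ : Tendsto (fun s : ℝ => inner ℂ (vacuum d μ) (waveField hσ hP hψ hψ (s • κ) 0)) (𝓝[>] 0)
      (𝓝 ((∑' y, ‖ψ₀ y‖ ^ 2 : ℝ) : ℂ)) := by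
    have hsum0 := hD.hasSum_waveMass hη hηm hψ le_rfl
    have h2 : Tendsto (fun s : ℝ => ∑' y, phase (s • κ) (-y) * waveMass μ P ψ 0 y) (𝓝[>] 0)
        (𝓝 (∑' y, (waveMass μ P ψ 0 y : ℂ))) := by
      refine tendsto_tsum_of_dominated_convergence hsum0.summable (fun y => ?_)
        (Eventually.of_forall fun s y => ?_)
      · have hc : Continuous fun s : ℝ => phase (s • κ) (-y) * waveMass μ P ψ 0 y := by
          simp only [phase, dotC_smul]
          fun_prop
        have := (hc.tendsto 0).mono_left (nhdsWithin_le_nhds (s := Set.Ioi 0))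
        simpa only [zero_smul, phase_zero_left, one_mul] using this
      · rw [norm_mul, norm_phase_of_real (hreal s), one_mul, Complex.norm_real,
          Real.norm_of_nonneg (waveMass_nonneg _ _)]
    rw [← Complex.ofReal_tsum, hsum0.tsum_eq] at h2
    refine h2.congr' ?_
    filter_upwards [hmem] with s hs
    exact (hfs s hs.1 hs.2 0 le_rfl).tsum_eq
  have h3 := hA.tendsto_inner_perturbed (A' := fun s => fiberOp hσ h hD.bdd (s • κ))
    (C₀ := 2 * absSum κ / m * hopMass h m) (C₁ := (4 * absSum κ / m) ^ 2 * hopMass h m)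
    (by positivity) (by positivity) hs₀
    (fun s h1 h2 x => norm_fiberOp_sub_le hσ hD.summable hm hD.bdd κ h1.le (hsm s h1 h2) x)
    (fun s h1 h2 x => fiberOp_symm hσ hD.selfAdjoint hD.summable hm hD.bdd (hreal s)
      (by linarith [hsk s h1 h2]) _ _)
    (fun s h1 h2 => inner_vacuum_fiberOp_vacuum hσ hD.summable hm hD.bdd (by linarith [hsk s h1 h2]))
    (fun s h1 h2 => norm_fiberOp_vacuum_sub_le hσ hD.summable hm hD.bdd κ h1.le (hsm s h1 h2))
    (inner_vacuum_driftVec hD.summable hm κ) hr hqr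
    (f := fun s => waveField hσ hP hψ hψ (s • κ))
    (fun s h1 h2 => hD.isMild_waveField hηm (by linarith [hsk s h1 h2]) hψ hψ)
    (fun s h1 h2 => hB _ (hsk s h1 h2)) ha₀
  refine h3.congr' ?_
  filter_upwards [hmem] with s hs
  exact (hfs s hs.1 hs.2 _ (by positivity)).tsum_eq.symm

end IsModel

end Transport

/-! ### Exponential moments and the diffusion matrix. -/

section Covariance

variable {d : ℕ} {Ω : Type*} [TopologicalSpace Ω] [MeasurableSpace Ω] {μ : Measure Ω}
  {σ : Site d → Ω → Ω} {P : Kernel Ω (RCPath Ω)} {w : Ω → ℝ} {M : ℝ}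
  {V : Site d → ℝ → RCPath Ω → ℝ} [IsProbabilityMeasure μ] [IsMarkovKernel P]
  {h : Site d → ℂ} {m η : ℝ} {ψ₀ ψ₀' : Site d → ℂ} {ψ ψ' : ℝ → RCPath Ω → Site d → ℂ}
  {hσ : IsShiftAction μ σ} {hP : IsMarkovProcess μ σ P}

/-- A real momentum as a complex one. -/
def cplx (κ : EuclideanSpace ℝ (Fin d)) : Fin d → ℂ := fun i => (κ i : ℂ)

theorem dotC_cplx (κ : EuclideanSpace ℝ (Fin d)) (y : Site d) :
    dotC (cplx κ) y = (inner ℝ (toSpace y) κ : ℝ) := by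
  simp [dotC, cplx, toSpace, PiLp.inner_apply]

theorem phase_cplx (κ : EuclideanSpace ℝ (Fin d)) (s : ℝ) (y : Site d) :
    phase (s • cplx κ) (-y) = Complex.exp ((inner ℝ (s • toSpace y) κ : ℝ) * Complex.I) := by
  rw [phase, dotC_smul, dotC_neg, dotC_cplx, inner_smul_left]
  congr 1
  simp
  ring

/-- Imaginary momenta make the phase a real exponential, so that the vacuum component becomes an
exponential moment. -/
theorem phase_single_I (j : Fin d) (ε s : ℝ) (y : Site d) :
    phase (s • (Pi.single j (ε * Complex.I) : Fin d → ℂ)) (-y)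
      = (Real.exp (-(s * ε * y j)) : ℝ) := by
  have e : dotC (Pi.single j (ε * Complex.I) : Fin d → ℂ) y = ε * Complex.I * y j := by
    rw [dotC, Finset.sum_eq_single j]
    · simp
    · intro i _ hi; simp [hi]
    · simp
  rw [phase, dotC_smul, dotC_neg, e, Complex.ofReal_exp]
  congr 1
  push_cast
  linear_combination (s * ε * y j : ℂ) * Complex.I_mul_I

theorem exists_norm_toSpace_le (hd : 0 < d) (y : Site d) :
    ∃ j, ‖toSpace y‖ ≤ d * |(y j : ℝ)| := by
  have : Nonempty (Fin d) := ⟨⟨0, hd⟩⟩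
  obtain ⟨j, -, hj⟩ := Finset.exists_max_image Finset.univ (fun i => |(y i : ℝ)|)
    Finset.univ_nonempty
  refine ⟨j, ?_⟩
  have hd1 : (1 : ℝ) ≤ d := by exact_mod_cast hd
  refine abs_le_of_sq_le_sq' ?_ (by positivity) |>.2
  rw [EuclideanSpace.norm_sq_eq]
  calc ∑ i, ‖toSpace y i‖ ^ 2 ≤ ∑ _i : Fin d, |(y j : ℝ)| ^ 2 := by
        refine Finset.sum_le_sum fun i _ => ?_
        exact pow_le_pow_left₀ (norm_nonneg _) (hj i (Finset.mem_univ i)) 2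
    _ = d * |(y j : ℝ)| ^ 2 := by simp
    _ ≤ (d * |(y j : ℝ)|) ^ 2 := by
        rw [mul_pow]
        exact mul_le_mul_of_nonneg_right (le_self_pow₀ hd1 two_ne_zero) (sq_nonneg _)

/-- The coordinate of largest modulus satisfies `‖y‖ ≤ d |y_j|`, and one of the two signs realizes
`|y_j|`. -/
theorem exp_norm_toSpace_le (hd : 0 < d) {s : ℝ} (hs : 0 ≤ s) (y : Site d) :
    Real.exp (s / d * ‖toSpace y‖)
      ≤ ∑ j, (Real.exp (-(s * 1 * y j)) + Real.exp (-(s * (-1) * y j))) := by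
  obtain ⟨j, hj⟩ := exists_norm_toSpace_le hd y
  have hd0 : (0 : ℝ) < d := by exact_mod_cast hd
  refine le_trans ?_ (Finset.single_le_sum (f := fun j =>
    Real.exp (-(s * 1 * y j)) + Real.exp (-(s * (-1) * y j))) (fun i _ => by positivity)
    (Finset.mem_univ j))
  have h1 : s / d * ‖toSpace y‖ ≤ s * |(y j : ℝ)| := by
    calc s / d * ‖toSpace y‖ ≤ s / d * (d * |(y j : ℝ)|) := by gcongr
      _ = s * |(y j : ℝ)| := by field_simp
  refine (Real.exp_le_exp.2 h1).trans ?_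
  rcases abs_cases (y j : ℝ) with ⟨h2, -⟩ | ⟨h2, -⟩ <;> rw [h2]
  · refine le_add_of_nonneg_of_le (Real.exp_pos _).le (Real.exp_le_exp.2 (by linarith))
  · refine le_add_of_le_of_nonneg (Real.exp_le_exp.2 (by linarith)) (Real.exp_pos _).le

theorem driftVec_eq_sum (hs : Summable fun y : Site d => Real.exp (m * ‖toSpace y‖) * ‖h y‖)
    (hm : 0 < m) (κ : Fin d → ℂ) :
    driftVec μ h κ = ∑ j, κ j • driftVec μ h (Pi.single j 1) := by
  have h1 : HasSum (fun ζ => ∑ j, κ j • (h ζ * (Complex.I * dotC (Pi.single j 1) ζ)) • siteVec μ ζ)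
      (∑ j, κ j • driftVec μ h (Pi.single j 1)) :=
    hasSum_sum fun j _ => (hasSum_driftVec hs hm (Pi.single j 1)).const_smul (κ j)
  refine (hasSum_driftVec hs hm κ).unique (h1.congr_fun fun ζ => ?_)
  simp only [smul_smul, ← Finset.sum_smul]
  congr 1
  have e : ∀ j, dotC (Pi.single j 1 : Fin d → ℂ) ζ = ζ j := fun j => by
    rw [dotC, Finset.sum_eq_single j]
    · simp
    · intro i _ hi; simp [hi]
    · simp
  simp only [e]
  simp only [dotC, Finset.mul_sum]
  exact Finset.sum_congr rfl fun j _ => by ring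

theorem eq_zero_of_exp_real {q : ℝ} (hq : ∀ s : ℝ, Real.sin (s ^ 2 * q) = 0) : q = 0 := by
  by_contra hne
  have habs : 0 < |q| := abs_pos.2 hne
  have h1 := hq (Real.sqrt (Real.pi / 2 / |q|))
  rw [Real.sq_sqrt (by positivity)] at h1
  rcases abs_cases q with ⟨e, -⟩ | ⟨e, -⟩
  · rw [e, div_mul_cancel₀ _ hne, Real.sin_pi_div_two] at h1
    exact one_ne_zero h1
  · have : Real.pi / 2 / |q| * q = -(Real.pi / 2) := by rw [e]; field_simp
    rw [this, Real.sin_neg, Real.sin_pi_div_two] at h1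
    norm_num at h1

namespace IsModel

theorem exists_exp_moment [BorelSpace Ω] (hD : IsModel hσ hP h m w M V) (hd : 0 < d) (hη : 0 < η)
    (hηm : η ≤ m) (hψ : IsWave μ P h V η ψ₀ ψ) : ∃ C, ∀ᶠ s : ℝ in 𝓝[>] 0,
      Summable (fun y => Real.exp (s / d * ‖toSpace y‖) * waveMass μ P ψ ((s ^ 2)⁻¹) y) ∧
      ∑' y, Real.exp (s / d * ‖toSpace y‖) * waveMass μ P ψ ((s ^ 2)⁻¹) y ≤ C := by
  have key : ∀ ε : ℝ, ∀ j : Fin d, ∃ C, ∀ᶠ s : ℝ in 𝓝[>] 0,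
      Summable (fun y => Real.exp (-(s * ε * y j)) * waveMass μ P ψ ((s ^ 2)⁻¹) y) ∧
      ∑' y, Real.exp (-(s * ε * y j)) * waveMass μ P ψ ((s ^ 2)⁻¹) y ≤ C := by
    intro ε j
    obtain ⟨C, hC⟩ := hD.exists_eventually_norm_le hη hηm hψ (Pi.single j (ε * Complex.I))
    refine ⟨C, hC.mono fun s hs => ?_⟩
    simp only [phase_single_I, ← Complex.ofReal_mul, ← Complex.ofReal_tsum, Complex.summable_ofReal,
      Complex.norm_real] at hs
    exact ⟨hs.1, (le_abs_self _).trans hs.2⟩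
  choose C hC using key
  refine ⟨∑ j, (C 1 j + C (-1) j), ?_⟩
  filter_upwards [eventually_all.2 fun j => hC 1 j, eventually_all.2 fun j => hC (-1) j,
    self_mem_nhdsWithin] with s h1 h2 hs
  have hs0 : 0 < s := hs
  have h3 : Summable fun y => ∑ j, (Real.exp (-(s * 1 * y j)) * waveMass μ P ψ ((s ^ 2)⁻¹) y
      + Real.exp (-(s * (-1) * y j)) * waveMass μ P ψ ((s ^ 2)⁻¹) y) :=
    summable_sum fun j _ => (h1 j).1.add (h2 j).1
  have hle : ∀ y, Real.exp (s / d * ‖toSpace y‖) * waveMass μ P ψ ((s ^ 2)⁻¹) y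
      ≤ ∑ j, (Real.exp (-(s * 1 * y j)) * waveMass μ P ψ ((s ^ 2)⁻¹) y
      + Real.exp (-(s * (-1) * y j)) * waveMass μ P ψ ((s ^ 2)⁻¹) y) := fun y => by
    simp only [← add_mul, ← Finset.sum_mul]
    exact mul_le_mul_of_nonneg_right (exp_norm_toSpace_le hd hs0.le y) (waveMass_nonneg _ _)
  have h4 : Summable (fun y => Real.exp (s / d * ‖toSpace y‖) * waveMass μ P ψ ((s ^ 2)⁻¹) y) :=
    h3.of_nonneg_of_le (fun y => mul_nonneg (Real.exp_pos _).le (waveMass_nonneg _ _)) hle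
  refine ⟨h4, (h4.tsum_le_tsum hle h3).trans ?_⟩
  rw [Summable.tsum_finsetSum fun j _ => (h1 j).1.add (h2 j).1]
  refine Finset.sum_le_sum fun j _ => ?_
  rw [(h1 j).1.tsum_add (h2 j).1]
  exact add_le_add (h1 j).2 (h2 j).2

/-- The diffusion matrix and the limit of the characteristic functions. -/
theorem exists_covariance [BorelSpace Ω] (hD : IsModel hσ hP h m w M V)
    (hnd : ∀ k : EuclideanSpace ℝ (Fin d), k ≠ 0 →
      ∃ y : Site d, inner ℝ k (toSpace y) ≠ 0 ∧ h y ≠ 0) :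
    ∃ D : Matrix (Fin d) (Fin d) ℝ, D.PosDef ∧
      ∀ (η : ℝ) (ψ₀ : Site d → ℂ) (ψ : ℝ → RCPath Ω → Site d → ℂ), 0 < η → η ≤ m →
        IsWave μ P h V η ψ₀ ψ → ∀ κ : EuclideanSpace ℝ (Fin d),
        Tendsto (fun s : ℝ => ∑' y, Complex.exp ((inner ℝ (s • toSpace y) κ : ℝ) * Complex.I)
            * waveMass μ P ψ ((s ^ 2)⁻¹) y) (𝓝[>] 0)
          (𝓝 (Real.exp (-(1 / 2 * (κ.ofLp ⬝ᵥ D.mulVec κ.ofLp))) * ∑' y, ‖ψ₀ y‖ ^ 2 : ℝ)) := by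
  have hm := hD.pos
  obtain ⟨γ, χ, hS, hA⟩ := hD.coupling
  -- The resolvent is chosen for the coordinate momenta and extended linearly, which makes `Q` a
  -- quadratic form in `κ`.
  choose r hqr hr using fun j : Fin d => hD.exists_resolvent_drift (Pi.single j 1)
  set R : EuclideanSpace ℝ (Fin d) → FiberSpace d μ := fun κ => ∑ j, (κ j : ℂ) • r j with hR
  have hqR : ∀ κ, inner ℂ (vacuum d μ) (R κ) = 0 := fun κ => by
    simp [hR, hqr, inner_sum, inner_smul_right]
  have hRlim : ∀ κ, Tendsto (fun u : ℝ => u⁻¹ • (R κ - fiberSemigroup hP u (R κ))) (𝓝[>] 0)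
      (𝓝 (driftVec μ h (cplx κ) - Complex.I • fiberOp hσ h hD.bdd 0 (R κ))) := fun κ => by
    have h1 := tendsto_finsetSum (Finset.univ : Finset (Fin d)) fun j _ =>
      (hr j).const_smul (κ j : ℂ)
    have e1 : ∑ j, (κ j : ℂ) • (driftVec μ h (Pi.single j 1)
        - Complex.I • fiberOp hσ h hD.bdd 0 (r j))
        = driftVec μ h (cplx κ) - Complex.I • fiberOp hσ h hD.bdd 0 (R κ) := by
      simp only [hR, driftVec_eq_sum hD.summable hm (cplx κ), map_sum, map_smul, smul_sub,
        Finset.sum_sub_distrib, Finset.smul_sum, cplx]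
      congr 1
      exact Finset.sum_congr rfl fun j _ => smul_comm _ _ _
    rw [e1] at h1
    refine h1.congr fun u => ?_
    simp only [hR, map_sum, map_smul, ← Finset.sum_sub_distrib, Finset.smul_sum]
    refine Finset.sum_congr rfl fun j _ => ?_
    rw [← smul_sub]
    exact smul_comm _ _ _
  set G : Fin d → Fin d → ℂ := fun j l => inner ℂ (driftVec μ h (Pi.single j 1)) (r l) with hG
  set Q : EuclideanSpace ℝ (Fin d) → ℂ := fun κ => inner ℂ (driftVec μ h (cplx κ)) (R κ) with hQ
  have hQG : ∀ κ, Q κ = ∑ j, ∑ l, (κ j * κ l : ℂ) * G j l := fun κ => by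
    simp only [hQ, hR, driftVec_eq_sum hD.summable hm (cplx κ), sum_inner, inner_sum,
      inner_smul_left, inner_smul_right, cplx, Complex.conj_ofReal, hG, Finset.mul_sum]
    rw [Finset.sum_comm]
    refine Finset.sum_congr rfl fun j _ => Finset.sum_congr rfl fun l _ => by ring
  have hQsmul : ∀ (s : ℝ) κ, Q (s • κ) = s ^ 2 * Q κ := fun s κ => by
    simp only [hQG, Finset.mul_sum, PiLp.smul_apply, smul_eq_mul]
    refine Finset.sum_congr rfl fun j _ => Finset.sum_congr rfl fun l _ => by push_cast; ring
  -- A vanishing drift vector would mean `h(y) (κ·y) = 0` for all `y`, against the nondegeneracy of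
  -- `h`.
  have hQpos : ∀ κ, κ ≠ 0 → 0 < (Q κ).re := fun κ hκ => by
    refine hA.re_inner_pos (liftL_meanL2_driftVec hD.summable hm _) (fun h0 => ?_) (hRlim κ)
    obtain ⟨y, hy, hhy⟩ := hnd κ hκ
    have h1 := driftVec_apply (μ := μ) hD.summable hm (cplx κ) y
    rw [h0] at h1
    have h2 : (h y * (Complex.I * dotC (cplx κ) y)) • oneL2 μ = 0 := h1.symm
    have h3 : oneL2 μ ≠ 0 := fun h0 => by
      have := norm_oneL2 (μ := μ)
      rw [h0, norm_zero] at this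
      exact zero_ne_one this
    rw [smul_eq_zero_iff_left h3, dotC_cplx, real_inner_comm] at h2
    simp only [mul_eq_zero, Complex.I_ne_zero, Complex.ofReal_eq_zero, false_or] at h2
    exact h2.elim hhy hy
  have hlim : ∀ (η : ℝ) (ψ₀ : Site d → ℂ) (ψ : ℝ → RCPath Ω → Site d → ℂ), 0 < η → η ≤ m →
      IsWave μ P h V η ψ₀ ψ → ∀ κ : EuclideanSpace ℝ (Fin d),
      Tendsto (fun s : ℝ => ∑' y, Complex.exp ((inner ℝ (s • toSpace y) κ : ℝ) * Complex.I)
          * waveMass μ P ψ ((s ^ 2)⁻¹) y) (𝓝[>] 0)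
        (𝓝 (Complex.exp (-Q κ) * (∑' y, ‖ψ₀ y‖ ^ 2 : ℝ))) := fun η ψ₀ ψ hη hηm hψ κ => by
    have := hD.tendsto_phase_waveMass hη hηm hψ (κ := cplx κ) (fun i => by simp [cplx]) (hqR κ)
      (hRlim κ)
    simpa only [phase_cplx] using this
  -- For the wave from `δ_0` the characteristic functions at `κ` and `-κ` are conjugate, while `Q`
  -- is even. Hence `e^{-Q(sκ)}` is real for all `s`, which forces `Im Q = 0` as `Q(sκ) = s² Q(κ)`.
  have hQim : ∀ κ, (Q κ).im = 0 := by
    obtain ⟨ψ, hψ⟩ := hD.exists_wave_delta hm.le le_rfl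
    have hone : ∑' y : Site d, ‖(Pi.single 0 1 : Site d → ℂ) y‖ ^ 2 = 1 := by
      rw [tsum_eq_single 0 fun y hy => by simp [Pi.single_eq_of_ne hy]]
      simp
    have hl := hlim m _ ψ hm le_rfl hψ
    simp only [hone, Complex.ofReal_one, mul_one] at hl
    have hconj : ∀ κ, (starRingEnd ℂ) (Complex.exp (-Q κ)) = Complex.exp (-Q κ) := fun κ => by
      have h1 := hl (-κ)
      have e : Q (-κ) = Q κ := by
        have := hQsmul (-1) κ
        simpa using this
      rw [e] at h1
      have h2 := (Complex.continuous_conj.tendsto _).comp (hl κ)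
      refine tendsto_nhds_unique h2 (h1.congr fun s => ?_)
      rw [Function.comp_apply, Complex.conj_tsum]
      refine tsum_congr fun y => ?_
      rw [map_mul, Complex.conj_ofReal, ← Complex.exp_conj, map_mul, Complex.conj_ofReal,
        Complex.conj_I, inner_neg_right]
      push_cast
      ring_nf
    intro κ
    refine eq_zero_of_exp_real fun s => ?_
    have h1 := Complex.conj_eq_iff_im.1 (hconj (s • κ))
    rw [hQsmul, Complex.exp_im] at h1
    have h2 : (-((s : ℂ) ^ 2 * Q κ)).im = -(s ^ 2 * (Q κ).im) := by
      rw [← Complex.ofReal_pow, Complex.neg_im, Complex.im_ofReal_mul]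
    rw [h2, Real.sin_neg, mul_neg, neg_eq_zero] at h1
    exact (mul_eq_zero.1 h1).resolve_left (Real.exp_pos _).ne'
  -- Adding the transpose makes `D` symmetric, with `κ·Dκ = 2 Re Q(κ)`.
  set D : Matrix (Fin d) (Fin d) ℝ := fun j l => (G j l).re + (G l j).re with hDdef
  have hDQ : ∀ κ : EuclideanSpace ℝ (Fin d), κ.ofLp ⬝ᵥ D.mulVec κ.ofLp = 2 * (Q κ).re := by
    intro κ
    have e1 : (Q κ).re = ∑ j, ∑ l, κ j * κ l * (G j l).re := by
      rw [hQG]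
      simp only [Complex.re_sum, ← Complex.ofReal_mul, Complex.re_ofReal_mul]
    have e2 : (Q κ).re = ∑ j, ∑ l, κ j * κ l * (G l j).re := by
      rw [e1, Finset.sum_comm]
      exact Finset.sum_congr rfl fun j _ => Finset.sum_congr rfl fun l _ => by ring
    rw [two_mul]
    nth_rewrite 1 [e1]
    rw [e2, ← Finset.sum_add_distrib]
    refine Finset.sum_congr rfl fun j _ => ?_
    rw [← Finset.sum_add_distrib, Matrix.mulVec, dotProduct, Finset.mul_sum]
    exact Finset.sum_congr rfl fun l _ => by rw [hDdef]; ring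
  refine ⟨D, Matrix.PosDef.of_dotProduct_mulVec_pos ?_ fun x hx => ?_, fun η ψ₀ ψ hη hηm hψ κ => ?_⟩
  · refine Matrix.IsHermitian.ext fun i j => ?_
    rw [hDdef]
    simp [add_comm]
  · have h1 := hDQ (WithLp.toLp 2 x)
    rw [star_trivial]
    change 0 < (WithLp.toLp 2 x).ofLp ⬝ᵥ D.mulVec (WithLp.toLp 2 x).ofLp
    rw [h1]
    have := hQpos (WithLp.toLp 2 x) (fun h0 => hx (by simpa using h0))
    linarith
  · have h1 := hlim η ψ₀ ψ hη hηm hψ κ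
    have e : Q κ = ((Q κ).re : ℂ) := by
      refine Complex.ext rfl ?_
      rw [hQim, Complex.ofReal_im]
    rw [hDQ]
    rw [e] at h1
    convert h1 using 2
    push_cast
    ring_nf

end IsModel

end Covariance

/-! ### Gaussian integrals. -/

variable {d : ℕ}

theorem PolyBounded.exists_le_exp {f : EuclideanSpace ℝ (Fin d) → ℝ} (hf : PolyBounded f) {c : ℝ}
    (hc : 0 < c) : ∃ A : ℝ, 0 ≤ A ∧ ∀ y, |f y| ≤ A * Real.exp (c * ‖y‖) := by
  obtain ⟨C, n, hC⟩ := hf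
  refine ⟨|C| * (n.factorial / c ^ n * Real.exp c), by positivity, fun y => ?_⟩
  have h1 := Real.pow_div_factorial_le_exp (c * (1 + ‖y‖)) (by positivity) n
  rw [mul_pow, mul_add, mul_one, Real.exp_add, div_le_iff₀ (by positivity)] at h1
  have h2 : (1 + ‖y‖) ^ n ≤ n.factorial / c ^ n * Real.exp c * Real.exp (c * ‖y‖) := by
    rw [div_mul_eq_mul_div, div_mul_eq_mul_div, le_div_iff₀ (by positivity)]
    linarith
  calc |f y| ≤ C * (1 + ‖y‖) ^ n := hC y
    _ ≤ |C| * (1 + ‖y‖) ^ n := by gcongr; exact le_abs_self C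
    _ ≤ |C| * (n.factorial / c ^ n * Real.exp c * Real.exp (c * ‖y‖)) := by gcongr
    _ = _ := by ring

theorem exists_symmetric_sqrt {D : Matrix (Fin d) (Fin d) ℝ} (hD : D.PosDef) :
    ∃ S : Matrix (Fin d) (Fin d) ℝ, S.transpose = S ∧ S * S = D := by
  open scoped MatrixOrder in
  refine ⟨CFC.sqrt D, ?_, CFC.sqrt_mul_sqrt_self D hD.posSemidef.nonneg⟩
  open scoped MatrixOrder in
  have h := (CFC.sqrt_nonneg D).isSelfAdjoint
  rwa [IsSelfAdjoint, Matrix.star_eq_conjTranspose, Matrix.conjTranspose_eq_transpose_of_trivial]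
    at h

section LinearChange

variable {S D : Matrix (Fin d) (Fin d) ℝ}

theorem abs_det_of_mul_self (hS : S * S = D) : |S.det| = √D.det := by
  rw [← hS, Matrix.det_mul, Real.sqrt_mul_self_eq_abs]

/-- With `S` the symmetric square root of `D`, the substitution `y = S x` reduces to the standard
Gaussian, since `S D⁻¹ S = 1`. -/
theorem gaussianDensity_toLpLin (hT : S.transpose = S) (hS : S * S = D) (hdet : S.det ≠ 0)
    (x : EuclideanSpace ℝ (Fin d)) : gaussianDensity D (S.toLpLin 2 2 x)
      = (√((2 * Real.pi) ^ d * D.det))⁻¹ * Real.exp (-(1 / 2) * ‖x‖ ^ 2) := by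
  have hu : IsUnit S.det := isUnit_iff_ne_zero.2 hdet
  have h1 : S * (D⁻¹ * S) = 1 := by
    rw [← hS, Matrix.mul_inv_rev, Matrix.mul_assoc, Matrix.nonsing_inv_mul S hu, Matrix.mul_one,
      Matrix.mul_nonsing_inv S hu]
  have h2 : (S.toLpLin 2 2 x).ofLp ⬝ᵥ D⁻¹.mulVec (S.toLpLin 2 2 x).ofLp = ‖x‖ ^ 2 := by
    have h3 : (S.toLpLin 2 2 x).ofLp = S.mulVec x.ofLp := rfl
    rw [h3, Matrix.mulVec_mulVec, ← Matrix.vecMul_transpose, hT, ← Matrix.dotProduct_mulVec,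
      Matrix.mulVec_mulVec, h1, Matrix.one_mulVec, EuclideanSpace.real_norm_sq_eq]
    simp [dotProduct, sq]
  rw [gaussianDensity, h2]

theorem toLpLin_injective_of_det (hdet : S.det ≠ 0) :
    Function.Injective (S.toLpLin 2 2) ∧ Function.Surjective (S.toLpLin 2 2) := by
  have h : IsUnit (LinearMap.det (S.toLpLin 2 2)) := by
    rw [LinearMap.det_toLpLin]; exact isUnit_iff_ne_zero.2 hdet
  exact (LinearEquiv.ofIsUnitDet (f := S.toLpLin 2 2) (v := PiLp.basisFun 2 ℝ (Fin d))
    (v' := PiLp.basisFun 2 ℝ (Fin d)) (by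
      rw [LinearMap.det_toMatrix]; exact h)).bijective

theorem integral_eq_toLpLin {F : Type*} [NormedAddCommGroup F] [NormedSpace ℝ F]
    (hdet : S.det ≠ 0) (g : EuclideanSpace ℝ (Fin d) → F) :
    ∫ y, g y = |S.det| • ∫ x, g (S.toLpLin 2 2 x) := by
  obtain ⟨hi, hs⟩ := toLpLin_injective_of_det hdet
  set L := LinearMap.toContinuousLinearMap (S.toLpLin 2 2) with hL
  have h1 := integral_image_eq_integral_abs_det_fderiv_smul (volume : Measure _)
    (f := L) (f' := fun _ => L) MeasurableSet.univ
    (fun x _ => L.hasFDerivAt.hasFDerivWithinAt) hi.injOn g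
  have h2 : L.det = S.det := by
    rw [← LinearMap.det_toLpLin 2 S]; rfl
  rw [Set.image_univ, show Set.range L = Set.univ from Set.range_eq_univ.2 hs, setIntegral_univ, setIntegral_univ, h2,
    integral_smul] at h1
  exact h1

theorem integrable_of_toLpLin {F : Type*} [NormedAddCommGroup F] [NormedSpace ℝ F]
    (hdet : S.det ≠ 0) {g : EuclideanSpace ℝ (Fin d) → F}
    (hg : Integrable fun x => g (S.toLpLin 2 2 x)) : Integrable g := by
  obtain ⟨hi, hs⟩ := toLpLin_injective_of_det hdet
  set L := LinearMap.toContinuousLinearMap (S.toLpLin 2 2) with hL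
  have h1 := integrableOn_image_iff_integrableOn_abs_det_fderiv_smul (volume : Measure _)
    (f := L) (f' := fun _ => L) MeasurableSet.univ
    (fun x _ => L.hasFDerivAt.hasFDerivWithinAt) hi.injOn g
  rw [Set.image_univ, show Set.range L = Set.univ from Set.range_eq_univ.2 hs, integrableOn_univ, integrableOn_univ] at h1
  exact h1.2 (hg.smul _)

end LinearChange

section Gaussian

variable {D : Matrix (Fin d) (Fin d) ℝ}

theorem gaussianDensity_nonneg (y : EuclideanSpace ℝ (Fin d)) : 0 ≤ gaussianDensity D y := by
  unfold gaussianDensity; positivity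

theorem gaussianDensity_pos (hD : D.PosDef) (y : EuclideanSpace ℝ (Fin d)) :
    0 < gaussianDensity D y := by
  have := hD.det_pos
  unfold gaussianDensity; positivity

theorem continuous_gaussianDensity : Continuous (gaussianDensity D) := by
  unfold gaussianDensity
  refine continuous_const.mul (Real.continuous_exp.comp (continuous_const.mul ?_))
  exact (PiLp.continuous_ofLp 2 _).dotProduct (continuous_const.matrix_mulVec (PiLp.continuous_ofLp 2 _))

theorem integrable_exp_gaussianDensity (hD : D.PosDef) (c : ℝ) :
    Integrable fun y => Real.exp (c * ‖y‖) * gaussianDensity D y := by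
  obtain ⟨S, hT, hS⟩ := exists_symmetric_sqrt hD
  have hdet : S.det ≠ 0 := fun h0 => hD.det_pos.ne' (by rw [← hS, Matrix.det_mul, h0, zero_mul])
  refine integrable_of_toLpLin hdet ?_
  simp_rw [gaussianDensity_toLpLin hT hS hdet]
  set L := LinearMap.toContinuousLinearMap (S.toLpLin 2 2) with hL
  set k := (√((2 * Real.pi) ^ d * D.det))⁻¹
  have h0 : Integrable fun x : EuclideanSpace ℝ (Fin d) => Real.exp (-(1 / 4) * ‖x‖ ^ 2) := by
    have h1 := (GaussianFourier.integrable_cexp_neg_mul_sq_norm_add (b := (1 / 4 : ℂ))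
      (by norm_num) 0 (0 : EuclideanSpace ℝ (Fin d))).re
    refine h1.congr (Eventually.of_forall fun x => ?_)
    have : (-(1 / 4 : ℂ) * (‖x‖ : ℂ) ^ 2 + 0 * ((inner ℝ (0 : EuclideanSpace ℝ (Fin d)) x : ℝ) : ℂ))
        = ((-(1 / 4) * ‖x‖ ^ 2 : ℝ) : ℂ) := by push_cast; ring
    simp only [this]
    exact Complex.exp_ofReal_re _
  refine (h0.const_mul (k * Real.exp ((c * ‖L‖) ^ 2))).mono' ?_ (Eventually.of_forall fun x => ?_)
  · exact (((Real.continuous_exp.comp (continuous_const.mul L.continuous.norm)).mul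
      (by fun_prop)) : Continuous fun x => Real.exp (c * ‖L x‖) *
        (k * Real.exp (-(1 / 2) * ‖x‖ ^ 2))).aestronglyMeasurable
  · have h2 : c * ‖L x‖ ≤ |c| * (‖L‖ * ‖x‖) :=
      mul_le_mul (le_abs_self c) (L.le_opNorm x) (norm_nonneg _) (abs_nonneg c)
    -- Young's inequality `|c| ‖L‖ ‖x‖ ≤ (c ‖L‖)² + ‖x‖²/4` leaves a Gaussian with exponent `1/4`.
    have h3 : c * ‖L x‖ + -(1 / 2) * ‖x‖ ^ 2 ≤ (c * ‖L‖) ^ 2 + -(1 / 4) * ‖x‖ ^ 2 := by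
      have : (c * ‖L‖) ^ 2 = (|c| * ‖L‖) ^ 2 := by rw [mul_pow, mul_pow, sq_abs]
      rw [this]
      nlinarith [sq_nonneg (|c| * ‖L‖ - ‖x‖ / 2)]
    have hk : 0 ≤ k := by positivity
    rw [Real.norm_of_nonneg (by positivity)]
    calc Real.exp (c * ‖L x‖) * (k * Real.exp (-(1 / 2) * ‖x‖ ^ 2))
        = k * Real.exp (c * ‖L x‖ + -(1 / 2) * ‖x‖ ^ 2) := by rw [Real.exp_add]; ring
      _ ≤ k * Real.exp ((c * ‖L‖) ^ 2 + -(1 / 4) * ‖x‖ ^ 2) := by gcongr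
      _ = _ := by rw [Real.exp_add]; ring

theorem integral_cexp_gaussianDensity (hD : D.PosDef) (κ : EuclideanSpace ℝ (Fin d)) :
    ∫ y, Complex.exp ((inner ℝ y κ : ℝ) * Complex.I) * (gaussianDensity D y : ℂ)
      = (Real.exp (-(1 / 2 * (κ.ofLp ⬝ᵥ D.mulVec κ.ofLp))) : ℂ) := by
  obtain ⟨S, hT, hS⟩ := exists_symmetric_sqrt hD
  have hdet : S.det ≠ 0 := fun h0 => hD.det_pos.ne' (by rw [← hS, Matrix.det_mul, h0, zero_mul])
  rw [integral_eq_toLpLin hdet]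
  simp_rw [gaussianDensity_toLpLin hT hS hdet]
  set k := (√((2 * Real.pi) ^ d * D.det))⁻¹ with hk
  have hi : ∀ x : EuclideanSpace ℝ (Fin d), inner ℝ (S.toLpLin 2 2 x) κ
      = inner ℝ (S.toLpLin 2 2 κ) x := fun x => by
    rw [EuclideanSpace.inner_eq_star_dotProduct, EuclideanSpace.inner_eq_star_dotProduct]
    change κ.ofLp ⬝ᵥ S.mulVec x.ofLp = x.ofLp ⬝ᵥ S.mulVec κ.ofLp
    rw [Matrix.dotProduct_mulVec, ← Matrix.mulVec_transpose, hT, dotProduct_comm]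
  have hn : ‖S.toLpLin 2 2 κ‖ ^ 2 = κ.ofLp ⬝ᵥ D.mulVec κ.ofLp := by
    rw [EuclideanSpace.real_norm_sq_eq]
    have : ∑ i, (S.toLpLin 2 2 κ) i ^ 2 = S.mulVec κ.ofLp ⬝ᵥ S.mulVec κ.ofLp := by
      simp only [dotProduct, sq]; rfl
    rw [this, ← hS, ← Matrix.mulVec_mulVec, Matrix.dotProduct_mulVec κ.ofLp,
      ← Matrix.mulVec_transpose, hT]
  have he : ∀ x : EuclideanSpace ℝ (Fin d),
      Complex.exp ((inner ℝ (S.toLpLin 2 2 x) κ : ℝ) * Complex.I)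
          * ((k * Real.exp (-(1 / 2) * ‖x‖ ^ 2) : ℝ) : ℂ)
        = k * Complex.exp (-(1 / 2 : ℂ) * (‖x‖ : ℂ) ^ 2
          + Complex.I * (inner ℝ (S.toLpLin 2 2 κ) x : ℝ)) := fun x => by
    rw [hi, Complex.exp_add]; push_cast; ring_nf
  simp_rw [he]
  rw [integral_const_mul, GaussianFourier.integral_cexp_neg_mul_sq_norm_add (by norm_num)]
  have hp : ((Real.pi : ℂ) / (1 / 2)) ^ (Module.finrank ℝ (EuclideanSpace ℝ (Fin d)) / 2 : ℂ)
      = (√((2 * Real.pi) ^ d) : ℝ) := by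
    rw [finrank_euclideanSpace_fin, Real.sqrt_eq_rpow, ← Real.rpow_natCast, ← Real.rpow_mul
      (by positivity), Complex.ofReal_cpow (by positivity)]
    push_cast; congr 1 <;> ring
  have hc : |S.det| * (k * √((2 * Real.pi) ^ d)) = 1 := by
    have h1 := Real.sqrt_pos.2 hD.det_pos
    have h2 : 0 < √((2 * Real.pi) ^ d) := Real.sqrt_pos.2 (by positivity)
    rw [abs_det_of_mul_self hS, hk, Real.sqrt_mul (by positivity)]
    field_simp
  rw [hp, Complex.real_smul, ← mul_assoc, ← mul_assoc, mul_assoc _ (k : ℂ)]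
  have hc' : ((|S.det| : ℝ) : ℂ) * ((k : ℂ) * (√((2 * Real.pi) ^ d) : ℝ)) = 1 := by exact_mod_cast hc
  rw [hc', one_mul, ← hn, Complex.I_sq]
  push_cast; congr 1; ring

theorem integral_gaussianDensity (hD : D.PosDef) : ∫ y, gaussianDensity D y = 1 := by
  have h := integral_cexp_gaussianDensity hD 0
  simp only [inner_zero_right, Complex.ofReal_zero, zero_mul, Complex.exp_zero, one_mul] at h
  rw [integral_complex_ofReal] at h
  simpa using congrArg Complex.re h

theorem PolyBounded.integrable_mul_gaussianDensity (hD : D.PosDef)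
    {f : EuclideanSpace ℝ (Fin d) → ℝ} (hf : Continuous f) (hp : PolyBounded f) :
    Integrable fun y => f y * gaussianDensity D y := by
  obtain ⟨A, -, hA⟩ := hp.exists_le_exp one_pos
  refine ((integrable_exp_gaussianDensity hD 1).const_mul A).mono'
    (hf.mul continuous_gaussianDensity).aestronglyMeasurable (Eventually.of_forall fun y => ?_)
  rw [norm_mul, Real.norm_eq_abs, Real.norm_of_nonneg (gaussianDensity_nonneg y), ← mul_assoc]
  exact mul_le_mul_of_nonneg_right (hA y) (gaussianDensity_nonneg y)

end Gaussian

/-! ### Weak convergence and test functions of polynomial growth. -/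

variable {d : ℕ}

/-- The truncation error is bounded by `t²`, so a uniform bound on the integrals of `f²` makes
truncation at height `R` uniformly cheap. -/
theorem abs_sub_clamp_le {R : ℝ} (hR : 0 < R) (t : ℝ) : |t - max (-R) (min t R)| ≤ t ^ 2 / R := by
  rw [le_div_iff₀ hR]
  rcases le_total t R with h | h
  · rw [min_eq_left h]
    rcases le_total (-R) t with h' | h'
    · rw [max_eq_right h']; simp; positivity
    · rw [max_eq_left h', abs_of_nonpos (by linarith)]; nlinarith
  · rw [min_eq_right h, max_eq_right (by linarith), abs_of_nonneg (by linarith)]; nlinarith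

/-- The probability distribution with the given weights, on the rescaled lattice `s ℤ^d`. -/
def latticeLaw (p : PMF (Site d)) (s : ℝ) : Measure (EuclideanSpace ℝ (Fin d)) :=
  p.toMeasure.map fun y => s • toSpace y

instance (p : PMF (Site d)) (s : ℝ) : IsProbabilityMeasure (latticeLaw p s) :=
  Measure.isProbabilityMeasure_map (measurable_of_countable _).aemeasurable

theorem integral_latticeLaw {F : Type*} [NormedAddCommGroup F] [NormedSpace ℝ F]
    [SecondCountableTopology F] [CompleteSpace F]
    (p : PMF (Site d)) (s : ℝ) {g : EuclideanSpace ℝ (Fin d) → F} (hg : Continuous g)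
    {R : ℝ} (hR : ∀ y, ‖g y‖ ≤ R) :
    ∫ y, g y ∂(latticeLaw p s) = ∑' y, (p y).toReal • g (s • toSpace y) := by
  rw [latticeLaw, integral_map (measurable_of_countable _).aemeasurable hg.aestronglyMeasurable,
    PMF.integral_eq_tsum]
  refine Integrable.of_bound ?_ R (Eventually.of_forall fun y => hR _)
  exact (hg.stronglyMeasurable.comp_measurable (measurable_of_countable _)).aestronglyMeasurable

/-- The distribution of a sequence of nonnegative weights with total mass one. -/
def weightPMF (w : Site d → ℝ) (h0 : ∀ y, 0 ≤ w y) (h1 : HasSum w 1) : PMF (Site d) :=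
  ⟨fun y => ENNReal.ofReal (w y), by
    have h := ENNReal.ofReal_tsum_of_nonneg h0 h1.summable
    rw [h1.tsum_eq, ENNReal.ofReal_one] at h
    rw [h]; exact ENNReal.summable.hasSum⟩

theorem weightPMF_toReal (w : Site d → ℝ) (h0 : ∀ y, 0 ≤ w y) (h1 : HasSum w 1) (y : Site d) :
    (weightPMF w h0 h1 y).toReal = w y := ENNReal.toReal_ofReal (h0 y)

section Convergence

variable {D : Matrix (Fin d) (Fin d) ℝ}

/-- The centered Gaussian measure with density `gaussianDensity D`. -/
def gaussianLaw (D : Matrix (Fin d) (Fin d) ℝ) : Measure (EuclideanSpace ℝ (Fin d)) :=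
  volume.withDensity fun y => ENNReal.ofReal (gaussianDensity D y)

theorem integrable_gaussianDensity (hD : D.PosDef) : Integrable (gaussianDensity D) := by
  simpa using integrable_exp_gaussianDensity hD 0

theorem isProbabilityMeasure_gaussianLaw (hD : D.PosDef) :
    IsProbabilityMeasure (gaussianLaw D) := by
  refine ⟨?_⟩
  rw [gaussianLaw, withDensity_apply _ MeasurableSet.univ, Measure.restrict_univ,
    ← ofReal_integral_eq_lintegral_ofReal (integrable_gaussianDensity hD)
      (Eventually.of_forall gaussianDensity_nonneg), integral_gaussianDensity hD, ENNReal.ofReal_one]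

theorem integral_gaussianLaw {F : Type*} [NormedAddCommGroup F] [NormedSpace ℝ F]
    (g : EuclideanSpace ℝ (Fin d) → F) :
    ∫ y, g y ∂(gaussianLaw D) = ∫ y, gaussianDensity D y • g y := by
  rw [gaussianLaw, integral_withDensity_eq_integral_toReal_smul
    continuous_gaussianDensity.measurable.ennreal_ofReal
    (Eventually.of_forall fun y => ENNReal.ofReal_lt_top)]
  simp_rw [ENNReal.toReal_ofReal (gaussianDensity_nonneg _)]

/-- Lévy's continuity theorem, applied along sequences `s → 0` to the measures on `s ℤ^d` with
weights `w s`. -/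
theorem tendsto_tsum_of_bounded (hD : D.PosDef) {w : ℝ → Site d → ℝ} (h0 : ∀ s y, 0 ≤ w s y)
    (h1 : ∀ s, HasSum (w s) 1)
    (hw : ∀ κ : EuclideanSpace ℝ (Fin d), Tendsto (fun s : ℝ => ∑' y,
      Complex.exp ((inner ℝ (s • toSpace y) κ : ℝ) * Complex.I) * (w s y : ℂ)) (𝓝[>] 0)
      (𝓝 (Real.exp (-(1 / 2 * (κ.ofLp ⬝ᵥ D.mulVec κ.ofLp))) : ℂ)))
    {g : EuclideanSpace ℝ (Fin d) → ℝ} (hg : Continuous g) {R : ℝ} (hR : ∀ y, |g y| ≤ R) :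
    Tendsto (fun s : ℝ => ∑' y, g (s • toSpace y) * w s y) (𝓝[>] 0)
      (𝓝 (∫ y, g y * gaussianDensity D y)) := by
  refine tendsto_of_seq_tendsto fun u hu => ?_
  have := isProbabilityMeasure_gaussianLaw hD
  let p : ℕ → PMF (Site d) := fun n => weightPMF (w (u n)) (h0 _) (h1 _)
  let ρ : ℕ → ProbabilityMeasure (EuclideanSpace ℝ (Fin d)) := fun n =>
    ⟨latticeLaw (p n) (u n), inferInstance⟩
  let ρ₀ : ProbabilityMeasure (EuclideanSpace ℝ (Fin d)) := ⟨gaussianLaw D, this⟩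
  have hρ : Tendsto ρ atTop (𝓝 ρ₀) := by
    refine ProbabilityMeasure.tendsto_iff_tendsto_charFun.2 fun κ => ?_
    have hl : charFun (gaussianLaw D) κ
        = (Real.exp (-(1 / 2 * (κ.ofLp ⬝ᵥ D.mulVec κ.ofLp))) : ℂ) := by
      rw [charFun_apply, integral_gaussianLaw, ← integral_cexp_gaussianDensity hD]
      refine integral_congr_ae (Eventually.of_forall fun y => ?_)
      simp only [Complex.real_smul, mul_comm]
    have hr : ∀ n, charFun (latticeLaw (p n) (u n)) κ = ∑' y,
        Complex.exp ((inner ℝ (u n • toSpace y) κ : ℝ) * Complex.I) * (w (u n) y : ℂ) := fun n => by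
      rw [charFun_apply, integral_latticeLaw (R := 1) _ _ (by fun_prop)
        (fun y => (Complex.norm_exp_ofReal_mul_I _).le)]
      refine tsum_congr fun y => ?_
      rw [weightPMF_toReal, Complex.real_smul, mul_comm]
    change Tendsto (fun n => charFun (latticeLaw (p n) (u n)) κ) atTop
      (𝓝 (charFun (gaussianLaw D) κ))
    rw [hl]
    simp_rw [hr]
    exact (hw κ).comp hu
  have hb := ProbabilityMeasure.tendsto_iff_forall_integral_tendsto.1 hρ
    (BoundedContinuousFunction.ofNormedAddCommGroup g hg R hR)
  have e1 : ∫ y, g y ∂(gaussianLaw D) = ∫ y, g y * gaussianDensity D y := by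
    rw [integral_gaussianLaw]
    simp only [smul_eq_mul, mul_comm]
  have e2 : ∀ n, ∫ y, g y ∂(latticeLaw (p n) (u n))
      = ∑' y, g (u n • toSpace y) * w (u n) y := fun n => by
    rw [integral_latticeLaw _ _ hg hR]
    refine tsum_congr fun y => ?_
    rw [weightPMF_toReal, smul_eq_mul, mul_comm]
  rw [← e1]
  exact hb.congr e2

/-- Convergence of characteristic functions together with a uniform exponential moment bound gives
convergence of the integrals of continuous functions of polynomial growth. -/
theorem tendsto_tsum_of_polyBounded (hD : D.PosDef) {w : ℝ → Site d → ℝ} (h0 : ∀ s y, 0 ≤ w s y)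
    (h1 : ∀ s, HasSum (w s) 1)
    (hw : ∀ κ : EuclideanSpace ℝ (Fin d), Tendsto (fun s : ℝ => ∑' y,
      Complex.exp ((inner ℝ (s • toSpace y) κ : ℝ) * Complex.I) * (w s y : ℂ)) (𝓝[>] 0)
      (𝓝 (Real.exp (-(1 / 2 * (κ.ofLp ⬝ᵥ D.mulVec κ.ofLp))) : ℂ)))
    {c C : ℝ} (hc : 0 < c) (hC : ∀ᶠ s : ℝ in 𝓝[>] 0,
      Summable (fun y => Real.exp (c * ‖s • toSpace y‖) * w s y)
        ∧ ∑' y, Real.exp (c * ‖s • toSpace y‖) * w s y ≤ C)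
    {f : EuclideanSpace ℝ (Fin d) → ℝ} (hf : Continuous f) (hp : PolyBounded f) :
    Tendsto (fun s : ℝ => ∑' y, f (s • toSpace y) * w s y) (𝓝[>] 0)
      (𝓝 (∫ y, f y * gaussianDensity D y)) := by
  obtain ⟨A₁, hA₁0, hA₁⟩ := hp.exists_le_exp hc
  obtain ⟨A₂, -, hA₂⟩ := hp.exists_le_exp (half_pos hc)
  have hsq : ∀ y, f y ^ 2 ≤ A₂ ^ 2 * Real.exp (c * ‖y‖) := fun y => by
    calc f y ^ 2 = |f y| ^ 2 := (sq_abs _).symm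
      _ ≤ (A₂ * Real.exp (c / 2 * ‖y‖)) ^ 2 := by gcongr; exact hA₂ y
      _ = A₂ ^ 2 * Real.exp (c * ‖y‖) := by rw [mul_pow, ← Real.exp_nat_mul]; congr 2; push_cast; ring
  set G := ∫ y, Real.exp (c * ‖y‖) * gaussianDensity D y with hG
  rw [Metric.tendsto_nhds]
  intro ε hε
  set B := A₂ ^ 2 * (|C| + |G|) + 1 with hB
  have hB0 : 0 < B := by positivity
  -- With this height, truncation changes both the sums and the Gaussian integral by at most `ε /
  -- 3`; the bounded function `g` is covered by `tendsto_tsum_of_bounded`.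
  set R := 3 * B / ε with hRdef
  have hR : 0 < R := by positivity
  have hBR : B / R = ε / 3 := by rw [hRdef]; field_simp
  set g : EuclideanSpace ℝ (Fin d) → ℝ := fun y => max (-R) (min (f y) R) with hgdef
  have hg : Continuous g := continuous_const.max (hf.min continuous_const)
  have hgR : ∀ y, |g y| ≤ R := fun y =>
    abs_le.2 ⟨le_max_left _ _, max_le (by linarith) (min_le_right _ _)⟩
  have hfg : ∀ y, |f y - g y| ≤ A₂ ^ 2 / R * Real.exp (c * ‖y‖) := fun y => by
    refine (abs_sub_clamp_le hR (f y)).trans ?_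
    rw [div_mul_eq_mul_div]
    exact div_le_div_of_nonneg_right (hsq y) hR.le
  have hgp : PolyBounded g := ⟨R, 0, fun y => by simpa using hgR y⟩
  have hI : |(∫ y, f y * gaussianDensity D y) - ∫ y, g y * gaussianDensity D y| ≤ ε / 3 := by
    rw [← integral_sub (hp.integrable_mul_gaussianDensity hD hf)
      (hgp.integrable_mul_gaussianDensity hD hg), ← hBR]
    have hb : ∀ y, ‖f y * gaussianDensity D y - g y * gaussianDensity D y‖
        ≤ A₂ ^ 2 / R * (Real.exp (c * ‖y‖) * gaussianDensity D y) := fun y => by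
      rw [← sub_mul, norm_mul, Real.norm_eq_abs, Real.norm_of_nonneg (gaussianDensity_nonneg y),
        ← mul_assoc]
      exact mul_le_mul_of_nonneg_right (hfg y) (gaussianDensity_nonneg y)
    have h2 := norm_integral_le_of_norm_le
      ((integrable_exp_gaussianDensity hD c).const_mul (A₂ ^ 2 / R)) (Eventually.of_forall hb)
    rw [integral_const_mul, ← hG] at h2
    refine h2.trans ?_
    rw [div_mul_eq_mul_div]
    refine div_le_div_of_nonneg_right ?_ hR.le
    have := mul_le_mul_of_nonneg_left (le_abs_self G) (sq_nonneg A₂)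
    have := mul_nonneg (sq_nonneg A₂) (abs_nonneg C)
    rw [hB]; linarith
  filter_upwards [hC, (Metric.tendsto_nhds.1 (tendsto_tsum_of_bounded hD h0 h1 hw hg hgR))
    (ε / 3) (by positivity)] with s hs hd
  obtain ⟨hs1, hs2⟩ := hs
  have hsf : Summable fun y => f (s • toSpace y) * w s y := by
    refine Summable.of_norm_bounded (hs1.mul_left A₁) fun y => ?_
    rw [norm_mul, Real.norm_eq_abs, Real.norm_of_nonneg (h0 s y), ← mul_assoc]
    exact mul_le_mul_of_nonneg_right (hA₁ _) (h0 s y)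
  have hsg : Summable fun y => g (s • toSpace y) * w s y := by
    refine Summable.of_norm_bounded ((h1 s).summable.mul_left R) fun y => ?_
    rw [norm_mul, Real.norm_eq_abs, Real.norm_of_nonneg (h0 s y)]
    exact mul_le_mul_of_nonneg_right (hgR _) (h0 s y)
  have hS : |(∑' y, f (s • toSpace y) * w s y) - ∑' y, g (s • toSpace y) * w s y| ≤ ε / 3 := by
    rw [← hsf.tsum_sub hsg, ← hBR]
    have hb : ∀ y, ‖f (s • toSpace y) * w s y - g (s • toSpace y) * w s y‖
        ≤ A₂ ^ 2 / R * (Real.exp (c * ‖s • toSpace y‖) * w s y) := fun y => by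
      rw [← sub_mul, norm_mul, Real.norm_eq_abs, Real.norm_of_nonneg (h0 s y), ← mul_assoc]
      exact mul_le_mul_of_nonneg_right (hfg _) (h0 s y)
    refine (tsum_of_norm_bounded (hs1.hasSum.mul_left (A₂ ^ 2 / R)) hb).trans ?_
    rw [div_mul_eq_mul_div]
    refine div_le_div_of_nonneg_right ?_ hR.le
    have := mul_le_mul_of_nonneg_left (hs2.trans (le_abs_self C)) (sq_nonneg A₂)
    have := mul_nonneg (sq_nonneg A₂) (abs_nonneg G)
    rw [hB]; linarith
  rw [Real.dist_eq] at hd ⊢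
  rw [abs_lt] at hd ⊢
  rw [abs_le] at hI hS
  constructor <;> linarith [hd.1, hd.2, hI.1, hI.2, hS.1, hS.2]

theorem continuous_norm_rpow {p : ℝ} (hp : 0 < p) :
    Continuous fun y : EuclideanSpace ℝ (Fin d) => ‖y‖ ^ p :=
  continuous_norm.rpow_const fun _ => Or.inr hp.le

theorem polyBounded_norm_rpow {p : ℝ} (hp : 0 < p) :
    PolyBounded fun y : EuclideanSpace ℝ (Fin d) => ‖y‖ ^ p := by
  refine ⟨1, ⌈p⌉₊, fun y => ?_⟩
  have h0 := norm_nonneg y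
  rw [abs_of_nonneg (by positivity), one_mul, ← Real.rpow_natCast]
  calc ‖y‖ ^ p ≤ (1 + ‖y‖) ^ p := Real.rpow_le_rpow h0 (by linarith) hp.le
    _ ≤ (1 + ‖y‖) ^ (⌈p⌉₊ : ℝ) := Real.rpow_le_rpow_of_exponent_le (by linarith) (Nat.le_ceil p)

theorem integral_norm_rpow_gaussianDensity_pos (hd : 0 < d) (hD : D.PosDef) {p : ℝ} (hp : 0 < p) :
    0 < ∫ y, ‖y‖ ^ p * gaussianDensity D y := by
  refine integral_pos_of_integrable_nonneg_nonzero (x := EuclideanSpace.single ⟨0, hd⟩ 1)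
    ((continuous_norm_rpow hp).mul continuous_gaussianDensity)
    ((polyBounded_norm_rpow hp).integrable_mul_gaussianDensity hD (continuous_norm_rpow hp))
    (fun y => mul_nonneg (by positivity) (gaussianDensity_nonneg y)) ?_
  simpa using (gaussianDensity_pos hD _).ne'

end Convergence

/-! ### The limit theorem for the model. -/

section Limit

variable {d : ℕ} {Ω : Type*} [TopologicalSpace Ω] [MeasurableSpace Ω] {μ : Measure Ω}
  {σ : Site d → Ω → Ω} {P : Kernel Ω (RCPath Ω)} {w : Ω → ℝ} {M : ℝ}
  {V : Site d → ℝ → RCPath Ω → ℝ} [IsProbabilityMeasure μ] [IsMarkovKernel P]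
  {h : Site d → ℂ} {m η : ℝ} {ψ₀ : Site d → ℂ} {ψ : ℝ → RCPath Ω → Site d → ℂ}
  {hσ : IsShiftAction μ σ} {hP : IsMarkovProcess μ σ P}

theorem IsWave.integrable_norm_sq (hψ : IsWave μ P h V η ψ₀ ψ) (t : ℝ) (x : Site d) :
    Integrable (fun ω => ‖ψ t ω x‖ ^ 2) (pathLaw μ P) := by
  obtain ⟨B, C, hB, -, hb⟩ := hψ.bound
  refine Integrable.of_bound ?_ ((B * Real.exp (C * |t|) * Real.exp (-(η * ‖toSpace x‖))) ^ 2)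
    (Eventually.of_forall fun ω => ?_)
  · exact (((hψ.meas x).comp_measurable measurable_prodMk_left).norm.pow 2).aestronglyMeasurable
  · rw [Real.norm_of_nonneg (by positivity)]
    gcongr
    exact hb t ω x

theorem IsWave.exists_waveMass_le (hψ : IsWave μ P h V η ψ₀ ψ) (t : ℝ) :
    ∃ A : ℝ, 0 ≤ A ∧ ∀ x, waveMass μ P ψ t x ≤ A * Real.exp (-(2 * η * ‖toSpace x‖)) := by
  obtain ⟨B, C, hB, -, hb⟩ := hψ.bound
  refine ⟨(B * Real.exp (C * |t|)) ^ 2, by positivity, fun x => ?_⟩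
  have h1 := integral_mono (hψ.integrable_norm_sq t x)
    (integrable_const ((B * Real.exp (C * |t|) * Real.exp (-(η * ‖toSpace x‖))) ^ 2))
    fun ω => pow_le_pow_left₀ (norm_nonneg _) (hb t ω x) 2
  rw [integral_const, probReal_univ, one_smul, mul_pow _ (Real.exp (-_)), ← Real.exp_nat_mul] at h1
  refine h1.trans (le_of_eq ?_)
  congr 2; push_cast; ring

/-- The mass decays like `e^{-2η|x|}`; half of this rate is spent on the growth of `f`. -/
theorem IsWave.summable_mul_waveMass (hη : 0 < η) (hψ : IsWave μ P h V η ψ₀ ψ)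
    {f : EuclideanSpace ℝ (Fin d) → ℝ} (hf : PolyBounded f) (s t : ℝ) :
    Summable fun x => f (s • toSpace x) * waveMass μ P ψ t x := by
  obtain ⟨A, hA0, hA⟩ := hψ.exists_waveMass_le t
  obtain ⟨A', hA'0, hA'⟩ := hf.exists_le_exp (c := η / (|s| + 1)) (by positivity)
  refine Summable.of_norm_bounded ((summable_exp_neg_norm (d := d) hη).mul_left (A' * A))
    fun x => ?_
  have h1 : η / (|s| + 1) * ‖s • toSpace x‖ ≤ η * ‖toSpace x‖ := by
    rw [norm_smul, Real.norm_eq_abs, ← mul_assoc]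
    refine mul_le_mul_of_nonneg_right ?_ (norm_nonneg _)
    rw [div_mul_eq_mul_div, div_le_iff₀ (by positivity)]
    nlinarith
  rw [norm_mul, Real.norm_eq_abs, Real.norm_of_nonneg (waveMass_nonneg t x)]
  calc |f (s • toSpace x)| * waveMass μ P ψ t x
      ≤ A' * Real.exp (η * ‖toSpace x‖) * (A * Real.exp (-(2 * η * ‖toSpace x‖))) :=
        mul_le_mul ((hA' _).trans (by gcongr)) (hA x) (waveMass_nonneg t x) (by positivity)
    _ = A' * A * (Real.exp (η * ‖toSpace x‖) * Real.exp (-(2 * η * ‖toSpace x‖))) := by ring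
    _ = _ := by rw [← Real.exp_add]; ring_nf

/-- Diffusive limit of the mean square amplitude, tested against functions of polynomial growth. -/
theorem IsModel.tendsto_tsum_waveMass [BorelSpace Ω] (hD : IsModel hσ hP h m w M V) (hd : 0 < d)
    (hη : 0 < η) (hηm : η ≤ m) (hψ : IsWave μ P h V η ψ₀ ψ) {D : Matrix (Fin d) (Fin d) ℝ}
    (hC : D.PosDef)
    (hlim : ∀ κ : EuclideanSpace ℝ (Fin d), Tendsto (fun s : ℝ => ∑' y,
      Complex.exp ((inner ℝ (s • toSpace y) κ : ℝ) * Complex.I) * waveMass μ P ψ ((s ^ 2)⁻¹) y)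
      (𝓝[>] 0) (𝓝 (Real.exp (-(1 / 2 * (κ.ofLp ⬝ᵥ D.mulVec κ.ofLp))) * ∑' y, ‖ψ₀ y‖ ^ 2 : ℝ)))
    {f : EuclideanSpace ℝ (Fin d) → ℝ} (hf : Continuous f) (hp : PolyBounded f) :
    Tendsto (fun s : ℝ => ∑' y, f (s • toSpace y) * waveMass μ P ψ ((s ^ 2)⁻¹) y) (𝓝[>] 0)
      (𝓝 ((∑' y, ‖ψ₀ y‖ ^ 2) * ∫ y, f y * gaussianDensity D y)) := by
  set M₀ := ∑' y, ‖ψ₀ y‖ ^ 2 with hM₀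
  have hsum : ∀ s : ℝ, HasSum (waveMass μ P ψ ((s ^ 2)⁻¹)) M₀ := fun s =>
    hD.hasSum_waveMass hη hηm hψ (by positivity)
  have hM0 : 0 ≤ M₀ := tsum_nonneg fun y => by positivity
  -- Zero mass is treated apart, as the weights are normalized to total mass one below.
  rcases hM0.eq_or_lt with h0 | hpos
  · have hz : ∀ s y, waveMass μ P ψ (((s : ℝ) ^ 2)⁻¹) y = 0 := fun s y => by
      have := hsum s
      rw [← h0] at this
      exact congrFun ((hasSum_zero_iff_of_nonneg fun y => waveMass_nonneg _ y).1 this) y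
    simp only [hz, mul_zero, tsum_zero, ← h0, zero_mul]
    exact tendsto_const_nhds
  obtain ⟨C, hC'⟩ := hD.exists_exp_moment hd hη hηm hψ
  have hdpos : (0 : ℝ) < d := by exact_mod_cast hd
  have key := tendsto_tsum_of_polyBounded hC
    (w := fun s y => waveMass μ P ψ ((s ^ 2)⁻¹) y * M₀⁻¹)
    (fun s y => mul_nonneg (waveMass_nonneg _ y) (by positivity))
    (fun s => by simpa [hpos.ne'] using (hsum s).mul_right M₀⁻¹)
    (fun κ => by
      have h1 := (hlim κ).mul_const ((M₀⁻¹ : ℝ) : ℂ)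
      rw [← Complex.ofReal_mul, mul_assoc, mul_inv_cancel₀ hpos.ne', mul_one] at h1
      refine h1.congr fun s => ?_
      rw [← tsum_mul_right]
      refine tsum_congr fun y => ?_
      push_cast; ring)
    (c := 1 / d) (C := C * M₀⁻¹) (by positivity)
    (by
      filter_upwards [hC', self_mem_nhdsWithin] with s hs hs0
      have e : ∀ y : Site d, Real.exp (1 / d * ‖s • toSpace y‖)
          * (waveMass μ P ψ ((s ^ 2)⁻¹) y * M₀⁻¹)
          = Real.exp (s / d * ‖toSpace y‖) * waveMass μ P ψ ((s ^ 2)⁻¹) y * M₀⁻¹ := fun y => by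
        rw [norm_smul, Real.norm_of_nonneg (le_of_lt hs0), mul_assoc (Real.exp _)]
        congr 2; ring
      simp_rw [e]
      refine ⟨hs.1.mul_right _, ?_⟩
      rw [tsum_mul_right]
      exact mul_le_mul_of_nonneg_right hs.2 (by positivity))
    hf hp
  refine (key.const_mul M₀).congr fun s => ?_
  rw [← tsum_mul_left]
  refine tsum_congr fun y => ?_
  field_simp

theorem tendsto_inv_sqrt_nhdsGT : Tendsto (fun t : ℝ≥0 => (√(t : ℝ))⁻¹) atTop (𝓝[>] 0) :=
  tendsto_inv_atTop_nhdsGT_zero.comp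
    (Real.tendsto_sqrt_atTop.comp (NNReal.tendsto_coe_atTop.2 tendsto_id))

theorem inv_inv_sqrt_sq (t : ℝ≥0) : (((√(t : ℝ))⁻¹) ^ 2)⁻¹ = (t : ℝ) := by
  rw [inv_pow, inv_inv, Real.sq_sqrt t.coe_nonneg]

theorem norm_inv_sqrt_smul_rpow {t : ℝ≥0} (x : Site d) (p : ℝ) :
    ‖(√(t : ℝ))⁻¹ • toSpace x‖ ^ p = ‖toSpace x‖ ^ p / (t : ℝ) ^ (p / 2) := by
  rw [norm_smul, Real.norm_of_nonneg (by positivity), Real.mul_rpow (by positivity) (norm_nonneg _),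
    Real.inv_rpow (by positivity), Real.sqrt_eq_rpow, ← Real.rpow_mul t.coe_nonneg, one_div_mul_eq_div,
    div_eq_inv_mul (_ ^ p)]

/-- The nondegeneracy hypothesis concerns `v₀`; it passes to the bounded representative `w`, since
`w` and each of its shifts agree almost everywhere with those of `v₀`. -/
theorem exists_isModel [BorelSpace Ω] (hσ : IsShiftAction μ σ) (hP : IsMarkovProcess μ σ P)
    (hB : HasGapSectorial hP) (hh : IsHoppingKernel h) {v₀ : Ω → ℝ} (hv : IsPotential hP v₀) :
    ∃ (m : ℝ) (w : Ω → ℝ) (M : ℝ) (V : Site d → ℝ → RCPath Ω → ℝ), IsModel hσ hP h m w M V ∧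
      ∀ᵐ ω ∂(pathLaw μ P), ∀ x, ∀ᵐ s ∂(volume.restrict (Set.Ici (0 : ℝ))),
        V x s ω = v₀ (σ x (ω.1 s.toNNReal)) := by
  obtain ⟨w, M, V, hw, hwv, hV, hVv⟩ := exists_potentialVersion hσ hv
  obtain ⟨m, hm, hs⟩ := hh.expBounded
  obtain ⟨γ, hγ⟩ := isGapped_backward hP hB
  have hS : IsGapped (fiberSemigroup hP) (liftL (Site d) (meanL2 μ)) γ := hγ.lift (Site d)
  obtain ⟨χ, hχ0, hχ⟩ := hv.nondegenerate
  refine ⟨m, w, M, V, ⟨hh.selfAdjoint, hm, hs, hw, hV, γ, χ, hS,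
    isCoupling_fiberOp hσ hP hh.selfAdjoint hs hm hw hχ0 (fun x hx u w' hw' => ?_) hS⟩, hVv⟩
  refine hχ x hx u w' ?_
  filter_upwards [hw', hwv, (hσ.preserving x).quasiMeasurePreserving.ae_eq_comp hwv]
    with a h1 h2 h3
  simp only [Function.comp_apply] at h3
  rw [h1, h2, h3]

end Limit

end

end MarkovSchrodinger

theorem mainTheorem2 {d : ℕ} (hd : 0 < d)
    {Ω : Type*} [TopologicalSpace Ω] [MeasurableSpace Ω] [BorelSpace Ω]
    (μ : Measure Ω) [IsProbabilityMeasure μ]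
    (σ : Site d → Ω → Ω) (hσ : IsShiftAction μ σ)
    (P : Kernel Ω (RCPath Ω)) [IsMarkovKernel P] (hP : IsMarkovProcess μ σ P)
    (hB : HasGapSectorial hP)
    (h : Site d → ℂ) (hh : IsHoppingKernel h)
    (v₀ : Ω → ℝ) (hv : IsPotential hP v₀) :
    ∃ D : Matrix (Fin d) (Fin d) ℝ, D.PosDef ∧
      ∀ ψ₀ : Ell2 d, ExpBounded ψ₀ →
        -- almost surely the Schrödinger equation has a unique solution
        (∀ᵐ ω ∂(pathLaw μ P), ∃! ψ : ℝ≥0 → Ell2 d, IsSolution h σ v₀ ω ψ₀ ψ) ∧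
        ∀ Ψ : RCPath Ω → ℝ≥0 → Ell2 d,
          (∀ᵐ ω ∂(pathLaw μ P), IsSolution h σ v₀ ω ψ₀ (Ψ ω)) →
          (∀ t x, Integrable (fun ω => ‖Ψ ω t x‖ ^ 2) (pathLaw μ P)) ∧
          -- central limit theorem
          (∀ f : EuclideanSpace ℝ (Fin d) → ℝ, Continuous f → PolyBounded f →
            (∀ t : ℝ≥0, 0 < t → Summable fun x : Site d =>
              f ((Real.sqrt t)⁻¹ • toSpace x) * meanSq μ P Ψ t x) ∧
            Integrable (fun y => f y * gaussianDensity D y) ∧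
            Tendsto (fun t : ℝ≥0 => ∑' x : Site d,
                f ((Real.sqrt t)⁻¹ • toSpace x) * meanSq μ P Ψ t x) atTop
              (𝓝 (‖ψ₀‖ ^ 2 * ∫ y, f y * gaussianDensity D y))) ∧
          -- diffusive scaling of the position moments
          (∀ p : ℝ, 0 < p →
            (∀ t : ℝ≥0, Summable fun x : Site d => ‖toSpace x‖ ^ p * meanSq μ P Ψ t x) ∧
            0 < ∫ y, ‖y‖ ^ p * gaussianDensity D y ∧
            Tendsto (fun t : ℝ≥0 =>
                (∑' x : Site d, ‖toSpace x‖ ^ p * meanSq μ P Ψ t x) / (t : ℝ) ^ (p / 2)) atTop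
              (𝓝 (‖ψ₀‖ ^ 2 * ∫ y, ‖y‖ ^ p * gaussianDensity D y))) := by
  obtain ⟨m, w, M, V, hM, hV⟩ := exists_isModel hσ hP hB hh hv
  obtain ⟨D, hD, hlim⟩ := hM.exists_covariance hh.nondegenerate
  refine ⟨D, hD, fun ψ₀ ⟨ν, C, hν, hψ₀⟩ => ?_⟩
  have hm := hM.pos
  -- `η ≤ m` keeps the conjugated hopping bounded; `η < ν` leaves enough decay for the weighted
  -- initial value to be square summable.
  set η := min m (ν / 2) with hηdef
  have hη : 0 < η := lt_min hm (half_pos hν)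
  have hηm : η ≤ m := min_le_left _ _
  have hην : η < ν := (min_le_right _ _).trans_lt (half_lt_self hν)
  obtain ⟨φ, hφ⟩ := exists_weighted hη.le hην hψ₀
  have hφ' : weightL d η hη.le φ = ψ₀ := lp.ext (funext hφ)
  have hK := isKernel_hopCoef hM.summable hη.le hηm
  have hK0 := isKernel_hopCoef hM.summable le_rfl hm.le
  have hψ := isWave_waveVec hσ hM.bdd hM.version hK hη.le φ
  have hsol : ∀ᵐ ω ∂(pathLaw μ P), IsSolution h σ v₀ ω ψ₀
      (fun t => waveVec hM.version hK hη.le φ t ω) ∧ ∀ ψ, IsSolution h σ v₀ ω ψ₀ ψ →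
        ∀ t, ψ t = waveVec hM.version hK hη.le φ t ω := by
    filter_upwards [hV] with ω hω
    rw [← hφ']
    exact ⟨isSolution_waveVec hM.version hK hη.le φ hω, fun ψ hψ t =>
      hψ.eq_waveVec hM.version hK hK0 hη.le φ hω t⟩
  refine ⟨hsol.mono fun ω hω => ⟨_, hω.1, fun ψ hψ => funext (hω.2 ψ hψ)⟩, fun Ψ hΨ => ?_⟩
  have hae : ∀ (t : ℝ≥0) x, (fun ω => ‖waveVec hM.version hK hη.le φ t ω x‖ ^ 2)
      =ᵐ[pathLaw μ P] fun ω => ‖Ψ ω t x‖ ^ 2 := fun t x => by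
    filter_upwards [hsol, hΨ] with ω h1 h2
    rw [h1.2 _ h2 t]
  have hmass : ∀ (t : ℝ≥0) x, meanSq μ P Ψ t x
      = waveMass μ P (fun t ω => waveVec hM.version hK hη.le φ t ω) t x := fun t x =>
    (integral_congr_ae (hae t x)).symm
  have hnorm : ∑' y, ‖weightL d η hη.le φ y‖ ^ 2 = ‖ψ₀‖ ^ 2 := by
    rw [(lp_hasSum_norm_sq _).tsum_eq, hφ']
  have hclt : ∀ f : EuclideanSpace ℝ (Fin d) → ℝ, Continuous f → PolyBounded f →
      Tendsto (fun t : ℝ≥0 => ∑' x : Site d,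
        f ((Real.sqrt t)⁻¹ • toSpace x) * meanSq μ P Ψ t x) atTop
        (𝓝 (‖ψ₀‖ ^ 2 * ∫ y, f y * gaussianDensity D y)) := fun f hf hp => by
    -- The parameter `s = 1/√t` turns the time `s⁻²` of the fiber analysis into `t`.
    have h1 := (hM.tendsto_tsum_waveMass hd hη hηm hψ hD
      (hlim η _ _ hη hηm hψ) hf hp).comp tendsto_inv_sqrt_nhdsGT
    rw [hnorm] at h1
    refine h1.congr fun t => tsum_congr fun x => ?_
    rw [inv_inv_sqrt_sq, hmass]
  refine ⟨fun t x => (hψ.integrable_norm_sq t x).congr (hae t x), fun f hf hp => ⟨fun t _ => ?_,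
    hp.integrable_mul_gaussianDensity hD hf, hclt f hf hp⟩, fun p hp => ⟨fun t => ?_,
    integral_norm_rpow_gaussianDensity_pos hd hD hp, ?_⟩⟩
  · simp_rw [hmass]
    exact hψ.summable_mul_waveMass hη hp _ _
  · simp_rw [hmass]
    simpa using hψ.summable_mul_waveMass hη (polyBounded_norm_rpow hp) 1 t
  -- The moments are the case `f(y) = |y|^p`, by homogeneity.
  · refine (hclt _ (continuous_norm_rpow hp) (polyBounded_norm_rpow hp)).congr fun t => ?_
    simp_rw [norm_inv_sqrt_smul_rpow, div_mul_eq_mul_div]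
    rw [tsum_div_const]
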